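/- **Proposition 3.4.** Let $Q$ be a finite quiver, with arrows $a$ from $t(a)$ to $h(a)$, let $W\in\mathbb CQ_{\rm cycl}$ be a potential (a finite linear combination of loops up to cyclic rotation), and let $\mathbf d=(d_i)\in\mathbb N^{V(Q)}$. Let $\partial_aW\in\mathbb CQ$ be the cyclic derivatives of $W$, and $J(Q,W)=\mathbb CQ/\langle\langle\partial_aW\mid a\in E(Q)\rangle\rangle$ the Jacobi algebra. Put $U_i=\mathbb C^{d_i}$, $$N_{\mathbf d}=\prod_{a\in E(Q)}\operatorname{Hom}(U_{t(a)},U_{h(a)}),\qquad G_{\mathbf d}=\prod_{i\in V(Q)}GL(U_i),\qquad M_{\mathbf d}=\{\phi\in N_{\mathbf d}:\ \partial_aW(\phi)=0\ \text{for all } a\},$$ and for $j\in V(Q)$ let $N^j_{\mathbf d}\subset N_{\mathbf d}\times U_j$ be the locus of pairs $(\phi,v)$ such that the images of $v$ under all compositions of the $\phi_a$ span $\bigoplus_iU_i$, and $M^j_{\mathbf d}\subset N^j_{\mathbf d}$ the closed subscheme defined by the relations $\partial_aW(\phi)=0$. Stacks are stacks in groupoids over affine complex schemes with the étale topology. A family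 of representations over $\operatorname{Spec}A$ consists of vector bundles of ranks $d_i$ and linear maps attached to the arrows. 1. The stack of families of representations of $Q$ of dimension vector $\mathbf d$, with the tautological map from $N_{\mathbf d}$, is the quotient stack $[N_{\mathbf d}/G_{\mathbf d}]$. It is a smooth algebraic stack over $\mathbb C$ with affine diagonal, and it carries a regular function $\operatorname{Tr}W$, whose value on a family of representations on free modules is the trace of $W$ in it. The stack-theoretic critical locus of this function (the closed substack which restricts on every smooth chart to the scheme-theoretic critical locus of the restricted function) is the substack of those families which are families of representations of $J(Q,W)$, and it is the quotient stack $[M_{\mathbf d}/G_{\mathbf d}]\subset[N_{\mathbf d}/G_{\mathbf d}]$. 2. For every vertex $j$, the group $G_{\mathbf d}$ acts freely on $N^j_{\mathbf d}$, and the quotient $\mathcal R=N^j_{\mathbf d}/G_{\mathbf d}$ exists as a complex scheme over which $N^j_{\mathbf d}$ is a principal $G_{\mathbf d}$-bundle. It is a fine moduli space of families of representations of $Q$ of dimension vector $\mathbf d$ with a section of the bundle at $j$ that is a cyclic vector in every fibre. The scheme $\mathcal R$ is smooth and quasiprojective over $\mathbb C$, and is integral unless it is empty. The function $\operatorname{Tr}W$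 on $N^j_{\mathbf d}$ descends to a regular function $W^j_{\mathbf d}$ on $\mathcal R$. The scheme-theoretic critical locus $\{dW^j_{\mathbf d}=0\}$ is the closed subscheme $M^j_{\mathbf d}/G_{\mathbf d}$ of $\mathcal R$ (with $M^j_{\mathbf d}$ a principal $G_{\mathbf d}$-bundle over it), and it is the fine moduli space of those framed families which are families of representations of $J(Q,W)$. -/

import Mathlib

open CategoryTheory Opposite AlgebraicGeometry

noncomputable section

namespace QuiverCrit

/-! ### Quivers, path algebras, potentials and Jacobi algebras -/

/-- A finite quiver: finite sets of vertices and arrows, each arrow having a tail and a head. -/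
structure FinQuiver where
  V : Type
  E : Type
  [fintypeV : Fintype V]
  [decEqV : DecidableEq V]
  [fintypeE : Fintype E]
  tail : E → V
  head : E → V

attribute [instance] FinQuiver.fintypeV FinQuiver.decEqV FinQuiver.fintypeE

namespace FinQuiver

variable (Q : FinQuiver)

/-- A word `[a₁, …, aₙ]`, listed in the order in which the arrows are traversed, is a path starting
at the vertex `i`. -/
def Composable : Q.V → List Q.E → Prop
  | _, [] => True
  | i, a :: l => Q.tail a = i ∧ Composable (Q.head a) l

/-- The vertex reached from `i` after traversing the word. -/
def endpoint : Q.V → List Q.E → Q.V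
  | i, [] => i
  | _, a :: l => endpoint (Q.head a) l

/-- Paths `aₙ ⋯ a₁` in `Q`; `arrows` is the list `[a₁, …, aₙ]`. The path with source `i` and no
arrows is the empty loop `s_i`. -/
structure Path where
  source : Q.V
  arrows : List Q.E
  composable : Q.Composable source arrows

variable {Q}

/-- The end vertex of a path. -/
def Path.target (p : Q.Path) : Q.V := Q.endpoint p.source p.arrows

theorem composable_append {l m : List Q.E} : ∀ {i : Q.V},
    Q.Composable i (l ++ m) ↔ Q.Composable i l ∧ Q.Composable (Q.endpoint i l) m := by
  induction l with
  | nil => intro i; simp [Composable, endpoint]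
  | cons a l ih => intro i; simp [Composable, endpoint, ih, and_assoc]

theorem endpoint_append {l m : List Q.E} : ∀ {i : Q.V},
    Q.endpoint i (l ++ m) = Q.endpoint (Q.endpoint i l) m := by
  induction l with
  | nil => intro i; simp [endpoint]
  | cons a l ih => intro i; simp [endpoint, ih]

/-- The composite path: first `p`, then `q`. -/
def Path.comp (p q : Q.Path) (h : p.target = q.source) : Q.Path where
  source := p.source
  arrows := p.arrows ++ q.arrows
  composable := composable_append.2 ⟨p.composable, by
    have := q.composable
    rw [← h] at this
    exact this⟩

/-- The empty loop at a vertex. -/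
def Path.empty (i : Q.V) : Q.Path := ⟨i, [], trivial⟩

theorem Path.target_comp (p q : Q.Path) (h : p.target = q.source) :
    (p.comp q h).target = q.target := by
  have h' : Q.endpoint p.source p.arrows = q.source := h
  simp only [Path.target, Path.comp, endpoint_append, h']

variable (Q)

/-- The path algebra `ℂQ`: the complex vector space with basis the paths of `Q`. -/
def PathAlgebra : Type := Q.Path →₀ ℂ

namespace PathAlgebra

instance : AddCommGroup Q.PathAlgebra := inferInstanceAs (AddCommGroup (Q.Path →₀ ℂ))
instance : Module ℂ Q.PathAlgebra := inferInstanceAs (Module ℂ (Q.Path →₀ ℂ))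

variable {Q}

/-- The basis element of `ℂQ` given by a path. -/
def ofPath (p : Q.Path) : Q.PathAlgebra := Finsupp.single p 1

/-- The product `q p` of two paths (first `p`, then `q`): their composite if they are composable,
and zero otherwise. -/
def mulPath (q p : Q.Path) : Q.PathAlgebra :=
  if h : p.target = q.source then ofPath (p.comp q h) else 0

/-- The bilinear extension of `mulPath`. -/
def mulLin : Q.PathAlgebra →ₗ[ℂ] Q.PathAlgebra →ₗ[ℂ] Q.PathAlgebra :=
  Finsupp.linearCombination ℂ
    (fun q : Q.Path => (Finsupp.linearCombination ℂ (fun p : Q.Path => mulPath q p) :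
      Q.PathAlgebra →ₗ[ℂ] Q.PathAlgebra))

theorem mulLin_ofPath (q p : Q.Path) : mulLin (ofPath q) (ofPath p) = mulPath q p := by
  have h1 : mulLin (ofPath q) = (Finsupp.linearCombination ℂ (fun p : Q.Path => mulPath q p) :
      Q.PathAlgebra →ₗ[ℂ] Q.PathAlgebra) := by
    unfold mulLin ofPath
    exact (Finsupp.linearCombination_single ℂ 1 q).trans (one_smul _ _)
  rw [h1]
  unfold ofPath
  exact (Finsupp.linearCombination_single ℂ 1 p).trans (one_smul _ _)

theorem induction_paths {P : Q.PathAlgebra → Prop} (u : Q.PathAlgebra) (h0 : P 0)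
    (hadd : ∀ u v, P u → P v → P (u + v)) (hs : ∀ (z : ℂ) p, P (z • ofPath p)) : P u := by
  refine Finsupp.induction_linear (motive := P) u h0 hadd (fun p z => ?_)
  have := hs z p
  have h2 : (z • ofPath p : Q.PathAlgebra) = (Finsupp.single p z : Q.Path →₀ ℂ) := by
    unfold ofPath
    exact (Finsupp.smul_single z p 1).trans (by simp)
  rw [h2] at this
  exact this

theorem mulLin_assoc (u v w : Q.PathAlgebra) :
    mulLin (mulLin u v) w = mulLin u (mulLin v w) := by
  induction u using induction_paths with
  | h0 => simp
  | hadd a b ha hb => simp [ha, hb]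
  | hs z r =>
  induction v using induction_paths with
  | h0 => simp
  | hadd a b ha hb => simp only [map_add, LinearMap.add_apply, ha, hb]
  | hs y q =>
  induction w using induction_paths with
  | h0 => simp
  | hadd a b ha hb => simp only [map_add, ha, hb]
  | hs x p =>
  simp only [map_smul, LinearMap.smul_apply, mulLin_ofPath]
  have key : mulLin (mulPath r q) (ofPath p) = mulLin (ofPath r) (mulPath q p) := by
    by_cases h1 : q.target = r.source
    · by_cases h2 : p.target = q.source
      · have e1 : p.target = (q.comp r h1).source := h2
        have e2 : (p.comp q h2).target = r.source := (Path.target_comp p q h2).trans h1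
        rw [mulPath, dif_pos h1, mulLin_ofPath, mulPath, dif_pos e1, mulPath, dif_pos h2,
          mulLin_ofPath, mulPath, dif_pos e2]
        simp [Path.comp, List.append_assoc]
      · have e1 : ¬ p.target = (q.comp r h1).source := h2
        rw [mulPath, dif_pos h1, mulLin_ofPath, mulPath, dif_neg e1, mulPath, dif_neg h2, map_zero]
    · by_cases h2 : p.target = q.source
      · have e2 : ¬ (p.comp q h2).target = r.source := by rwa [Path.target_comp p q h2]
        rw [mulPath, dif_neg h1, map_zero, LinearMap.zero_apply, mulPath, dif_pos h2,
          mulLin_ofPath, mulPath, dif_neg e2]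
      · rw [mulPath, dif_neg h1, map_zero, LinearMap.zero_apply, mulPath, dif_neg h2, map_zero]
  rw [key]

/-- The unit of `ℂQ`: the sum of the empty loops. -/
def unit : Q.PathAlgebra := ∑ i : Q.V, ofPath (Path.empty i)

theorem mulLin_unit (u : Q.PathAlgebra) : mulLin u unit = u := by
  induction u using induction_paths with
  | h0 => simp
  | hadd a b ha hb => simp [ha, hb]
  | hs z p =>
    have h : ∀ i : Q.V, mulPath p (Path.empty i) = if i = p.source then ofPath p else 0 := by
      intro i
      by_cases hi : i = p.source
      · subst hi
        rw [mulPath, dif_pos (show (Path.empty p.source).target = p.source from rfl), if_pos rfl]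
        rfl
      · rw [mulPath, dif_neg (show ¬ (Path.empty i).target = p.source from hi), if_neg hi]
    simp [unit, map_sum, mulLin_ofPath, h]

theorem unit_mulLin (u : Q.PathAlgebra) : mulLin unit u = u := by
  induction u using induction_paths with
  | h0 => simp
  | hadd a b ha hb => simp [ha, hb]
  | hs z p =>
    have h : ∀ i : Q.V, mulPath (Path.empty i) p = if i = p.target then ofPath p else 0 := by
      intro i
      by_cases hi : i = p.target
      · subst hi
        rw [mulPath, dif_pos (show p.target = (Path.empty p.target).source from rfl), if_pos rfl]
        simp [Path.comp, Path.empty]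
      · rw [mulPath, dif_neg (show ¬ p.target = (Path.empty i).source from fun e => hi e.symm),
          if_neg hi]
    simp [unit, map_sum, LinearMap.sum_apply, mulLin_ofPath, h]

instance : Ring Q.PathAlgebra :=
  { (inferInstance : AddCommGroup Q.PathAlgebra) with
    mul := fun u v => mulLin u v
    one := unit
    mul_assoc := mulLin_assoc
    one_mul := unit_mulLin
    mul_one := mulLin_unit
    left_distrib := fun u v w => map_add (mulLin u) v w
    right_distrib := fun u v w => by
      change mulLin (u + v) w = mulLin u w + mulLin v w
      simp
    zero_mul := fun u => by
      change mulLin 0 u = 0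
      simp
    mul_zero := fun u => map_zero (mulLin u) }

instance : Algebra ℂ Q.PathAlgebra :=
  Algebra.ofModule
    (fun z u v => by
      change mulLin (z • u) v = z • mulLin u v
      simp)
    (fun z u v => map_smul (mulLin u) z v)

open Classical in
/-- The product `aₙ ⋯ a₁ s_i` in `ℂQ` of the arrows of a word `[a₁, …, aₙ]`, starting at the vertex
`i`: it vanishes unless the word is a path. -/
def ofWord (i : Q.V) (l : List Q.E) : Q.PathAlgebra :=
  if h : Q.Composable i l then ofPath ⟨i, l, h⟩ else 0

end PathAlgebra

/-- Loops up to cyclic rotation: the empty loops `s_i`, and the nonempty cyclic words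
`(a₁, …, aₙ)` with `head a_k = tail a_{k+1}` for all `k` modulo `n`. -/
def Loop : Type :=
  Q.V ⊕ {c : Cycle Q.E // c ≠ Cycle.nil ∧ c.Chain (fun a b => Q.head a = Q.tail b)}

/-- The space `ℂQ_cycl` of potentials: linear combinations of loops up to cyclic rotation. -/
abbrev Potential : Type := Q.Loop →₀ ℂ

variable {Q}

open Classical in
/-- The cyclic derivative of a loop with respect to an arrow `a`: the sum, over all occurrences of
`a` in the loop, of the path obtained by going once around the loop from the head of this
occurrence of `a` to its tail. The multiset `c.lists` consists of the `n` rotations of a cyclic word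
of length `n`, one for each position. -/
def Loop.cyclicDeriv (a : Q.E) : Q.Loop → Q.PathAlgebra
  | Sum.inl _ => 0
  | Sum.inr c => (c.1.lists.map fun l => match l with
      | [] => (0 : Q.PathAlgebra)
      | b :: r => if b = a then PathAlgebra.ofWord (Q.head a) r else 0).sum

/-- The formal partial derivative `∂_a : ℂQ_cycl → ℂQ`. -/
def cyclicDeriv (a : Q.E) (W : Q.Potential) : Q.PathAlgebra :=
  W.sum fun c z => z • c.cyclicDeriv a

/-- The two-sided ideal `⟨⟨∂_a W | a ∈ E(Q)⟩⟩` of `ℂQ`. -/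
def jacobiIdeal (W : Q.Potential) : TwoSidedIdeal Q.PathAlgebra :=
  TwoSidedIdeal.span (Set.range fun a : Q.E => cyclicDeriv a W)

/-- The Jacobi algebra `J(Q, W)`. -/
abbrev JacobiAlgebra (W : Q.Potential) : Type := (jacobiIdeal W).ringCon.Quotient

/-- The quotient map `ℂQ → J(Q, W)`. -/
def toJacobi (W : Q.Potential) : Q.PathAlgebra →+* JacobiAlgebra W := (jacobiIdeal W).ringCon.mk'

end FinQuiver

/-! ### Families of representations -/

/-- A family, over (the spectrum of) a commutative ring `A`, of representations of `Q` of dimension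
vector `d`: vector bundles `U i` of rank `d i` and linear maps attached to the arrows. If `A` is a
field this is a representation of `Q` of dimension vector `d`. -/
structure RepFam (Q : FinQuiver) (d : Q.V → ℕ) (A : Type) [CommRing A] where
  U : Q.V → Type
  [addCommGroup : ∀ i, AddCommGroup (U i)]
  [module : ∀ i, Module A (U i)]
  finite : ∀ i, Module.Finite A (U i)
  projective : ∀ i, Module.Projective A (U i)
  rank : ∀ (i : Q.V) (p : PrimeSpectrum A), Module.rankAtStalk (R := A) (U i) p = d i
  φ : ∀ a : Q.E, U (Q.tail a) →ₗ[A] U (Q.head a)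

attribute [instance] RepFam.addCommGroup RepFam.module

namespace RepFam

variable {Q : FinQuiver} {d : Q.V → ℕ} {A : Type} [CommRing A] (x : RepFam Q d A)

/-- The direct sum of all `U i`. -/
abbrev Total : Type := ∀ i, x.U i

/-- The projector of `⨁ U i` onto the summand `U i`. -/
def vertexEnd (i : Q.V) : Module.End A x.Total :=
  LinearMap.single A x.U i ∘ₗ LinearMap.proj i

/-- An arrow, as an endomorphism of `⨁ U i`. -/
def arrowEnd (a : Q.E) : Module.End A x.Total :=
  LinearMap.single A x.U (Q.head a) ∘ₗ x.φ a ∘ₗ LinearMap.proj (Q.tail a)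

/-- The composite `φ_{aₙ} ⋯ φ_{a₁}` for a word `[a₁, …, aₙ]`, as an endomorphism of `⨁ U i`. -/
def wordEnd : List Q.E → Module.End A x.Total
  | [] => 1
  | a :: l => wordEnd l * x.arrowEnd a

/-- The action of a path on `⨁ U i`. -/
def pathEnd (p : Q.Path) : Module.End A x.Total := x.wordEnd p.arrows * x.vertexEnd p.source

/-- Evaluation of an element of the path algebra on the representation. -/
def act [Algebra ℂ A] (u : Q.PathAlgebra) : Module.End A x.Total :=
  Finsupp.sum (show Q.Path →₀ ℂ from u) fun p z => algebraMap ℂ A z • x.pathEnd p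

/-- The family is a family of representations of the Jacobi algebra: the action of `ℂQ` on `⨁ U i`
factors through an action of `J(Q, W)`. -/
def IsJacobi [Algebra ℂ A] (W : Q.Potential) : Prop :=
  ∃ ρ : FinQuiver.JacobiAlgebra W →+* Module.End A x.Total,
    ∀ u : Q.PathAlgebra, ρ (FinQuiver.toJacobi W u) = x.act u

/-- The family satisfies the relations `∂_a W = 0` for all arrows `a`. -/
def Relations [Algebra ℂ A] (W : Q.Potential) : Prop :=
  ∀ a : Q.E, x.act (FinQuiver.cyclicDeriv a W) = 0

theorem wordEnd_append (l m : List Q.E) : x.wordEnd (l ++ m) = x.wordEnd m * x.wordEnd l := by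
  induction l with
  | nil => simp [wordEnd]
  | cons a l ih => simp [wordEnd, ih, mul_assoc]

/-- The trace of a cyclic word. -/
def cycleTrace (c : Cycle Q.E) : A :=
  Quotient.liftOn' c (fun l => LinearMap.trace A x.Total (x.wordEnd l)) (by
    rintro l m ⟨n, rfl⟩
    rw [List.rotate_eq_drop_append_take_mod, wordEnd_append, LinearMap.trace_mul_comm,
      ← wordEnd_append, List.take_append_drop])

/-- The trace of a loop. -/
def loopTrace : Q.Loop → A
  | Sum.inl i => LinearMap.trace A x.Total (x.vertexEnd i)
  | Sum.inr c => x.cycleTrace c.1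

/-- The trace `Tr W`. The trace of `LinearMap.trace` is the usual one for free modules; `traceW` is
only used when all `U i` are free. -/
def traceW [Algebra ℂ A] (W : Q.Potential) : A :=
  W.sum fun c z => algebraMap ℂ A z * x.loopTrace c

/-- The vector `v` is cyclic: its images under all combinations of the `φ_a` span `⨁ U i`. For a
family this says that `v` is cyclic on every fibre, by the Nakayama lemma. -/
def IsCyclic (j : Q.V) (v : x.U j) : Prop :=
  Submodule.span A (Set.range fun l : List Q.E => x.wordEnd l (Pi.single j v)) = ⊤

end RepFam

/-- An object of the stack of representations: a complex algebra `A` and a family over `Spec A`. -/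
structure Rep (Q : FinQuiver) (d : Q.V → ℕ) where
  A : CommAlgCat.{0} ℂ
  fam : RepFam Q d A

namespace Rep

variable {Q : FinQuiver} {d : Q.V → ℕ}

/-- A morphism of families lying over an algebra map `f : A → B`: maps `U i → U' i` that are
`f`-semilinear, commute with the arrows, and identify `U' i` with the base change of `U i` along
`f`. Since the induced map `B ⊗ U i → U' i` goes between vector bundles of the same rank, it is an
isomorphism as soon as it is surjective. -/
@[ext]
structure Hom (x y : Rep Q d) where
  base : x.A ⟶ y.A
  map : ∀ i, x.fam.U i →+ y.fam.U i
  map_smul : ∀ i (r : x.A) (m : x.fam.U i), map i (r • m) = base.hom r • map i m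
  map_φ : ∀ (a : Q.E) (m : x.fam.U (Q.tail a)),
    map (Q.head a) (x.fam.φ a m) = y.fam.φ a (map (Q.tail a) m)
  span_range : ∀ i, Submodule.span y.A (Set.range (map i)) = ⊤

/-- Composition of morphisms of families. -/
def Hom.comp {x y z : Rep Q d} (u : Hom x y) (v : Hom y z) : Hom x z where
  base := u.base ≫ v.base
  map i := (v.map i).comp (u.map i)
  map_smul i r m := by simp [u.map_smul, v.map_smul]
  map_φ a m := by simp [u.map_φ, v.map_φ]
  span_range i := by
    rw [eq_top_iff, ← v.span_range i, Submodule.span_le]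
    rintro _ ⟨m, rfl⟩
    have hm : m ∈ Submodule.span y.A (Set.range (u.map i)) := by
      rw [u.span_range i]; trivial
    induction hm using Submodule.span_induction with
    | mem m hm =>
      obtain ⟨n, rfl⟩ := hm
      exact Submodule.subset_span ⟨n, rfl⟩
    | zero => rw [map_zero]; exact Submodule.zero_mem _
    | add a b _ _ ha hb => rw [map_add]; exact Submodule.add_mem _ ha hb
    | smul r a _ ha => rw [v.map_smul]; exact Submodule.smul_mem _ _ ha

instance : Category (Rep Q d) where
  Hom := Hom
  id x :=
    { base := 𝟙 _
      map := fun i => AddMonoidHom.id _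
      map_smul := fun i r m => by simp
      map_φ := fun a m => rfl
      span_range := fun i => by
        rw [eq_top_iff]
        exact fun m _ => Submodule.subset_span ⟨m, rfl⟩ }
  comp u v := u.comp v

variable (Q d)

/-- The functor sending a family to its base algebra. -/
def proj : Rep Q d ⥤ CommAlgCat.{0} ℂ where
  obj x := x.A
  map u := u.base

variable {Q d}

/-- The map between direct sums induced by a morphism of families. -/
def Hom.total {x y : Rep Q d} (u : Hom x y) (m : x.fam.Total) : y.fam.Total :=
  fun i => u.map i (m i)

theorem Hom.total_single {x y : Rep Q d} (u : Hom x y) (i : Q.V) (m : x.fam.U i) :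
    u.total (Pi.single i m) = Pi.single i (u.map i m) := by
  funext k
  by_cases h : k = i
  · subst h; simp [Hom.total]
  · simp [Hom.total, Pi.single_eq_of_ne h]

theorem Hom.total_add {x y : Rep Q d} (u : Hom x y) (m n : x.fam.Total) :
    u.total (m + n) = u.total m + u.total n := by
  funext k; simp [Hom.total]

theorem Hom.total_zero {x y : Rep Q d} (u : Hom x y) : u.total 0 = 0 := by
  funext k; simp [Hom.total]

theorem Hom.total_smul {x y : Rep Q d} (u : Hom x y) (r : x.A) (m : x.fam.Total) :
    u.total (r • m) = u.base.hom r • u.total m := by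
  funext k; simp [Hom.total, u.map_smul]

theorem Hom.total_word {x y : Rep Q d} (u : Hom x y) (l : List Q.E) : ∀ m : x.fam.Total,
    u.total (x.fam.wordEnd l m) = y.fam.wordEnd l (u.total m) := by
  induction l with
  | nil => intro m; rfl
  | cons a l ih =>
    intro m
    simp only [RepFam.wordEnd, Module.End.mul_apply, ih]
    congr 1
    simp only [RepFam.arrowEnd, LinearMap.comp_apply, LinearMap.proj_apply,
      LinearMap.coe_single, u.total_single, u.map_φ]
    rfl

theorem Hom.total_act {x y : Rep Q d} (u : Hom x y) (w : Q.PathAlgebra) (m : x.fam.Total) :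
    u.total (x.fam.act w m) = y.fam.act w (u.total m) := by
  let T : x.fam.Total →+ y.fam.Total := ⟨⟨u.total, u.total_zero⟩, u.total_add⟩
  have hT : ∀ m, u.total m = T m := fun _ => rfl
  unfold RepFam.act Finsupp.sum
  rw [LinearMap.sum_apply, LinearMap.sum_apply, hT, map_sum]
  refine Finset.sum_congr rfl fun p _ => ?_
  rw [← hT, LinearMap.smul_apply, LinearMap.smul_apply, u.total_smul]
  congr 1
  · simp
  · simp only [RepFam.pathEnd, Module.End.mul_apply, u.total_word]
    congr 1
    simp only [RepFam.vertexEnd, LinearMap.comp_apply, LinearMap.proj_apply,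
      LinearMap.coe_single, u.total_single]
    rfl

theorem Hom.total_range {x y : Rep Q d} (u : Hom x y) (S : Submodule y.A y.fam.Total)
    (hS : ∀ m, u.total m ∈ S) : S = ⊤ := by
  have h1 : ∀ i (n : y.fam.U i), (Pi.single i n : y.fam.Total) ∈ S := by
    intro i n
    have hn : n ∈ Submodule.span y.A (Set.range (u.map i)) := by
      rw [u.span_range i]; trivial
    induction hn using Submodule.span_induction with
    | mem n hn =>
      obtain ⟨m, rfl⟩ := hn
      rw [← u.total_single]; exact hS _
    | zero => rw [Pi.single_zero]; exact S.zero_mem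
    | add a b _ _ ha hb => rw [Pi.single_add]; exact S.add_mem ha hb
    | smul r a _ ha => rw [Pi.single_smul]; exact S.smul_mem _ ha
  rw [eq_top_iff]
  intro n _
  rw [← Finset.univ_sum_single n]
  exact S.sum_mem fun i _ => h1 i (n i)

theorem Hom.isCyclic {x y : Rep Q d} (u : Hom x y) {j : Q.V} {v : x.fam.U j}
    (h : x.fam.IsCyclic j v) : y.fam.IsCyclic j (u.map j v) := by
  refine u.total_range _ fun m => ?_
  have hm : m ∈ Submodule.span x.A
      (Set.range fun l : List Q.E => x.fam.wordEnd l (Pi.single j v)) := by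
    rw [show Submodule.span x.A _ = ⊤ from h]; trivial
  induction hm using Submodule.span_induction with
  | mem m hm =>
    obtain ⟨l, rfl⟩ := hm
    refine Submodule.subset_span ⟨l, ?_⟩
    simp only [u.total_word, u.total_single]
  | zero => rw [u.total_zero]; exact Submodule.zero_mem _
  | add a b _ _ ha hb => rw [u.total_add]; exact Submodule.add_mem _ ha hb
  | smul r a _ ha => rw [u.total_smul]; exact Submodule.smul_mem _ _ ha

theorem Hom.relations {x y : Rep Q d} (u : Hom x y) {W : Q.Potential}
    (h : x.fam.Relations W) : y.fam.Relations W := by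
  intro a
  refine LinearMap.ker_eq_top.1 (u.total_range _ fun m => ?_)
  rw [LinearMap.mem_ker, ← u.total_act, h a, LinearMap.zero_apply, u.total_zero]

end Rep

/-! ### Group actions and the spaces of representations -/

/-- A group functor `G` acting on a set-valued functor `X`, both on complex algebras (that is, on
affine complex schemes), given through their functors of points. -/
structure GroupAction where
  G : CommAlgCat.{0} ℂ → Type
  X : CommAlgCat.{0} ℂ → Type
  [group : ∀ A, Group (G A)]
  [action : ∀ A, MulAction (G A) (X A)]
  mapG : ∀ {A B : CommAlgCat.{0} ℂ}, (A ⟶ B) → G A →* G B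
  mapX : ∀ {A B : CommAlgCat.{0} ℂ}, (A ⟶ B) → X A → X B
  mapG_id : ∀ {A : CommAlgCat.{0} ℂ} (g : G A), mapG (𝟙 A) g = g
  mapG_comp : ∀ {A B C : CommAlgCat.{0} ℂ} (f : A ⟶ B) (f' : B ⟶ C) (g : G A),
    mapG (f ≫ f') g = mapG f' (mapG f g)
  mapX_id : ∀ {A : CommAlgCat.{0} ℂ} (x : X A), mapX (𝟙 A) x = x
  mapX_comp : ∀ {A B C : CommAlgCat.{0} ℂ} (f : A ⟶ B) (f' : B ⟶ C) (x : X A),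
    mapX (f ≫ f') x = mapX f' (mapX f x)
  mapX_smul : ∀ {A B : CommAlgCat.{0} ℂ} (f : A ⟶ B) (g : G A) (x : X A),
    mapX f (g • x) = mapG f g • mapX f x

attribute [instance] GroupAction.group GroupAction.action

namespace GroupAction

/-- The restriction of an action to an invariant subfunctor. -/
def restrict (𝒢 : GroupAction) (P : ∀ A, 𝒢.X A → Prop)
    (hP : ∀ {A B : CommAlgCat.{0} ℂ} (f : A ⟶ B) (g : 𝒢.G B) (x : 𝒢.X A),
      P A x → P B (g • 𝒢.mapX f x)) : GroupAction where
  G := 𝒢.G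
  X A := {x : 𝒢.X A // P A x}
  action A :=
    { smul := fun g x => ⟨g • x.1, by
        have := hP (𝟙 A) g x.1 x.2
        rwa [𝒢.mapX_id] at this⟩
      one_smul := fun x => Subtype.ext (one_smul _ x.1)
      mul_smul := fun g h x => Subtype.ext (mul_smul g h x.1) }
  mapG := 𝒢.mapG
  mapX f x := ⟨𝒢.mapX f x.1, by
    have := hP f 1 x.1 x.2
    rwa [one_smul] at this⟩
  mapG_id := 𝒢.mapG_id
  mapG_comp := 𝒢.mapG_comp
  mapX_id x := Subtype.ext (𝒢.mapX_id x.1)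
  mapX_comp f f' x := Subtype.ext (𝒢.mapX_comp f f' x.1)
  mapX_smul f g x := Subtype.ext (𝒢.mapX_smul f g x.1)

/-- The quotient prestack `[X /ₚ G]`: its objects over `Spec A` are the elements of `X(A)`, and the
morphisms between two of them are the elements of `G` carrying one to the other. -/
structure Prestack (𝒢 : GroupAction) where
  A : CommAlgCat.{0} ℂ
  pt : 𝒢.X A

/-- Morphisms of the quotient prestack, over a map of algebras. -/
@[ext]
structure PrestackHom (𝒢 : GroupAction) (x y : 𝒢.Prestack) where
  base : x.A ⟶ y.A
  g : 𝒢.G y.A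
  smul_eq : g • 𝒢.mapX base x.pt = y.pt

instance (𝒢 : GroupAction) : Category 𝒢.Prestack where
  Hom := 𝒢.PrestackHom
  id x := ⟨𝟙 _, 1, by rw [𝒢.mapX_id, one_smul]⟩
  comp u v := ⟨u.base ≫ v.base, v.g * 𝒢.mapG v.base u.g, by
    rw [𝒢.mapX_comp, mul_smul, ← 𝒢.mapX_smul, u.smul_eq, v.smul_eq]⟩
  id_comp u := PrestackHom.ext (Category.id_comp _) (by simp)
  comp_id u := PrestackHom.ext (Category.comp_id _) (by simp [𝒢.mapG_id])
  assoc u v w := PrestackHom.ext (Category.assoc _ _ _) (by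
    simp [𝒢.mapG_comp, mul_assoc])

/-- The projection of the quotient prestack to algebras. -/
def prestackProj (𝒢 : GroupAction) : 𝒢.Prestack ⥤ CommAlgCat.{0} ℂ where
  obj x := x.A
  map u := u.base

/-- The inclusion of quotient prestacks induced by an invariant subfunctor. -/
def prestackIncl (𝒢 : GroupAction) (P : ∀ A, 𝒢.X A → Prop)
    (hP : ∀ {A B : CommAlgCat.{0} ℂ} (f : A ⟶ B) (g : 𝒢.G B) (x : 𝒢.X A),
      P A x → P B (g • 𝒢.mapX f x)) : (𝒢.restrict P hP).Prestack ⥤ 𝒢.Prestack where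
  obj x := ⟨x.A, x.pt.1⟩
  map u := ⟨u.base, u.g, congrArg Subtype.val u.smul_eq⟩

end GroupAction

section RepSpace

variable (Q : FinQuiver) (d : Q.V → ℕ)

/-- The `A`-points of `G_d = ∏ GL(d i)`. -/
abbrev GLProd (A : Type) [CommRing A] : Type := ∀ i : Q.V, GL (Fin (d i)) A

/-- The `A`-points of `N_d = ∏ Hom(U_{t(a)}, U_{h(a)})`, with `U_i = ℂ^{d i}`. -/
def RepSpace (A : Type) [CommRing A] : Type :=
  ∀ a : Q.E, Matrix (Fin (d (Q.head a))) (Fin (d (Q.tail a))) A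

variable {Q d}

instance (A : Type) [CommRing A] : MulAction (GLProd Q d A) (RepSpace Q d A) where
  smul g φ := fun a => (g (Q.head a)).1 * φ a * (g (Q.tail a))⁻¹.1
  one_smul φ := by
    funext a
    change (1 : GL _ A).1 * φ a * (1 : GL _ A)⁻¹.1 = φ a
    simp
  mul_smul g h φ := by
    funext a
    change (g (Q.head a) * h (Q.head a)).1 * φ a * (g (Q.tail a) * h (Q.tail a))⁻¹.1 =
      (g (Q.head a)).1 * ((h (Q.head a)).1 * φ a * (h (Q.tail a))⁻¹.1) * (g (Q.tail a))⁻¹.1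
    rw [mul_inv_rev, Units.val_mul, Units.val_mul]
    simp only [Matrix.mul_assoc]

theorem RepSpace.smul_apply {A : Type} [CommRing A] (g : GLProd Q d A) (φ : RepSpace Q d A)
    (a : Q.E) : (g • φ) a = (g (Q.head a)).1 * φ a * (g (Q.tail a))⁻¹.1 := rfl

/-- The map on points of `G_d` induced by a ring map. -/
def GLProd.map {A B : Type} [CommRing A] [CommRing B] (f : A →+* B) :
    GLProd Q d A →* GLProd Q d B where
  toFun g := fun i => Matrix.GeneralLinearGroup.map f (g i)
  map_one' := by
    funext i
    exact map_one (Matrix.GeneralLinearGroup.map (n := Fin (d i)) f)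
  map_mul' g h := by
    funext i
    exact map_mul (Matrix.GeneralLinearGroup.map (n := Fin (d i)) f) (g i) (h i)

/-- The map on points of `N_d` induced by a ring map. -/
def RepSpace.map {A B : Type} [CommRing A] [CommRing B] (f : A →+* B) (φ : RepSpace Q d A) :
    RepSpace Q d B :=
  fun a => Matrix.map (φ a) f

theorem RepSpace.map_smul {A B : Type} [CommRing A] [CommRing B] (f : A →+* B)
    (g : GLProd Q d A) (φ : RepSpace Q d A) :
    RepSpace.map f (g • φ) = GLProd.map f g • RepSpace.map f φ := by
  funext a
  change ((g (Q.head a)).1 * φ a * (g (Q.tail a))⁻¹.1).map f =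
    ((g (Q.head a)).1.map f * (φ a).map f * ((g (Q.tail a))⁻¹.1.map f))
  rw [Matrix.map_mul, Matrix.map_mul]

variable (Q d)

/-- The action of `G_d` on `N_d`. -/
def repAction : GroupAction where
  G A := GLProd Q d A
  X A := RepSpace Q d A
  mapG f := GLProd.map f.hom.toRingHom
  mapX f φ := RepSpace.map f.hom.toRingHom φ
  mapG_id g := by
    funext i; ext k l; rfl
  mapG_comp f f' g := by
    funext i; ext k l; rfl
  mapX_id φ := rfl
  mapX_comp f f' φ := rfl
  mapX_smul f g φ := RepSpace.map_smul _ g φ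

variable {Q d}

/-- The family of representations on the trivial bundles `A^{d i}` given by a point of `N_d(A)`. -/
def RepSpace.std {A : Type} [CommRing A] (φ : RepSpace Q d A) : RepFam Q d A where
  U i := Fin (d i) → A
  finite i := inferInstance
  projective i := inferInstance
  rank i p := by
    have := p.nontrivial
    rw [Module.rankAtStalk_eq_finrank_of_free]
    simp
  φ a := (φ a).mulVecLin

theorem span_mulVec_eq_top {A B : Type} [CommRing A] [CommRing B] (f : A →+* B) {n : ℕ}
    (g : GL (Fin n) B) :
    Submodule.span B (Set.range fun m : Fin n → A => g.1.mulVec (f ∘ m)) = ⊤ := by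
  have h1 : ∀ k, g.1.mulVec (Pi.single k 1) ∈
      Submodule.span B (Set.range fun m : Fin n → A => g.1.mulVec (f ∘ m)) := by
    intro k
    refine Submodule.subset_span ⟨Pi.single k 1, ?_⟩
    have h : f ∘ (Pi.single k 1 : Fin n → A) = Pi.single k 1 := by
      funext l
      by_cases hl : l = k
      · subst hl; simp
      · simp [Pi.single_eq_of_ne hl]
    simp only [h]
  rw [eq_top_iff]
  intro n' _
  have h2 : n' = g.1.mulVec (g⁻¹.1.mulVec n') := by
    rw [Matrix.mulVec_mulVec, ← Units.val_mul, mul_inv_cancel, Units.val_one, Matrix.one_mulVec]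
  rw [h2, pi_eq_sum_univ' (g⁻¹.1.mulVec n'), Matrix.mulVec_sum]
  refine Submodule.sum_mem _ fun k _ => ?_
  rw [Matrix.mulVec_smul]
  refine Submodule.smul_mem _ _ ?_
  convert h1 k using 2

/-- The morphism between tautological families induced by a base change followed by an element of
`G_d`. -/
def stdHom {A B : CommAlgCat.{0} ℂ} (f : A ⟶ B) (g : GLProd Q d B) {φ : RepSpace Q d A}
    {ψ : RepSpace Q d B} (h : g • RepSpace.map f.hom.toRingHom φ = ψ) :
    Rep.Hom (⟨A, φ.std⟩ : Rep Q d) ⟨B, ψ.std⟩ where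
  base := f
  map i :=
    { toFun := fun m => (g i).1.mulVec (fun k => f.hom (m k))
      map_zero' := by
        change (g i).1.mulVec (fun k => f.hom 0) = 0
        simp only [map_zero]
        exact Matrix.mulVec_zero _
      map_add' := fun m n => by
        change (g i).1.mulVec (fun k => f.hom (m k + n k)) = _
        simp only [map_add]
        exact Matrix.mulVec_add _ _ _ }
  map_smul i r m := by
    change (g i).1.mulVec (fun k => f.hom (r * m k)) = _
    simp only [map_mul]
    exact Matrix.mulVec_smul (g i).1 (f.hom r) (fun k => f.hom (m k))
  map_φ a m := by
    subst h
    change (g (Q.head a)).1.mulVec (fun k => f.hom.toRingHom ((φ a).mulVec m k)) =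
      ((g (Q.head a)).1 * (φ a).map f.hom.toRingHom * (g (Q.tail a))⁻¹.1).mulVec
        ((g (Q.tail a)).1.mulVec (fun k => f.hom.toRingHom (m k)))
    rw [Matrix.mulVec_mulVec, Matrix.mul_assoc, ← Units.val_mul, inv_mul_cancel, Units.val_one,
      Matrix.mul_one, ← Matrix.mulVec_mulVec]
    congr 1
    funext k
    exact RingHom.map_mulVec f.hom.toRingHom (φ a) m k
  span_range i := span_mulVec_eq_top f.hom.toRingHom (g i)

variable (Q d)

/-- The tautological functor from the quotient prestack `[N_d /ₚ G_d]` to families of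
representations: a point of `N_d(A)` is sent to the corresponding family on the bundles
`A^{d i}`. -/
def stdFunctor : (repAction Q d).Prestack ⥤ Rep Q d where
  obj x := ⟨x.A, RepSpace.std x.pt⟩
  map u := stdHom u.base u.g u.smul_eq
  map_id x := by
    refine Rep.Hom.ext rfl ?_
    funext i
    refine AddMonoidHom.ext fun m => ?_
    exact Matrix.one_mulVec _
  map_comp {x y z} u v := by
    refine Rep.Hom.ext rfl ?_
    funext i
    refine AddMonoidHom.ext fun m => ?_
    change ((v.g i).1 * (u.g i).1.map v.base.hom.toRingHom).mulVec
        (fun k => v.base.hom.toRingHom (u.base.hom.toRingHom (m k))) =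
      (v.g i).1.mulVec (fun k => v.base.hom.toRingHom
        ((u.g i).1.mulVec (fun k => u.base.hom.toRingHom (m k)) k))
    rw [← Matrix.mulVec_mulVec]
    congr 1
    funext k
    exact (RingHom.map_mulVec v.base.hom.toRingHom _ _ k).symm

variable {Q d}

/-- The points of `N_d` satisfying the relations `∂_a W = 0`, that is, the points of `M_d`. -/
def InM (W : Q.Potential) (A : CommAlgCat.{0} ℂ) (φ : (repAction Q d).X A) : Prop :=
  (RepSpace.std φ : RepFam Q d A).Relations W

theorem inM_stable (W : Q.Potential) {A B : CommAlgCat.{0} ℂ} (f : A ⟶ B)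
    (g : (repAction Q d).G B) (φ : (repAction Q d).X A) (h : InM W A φ) :
    InM W B (g • (repAction Q d).mapX f φ) :=
  (stdHom f g rfl).relations h

/-- The action of `G_d` on `M_d`. -/
def jacobiAction (d : Q.V → ℕ) (W : Q.Potential) : GroupAction :=
  (repAction Q d).restrict (InM W) (inM_stable W)

/-- The `A`-points of `∏ Hom(U_{t(a)}, U_{h(a)}) × U_j`. -/
@[ext]
structure FramedSpace (Q : FinQuiver) (d : Q.V → ℕ) (j : Q.V) (A : Type) [CommRing A] where
  φ : RepSpace Q d A
  v : Fin (d j) → A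

instance (j : Q.V) (A : Type) [CommRing A] : MulAction (GLProd Q d A) (FramedSpace Q d j A) where
  smul g x := ⟨g • x.φ, (g j).1.mulVec x.v⟩
  one_smul x := FramedSpace.ext (one_smul _ x.φ) (Matrix.one_mulVec x.v)
  mul_smul g h x := FramedSpace.ext (mul_smul g h x.φ)
    (Matrix.mulVec_mulVec x.v (g j).1 (h j).1).symm

/-- The action of `G_d` on `∏ Hom(U_{t(a)}, U_{h(a)}) × U_j`. -/
def framedSpaceAction (d : Q.V → ℕ) (j : Q.V) : GroupAction where
  G A := GLProd Q d A
  X A := FramedSpace Q d j A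
  mapG f := GLProd.map f.hom.toRingHom
  mapX f x := ⟨RepSpace.map f.hom.toRingHom x.φ, fun k => f.hom.toRingHom (x.v k)⟩
  mapG_id := (repAction Q d).mapG_id
  mapG_comp := (repAction Q d).mapG_comp
  mapX_id _ := rfl
  mapX_comp _ _ _ := rfl
  mapX_smul f g x := FramedSpace.ext (RepSpace.map_smul f.hom.toRingHom g x.φ)
    (funext fun k => RingHom.map_mulVec f.hom.toRingHom (g j).1 x.v k)

/-- The points of `∏ Hom(U_{t(a)}, U_{h(a)}) × U_j` at which the framing vector is cyclic, that is,
the points of `N_d^j`. -/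
def InNj (j : Q.V) (A : CommAlgCat.{0} ℂ) (x : (framedSpaceAction d j).X A) : Prop :=
  (RepSpace.std (FramedSpace.φ x) : RepFam Q d A).IsCyclic j (FramedSpace.v x)

theorem inNj_stable (j : Q.V) {A B : CommAlgCat.{0} ℂ} (f : A ⟶ B)
    (g : (framedSpaceAction d j).G B) (x : (framedSpaceAction d j).X A) (h : InNj j A x) :
    InNj j B (g • (framedSpaceAction d j).mapX f x) :=
  (stdHom f g rfl).isCyclic (j := j) h

/-- The action of `G_d` on `N_d^j`. -/
def framedAction (d : Q.V → ℕ) (j : Q.V) : GroupAction :=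
  (framedSpaceAction d j).restrict (InNj j) (inNj_stable j)

/-- The points of `N_d^j` satisfying the relations `∂_a W = 0`, that is, the points of `M_d^j`. -/
def InMj (j : Q.V) (W : Q.Potential) (A : CommAlgCat.{0} ℂ) (x : (framedAction d j).X A) : Prop :=
  (RepSpace.std (FramedSpace.φ x.1) : RepFam Q d A).Relations W

theorem inMj_stable (j : Q.V) (W : Q.Potential) {A B : CommAlgCat.{0} ℂ} (f : A ⟶ B)
    (g : (framedAction d j).G B) (x : (framedAction d j).X A) (h : InMj j W A x) :
    InMj j W B (g • (framedAction d j).mapX f x) :=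
  (stdHom f g rfl).relations h

/-- The action of `G_d` on `M_d^j`. -/
def framedJacobiAction (d : Q.V → ℕ) (j : Q.V) (W : Q.Potential) : GroupAction :=
  (framedAction d j).restrict (InMj j W) (inMj_stable j W)

end RepSpace

/-- A family of framed representations over `Spec A`: a family of representations of `Q` of
dimension vector `d`, with a section of `U j` that is cyclic on every fibre. -/
structure FramedRep (Q : FinQuiver) (d : Q.V → ℕ) (j : Q.V) (A : CommAlgCat.{0} ℂ) where
  fam : RepFam Q d A
  v : fam.U j
  cyclic : fam.IsCyclic j v

/-- The framed family on the bundles `A^{d i}` given by a point of `N_d^j(A)`. -/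
def stdFramed {Q : FinQuiver} {d : Q.V → ℕ} {j : Q.V} {A : CommAlgCat.{0} ℂ}
    (x : (framedAction d j).X A) : FramedRep Q d j A where
  fam := RepSpace.std (FramedSpace.φ x.1)
  v := FramedSpace.v x.1
  cyclic := x.2

/-! ### Stacks over the category of affine complex schemes

A category over affine complex schemes is given by a functor `p : 𝒳 ⥤ CommAlgCat ℂ`; since the
category of affine complex schemes is opposite to the category of complex algebras, the
corresponding category over affine schemes is `p.op : 𝒳ᵒᵖ ⥤ (CommAlgCat ℂ)ᵒᵖ`, and an arrow
`x ⟶ y` of `𝒳` over `A ⟶ B` exhibits `y` as the pullback of `x` along `Spec B → Spec A`. -/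

section Stacks

/-- A collection of algebra maps out of `A` covers `Spec A` in the étale topology: it contains a
finite jointly surjective family of étale maps. -/
def EtaleCovers (A : CommAlgCat.{0} ℂ) (R : ∀ B : CommAlgCat.{0} ℂ, (A ⟶ B) → Prop) : Prop :=
  ∃ (n : ℕ) (B : Fin n → CommAlgCat.{0} ℂ) (g : ∀ k, A ⟶ B k),
    (∀ k, (g k).hom.toRingHom.Etale) ∧
    (∀ P : PrimeSpectrum A, ∃ (k : Fin n) (P' : PrimeSpectrum (B k)),
      PrimeSpectrum.comap (g k).hom.toRingHom P' = P) ∧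
    ∀ k, R (B k) (g k)

variable {𝒳 : Type 1} [Category.{0} 𝒳] (p : 𝒳 ⥤ CommAlgCat.{0} ℂ)

/-- The fibered category over affine schemes attached to `p`. -/
def basedOver : BasedCategory.{0, 1} (CommAlgCat.{0} ℂ)ᵒᵖ := BasedCategory.ofFunctor p.op

/-- The category is fibered in groupoids over affine schemes: it is fibered, and every arrow is
strongly cartesian. -/
def IsFiberedInGroupoids : Prop :=
  p.op.IsFibered ∧ ∀ {x y : 𝒳ᵒᵖ} (f : x ⟶ y), p.op.IsStronglyCartesian (p.op.map f) f

/-- The category of affine schemes over `T`, as a category over affine schemes. -/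
def slice (T : (CommAlgCat.{0} ℂ)ᵒᵖ) : BasedCategory.{0, 1} (CommAlgCat.{0} ℂ)ᵒᵖ :=
  BasedCategory.ofFunctor (Over.forget T)

/-- A sieve on `T`, as a category over affine schemes. -/
def sieveCat {T : (CommAlgCat.{0} ℂ)ᵒᵖ} (S : Sieve T) :
    BasedCategory.{0, 1} (CommAlgCat.{0} ℂ)ᵒᵖ :=
  BasedCategory.ofFunctor
    ((ObjectProperty.ι _ : S.arrows.category ⥤ Over T) ⋙ Over.forget T)

/-- The inclusion of a sieve on `T` into the category of affine schemes over `T`. -/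
def sieveIncl {T : (CommAlgCat.{0} ℂ)ᵒᵖ} (S : Sieve T) : sieveCat S ⟶ slice T where
  toFunctor := (ObjectProperty.ι _ : S.arrows.category ⥤ Over T)
  w := rfl

/-- The category is a stack in groupoids for the étale topology: it is fibered in groupoids, and for
every covering sieve `S` of every `T`, restriction along `S ⊂ (affine schemes over T)` is an
equivalence from the category of functors to `𝒳` over the base defined on all affine schemes over `T`
(that is, of objects of `𝒳` over `T`) to the category of those defined on `S` (that is, of descent
data for `S`). -/
def IsStackInGroupoids : Prop :=
  IsFiberedInGroupoids p ∧
    ∀ (T : (CommAlgCat.{0} ℂ)ᵒᵖ) (S : Sieve T),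
      EtaleCovers T.unop (fun _ g => S.arrows g.op) →
        (Bicategory.precomp (basedOver p) (sieveIncl S)).IsEquivalence

variable {p}

/-- Arrows `a : x ⟶ z` and `b : y ⟶ z` exhibit `Spec p(z)` as the fibre product
`Spec p(x) ×_𝒳 Spec p(y)` of the morphisms to `𝒳` given by `x` and `y`. An object of this fibre product
over `Spec B` consists of maps from `Spec B` to both schemes together with an isomorphism of the two
pullbacks, that is, of a pair of arrows `x ⟶ w` and `y ⟶ w` where `w` lies over `Spec B`. -/
def IsFibreProduct {x y z : 𝒳} (a : x ⟶ z) (b : y ⟶ z) : Prop :=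
  ∀ (w : 𝒳) (a' : x ⟶ w) (b' : y ⟶ w), ∃! c : z ⟶ w, a ≫ c = a' ∧ b ≫ c = b'

variable (p)

/-- The morphism `Spec p(u) → 𝒳` given by `u` is representable by affine schemes and smooth. (For
stacks with affine diagonal, every morphism from an affine scheme is representable by affine
schemes.) -/
def IsSmoothChart (u : 𝒳) : Prop :=
  ∀ y : 𝒳, ∃ (z : 𝒳) (a : u ⟶ z) (b : y ⟶ z), IsFibreProduct a b ∧
    (p.map b).hom.toRingHom.Smooth

/-- The morphism `Spec p(u) → 𝒳` given by `u` is surjective. -/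
def IsSurjectiveChart (u : 𝒳) : Prop :=
  ∀ (y z : 𝒳) (a : u ⟶ z) (b : y ⟶ z), IsFibreProduct a b →
    Function.Surjective (PrimeSpectrum.comap (p.map b).hom.toRingHom)

/-- The category is a smooth algebraic stack over `ℂ` with affine diagonal: it is a stack in
groupoids for the étale topology, its diagonal is representable by affine schemes, and it has a
smooth surjective chart which is a smooth affine scheme over `ℂ`. -/
structure IsSmoothAlgebraicStack : Prop where
  stack : IsStackInGroupoids p
  diagonal : ∀ x y : 𝒳, ∃ (z : 𝒳) (a : x ⟶ z) (b : y ⟶ z), IsFibreProduct a b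
  atlas : ∃ u : 𝒳, IsSmoothChart p u ∧ IsSurjectiveChart p u ∧ Algebra.Smooth ℂ (p.obj u)

/-- The functor `F` from the quotient prestack of `G` acting on `X` exhibits `𝒳` as the quotient stack
`[X / G]`, that is, as the stackification of the quotient prestack: `𝒳` is a stack, and `F` is a fully
faithful functor over affine schemes such that every object of `𝒳` is étale-locally in its image. -/
structure IsQuotientStack (𝒢 : GroupAction) (F : 𝒢.Prestack ⥤ 𝒳) : Prop where
  stack : IsStackInGroupoids p
  over_base : F ⋙ p = 𝒢.prestackProj
  full : F.Full
  faithful : F.Faithful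
  locally_surjective : ∀ x : 𝒳, EtaleCovers (p.obj x) fun _ g =>
    ∃ (o : 𝒢.Prestack) (ψ : x ⟶ F.obj o), p.IsHomLift g ψ

/-- A regular function on `𝒳` (a morphism to the affine line): a function on the base of every
object, compatible with pullback. -/
structure RegularFunction where
  val : ∀ x : 𝒳, p.obj x
  map_val : ∀ {x y : 𝒳} (u : x ⟶ y), (p.map u).hom (val x) = val y

end Stacks

/-! ### Critical loci -/

/-- The ideal generated by all `D f`, where `D` runs over the `ℂ`-linear derivations of `A`. If `A` is
smooth over `ℂ` (via `c`), then its module of differentials is finitely generated projective with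
dual the module of derivations, and this is the ideal of the zero scheme of `df`. -/
def criticalIdeal {A : Type} [CommRing A] (c : ℂ →+* A) (f : A) : Ideal A :=
  letI := c.toAlgebra
  Ideal.span (Set.range fun D : Derivation ℂ A A => D f)

/-- An object `x` of a smooth stack lies in the stack-theoretic critical locus of `f`: for every
smooth chart `u : U → 𝒳`, the fibre product of `U` and `Spec p(x)` over `𝒳` maps to the
scheme-theoretic critical locus of the function `f` on the smooth scheme `U`. -/
def InCriticalLocus {𝒳 : Type 1} [Category.{0} 𝒳] {p : 𝒳 ⥤ CommAlgCat.{0} ℂ}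
    (f : RegularFunction p) (x : 𝒳) : Prop :=
  ∀ u : 𝒳, IsSmoothChart p u → ∀ (w : 𝒳) (_ : x ⟶ w) (b : u ⟶ w),
    ∀ r ∈ criticalIdeal (algebraMap ℂ (p.obj u)) (f.val u), (p.map b).hom r = 0

/-! ### Schemes over the complex numbers -/

section Schemes

/-- The base scheme `Spec ℂ`. -/
abbrev SpecC : Scheme.{0} := Spec (CommRingCat.of ℂ)

/-- The affine scheme of a complex algebra. -/
abbrev specAlg (A : CommAlgCat.{0} ℂ) : Scheme.{0} := Spec (CommRingCat.of A)

/-- Its structure morphism. -/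
def specStr (A : CommAlgCat.{0} ℂ) : specAlg A ⟶ SpecC :=
  Spec.map (CommRingCat.ofHom (algebraMap ℂ A))

/-- The morphism of affine schemes induced by an algebra map. -/
def specMap {A B : CommAlgCat.{0} ℂ} (f : A ⟶ B) : specAlg B ⟶ specAlg A :=
  Spec.map (CommRingCat.ofHom f.hom.toRingHom)

attribute [local instance] MvPolynomial.gradedAlgebra

/-- Projective `n`-space over `ℂ`. -/
def projSpace (n : ℕ) : Scheme.{0} := Proj (MvPolynomial.homogeneousSubmodule (Fin (n + 1)) ℂ)

/-- The structure morphism of projective space. -/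
def projSpaceStr (n : ℕ) : projSpace n ⟶ SpecC :=
  Proj.toSpecZero (MvPolynomial.homogeneousSubmodule (Fin (n + 1)) ℂ) ≫
    Spec.map (CommRingCat.ofHom
      (algebraMap ℂ (MvPolynomial.homogeneousSubmodule (Fin (n + 1)) ℂ 0)))

/-- A complex scheme is quasiprojective if it is a locally closed subscheme of a projective space. -/
def IsQuasiprojective {R : Scheme.{0}} (s : R ⟶ SpecC) : Prop :=
  ∃ (n : ℕ) (i : R ⟶ projSpace n), IsImmersion i ∧ i ≫ projSpaceStr n = s

/-- The structure map `ℂ → 𝒪(U)` for an open subset of a complex scheme. -/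
def constants {R : Scheme.{0}} (s : R ⟶ SpecC) (U : R.Opens) : ℂ →+* Γ(R, U) :=
  ((Scheme.ΓSpecIso (CommRingCat.of ℂ)).inv ≫ s.appLE ⊤ U le_top).hom

/-- The closed subscheme given by an ideal sheaf is the scheme-theoretic critical locus of the
function `w` on the smooth complex scheme `R`, the zero scheme of `dw`. -/
def IsCriticalLocus {R : Scheme.{0}} (s : R ⟶ SpecC) (w : Γ(R, ⊤)) (I : R.IdealSheafData) : Prop :=
  ∀ U : R.affineOpens, I.ideal U =
    criticalIdeal (constants s U.1) ((R.presheaf.map (homOfLE le_top : U.1 ⟶ ⊤).op).hom w)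

/-- The pullback of a function `w` on `R` along an `A`-valued point of `R`. -/
def evalAt {R : Scheme.{0}} {A : CommAlgCat.{0} ℂ} (w : Γ(R, ⊤)) (r : specAlg A ⟶ R) : A :=
  (Scheme.ΓSpecIso (CommRingCat.of A)).hom.hom (r.appTop.hom w)

/-- The map `π : X → R` exhibits the complex scheme `R` as the quotient of `X` by a free action of
`G`, in the strongest sense (`π` is a principal `G`-bundle): `π` is a morphism of functors of points
over `ℂ`, two points of `X(A)` have the same image exactly if an element of `G(A)` carries one to the
other, this element is then unique, and every point of `R` lifts étale-locally to `X`. -/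
structure IsFreeQuotient (𝒢 : GroupAction) {R : Scheme.{0}} (s : R ⟶ SpecC)
    (π : ∀ A : CommAlgCat.{0} ℂ, 𝒢.X A → (specAlg A ⟶ R)) : Prop where
  over_base : ∀ (A : CommAlgCat.{0} ℂ) (x : 𝒢.X A), π A x ≫ s = specStr A
  natural : ∀ {A B : CommAlgCat.{0} ℂ} (f : A ⟶ B) (x : 𝒢.X A),
    π B (𝒢.mapX f x) = specMap f ≫ π A x
  eq_iff : ∀ {A : CommAlgCat.{0} ℂ} (x y : 𝒢.X A), π A x = π A y ↔ ∃! g : 𝒢.G A, g • x = y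
  locally_surjective : ∀ (A : CommAlgCat.{0} ℂ) (r : specAlg A ⟶ R), r ≫ s = specStr A →
    EtaleCovers A fun B g => ∃ x : 𝒢.X B, π B x = specMap g ≫ r

/-- The complex scheme `R` is, via the classifying maps `κ`, the fine moduli space of those framed
families which satisfy `P`: every `A`-point of `R` is the classifying map of a family over `Spec A`, and
morphisms of framed families over `f : A → B` from `x` to `y` are unique, and exist exactly if the
classifying map of `y` is the restriction along `f` of that of `x`. -/
structure IsFineModuli {Q : FinQuiver} {d : Q.V → ℕ} {j : Q.V}
    (P : ∀ A : CommAlgCat.{0} ℂ, FramedRep Q d j A → Prop) {R : Scheme.{0}} (s : R ⟶ SpecC)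
    (κ : ∀ A : CommAlgCat.{0} ℂ, {x : FramedRep Q d j A // P A x} → (specAlg A ⟶ R)) : Prop where
  over_base : ∀ (A : CommAlgCat.{0} ℂ) (x : {x : FramedRep Q d j A // P A x}), κ A x ≫ s = specStr A
  eq_iff : ∀ {A B : CommAlgCat.{0} ℂ} (f : A ⟶ B) (x : {x : FramedRep Q d j A // P A x})
    (y : {y : FramedRep Q d j B // P B y}),
    κ B y = specMap f ≫ κ A x ↔
      ∃! u : Rep.Hom (⟨A, x.1.fam⟩ : Rep Q d) ⟨B, y.1.fam⟩, u.base = f ∧ u.map j x.1.v = y.1.v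
  surjective : ∀ (A : CommAlgCat.{0} ℂ) (r : specAlg A ⟶ R), r ≫ s = specStr A →
    ∃ x : {x : FramedRep Q d j A // P A x}, κ A x = r

end Schemes

end QuiverCrit

end

noncomputable section

namespace QuiverCrit

/-! ### The action of the path algebra -/

namespace RepFam

variable {Q : FinQuiver} {d : Q.V → ℕ} {A : Type} [CommRing A] (x : RepFam Q d A)

/-! The unframed stack. A family is a family of representations of the Jacobi algebra exactly when
the endomorphisms given by the cyclic derivatives vanish (`isJacobi_iff_relations`), so only
finitely many equations matter. A morphism of families identifies the target with the base change of
the source, by comparing ranks; hence every morphism is cocartesian (`Rep.Hom.exists_fac`) and the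
category is fibered in groupoids. Finite projective modules descend along finite flat covers,
because flat base change commutes with the equalizer defining the glued module
(`isBaseChange_gluedModule`, `exists_glue`). Vector bundles are Zariski-locally trivial and
morphisms of trivial families are matrices, which gives the quotient stack. In dual bases,
isomorphisms between two families are pairs of matrices satisfying polynomial equations, so the
diagonal is affine (`exists_isFibreProduct`). A map from the tautological family is a frame, frames
lift along nilpotent thickenings, and so `N_d` is a smooth atlas.

The critical locus. For a derivation `D`, the Leibniz rule and the cyclicity of the trace give `D(Tr
W) = ∑ₐ tr(∂ₐW · D φₐ)` (`RepFam.derivation_trW`). This holds in every dual basis, although the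
matrices of the vertex projectors are then merely idempotent. It shows that `Tr W` is critical
wherever the relations hold. Conversely, on `N_d` the partial derivatives of `Tr W` are the entries
of the `∂ₐW` (`pderiv_trW`), so criticality on this one chart already forces the relations.

The framed space. A cyclic vector generates the family under words in the arrows, so framed families
have no automorphisms (`hom_unique`). Choose `d i` words for each vertex `i`. Where these words,
applied to the framing vector, give bases of all `U i`, there is exactly one group element making
the bases standard; the normalised points form an affine slice. The slice is a retract of an open
subset of affine space, hence smooth. The products of determinants `wordDet` all transform by the
same character of `G_d`, so they are homogeneous coordinates on the quotient. By Cramer's rule every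
entry of `φ` and `v` on a slice is again such a determinant, so finitely many of them embed all
slices as closed subschemes of standard charts of a projective space; finitely many slices suffice
because the polynomial ring is noetherian. All slices share one generic point, so they are open
pieces of its scheme-theoretic image, and their union is `R` (`exists_glued_charts`). Thus `R` is
quasiprojective and, if nonempty, integral. Two points of slices coincide in `R` exactly when the
framed families are isomorphic (`Gluing.lifts_iff`); rigidity then lets classifying maps and
families glue, so `R` is a fine moduli space and a free quotient.

For the framed critical locus, deform a slice point over the dual numbers by an elementary matrix
and move it back into the slice by the group. The trace does not change, so the entries of `∂ₐW` are
derivatives of `Tr W` on the slice (`entry_mem_criticalIdeal`). Since critical ideals localize, the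
critical locus is a closed subscheme, and a family is classified by a point of it exactly when it
satisfies the relations. -/

theorem vertexEnd_apply (i : Q.V) (m : x.Total) : x.vertexEnd i m = Pi.single i (m i) := rfl

theorem arrowEnd_apply (a : Q.E) (m : x.Total) :
    x.arrowEnd a m = Pi.single (Q.head a) (x.φ a (m (Q.tail a))) := rfl

theorem vertexEnd_mul_self (i : Q.V) : x.vertexEnd i * x.vertexEnd i = x.vertexEnd i := by
  refine LinearMap.ext fun m => ?_
  simp [vertexEnd_apply]

theorem vertexEnd_mul_of_ne {i k : Q.V} (h : i ≠ k) : x.vertexEnd i * x.vertexEnd k = 0 := by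
  refine LinearMap.ext fun m => ?_
  simp [vertexEnd_apply, Pi.single_eq_of_ne h]

theorem sum_vertexEnd : ∑ i, x.vertexEnd i = 1 := by
  refine LinearMap.ext fun m => ?_
  simp [LinearMap.sum_apply, vertexEnd_apply, Finset.univ_sum_single]

theorem vertexEnd_mul_arrowEnd (a : Q.E) :
    x.vertexEnd (Q.head a) * x.arrowEnd a = x.arrowEnd a := by
  refine LinearMap.ext fun m => ?_
  simp [vertexEnd_apply, arrowEnd_apply]

theorem arrowEnd_mul_vertexEnd (a : Q.E) :
    x.arrowEnd a * x.vertexEnd (Q.tail a) = x.arrowEnd a := by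
  refine LinearMap.ext fun m => ?_
  simp [vertexEnd_apply, arrowEnd_apply]

theorem arrowEnd_mul_vertexEnd_of_ne {a : Q.E} {i : Q.V} (h : Q.tail a ≠ i) :
    x.arrowEnd a * x.vertexEnd i = 0 := by
  rw [← arrowEnd_mul_vertexEnd, mul_assoc, vertexEnd_mul_of_ne x h, mul_zero]

theorem wordEnd_mul_vertexEnd_of_not_composable (l : List Q.E) : ∀ {i : Q.V},
    ¬ Q.Composable i l → x.wordEnd l * x.vertexEnd i = 0 := by
  induction l with
  | nil => intro i h; exact (h trivial).elim
  | cons a l ih =>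
    intro i h
    by_cases hi : Q.tail a = i
    · subst hi
      have h' : ¬ Q.Composable (Q.head a) l := fun h' => h ⟨rfl, h'⟩
      rw [wordEnd, mul_assoc, arrowEnd_mul_vertexEnd, ← vertexEnd_mul_arrowEnd, ← mul_assoc,
        ih h', zero_mul]
    · rw [wordEnd, mul_assoc, arrowEnd_mul_vertexEnd_of_ne x hi, mul_zero]

theorem vertexEnd_mul_wordEnd (l : List Q.E) : ∀ {i : Q.V}, Q.Composable i l →
    x.vertexEnd (Q.endpoint i l) * (x.wordEnd l * x.vertexEnd i) =
      x.wordEnd l * x.vertexEnd i := by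
  induction l with
  | nil => intro i _; simp [wordEnd, FinQuiver.endpoint, vertexEnd_mul_self]
  | cons a l ih =>
    rintro i ⟨rfl, h⟩
    have := ih h
    rw [wordEnd, mul_assoc, arrowEnd_mul_vertexEnd, ← vertexEnd_mul_arrowEnd,
      ← mul_assoc (x.wordEnd l), FinQuiver.endpoint, ← mul_assoc, this]

theorem vertexEnd_mul_pathEnd (p : Q.Path) :
    x.vertexEnd p.target * x.pathEnd p = x.pathEnd p :=
  x.vertexEnd_mul_wordEnd p.arrows p.composable

theorem pathEnd_mul_of_eq (q p : Q.Path) (h : p.target = q.source) :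
    x.pathEnd q * x.pathEnd p = x.pathEnd (p.comp q h) := by
  have : x.pathEnd (p.comp q h) = x.wordEnd q.arrows * x.pathEnd p := by
    simp [pathEnd, FinQuiver.Path.comp, wordEnd_append, mul_assoc]
  rw [this, ← x.vertexEnd_mul_pathEnd p, ← mul_assoc, ← mul_assoc, h]
  conv_lhs => rw [pathEnd, mul_assoc (x.wordEnd _), vertexEnd_mul_self]

theorem pathEnd_mul_of_ne (q p : Q.Path) (h : p.target ≠ q.source) :
    x.pathEnd q * x.pathEnd p = 0 := by
  rw [← x.vertexEnd_mul_pathEnd p, pathEnd, mul_assoc, ← mul_assoc (x.vertexEnd _),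
    vertexEnd_mul_of_ne x h.symm, zero_mul, mul_zero]

variable [Algebra ℂ A]


open FinQuiver

theorem act_zero : x.act 0 = 0 := Finsupp.sum_zero_index

theorem act_add (u v : Q.PathAlgebra) : x.act (u + v) = x.act u + x.act v :=
  Finsupp.sum_add_index' (h := fun p z => algebraMap ℂ A z • x.pathEnd p) (fun p => by simp)
    (fun p z z' => by rw [map_add, add_smul])

theorem act_smul (z : ℂ) (u : Q.PathAlgebra) : x.act (z • u) = algebraMap ℂ A z • x.act u := by
  refine (Finsupp.sum_smul_index (h := fun p z => algebraMap ℂ A z • x.pathEnd p)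
    (fun p => by simp)).trans ?_
  rw [act, Finsupp.smul_sum]
  refine Finsupp.sum_congr fun p _ => ?_
  rw [map_mul, mul_smul]

theorem act_ofPath (p : Q.Path) : x.act (PathAlgebra.ofPath p) = x.pathEnd p := by
  refine (Finsupp.sum_single_index (h := fun p z => algebraMap ℂ A z • x.pathEnd p)
    (by simp)).trans ?_
  rw [map_one, one_smul]

/-- The action of the path algebra as an additive map. -/
def actHom : Q.PathAlgebra →+ Module.End A x.Total := ⟨⟨x.act, x.act_zero⟩, x.act_add⟩

theorem act_sum {ι : Type*} (s : Finset ι) (u : ι → Q.PathAlgebra) :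
    x.act (∑ i ∈ s, u i) = ∑ i ∈ s, x.act (u i) :=
  map_sum x.actHom u s

theorem act_mul (u v : Q.PathAlgebra) : x.act (u * v) = x.act u * x.act v := by
  change x.act (PathAlgebra.mulLin u v) = _
  induction u using PathAlgebra.induction_paths with
  | h0 => simp [act_zero]
  | hadd a b ha hb => simp [act_add, ha, hb, add_mul]
  | hs z q =>
    induction v using PathAlgebra.induction_paths with
    | h0 => simp [act_zero]
    | hadd a b ha hb =>
      rw [map_add, act_add, ha, hb, act_add, mul_add]
    | hs y p =>
      simp only [map_smul, LinearMap.smul_apply, PathAlgebra.mulLin_ofPath, act_smul, act_ofPath]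
      rw [smul_mul_smul_comm, smul_smul, mul_comm (algebraMap ℂ A y)]
      congr 1
      by_cases h : p.target = q.source
      · have e : PathAlgebra.mulPath q p = PathAlgebra.ofPath (p.comp q h) := dif_pos h
        rw [e, act_ofPath, pathEnd_mul_of_eq]
      · have e : PathAlgebra.mulPath q p = 0 := dif_neg h
        rw [e, act_zero, pathEnd_mul_of_ne x q p h]

theorem act_one : x.act 1 = 1 := by
  change x.act PathAlgebra.unit = 1
  rw [PathAlgebra.unit, act_sum, ← x.sum_vertexEnd]
  refine Finset.sum_congr rfl fun i _ => ?_
  rw [act_ofPath]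
  exact one_mul _

/-- The action of the path algebra as a ring homomorphism. -/
def actRingHom : Q.PathAlgebra →+* Module.End A x.Total where
  toFun := x.act
  map_one' := x.act_one
  map_mul' := x.act_mul
  map_zero' := x.act_zero
  map_add' := x.act_add

theorem act_ofWord (i : Q.V) (l : List Q.E) :
    x.act (PathAlgebra.ofWord i l) = x.wordEnd l * x.vertexEnd i := by
  unfold PathAlgebra.ofWord
  split_ifs with h
  · rw [act_ofPath]; rfl
  · rw [act_zero, wordEnd_mul_vertexEnd_of_not_composable x l h]

/-- The action is a ring homomorphism, so its kernel is a two-sided ideal, and it factors through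
the quotient as soon as the generators act by zero. The Jacobi algebra itself is not needed in later
arguments. -/
theorem isJacobi_iff_relations (W : Q.Potential) : x.IsJacobi W ↔ x.Relations W := by
  constructor
  · rintro ⟨ρ, hρ⟩ a
    have h : toJacobi W (cyclicDeriv a W) = toJacobi W 0 :=
      ((jacobiIdeal W).ringCon.eq).2
        ((TwoSidedIdeal.rel_iff _ _ _).2 (by
          rw [sub_zero]
          exact TwoSidedIdeal.subset_span ⟨a, rfl⟩))
    rw [← hρ, h, hρ, act_zero]
  · intro h
    have hle : jacobiIdeal W ≤ TwoSidedIdeal.ker x.actRingHom := by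
      rw [jacobiIdeal, TwoSidedIdeal.span_le]
      rintro _ ⟨a, rfl⟩
      exact (TwoSidedIdeal.mem_ker _).2 (h a)
    have hle' : (jacobiIdeal W).ringCon ≤ RingCon.ker x.actRingHom := by
      intro u v huv
      have h1 := (TwoSidedIdeal.mem_ker _).1 (hle ((TwoSidedIdeal.rel_iff _ _ _).1 huv))
      rw [map_sub, sub_eq_zero] at h1
      exact h1
    exact ⟨RingCon.lift _ x.actRingHom hle', fun u => rfl⟩

end RepFam
end QuiverCrit
end

noncomputable section

namespace QuiverCrit

set_option linter.style.haveILetI false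

open scoped TensorProduct

/-! ### Dual bases -/

/-- A dual basis of a module: finitely many vectors `e k` and functionals `ε k` such that every `m`
is the combination of the `e k` with coefficients `ε k m`. -/
structure DualBasis (A M : Type) [CommRing A] [AddCommGroup M] [Module A M] where
  n : ℕ
  e : Fin n → M
  ε : Fin n → M →ₗ[A] A
  sum_eq : ∀ m, ∑ k, ε k m • e k = m

/-- Split a surjection from a free module and take coordinates of the section. Dual bases replace
bases throughout, because the bundles of a family are only projective. -/
theorem DualBasis.nonempty (A M : Type) [CommRing A] [AddCommGroup M] [Module A M]
    [Module.Finite A M] [Module.Projective A M] : Nonempty (DualBasis A M) := by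
  obtain ⟨n, f, hf⟩ := Module.Finite.exists_fin' A M
  obtain ⟨g, hg⟩ := Module.projective_lifting_property f LinearMap.id hf
  refine ⟨⟨n, fun k => f (Pi.single k 1), fun k => LinearMap.proj k ∘ₗ g, fun m => ?_⟩⟩
  have h : f (g m) = m := LinearMap.congr_fun hg m
  conv_rhs => rw [← h, pi_eq_sum_univ' (g m), map_sum]
  refine Finset.sum_congr rfl fun k _ => ?_
  rw [map_smul]
  rfl

/-- Spanning makes `B ⊗ M → N` surjective, and a surjection of finite projective modules of equal
rank at every prime is bijective. This is why morphisms of families only need to have spanning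
image. -/
theorem isBaseChange_of_span_eq_top {A B M N : Type} [CommRing A] [CommRing B] [Algebra A B]
    [AddCommGroup M] [Module A M] [AddCommGroup N] [Module A N] [Module B N] [IsScalarTower A B N]
    [Module.Finite A M] [Module.Projective A M] [Module.Finite B N] [Module.Projective B N]
    (l : M →ₗ[A] N) (hl : Submodule.span B (Set.range l) = ⊤)
    (hr : ∀ p : PrimeSpectrum B, Module.rankAtStalk (R := B) N p =
      Module.rankAtStalk (R := A) M (PrimeSpectrum.comap (algebraMap A B) p)) :
    IsBaseChange B l := by
  have hs : Function.Surjective (l.liftBaseChange B) := by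
    rw [← LinearMap.range_eq_top, eq_top_iff, ← hl, Submodule.span_le]
    rintro _ ⟨m, rfl⟩
    exact ⟨1 ⊗ₜ m, by simp⟩
  have hb : Function.Bijective (l.liftBaseChange B) :=
    Module.bijective_of_surjective_of_rankAtStalk_eq hs fun m _ => by
      rw [Module.rankAtStalk_baseChange, hr]
  exact IsBaseChange.of_equiv (LinearEquiv.ofBijective _ hb) fun m => by simp

instance (Q : FinQuiver) (d : Q.V → ℕ) (A : Type) [CommRing A] (x : RepFam Q d A) (i : Q.V) :
    Module.Finite A (x.U i) := x.finite i

instance (Q : FinQuiver) (d : Q.V → ℕ) (A : Type) [CommRing A] (x : RepFam Q d A) (i : Q.V) :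
    Module.Projective A (x.U i) := x.projective i

namespace Rep

variable {Q : FinQuiver} {d : Q.V → ℕ}

namespace Hom

variable {x y : Rep Q d} (u : Hom x y)

/-- The codomain of the base map as an algebra over its domain. -/
@[reducible] def algebra : Algebra x.A y.A := u.base.hom.toRingHom.toAlgebra

/-- The fibre of the target, as a module over the source algebra. -/
@[reducible] def moduleU (i : Q.V) : Module x.A (y.fam.U i) := Module.compHom _ u.base.hom.toRingHom

/-- The components of a morphism of families as linear maps. -/
def mapLin (i : Q.V) :
    letI := u.moduleU i
    x.fam.U i →ₗ[x.A] y.fam.U i :=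
  letI := u.moduleU i
  { toFun := u.map i
    map_add' := map_add _
    map_smul' := u.map_smul i }

theorem isScalarTower (i : Q.V) :
    letI := u.algebra
    letI := u.moduleU i
    IsScalarTower x.A y.A (y.fam.U i) :=
  letI := u.algebra
  letI := u.moduleU i
  ⟨fun r s m => mul_smul (u.base.hom r) s m⟩

theorem isBaseChange (i : Q.V) :
    letI := u.algebra
    letI := u.moduleU i
    haveI := u.isScalarTower i
    IsBaseChange y.A (u.mapLin i) := by
  letI := u.algebra
  letI := u.moduleU i
  haveI := u.isScalarTower i
  exact isBaseChange_of_span_eq_top (u.mapLin i) (u.span_range i) fun p => by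
    rw [y.fam.rank, x.fam.rank]

/-- A semilinear map out of the fibre of the source extends to the fibre of the target. -/
theorem exists_extend (i : Q.V) {C Z : Type} [CommRing C] [AddCommGroup Z] [Module C Z]
    (g : y.A →+* C) (h : x.fam.U i →+ Z) (hh : ∀ r m, h (r • m) = g (u.base.hom r) • h m) :
    ∃ k : y.fam.U i →+ Z, (∀ r n, k (r • n) = g r • k n) ∧ ∀ m, k (u.map i m) = h m := by
  letI := u.algebra
  letI := u.moduleU i
  haveI := u.isScalarTower i
  letI : Module y.A Z := Module.compHom Z g
  letI : Module x.A Z := Module.compHom Z (g.comp u.base.hom.toRingHom)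
  haveI : IsScalarTower x.A y.A Z := ⟨fun r s m => by
    change g (u.base.hom r * s) • m = g (u.base.hom r) • g s • m
    rw [map_mul, mul_smul]⟩
  let hl : x.fam.U i →ₗ[x.A] Z :=
    { toFun := h, map_add' := map_add h, map_smul' := hh }
  refine ⟨((u.isBaseChange i).lift hl).toAddMonoidHom, fun r n => ?_, fun m => ?_⟩
  · exact ((u.isBaseChange i).lift hl).map_smul r n
  · exact (u.isBaseChange i).lift_eq hl m

theorem ext_extend (i : Q.V) {C Z : Type} [CommRing C] [AddCommGroup Z] [Module C Z]
    (g : y.A → C) {k k' : y.fam.U i →+ Z} (hk : ∀ r n, k (r • n) = g r • k n)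
    (hk' : ∀ r n, k' (r • n) = g r • k' n) (h : ∀ m, k (u.map i m) = k' (u.map i m)) :
    k = k' := by
  refine AddMonoidHom.ext fun n => ?_
  have hn : n ∈ Submodule.span y.A (Set.range (u.map i)) := by rw [u.span_range i]; trivial
  induction hn using Submodule.span_induction with
  | mem n hn => obtain ⟨m, rfl⟩ := hn; exact h m
  | zero => rw [map_zero, map_zero]
  | add a b _ _ ha hb => rw [map_add, map_add, ha, hb]
  | smul r a _ ha => rw [hk, hk', ha]

/-- Two morphisms out of the target of `u` which agree on bases and after composition with `u`
agree. -/
theorem cancel {z : Rep Q d} {c c' : y ⟶ z} (hb : c.base = c'.base)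
    (h : (show x ⟶ y from u) ≫ c = (show x ⟶ y from u) ≫ c') : c = c' := by
  refine Hom.ext hb (funext fun i => ?_)
  refine u.ext_extend i (fun r => c.base.hom r) (c.map_smul i)
    (fun r n => by rw [hb]; exact c'.map_smul i r n) fun m => ?_
  exact DFunLike.congr_fun (congrFun (congrArg Hom.map h) i) m

/-- Every morphism of families is cocartesian. -/
theorem exists_fac {z : Rep Q d} (v : Hom x z) (h : y.A ⟶ z.A) (hh : u.base ≫ h = v.base) :
    ∃ c : Hom y z, c.base = h ∧ u.comp c = v := by
  have hr : ∀ r, h.hom (u.base.hom r) = v.base.hom r := fun r => by rw [← hh]; rfl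
  choose k hk1 hk2 using fun i => u.exists_extend i h.hom.toRingHom (v.map i) (fun r m => by
    rw [v.map_smul, ← hr]; rfl)
  refine ⟨⟨h, k, hk1, fun a n => ?_, fun i => ?_⟩, rfl, ?_⟩
  · have := u.ext_extend (Q.tail a) (fun r => h.hom r)
      (k := (k (Q.head a)).comp (y.fam.φ a).toAddMonoidHom)
      (k' := (z.fam.φ a).toAddMonoidHom.comp (k (Q.tail a)))
      (fun r n => by
        change k _ (y.fam.φ a (r • n)) = _ • k _ (y.fam.φ a n)
        rw [_root_.map_smul, hk1]; rfl)
      (fun r n => by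
        change z.fam.φ a (k _ (r • n)) = _ • z.fam.φ a (k _ n)
        rw [hk1, _root_.map_smul]; rfl)
      (fun m => by
        change k _ (y.fam.φ a (u.map _ m)) = z.fam.φ a (k _ (u.map _ m))
        rw [← u.map_φ, hk2, hk2, v.map_φ])
    exact DFunLike.congr_fun this n
  · rw [eq_top_iff, ← v.span_range i, Submodule.span_le]
    rintro _ ⟨m, rfl⟩
    exact Submodule.subset_span ⟨u.map i m, hk2 i m⟩
  · exact Hom.ext hh (funext fun i => AddMonoidHom.ext fun m => hk2 i m)

/-- A vertical morphism of families has an inverse. -/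
theorem exists_inverse (e : y.A ⟶ x.A) (h1 : u.base ≫ e = 𝟙 _) (h2 : e ≫ u.base = 𝟙 _) :
    ∃ c : y ⟶ x, c.base = e ∧ (show x ⟶ y from u) ≫ c = 𝟙 x ∧ c ≫ u = 𝟙 y := by
  obtain ⟨c, hc, hc'⟩ := u.exists_fac (𝟙 x : x ⟶ x) e h1
  refine ⟨c, hc, hc', ?_⟩
  refine u.cancel (c := (c : y ⟶ x) ≫ u) (c' := 𝟙 y) ?_ ?_
  · change c.base ≫ u.base = 𝟙 _
    rw [hc, h2]
  · rw [Category.comp_id, ← Category.assoc]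
    have : (show x ⟶ y from u) ≫ (c : y ⟶ x) = 𝟙 x := hc'
    rw [this, Category.id_comp]

/-- The image of a dual basis of the total space of the source. -/
theorem exists_dualBasis (β : DualBasis x.A x.fam.Total) :
    ∃ (ε : Fin β.n → y.fam.Total →ₗ[y.A] y.A),
      (∀ k m, ε k (u.total m) = u.base.hom (β.ε k m)) ∧
      ∀ m, ∑ k, ε k m • u.total (β.e k) = m := by
  choose ε0 h1 h2 using fun (k : Fin β.n) (i : Q.V) => u.exists_extend i (RingHom.id y.A)
    (u.base.hom.toRingHom.toAddMonoidHom.comp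
      (β.ε k ∘ₗ LinearMap.single x.A x.fam.U i).toAddMonoidHom) (fun r m => by
      change u.base.hom (β.ε k (Pi.single i (r • m))) =
        u.base.hom r * u.base.hom (β.ε k (Pi.single i m))
      rw [Pi.single_smul, _root_.map_smul, smul_eq_mul, map_mul])
  let ε (k : Fin β.n) : y.fam.Total →ₗ[y.A] y.A :=
    { toFun := fun m => ∑ i, ε0 k i (m i)
      map_add' := fun m n => by simp [Finset.sum_add_distrib]
      map_smul' := fun r m => by simp [Finset.mul_sum, h1] }
  have hε : ∀ k m, ε k (u.total m) = u.base.hom (β.ε k m) := by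
    intro k m
    conv_rhs => rw [← Finset.univ_sum_single m, map_sum, map_sum]
    exact Finset.sum_congr rfl fun i _ => h2 k i (m i)
  refine ⟨ε, hε, fun m => ?_⟩
  -- An identity of `y.A`-linear maps may be checked on the image of `u.total`, which spans; there
  -- it is the image of the dual basis identity of the source.
  have hlin : (∑ k, (LinearMap.toSpanSingleton y.A _ (u.total (β.e k))) ∘ₗ ε k) =
      LinearMap.id := by
    rw [← sub_eq_zero, ← LinearMap.ker_eq_top]
    refine u.total_range _ fun m => ?_
    rw [LinearMap.mem_ker, LinearMap.sub_apply, sub_eq_zero, LinearMap.sum_apply]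
    simp only [LinearMap.comp_apply, hε, LinearMap.toSpanSingleton_apply, LinearMap.id_apply]
    let T : x.fam.Total →+ y.fam.Total := ⟨⟨u.total, u.total_zero⟩, u.total_add⟩
    have hT : ∀ m, u.total m = T m := fun _ => rfl
    conv_rhs => rw [← β.sum_eq m, hT, map_sum]
    exact Finset.sum_congr rfl fun k _ => (u.total_smul _ _).symm
  have := LinearMap.congr_fun hlin m
  rw [LinearMap.sum_apply] at this
  exact this

/-- The image of a dual basis of the total space of the source. -/
def pushDualBasis (β : DualBasis x.A x.fam.Total) : DualBasis y.A y.fam.Total :=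
  ⟨β.n, fun k => u.total (β.e k), (u.exists_dualBasis β).choose,
    (u.exists_dualBasis β).choose_spec.2⟩

theorem pushDualBasis_ε (β : DualBasis x.A x.fam.Total) (k : Fin β.n) (m : x.fam.Total) :
    (u.pushDualBasis β).ε k (u.total m) = u.base.hom (β.ε k m) :=
  (u.exists_dualBasis β).choose_spec.1 k m

end Hom

/-! ### Base change of families -/

end Rep

/-- The base change of a family of representations. -/
def RepFam.baseChange {Q : FinQuiver} {d : Q.V → ℕ} {A : Type} [CommRing A] (x : RepFam Q d A)
    (B : Type) [CommRing B] [Algebra A B] : RepFam Q d B where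
  U i := B ⊗[A] x.U i
  finite i := inferInstance
  projective i := inferInstance
  rank i p := by rw [Module.rankAtStalk_baseChange, x.rank]
  φ a := (x.φ a).baseChange B

namespace Rep

variable {Q : FinQuiver} {d : Q.V → ℕ}

/-- The base change of an object along an algebra map. -/
def push (x : Rep Q d) {B : CommAlgCat.{0} ℂ} (f : x.A ⟶ B) : Rep Q d :=
  ⟨B, letI := f.hom.toRingHom.toAlgebra; x.fam.baseChange B⟩

/-- The morphism from an object to its base change. -/
def toPush (x : Rep Q d) {B : CommAlgCat.{0} ℂ} (f : x.A ⟶ B) : x ⟶ x.push f :=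
  letI := f.hom.toRingHom.toAlgebra
  { base := f
    map := fun i => ((TensorProduct.mk x.A B (x.fam.U i)) 1).toAddMonoidHom
    map_smul := fun i r m => by
      change @Eq (B ⊗[x.A] x.fam.U i) ((1 : B) ⊗ₜ[x.A] (r • m))
        (f.hom r • ((1 : B) ⊗ₜ[x.A] m))
      rw [TensorProduct.tmul_smul, TensorProduct.smul_tmul', TensorProduct.smul_tmul',
        smul_eq_mul, Algebra.smul_def]
      rfl
    map_φ := fun a m => rfl
    span_range := fun i => by
      have key : ∀ m : B ⊗[x.A] x.fam.U i,
          m ∈ Submodule.span B (Set.range fun m : x.fam.U i => (1 : B) ⊗ₜ[x.A] m) := by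
        intro m
        induction m with
        | zero => exact Submodule.zero_mem _
        | add a b ha hb => exact Submodule.add_mem _ ha hb
        | tmul b m =>
          have : b ⊗ₜ[x.A] m = b • ((1 : B) ⊗ₜ[x.A] m) := by
            rw [TensorProduct.smul_tmul', smul_eq_mul, mul_one]
          rw [this]
          exact Submodule.smul_mem _ _ (Submodule.subset_span ⟨m, rfl⟩)
      exact eq_top_iff.2 fun m _ => key m }

end Rep
end QuiverCrit
end

noncomputable section

namespace QuiverCrit

set_option linter.style.haveILetI false

open scoped TensorProduct

/-! ### Flat base change of equalizers and descent of finite projective modules -/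

section Flat

variable {A : Type} [CommRing A]

/-- Tensoring with a flat algebra preserves kernels, hence equalizers; `hi` and `hk` identify the
tensored maps with `f'` and `g'`. -/
theorem bijective_eqLocus_baseChange {B : Type} [CommRing B] [Algebra A B] [Module.Flat A B]
    {M N M' N' : Type} [AddCommGroup M] [Module A M] [AddCommGroup N] [Module A N]
    [AddCommGroup M'] [Module A M'] [Module B M'] [IsScalarTower A B M']
    [AddCommGroup N'] [Module A N'] [Module B N'] [IsScalarTower A B N']
    (f g : M →ₗ[A] N) (f' g' : M' →ₗ[B] N') (i : M →ₗ[A] M') (k : N →ₗ[A] N')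
    (hi : IsBaseChange B i) (hk : IsBaseChange B k)
    (hf : ∀ m, k (f m) = f' (i m)) (hg : ∀ m, k (g m) = g' (i m)) :
    Function.Injective
      ((i ∘ₗ (LinearMap.eqLocus f g).subtype).liftBaseChange B) ∧
    ∀ m', f' m' = g' m' →
      ∃ z, ((i ∘ₗ (LinearMap.eqLocus f g).subtype).liftBaseChange B) z = m' := by
  have h0 : ∀ z : B ⊗[A] LinearMap.eqLocus f g,
      ((i ∘ₗ (LinearMap.eqLocus f g).subtype).liftBaseChange B) z =
        hi.equiv ((LinearMap.eqLocus f g).subtype.lTensor B z) := by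
    intro z
    induction z with
    | zero => simp
    | add a b ha hb => rw [map_add, map_add, map_add, ha, hb]
    | tmul b m => simp [hi.equiv_tmul]
  have h1 : ∀ z : B ⊗[A] M, hk.equiv (f.lTensor B z) = f' (hi.equiv z) := by
    intro z
    induction z with
    | zero => simp
    | add a b ha hb => simp only [map_add, ha, hb]
    | tmul b m => simp [hi.equiv_tmul, hk.equiv_tmul, hf]
  have h2 : ∀ z : B ⊗[A] M, hk.equiv (g.lTensor B z) = g' (hi.equiv z) := by
    intro z
    induction z with
    | zero => simp
    | add a b ha hb => simp only [map_add, ha, hb]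
    | tmul b m => simp [hi.equiv_tmul, hk.equiv_tmul, hg]
  refine ⟨?_, fun m' hm' => ?_⟩
  · intro z w hzw
    rw [h0, h0] at hzw
    exact Module.Flat.lTensor_preserves_injective_linearMap _
      (LinearMap.eqLocus f g).injective_subtype (hi.equiv.injective hzw)
  · have h3 : hi.equiv.symm m' ∈ LinearMap.eqLocus
        (TensorProduct.AlgebraTensorModule.lTensor B B f)
        (TensorProduct.AlgebraTensorModule.lTensor B B g) := by
      rw [LinearMap.mem_eqLocus]
      apply hk.equiv.injective
      have e1 := h1 (hi.equiv.symm m')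
      have e2 := h2 (hi.equiv.symm m')
      rw [LinearEquiv.apply_symm_apply] at e1 e2
      exact e1.trans (hm'.trans e2.symm)
    refine ⟨(LinearMap.tensorEqLocusEquiv B B f g).symm ⟨_, h3⟩, ?_⟩
    rw [h0, LinearMap.lTensor_eqLocus_subtype_tensoreqLocusEquiv_symm]
    simp

/-- The submodule of a product of modules `M k` cut out by the conditions `p k l m_k = q k l m_l`. -/
def gluedModule {κ : Type} {M : κ → Type} {MM : κ → κ → Type}
    [∀ k, AddCommGroup (M k)] [∀ k, Module A (M k)]
    [∀ k l, AddCommGroup (MM k l)] [∀ k l, Module A (MM k l)]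
    (p : ∀ k l, M k →ₗ[A] MM k l) (q : ∀ k l, M l →ₗ[A] MM k l) : Submodule A (∀ k, M k) :=
  LinearMap.eqLocus (LinearMap.pi fun kl : κ × κ => p kl.1 kl.2 ∘ₗ LinearMap.proj kl.1)
    (LinearMap.pi fun kl : κ × κ => q kl.1 kl.2 ∘ₗ LinearMap.proj kl.2)

theorem mem_gluedModule {κ : Type} {M : κ → Type} {MM : κ → κ → Type}
    [∀ k, AddCommGroup (M k)] [∀ k, Module A (M k)]
    [∀ k l, AddCommGroup (MM k l)] [∀ k l, Module A (MM k l)]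
    (p : ∀ k l, M k →ₗ[A] MM k l) (q : ∀ k l, M l →ₗ[A] MM k l) (m : ∀ k, M k) :
    m ∈ gluedModule p q ↔ ∀ k l, p k l (m k) = q k l (m l) := by
  unfold gluedModule
  rw [LinearMap.mem_eqLocus]
  exact ⟨fun h k l => congrFun h (k, l), fun h => funext fun kl => h kl.1 kl.2⟩

/-- The glued module is an equalizer of maps between finite products, so its flat base change is the
equalizer of the base-changed maps. The module `N` maps into that equalizer by `P`, thanks to `h3`,
and one injective component `P k₀` is enough to recognise `N` there. In the application `B` is a
member of the cover, `N` its own fibre, the `N' k` are fibres on double overlaps and the `T k l` on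
triple overlaps. -/
theorem isBaseChange_gluedModule {κ : Type} [Finite κ] {M : κ → Type} {MM : κ → κ → Type}
    [∀ k, AddCommGroup (M k)] [∀ k, Module A (M k)]
    [∀ k l, AddCommGroup (MM k l)] [∀ k l, Module A (MM k l)]
    (p : ∀ k l, M k →ₗ[A] MM k l) (q : ∀ k l, M l →ₗ[A] MM k l)
    {B : Type} [CommRing B] [Algebra A B] [Module.Flat A B]
    {N : Type} [AddCommGroup N] [Module A N] [Module B N] [hN : IsScalarTower A B N]
    {N' : κ → Type} [∀ k, AddCommGroup (N' k)] [∀ k, Module A (N' k)] [∀ k, Module B (N' k)]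
    [∀ k, IsScalarTower A B (N' k)]
    {T : κ → κ → Type} [∀ k l, AddCommGroup (T k l)] [∀ k l, Module A (T k l)]
    [∀ k l, Module B (T k l)] [∀ k l, IsScalarTower A B (T k l)]
    (P : ∀ k, N →ₗ[B] N' k) (r : ∀ k, M k →ₗ[A] N' k) (hr : ∀ k, IsBaseChange B (r k))
    (e1 : ∀ k l, N' k →ₗ[B] T k l) (e2 : ∀ k l, N' l →ₗ[B] T k l)
    (e3 : ∀ k l, MM k l →ₗ[A] T k l) (he3 : ∀ k l, IsBaseChange B (e3 k l))
    (h1 : ∀ k l m, e1 k l (r k m) = e3 k l (p k l m))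
    (h2 : ∀ k l m, e2 k l (r l m) = e3 k l (q k l m))
    (h3 : ∀ k l m, e1 k l (P k m) = e2 k l (P l m))
    (π : gluedModule p q →ₗ[A] N) (hπ : ∀ u k, P k (π u) = r k (u.1 k))
    (k₀ : κ) (hk₀ : Function.Injective (P k₀)) : IsBaseChange B π := by
  obtain ⟨hinj, hsurj⟩ := bijective_eqLocus_baseChange (B := B)
    (LinearMap.pi fun kl : κ × κ => p kl.1 kl.2 ∘ₗ LinearMap.proj kl.1)
    (LinearMap.pi fun kl : κ × κ => q kl.1 kl.2 ∘ₗ LinearMap.proj kl.2)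
    (LinearMap.pi fun kl : κ × κ => e1 kl.1 kl.2 ∘ₗ LinearMap.proj kl.1)
    (LinearMap.pi fun kl : κ × κ => e2 kl.1 kl.2 ∘ₗ LinearMap.proj kl.2)
    (LinearMap.pi fun k => r k ∘ₗ LinearMap.proj k)
    (LinearMap.pi fun kl : κ × κ => e3 kl.1 kl.2 ∘ₗ LinearMap.proj kl)
    (IsBaseChange.pi r hr) (IsBaseChange.pi _ fun kl : κ × κ => he3 kl.1 kl.2)
    (fun m => funext fun kl => (h1 kl.1 kl.2 _).symm)
    (fun m => funext fun kl => (h2 kl.1 kl.2 _).symm)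
  have key : ∀ (z : B ⊗[A] gluedModule p q) (k : κ),
      (((LinearMap.pi fun k => r k ∘ₗ LinearMap.proj k) ∘ₗ
        (gluedModule p q).subtype).liftBaseChange B) z k = P k (π.liftBaseChange B z) := by
    intro z k
    induction z with
    | zero => simp
    | add a b ha hb => rw [map_add, map_add, map_add, Pi.add_apply, ha, hb]
    | tmul b m => simp [hπ]
  have hb : Function.Bijective (π.liftBaseChange B) := by
    constructor
    · intro z w hzw
      refine hinj (funext fun k => ?_)
      exact (key z k).trans ((congrArg (P k) hzw).trans (key w k).symm)
    · intro n
      obtain ⟨z, hz⟩ := hsurj (fun k => P k n) (funext fun kl => h3 kl.1 kl.2 n)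
      exact ⟨z, hk₀ ((key z k₀).symm.trans (congrFun hz k₀))⟩
  exact IsBaseChange.of_equiv (LinearEquiv.ofBijective _ hb) fun m => by simp

/-- Finiteness and flatness descend directly. Projectivity is flatness plus finite presentation, and
the latter follows by descending the finiteness of the kernel of a presentation. -/
theorem finite_projective_of_faithfullyFlat (B : Type) [CommRing B] [Algebra A B]
    [Module.FaithfullyFlat A B] (M : Type) [AddCommGroup M] [Module A M]
    [Module.Finite B (B ⊗[A] M)] [Module.Projective B (B ⊗[A] M)] :
    Module.Finite A M ∧ Module.Projective A M := by
  have hfin : Module.Finite A M := Module.Finite.of_finite_tensorProduct_of_faithfullyFlat B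
  refine ⟨hfin, ?_⟩
  have : Module.Flat A M := Module.Flat.of_flat_tensorProduct A M B
  obtain ⟨n, f, hf⟩ := Module.Finite.exists_fin' A M
  have hfB : Function.Surjective (TensorProduct.AlgebraTensorModule.lTensor B B f) :=
    LinearMap.lTensor_surjective B hf
  have := Module.finitePresentation_of_projective B (B ⊗[A] M)
  have hker := Module.FinitePresentation.fg_ker _ hfB
  have : Module.Finite B (LinearMap.ker (TensorProduct.AlgebraTensorModule.lTensor B B f)) :=
    Module.Finite.iff_fg.2 hker
  have : Module.Finite B (B ⊗[A] LinearMap.ker f) :=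
    Module.Finite.equiv (LinearMap.tensorKerEquiv B B f).symm
  have : Module.Finite A (LinearMap.ker f) :=
    Module.Finite.of_finite_tensorProduct_of_faithfullyFlat B
  have := Module.finitePresentation_of_surjective f hf (Module.Finite.iff_fg.1 this)
  exact Module.Flat.projective_of_finitePresentation

/-! ### Finite families of algebras -/

variable {κ : Type} [Fintype κ] (B : κ → Type) [∀ k, CommRing (B k)]
  [∀ k, Algebra A (B k)]

theorem faithfullyFlat_pi [∀ k, Module.Flat A (B k)]
    (h : ∀ P : PrimeSpectrum A, ∃ k, ∃ P' : PrimeSpectrum (B k),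
      PrimeSpectrum.comap (algebraMap A (B k)) P' = P) :
    Module.FaithfullyFlat A (∀ k, B k) := by
  classical
  have : Module.Flat A (∀ k, B k) :=
    Module.Flat.of_linearEquiv (DirectSum.linearEquivFunOnFintype A κ B).symm
  refine Module.FaithfullyFlat.of_comap_surjective fun P => ?_
  obtain ⟨k, P', hP⟩ := h P
  exact ⟨PrimeSpectrum.comap (Pi.evalRingHom B k) P', hP⟩

variable [DecidableEq κ]

theorem sum_map_single_tmul {N : Type} [AddCommGroup N] [Module A N] (b : ∀ k, B k) (n : N) :
    ∑ k, TensorProduct.map (LinearMap.single A B k) LinearMap.id (b k ⊗ₜ[A] n) =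
      (b ⊗ₜ[A] n : (∀ k, B k) ⊗[A] N) := by
  simp only [TensorProduct.map_tmul, LinearMap.id_apply, LinearMap.coe_single]
  rw [← TensorProduct.sum_tmul, Finset.univ_sum_single]

/-- For a faithfully flat `A → C`, the ring `A` is the equalizer of the two maps `C → C ⊗ C`. With
`C` a finite product, `C ⊗ C` splits into blocks, so the descent condition is tested on pairs of
factors. -/
theorem exists_algebraMap_eq [Module.FaithfullyFlat A (∀ k, B k)] (b : ∀ k, B k)
    (h : ∀ k l, (b k ⊗ₜ[A] (1 : B l)) = (1 : B k) ⊗ₜ[A] b l) :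
    ∃ r : A, ∀ k, algebraMap A (B k) r = b k := by
  have key : b ⊗ₜ[A] (1 : ∀ k, B k) = (1 : ∀ k, B k) ⊗ₜ[A] b := by
    have e : ∀ b c : ∀ k, B k, b ⊗ₜ[A] c = ∑ k, ∑ l, TensorProduct.map (LinearMap.single A B k)
        (LinearMap.single A B l) (b k ⊗ₜ[A] c l) := by
      intro b c
      simp only [TensorProduct.map_tmul, LinearMap.coe_single]
      simp only [← TensorProduct.tmul_sum, ← TensorProduct.sum_tmul, Finset.univ_sum_single]
    rw [e, e]
    exact Finset.sum_congr rfl fun k _ => Finset.sum_congr rfl fun l _ => congrArg _ (h k l)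
  have h2 := (Algebra.IsEffective.of_faithfullyFlat A (∀ k, B k)).eqLocus_includeLeft_includeRight
  have h3 : b ∈ Set.range (algebraMap A (∀ k, B k)) := by
    rw [← h2]; exact key
  obtain ⟨r, hr⟩ := h3
  exact ⟨r, fun k => congrFun hr k⟩

/-- The idempotents of the product identify `(∏ B k) ⊗ M` with `∏ N k`, and dual bases of the
factors assemble to one of the product. Faithfully flat descent along `A → ∏ B k` then applies. -/
theorem finite_projective_of_isBaseChange_pi [Module.FaithfullyFlat A (∀ k, B k)]
    (M : Type) [AddCommGroup M] [Module A M] {N : κ → Type} [∀ k, AddCommGroup (N k)]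
    [∀ k, Module A (N k)] [∀ k, Module (B k) (N k)] [∀ k, IsScalarTower A (B k) (N k)]
    [∀ k, Module.Finite (B k) (N k)] [∀ k, Module.Projective (B k) (N k)]
    (π : ∀ k, M →ₗ[A] N k) (hπ : ∀ k, IsBaseChange (B k) (π k)) :
    Module.Finite A M ∧ Module.Projective A M := by
  let L : (∀ k, B k) ⊗[A] M →ₗ[∀ k, B k] ∀ k, N k :=
    { toFun := fun z k => (hπ k).equiv (TensorProduct.map (LinearMap.proj k) LinearMap.id z)
      map_add' := fun z w => funext fun k => by simp
      map_smul' := fun b z => funext fun k => by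
        induction z with
        | zero => simp
        | add z w hz hw =>
          simp only [smul_add, map_add, Pi.smul_apply', RingHom.id_apply] at hz hw ⊢
          rw [hz, hw]
        | tmul c m =>
          simp [TensorProduct.smul_tmul', (hπ k).equiv_tmul, mul_smul] }
  have hL : Function.Bijective L := by
    constructor
    · intro z w h
      have h1 : ∀ k, TensorProduct.map (LinearMap.proj k : (∀ k, B k) →ₗ[A] B k)
          (LinearMap.id : M →ₗ[A] M) z =
          TensorProduct.map (LinearMap.proj k) LinearMap.id w := fun k =>
        (hπ k).equiv.injective (congrFun h k)
      have h2 : ∀ z : (∀ k, B k) ⊗[A] M, z = ∑ k, TensorProduct.map (LinearMap.single A B k)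
          LinearMap.id (TensorProduct.map (LinearMap.proj k) LinearMap.id z) := by
        intro z
        induction z with
        | zero => simp
        | add z w hz hw =>
          simp only [map_add, Finset.sum_add_distrib]
          rw [← hz, ← hw]
        | tmul b m =>
          conv_lhs => rw [← sum_map_single_tmul]
          rfl
      rw [h2 z, h2 w]
      exact Finset.sum_congr rfl fun k _ => by rw [h1]
    · intro n
      refine ⟨∑ k, TensorProduct.map (LinearMap.single A B k) LinearMap.id
        ((hπ k).equiv.symm (n k)), funext fun l => ?_⟩
      rw [map_sum, Finset.sum_apply, Finset.sum_eq_single l]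
      · change (hπ l).equiv (TensorProduct.map _ _ (TensorProduct.map _ _ _)) = n l
        have : (LinearMap.proj l ∘ₗ LinearMap.single A B l : B l →ₗ[A] B l) = LinearMap.id :=
          LinearMap.ext fun b => by simp
        rw [← LinearMap.comp_apply, ← TensorProduct.map_comp, this, LinearMap.id_comp,
          TensorProduct.map_id, LinearMap.id_apply, LinearEquiv.apply_symm_apply]
      · intro k _ hk
        change (hπ l).equiv (TensorProduct.map _ _ (TensorProduct.map _ _ _)) = 0
        have : (LinearMap.proj l ∘ₗ LinearMap.single A B k : B k →ₗ[A] B l) = 0 :=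
          LinearMap.ext fun b => by simp [Pi.single_eq_of_ne hk.symm]
        rw [← LinearMap.comp_apply, ← TensorProduct.map_comp, this, TensorProduct.map_zero_left,
          LinearMap.zero_apply, map_zero]
      · intro h; exact absurd (Finset.mem_univ l) h
  let e := LinearEquiv.ofBijective L hL
  let β : ∀ k, DualBasis (B k) (N k) := fun k => (DualBasis.nonempty (B k) (N k)).some
  let ι := Σ k, Fin (β k).n
  let E : ι → ∀ k, N k := fun s => Pi.single s.1 ((β s.1).e s.2)
  let η : (∀ k, N k) →ₗ[∀ k, B k] (ι → ∀ k, B k) :=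
    { toFun := fun n s => Pi.single s.1 ((β s.1).ε s.2 (n s.1))
      map_add' := fun n m => funext fun s => by simp [Pi.single_add]
      map_smul' := fun b n => funext fun s => by
        refine funext fun l => ?_
        by_cases hl : l = s.1
        · subst hl; simp
        · simp [Pi.single_eq_of_ne hl] }
  let σ : (ι → ∀ k, B k) →ₗ[∀ k, B k] (∀ k, N k) :=
    Fintype.linearCombination (∀ k, B k) E
  have hση : σ ∘ₗ η = LinearMap.id := by
    refine LinearMap.ext fun n => ?_
    change ∑ s : ι, (Pi.single s.1 ((β s.1).ε s.2 (n s.1)) : ∀ k, B k) • E s = n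
    rw [Fintype.sum_sigma]
    conv_rhs => rw [← Finset.univ_sum_single n]
    refine Finset.sum_congr rfl fun k _ => ?_
    refine funext fun l => ?_
    rw [Finset.sum_apply]
    by_cases hl : l = k
    · subst hl
      simp only [E, Pi.smul_apply', Pi.single_eq_same]
      exact (β l).sum_eq (n l)
    · simp [E, Pi.single_eq_of_ne hl]
  have : Module.Finite (∀ k, B k) (∀ k, N k) :=
    Module.Finite.of_surjective σ fun n => ⟨η n, LinearMap.congr_fun hση n⟩
  have : Module.Projective (∀ k, B k) (∀ k, N k) := Module.Projective.of_split η σ hση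
  have : Module.Finite (∀ k, B k) ((∀ k, B k) ⊗[A] M) := Module.Finite.equiv e.symm
  have : Module.Projective (∀ k, B k) ((∀ k, B k) ⊗[A] M) := Module.Projective.of_equiv e.symm
  exact finite_projective_of_faithfullyFlat (∀ k, B k) M

end Flat

end QuiverCrit
end

/-! ### Pushouts of complex algebras as tensor products, and gluing over flat covers -/

noncomputable section

namespace QuiverCrit

set_option linter.style.haveILetI false

open scoped TensorProduct

/-- The codomain of a map of algebras, as an algebra over the domain. -/
@[reducible] def algOf {A B : CommAlgCat.{0} ℂ} (f : A ⟶ B) : Algebra A B := f.hom.toRingHom.toAlgebra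

theorem scalarTower_algOf {A B C : CommAlgCat.{0} ℂ} (f : A ⟶ B) (g : B ⟶ C) (h : A ⟶ C)
    (e : f ≫ g = h) :
    letI := algOf f; letI := algOf g; letI := algOf h
    IsScalarTower A B C := by
  letI := algOf f; letI := algOf g; letI := algOf h
  subst e
  exact IsScalarTower.of_algebraMap_eq fun r => rfl

/-- The tensor product of two algebras over a third, as a cocone. -/
theorem exists_tensorCocone {A B C : CommAlgCat.{0} ℂ} (b : A ⟶ B) (c : A ⟶ C) :
    letI := algOf b; letI := algOf c
    ∃ (T : CommAlgCat.{0} ℂ) (i : B ⟶ T) (k : C ⟶ T) (e : T ≃+* B ⊗[A] C), b ≫ i = c ≫ k ∧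
      (∀ x, e (i.hom x) = x ⊗ₜ 1) ∧ ∀ y, e (k.hom y) = 1 ⊗ₜ y := by
  letI := algOf b; letI := algOf c
  haveI : IsScalarTower ℂ A B := IsScalarTower.of_algebraMap_eq fun r => (b.hom.commutes r).symm
  haveI : IsScalarTower ℂ A C := IsScalarTower.of_algebraMap_eq fun r => (c.hom.commutes r).symm
  refine ⟨CommAlgCat.of ℂ (B ⊗[A] C), CommAlgCat.ofHom Algebra.TensorProduct.includeLeft,
    CommAlgCat.ofHom (Algebra.TensorProduct.includeRight.restrictScalars ℂ), RingEquiv.refl _,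
    ?_, fun _ => rfl, fun _ => rfl⟩
  ext x
  change (b.hom x) ⊗ₜ[A] (1 : C) = (1 : B) ⊗ₜ[A] (c.hom x)
  have h1 : b.hom x = x • (1 : B) := (Algebra.algebraMap_eq_smul_one (A := B) x)
  have h2 : c.hom x = x • (1 : C) := (Algebra.algebraMap_eq_smul_one (A := C) x)
  rw [h1, h2, TensorProduct.smul_tmul]

/-- The comparison map from the tensor product is injective because the universal property of `P`
supplies a left inverse, and surjective because the composite the other way is an endomorphism of
the cocone `P`, hence the identity. Overlaps are thus specified only by their universal property,
while module-theoretic base change remains available. -/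
theorem algebra_isPushout {A B C P : CommAlgCat.{0} ℂ} {b : A ⟶ B} {c : A ⟶ C} {i : B ⟶ P}
    {k : C ⟶ P} (h : CategoryTheory.IsPushout b c i k) :
    letI := algOf b; letI := algOf c; letI := algOf i; letI := algOf k; letI := algOf (b ≫ i)
    haveI := scalarTower_algOf b i _ rfl
    haveI := scalarTower_algOf c k _ h.w.symm
    Algebra.IsPushout A B C P := by
  letI := algOf b; letI := algOf c; letI := algOf i; letI := algOf k; letI := algOf (b ≫ i)
  haveI := scalarTower_algOf b i _ rfl
  haveI := scalarTower_algOf c k _ h.w.symm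
  obtain ⟨T, i', k', e, hw, hi, hk⟩ := exists_tensorCocone b c
  let φ : P ⟶ T := h.desc i' k' hw
  have hφ1 : ∀ x, φ.hom (i.hom x) = i'.hom x := fun x =>
    congrArg (fun f : B ⟶ T => f.hom x) (h.inl_desc i' k' hw)
  have hφ2 : ∀ x, φ.hom (k.hom x) = k'.hom x := fun x =>
    congrArg (fun f : C ⟶ T => f.hom x) (h.inr_desc i' k' hw)
  let ψ : B ⊗[A] C →ₐ[B] P := Algebra.TensorProduct.lift (Algebra.ofId B P)
    (IsScalarTower.toAlgHom A C P) fun _ _ => Commute.all _ _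
  have hψ : ∀ x y, ψ (x ⊗ₜ y) = i.hom x * k.hom y := fun x y =>
    Algebra.TensorProduct.lift_tmul _ _ _ _ _
  have hb : Function.Bijective ψ := by
    constructor
    · refine Function.LeftInverse.injective (g := fun z => e (φ.hom z)) fun z => ?_
      induction z with
      | zero => simp
      | add z w hz hw' => simp only [map_add] at hz hw' ⊢; rw [hz, hw']
      | tmul x y =>
        change e (φ.hom (ψ (x ⊗ₜ y))) = _
        rw [hψ, map_mul, map_mul, hφ1, hφ2, hi, hk]
        simp
    · have hinv : ∀ r : ℂ, ψ (e (algebraMap ℂ T r)) = algebraMap ℂ P r := fun r => by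
        rw [← i'.hom.commutes r, hi, hψ, map_one, mul_one]
        exact i.hom.commutes r
      let ψ' : T ⟶ P := CommAlgCat.ofHom
        { toRingHom := ψ.toRingHom.comp e.toRingHom, commutes' := hinv }
      have : φ ≫ ψ' = 𝟙 P := by
        apply h.hom_ext
        · ext x
          change ψ (e (φ.hom (i.hom x))) = i.hom x
          rw [hφ1, hi, hψ, map_one, mul_one]
        · ext x
          change ψ (e (φ.hom (k.hom x))) = k.hom x
          rw [hφ2, hk, hψ, map_one, one_mul]
      intro p
      exact ⟨e (φ.hom p), congrArg (fun f : P ⟶ P => f.hom p) this⟩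
  exact ⟨IsBaseChange.of_equiv (LinearEquiv.ofBijective ψ.toLinearMap hb) fun y => by
    change ψ (1 ⊗ₜ y) = k.hom y
    rw [hψ, map_one, one_mul]⟩

theorem IsPushout.desc_tmul {A B C P : CommAlgCat.{0} ℂ} {b : A ⟶ B} {c : A ⟶ C} {i : B ⟶ P}
    {k : C ⟶ P} (h : CategoryTheory.IsPushout b c i k) :
    letI := algOf b; letI := algOf c
    ∃ φ : P →+* B ⊗[A] C, (∀ x, φ (i.hom x) = x ⊗ₜ 1) ∧ ∀ y, φ (k.hom y) = 1 ⊗ₜ y := by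
  letI := algOf b; letI := algOf c
  obtain ⟨T, i', k', e, hw, hi, hk⟩ := exists_tensorCocone b c
  refine ⟨e.toRingHom.comp (h.desc i' k' hw).hom.toRingHom, fun x => ?_, fun y => ?_⟩
  · rw [← hi]
    exact congrArg (fun f : B ⟶ T => e (f.hom x)) (h.inl_desc i' k' hw)
  · rw [← hk]
    exact congrArg (fun f : C ⟶ T => e (f.hom y)) (h.inr_desc i' k' hw)

/-- A morphism over a pushout of base algebras is a base change along the opposite side. -/
theorem isBaseChange_of_isPushout {A B C P : CommAlgCat.{0} ℂ} {b : A ⟶ B} {c : A ⟶ C} {i : B ⟶ P}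
    {k : C ⟶ P} (h : CategoryTheory.IsPushout b c i k) {M N : Type} [AddCommGroup M]
    [AddCommGroup N] [Module A M] [Module C M] [Module A N] [Module B N] [Module C N] [Module P N]
    (hM : ∀ (r : A) (m : M), r • m = c.hom r • m) (hA : ∀ (r : A) (n : N), r • n = b.hom r • n)
    (hB : ∀ (r : B) (n : N), r • n = i.hom r • n) (hC : ∀ (r : C) (n : N), r • n = k.hom r • n)
    (l : M →ₗ[A] N) (l' : M →ₗ[C] N) (hl : ∀ m, l m = l' m)
    (hbc : letI := algOf k
      haveI : IsScalarTower C P N := ⟨fun r s n => (mul_smul (k.hom r) s n).trans (hC r _).symm⟩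
      IsBaseChange P l') :
    letI := algOf b
    haveI : IsScalarTower A B N := ⟨fun r s n => (mul_smul (b.hom r) s n).trans (hA r _).symm⟩
    IsBaseChange B l := by
  letI := algOf b; letI := algOf c; letI := algOf i; letI := algOf k; letI := algOf (b ≫ i)
  haveI := scalarTower_algOf b i _ rfl
  haveI := scalarTower_algOf c k _ h.w.symm
  haveI : IsScalarTower C P N := ⟨fun r s n => (mul_smul (k.hom r) s n).trans (hC r _).symm⟩
  haveI : IsScalarTower A B N := ⟨fun r s n => (mul_smul (b.hom r) s n).trans (hA r _).symm⟩
  haveI : IsScalarTower A C M := ⟨fun r s n => (mul_smul (c.hom r) s n).trans (hM r _).symm⟩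
  haveI : IsScalarTower B P N := ⟨fun r s n => (mul_smul (i.hom r) s n).trans (hB r _).symm⟩
  haveI := algebra_isPushout h
  let e1 := (Algebra.IsPushout.cancelBaseChange A B C P M).symm
  let e2 : P ⊗[C] M ≃ₗ[B] N := hbc.equiv.restrictScalars B
  refine IsBaseChange.of_equiv (e1.trans e2) fun m => ?_
  have : e1 (1 ⊗ₜ m) = 1 ⊗ₜ m := by
    simp only [e1]
    rw [LinearEquiv.symm_apply_eq, Algebra.IsPushout.cancelBaseChange_tmul]
  rw [LinearEquiv.trans_apply, this, hl]
  exact (hbc.equiv_tmul 1 m).trans (one_smul _ _)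



/-! ### Descent for algebras -/

/-- A finite family of flat algebras over `A` which is jointly surjective on spectra. -/
structure FlatCover {n : ℕ} (A : CommAlgCat.{0} ℂ) (B : Fin n → CommAlgCat.{0} ℂ)
    (τ : ∀ m, A ⟶ B m) : Prop where
  flat : ∀ m, (τ m).hom.toRingHom.Flat
  surj : ∀ P : PrimeSpectrum A, ∃ (m : Fin n) (P' : PrimeSpectrum (B m)),
    PrimeSpectrum.comap (τ m).hom.toRingHom P' = P

namespace FlatCover

variable {n : ℕ} {A : CommAlgCat.{0} ℂ} {B : Fin n → CommAlgCat.{0} ℂ} {τ : ∀ m, A ⟶ B m}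
  (h : FlatCover A B τ)

include h

theorem faithfullyFlat :
    letI := fun m => algOf (τ m)
    Module.FaithfullyFlat A (∀ m, B m) := by
  letI := fun m => algOf (τ m)
  haveI : ∀ m, Module.Flat A (B m) := h.flat
  exact faithfullyFlat_pi (fun m => B m) h.surj

theorem injective {r r' : A} (hr : ∀ m, (τ m).hom r = (τ m).hom r') : r = r' := by
  letI := fun m => algOf (τ m)
  haveI := h.faithfullyFlat
  exact FaithfulSMul.algebraMap_injective A (∀ m, B m) (funext hr)

theorem glue {P : Fin n → Fin n → CommAlgCat.{0} ℂ} {f : ∀ m l, B m ⟶ P m l}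
    {g : ∀ m l, B l ⟶ P m l} (hp : ∀ m l, CategoryTheory.IsPushout (τ m) (τ l) (f m l) (g m l))
    (b : ∀ m, B m) (hb : ∀ m l, (f m l).hom (b m) = (g m l).hom (b l)) :
    ∃ r : A, ∀ m, (τ m).hom r = b m := by
  letI := fun m => algOf (τ m)
  haveI := h.faithfullyFlat
  refine exists_algebraMap_eq (fun m => B m) b fun m l => ?_
  obtain ⟨φ, h1, h2⟩ := IsPushout.desc_tmul (hp m l)
  exact (h1 _).symm.trans ((congrArg φ (hb m l)).trans (h2 _))

omit h in
/-- Points of two spectra over the same point come from a common field. -/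
theorem exists_common_field {A B C : Type} [CommRing A] [CommRing B] [CommRing C] (f : A →+* B)
    (g : A →+* C) (x : PrimeSpectrum B) (y : PrimeSpectrum C)
    (hxy : PrimeSpectrum.comap f x = PrimeSpectrum.comap g y) :
    ∃ (F : Type) (_ : Field F) (α : B →+* F) (β : C →+* F), α.comp f = β.comp g ∧
      RingHom.ker α = x.asIdeal ∧ RingHom.ker β = y.asIdeal := by
  let a := PrimeSpectrum.comap f x
  letI : Algebra a.asIdeal.ResidueField x.asIdeal.ResidueField :=
    (Ideal.ResidueField.map a.asIdeal x.asIdeal f rfl).toAlgebra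
  letI : Algebra a.asIdeal.ResidueField y.asIdeal.ResidueField :=
    (Ideal.ResidueField.map a.asIdeal y.asIdeal g
      (congrArg PrimeSpectrum.asIdeal hxy)).toAlgebra
  let T := x.asIdeal.ResidueField ⊗[a.asIdeal.ResidueField] y.asIdeal.ResidueField
  -- A tensor product of two extensions of a field is nonzero, so it has a residue field, which
  -- receives both residue fields compatibly.
  obtain ⟨m, hm⟩ := Ideal.exists_maximal T
  letI := Ideal.Quotient.field m
  let α' : x.asIdeal.ResidueField →+* T ⧸ m := (Ideal.Quotient.mk m).comp
    (Algebra.TensorProduct.includeLeftRingHom)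
  let β' : y.asIdeal.ResidueField →+* T ⧸ m := (Ideal.Quotient.mk m).comp
    (Algebra.TensorProduct.includeRight (R := a.asIdeal.ResidueField)
      (A := x.asIdeal.ResidueField) (B := y.asIdeal.ResidueField)).toRingHom
  have key : ∀ r : a.asIdeal.ResidueField, α' (algebraMap _ _ r) = β' (algebraMap _ _ r) := by
    intro r
    refine congrArg (Ideal.Quotient.mk m) ?_
    change (algebraMap _ x.asIdeal.ResidueField r) ⊗ₜ[a.asIdeal.ResidueField]
        (1 : y.asIdeal.ResidueField) =
      (1 : x.asIdeal.ResidueField) ⊗ₜ[a.asIdeal.ResidueField] (algebraMap _ _ r)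
    rw [Algebra.algebraMap_eq_smul_one, Algebra.algebraMap_eq_smul_one, TensorProduct.smul_tmul]
  refine ⟨T ⧸ m, inferInstance, α'.comp (algebraMap _ _), β'.comp (algebraMap _ _), ?_, ?_, ?_⟩
  · refine RingHom.ext fun r => ?_
    have h1 : algebraMap B x.asIdeal.ResidueField (f r) =
        algebraMap a.asIdeal.ResidueField x.asIdeal.ResidueField (algebraMap A _ r) :=
      (Ideal.ResidueField.map_algebraMap a.asIdeal x.asIdeal f rfl r).symm
    have h2 : algebraMap C y.asIdeal.ResidueField (g r) =
        algebraMap a.asIdeal.ResidueField y.asIdeal.ResidueField (algebraMap A _ r) :=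
      (Ideal.ResidueField.map_algebraMap a.asIdeal y.asIdeal g _ r).symm
    change α' (algebraMap B x.asIdeal.ResidueField (f r)) =
      β' (algebraMap C y.asIdeal.ResidueField (g r))
    rw [h1, h2, key]
  · ext r
    rw [RingHom.mem_ker, RingHom.comp_apply, map_eq_zero, Ideal.algebraMap_residueField_eq_zero]
  · ext r
    rw [RingHom.mem_ker, RingHom.comp_apply, map_eq_zero, Ideal.algebraMap_residueField_eq_zero]

omit h in
theorem flat_of_isPushout {A B C P : CommAlgCat.{0} ℂ} {b : A ⟶ B} {c : A ⟶ C} {i : B ⟶ P}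
    {k : C ⟶ P} (h : CategoryTheory.IsPushout b c i k) (hb : b.hom.toRingHom.Flat) :
    k.hom.toRingHom.Flat := by
  letI := algOf b; letI := algOf c; letI := algOf i; letI := algOf k; letI := algOf (b ≫ i)
  haveI := scalarTower_algOf b i _ rfl
  haveI := scalarTower_algOf c k _ h.w.symm
  haveI := algebra_isPushout h
  haveI : Algebra.IsPushout A C B P := Algebra.IsPushout.symm inferInstance
  haveI : Module.Flat A B := hb
  exact Module.Flat.isBaseChange A C B P (Algebra.IsPushout.out (R := A) (S := C) (R' := B) (S' := P))

omit h in
-- A field receiving both residue fields over that of the common image gives a map from the tensor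
-- product; the kernel of this map is the required prime.
theorem comap_of_isPushout {A B C P : CommAlgCat.{0} ℂ} {b : A ⟶ B} {c : A ⟶ C} {i : B ⟶ P}
    {k : C ⟶ P} (h : CategoryTheory.IsPushout b c i k) (x : PrimeSpectrum B) (y : PrimeSpectrum C)
    (hxy : PrimeSpectrum.comap b.hom.toRingHom x = PrimeSpectrum.comap c.hom.toRingHom y) :
    ∃ z : PrimeSpectrum P, PrimeSpectrum.comap i.hom.toRingHom z = x ∧
      PrimeSpectrum.comap k.hom.toRingHom z = y := by
  obtain ⟨F, _, α, β, hαβ, hα, hβ⟩ := exists_common_field _ _ x y hxy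
  letI := algOf b; letI := algOf c
  letI : Algebra A F := (α.comp b.hom.toRingHom).toAlgebra
  obtain ⟨φ, h1, h2⟩ := IsPushout.desc_tmul h
  let ψ : B ⊗[A] C →ₐ[A] F := Algebra.TensorProduct.lift (⟨α, fun _ => rfl⟩ : B →ₐ[A] F)
    (⟨β, fun r => (RingHom.congr_fun hαβ r).symm⟩ : C →ₐ[A] F) fun _ _ => Commute.all _ _
  have hψ : ∀ x y, ψ (x ⊗ₜ y) = α x * β y := fun x y => Algebra.TensorProduct.lift_tmul _ _ _ _ _
  refine ⟨PrimeSpectrum.comap (ψ.toRingHom.comp φ) ⊥, ?_, ?_⟩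
  · refine PrimeSpectrum.ext (Ideal.ext fun r => ?_)
    change ψ (φ (i.hom r)) = 0 ↔ r ∈ x.asIdeal
    rw [h1, hψ, map_one, mul_one, ← hα, RingHom.mem_ker]
  · refine PrimeSpectrum.ext (Ideal.ext fun r => ?_)
    change ψ (φ (k.hom r)) = 0 ↔ r ∈ y.asIdeal
    rw [h2, hψ, map_one, one_mul, ← hβ, RingHom.mem_ker]

theorem pullback {C : CommAlgCat.{0} ℂ} (c : A ⟶ C) {P : Fin n → CommAlgCat.{0} ℂ}
    {i : ∀ m, B m ⟶ P m} {k : ∀ m, C ⟶ P m}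
    (hp : ∀ m, CategoryTheory.IsPushout (τ m) c (i m) (k m)) : FlatCover C P k where
  flat m := flat_of_isPushout (hp m) (h.flat m)
  surj y := by
    obtain ⟨m, x, hx⟩ := h.surj (PrimeSpectrum.comap c.hom.toRingHom y)
    obtain ⟨z, -, hz⟩ := comap_of_isPushout (hp m) x y hx
    exact ⟨m, z, hz⟩

end FlatCover

/-! ### Gluing of morphisms and of families -/

instance (Q : FinQuiver) (d : Q.V → ℕ) (A : Type) [CommRing A] (x : RepFam Q d A) :
    Module.Projective A x.Total :=
  Module.Projective.of_equiv (DirectSum.linearEquivFunOnFintype A Q.V x.U)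

namespace Rep

variable {Q : FinQuiver} {d : Q.V → ℕ}

/-- Families on the members of a flat cover and on their pairwise overlaps. -/
structure GlueData (Q : FinQuiver) (d : Q.V → ℕ) (A : CommAlgCat.{0} ℂ) where
  n : ℕ
  y : Fin n → Rep Q d
  τ : ∀ m, A ⟶ (y m).A
  cover : FlatCover A (fun m => (y m).A) τ
  yy : Fin n → Fin n → Rep Q d
  f : ∀ m l, y m ⟶ yy m l
  g : ∀ m l, y l ⟶ yy m l
  isPushout : ∀ m l, CategoryTheory.IsPushout (τ m) (τ l) (f m l).base (g m l).base

namespace GlueData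

variable {y : Rep Q d} (G : GlueData Q d y.A) (u : ∀ m, y ⟶ G.y m) (hu : ∀ m, (u m).base = G.τ m)

include hu

/-- In a dual basis of `y` this reduces to the injectivity of `A → ∏ B k` on coefficients. -/
theorem total_injective {m m' : y.fam.Total} (h : ∀ k, (u k).total m = (u k).total m') :
    m = m' := by
  obtain ⟨β⟩ := DualBasis.nonempty y.A y.fam.Total
  rw [← β.sum_eq m, ← β.sum_eq m']
  refine Finset.sum_congr rfl fun l _ => ?_
  congr 1
  refine G.cover.injective fun k => ?_
  rw [← hu, ← (u k).pushDualBasis_ε β l, ← (u k).pushDualBasis_ε β l, h]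

theorem map_injective (i : Q.V) {m m' : y.fam.U i} (h : ∀ k, (u k).map i m = (u k).map i m') :
    m = m' := by
  have := G.total_injective u hu (m := Pi.single i m) (m' := Pi.single i m') fun k => by
    rw [Hom.total_single, Hom.total_single, h]
  exact Pi.single_injective i this

variable (huu : ∀ m l, u m ≫ G.f m l = u l ≫ G.g m l)

include huu

/-- Since the dual basis already lives over `y`, only functions have to be descended: the
coefficients of the `b m` in the pushed dual bases agree on overlaps and glue, and the corresponding
combination of the `β.e k` is the glued element. -/
theorem exists_total (b : ∀ m, (G.y m).fam.Total)
    (hb : ∀ m l, (G.f m l).total (b m) = (G.g m l).total (b l)) :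
    ∃ m : y.fam.Total, ∀ k, (u k).total m = b k := by
  obtain ⟨β⟩ := DualBasis.nonempty y.A y.fam.Total
  have hext : ∀ (m l) (k : Fin β.n), ((G.f m l).base.hom (((u m).pushDualBasis β).ε k (b m))) =
      (G.g m l).base.hom (((u l).pushDualBasis β).ε k (b l)) := by
    intro m l k
    -- Coordinates in a pushed dual basis commute with a further morphism. By linearity this is
    -- checked on the generators, where both sides are images of the original coefficients.
    have e1 : ∀ (z w : Rep Q d) (p : y ⟶ z) (q : z ⟶ w) (c : z.fam.Total),
        q.base.hom ((p.pushDualBasis β).ε k c) =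
          ((Hom.pushDualBasis (p ≫ q) β).ε k (q.total c)) := by
      intro z w p q c
      rw [← ((p.pushDualBasis β).sum_eq c)]
      let T : z.fam.Total →+ w.fam.Total := ⟨⟨q.total, q.total_zero⟩, q.total_add⟩
      have hT : ∀ c, q.total c = T c := fun _ => rfl
      simp only [map_sum, hT]
      refine Finset.sum_congr rfl fun s _ => ?_
      rw [← hT, q.total_smul, LinearMap.map_smul, LinearMap.map_smul, smul_eq_mul, smul_eq_mul,
        map_mul]
      congr 1
      change q.base.hom ((p.pushDualBasis β).ε k (p.total (β.e s))) =
        (Hom.pushDualBasis (p ≫ q) β).ε k (Hom.total (p ≫ q) (β.e s))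
      rw [Hom.pushDualBasis_ε, Hom.pushDualBasis_ε]
      rfl
    rw [e1, e1, hb, huu]
  choose r hr using fun k : Fin β.n => G.cover.glue G.isPushout
    (fun m => ((u m).pushDualBasis β).ε k (b m)) fun m l => hext m l k
  refine ⟨∑ k, r k • β.e k, fun m => ?_⟩
  let T : y.fam.Total →+ (G.y m).fam.Total := ⟨⟨(u m).total, (u m).total_zero⟩, (u m).total_add⟩
  change T _ = _
  rw [map_sum, ← ((u m).pushDualBasis β).sum_eq (b m)]
  refine Finset.sum_congr rfl fun k _ => ?_
  change (u m).total _ = _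
  rw [Hom.total_smul, hu, hr]
  rfl

theorem exists_map (i : Q.V) (b : ∀ m, (G.y m).fam.U i)
    (hb : ∀ m l, (G.f m l).map i (b m) = (G.g m l).map i (b l)) :
    ∃ m : y.fam.U i, ∀ k, (u k).map i m = b k := by
  obtain ⟨m, hm⟩ := G.exists_total u hu huu (fun m => Pi.single i (b m)) fun m l => by
    rw [Hom.total_single, Hom.total_single, hb]
  refine ⟨m i, fun k => ?_⟩
  have := congrFun (hm k) i
  rwa [Pi.single_eq_same] at this

omit huu in
theorem hom_ext {x : Rep Q d} {v v' : x ⟶ y} (hb : v.base = v'.base)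
    (h : ∀ m, v ≫ u m = v' ≫ u m) : v = v' := by
  refine Hom.ext hb (funext fun i => AddMonoidHom.ext fun m => ?_)
  exact G.map_injective u hu i fun k =>
    DFunLike.congr_fun (congrFun (congrArg Hom.map (h k)) i) m

/-- After replacing `x` by its base change along `f₀`, the components are glued element by element:
the images of an element agree on overlaps, hence come from a unique element of `y`. Linearity and
compatibility with arrows follow from uniqueness, and the spanning condition from gluing elements of
the base-changed source in the same way. -/
theorem exists_hom {x : Rep Q d} (f₀ : x.A ⟶ y.A) (v : ∀ m, x ⟶ G.y m)
    (hv : ∀ m, (v m).base = f₀ ≫ G.τ m) (hvv : ∀ m l, v m ≫ G.f m l = v l ≫ G.g m l) :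
    ∃ w : x ⟶ y, w.base = f₀ ∧ ∀ m, w ≫ u m = v m := by
  let x' := x.push f₀
  let t : x ⟶ x' := x.toPush f₀
  have ht : t.base = f₀ := rfl
  choose v' hv'1 hv'2 using fun m => t.exists_fac (v m) (G.τ m) (hv m).symm
  have hvv' : ∀ m l, (v' m : x' ⟶ _) ≫ G.f m l = (v' l : x' ⟶ _) ≫ G.g m l := by
    intro m l
    refine t.cancel ?_ ?_
    · change (v' m).base ≫ _ = (v' l).base ≫ _
      rw [hv'1, hv'1]
      exact (G.isPushout m l).w
    · have e : ∀ m, (t ≫ (v' m : x' ⟶ _)) = v m := hv'2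
      change t ≫ (v' m : x' ⟶ _) ≫ _ = t ≫ (v' l : x' ⟶ _) ≫ _
      rw [← Category.assoc, ← Category.assoc, e, e, hvv]
  have hmap : ∀ i (m : x'.fam.U i), ∃ n : y.fam.U i, ∀ k, (u k).map i n = (v' k).map i m :=
    fun i m => G.exists_map u hu huu i (fun k => (v' k).map i m) fun k l =>
      DFunLike.congr_fun (congrFun (congrArg Hom.map (hvv' k l)) i) m
  choose w hw using hmap
  let w' : Hom x' y :=
    { base := 𝟙 y.A
      map := fun i =>
        { toFun := w i
          map_zero' := G.map_injective u hu i fun k => by rw [hw, map_zero, map_zero]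
          map_add' := fun m n => G.map_injective u hu i fun k => by
            rw [hw, map_add, map_add, hw, hw] }
      map_smul := fun i r m => G.map_injective u hu i fun k => by
        change (u k).map i (w i (r • m)) = (u k).map i ((show y.A from r) • w i m)
        rw [hw, Hom.map_smul, Hom.map_smul, hw, hv'1, hu]
        rfl
      map_φ := fun a m => G.map_injective u hu _ fun k => by
        change (u k).map _ (w _ (x'.fam.φ a m)) = (u k).map _ (y.fam.φ a (w _ m))
        rw [hw, Hom.map_φ, Hom.map_φ, hw]
      span_range := fun i => by
        rw [eq_top_iff]
        intro n _
        obtain ⟨m, hm⟩ := GlueData.exists_map (y := x') G (fun k => v' k) hv'1 hvv' i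
          (fun k => (u k).map i n) fun k l =>
            DFunLike.congr_fun (congrFun (congrArg Hom.map (huu k l)) i) n
        refine Submodule.subset_span ⟨m, G.map_injective u hu i fun k => ?_⟩
        exact (hw i m k).trans (hm k) }
  refine ⟨t ≫ w', ?_, fun m => ?_⟩
  · change f₀ ≫ 𝟙 _ = f₀
    rw [Category.comp_id]
  · rw [← hv'2 m, Category.assoc]
    have : (w' : x' ⟶ y) ≫ u m = v' m := by
      refine Hom.ext ?_ (funext fun i => AddMonoidHom.ext fun n => hw i n m)
      change 𝟙 _ ≫ (u m).base = _
      rw [Category.id_comp, hv'1, hu]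
    rw [this]
    rfl

end GlueData

end Rep

end QuiverCrit
end

/-! ### Effective descent for diagrams of families -/

noncomputable section

namespace QuiverCrit

set_option linter.style.haveILetI false

open scoped TensorProduct

namespace Rep

variable {Q : FinQuiver} {d : Q.V → ℕ}

/-- The fibre of a family, as a module over an algebra mapping to the base. -/
@[reducible] def restrModule (x : Rep Q d) {R : CommAlgCat.{0} ℂ} (h : R ⟶ x.A) (i : Q.V) :
    Module R (x.fam.U i) := Module.compHom _ h.hom.toRingHom

/-- The components of a morphism, as linear maps over an algebra mapping to both bases. -/
def Hom.linOver {x y : Rep Q d} (u : x ⟶ y) {R : CommAlgCat.{0} ℂ} (hx : R ⟶ x.A) (hy : R ⟶ y.A)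
    (e : hx ≫ u.base = hy) (i : Q.V) :
    letI := x.restrModule hx i
    letI := y.restrModule hy i
    x.fam.U i →ₗ[R] y.fam.U i :=
  letI := x.restrModule hx i
  letI := y.restrModule hy i
  { toFun := u.map i
    map_add' := map_add _
    map_smul' := fun r m => by
      subst e
      exact u.map_smul i (hx.hom r) m }

universe v u

/-- A diagram of families whose bases cover `Spec A`, closed under fibre products over `Spec A`. -/
structure DescentDiagram {J : Type u} [Category.{v} J] (D : J ⥤ Rep Q d) (A : CommAlgCat.{0} ℂ) where
  τ : ∀ j, A ⟶ (D.obj j).A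
  nat : ∀ {j j' : J} (f : j ⟶ j'), τ j ≫ (D.map f).base = τ j'
  n : ℕ
  k : Fin n → J
  cover : FlatCover A (fun m => (D.obj (k m)).A) fun m => τ (k m)
  P : J → J → J
  inl : ∀ a b, a ⟶ P a b
  inr : ∀ a b, b ⟶ P a b
  isPushout : ∀ a b, CategoryTheory.IsPushout (τ a) (τ b) (D.map (inl a b)).base
    (D.map (inr a b)).base
  exists_desc : ∀ {a b q : J} (f : a ⟶ q) (g : b ⟶ q),
    ∃ h : P a b ⟶ q, inl a b ≫ h = f ∧ inr a b ≫ h = g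

namespace DescentDiagram

variable {J : Type u} [Category.{v} J] {D : J ⥤ Rep Q d} {A : CommAlgCat.{0} ℂ}
  (c : DescentDiagram D A)

/-- The finite gluing data given by the covering members of the diagram. -/
def glueData : GlueData Q d A where
  n := c.n
  y m := D.obj (c.k m)
  τ m := c.τ (c.k m)
  cover := c.cover
  yy m l := D.obj (c.P (c.k m) (c.k l))
  f _ _ := D.map (c.inl _ _)
  g _ _ := D.map (c.inr _ _)
  isPushout _ _ := c.isPushout _ _

/-- The comparison of two overlaps inside a triple overlap. -/
def tri (m l : Fin c.n) (j : J) : c.P (c.k m) j ⟶ c.P (c.k m) (c.P (c.k l) j) :=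
  (c.exists_desc (c.inl (c.k m) (c.P (c.k l) j)) (c.inr (c.k l) j ≫ c.inr _ _)).choose

theorem inl_tri (m l : Fin c.n) (j : J) : c.inl _ _ ≫ c.tri m l j = c.inl _ _ :=
  (c.exists_desc (c.inl (c.k m) (c.P (c.k l) j)) (c.inr (c.k l) j ≫ c.inr _ _)).choose_spec.1

theorem inr_tri (m l : Fin c.n) (j : J) : c.inr _ _ ≫ c.tri m l j = c.inr _ _ ≫ c.inr _ _ :=
  (c.exists_desc (c.inl (c.k m) (c.P (c.k l) j)) (c.inr (c.k l) j ≫ c.inr _ _)).choose_spec.2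

/-- The restriction of the gluing data to a member of the diagram. -/
def glueDataAt (j : J) : GlueData Q d (D.obj j).A where
  n := c.n
  y m := D.obj (c.P (c.k m) j)
  τ m := (D.map (c.inr (c.k m) j)).base
  cover := c.cover.pullback (c.τ j) fun m => c.isPushout (c.k m) j
  yy m l := D.obj (c.P (c.k m) (c.P (c.k l) j))
  f m l := D.map (c.tri m l j)
  g m l := D.map (c.inr _ _)
  isPushout m l := by
    -- The triple overlap is a pushout of `k m` with the overlap of `k l` and `j` over `A`.
    -- Cancelling the pushout of `k m` with `j` leaves a pushout over the base of `j`.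
    refine (CategoryTheory.IsPushout.of_left (h₁₁ := c.τ j) (v₁₁ := c.τ (c.k m))
      (h₂₁ := (D.map (c.inl (c.k m) j)).base) ?_ ?_ (c.isPushout (c.k m) j).flip).flip
    · have e1 : c.τ j ≫ (D.map (c.inr (c.k l) j)).base = c.τ (c.P (c.k l) j) := c.nat _
      have e2 : (D.map (c.inl (c.k m) j)).base ≫ (D.map (c.tri m l j)).base =
          (D.map (c.inl (c.k m) (c.P (c.k l) j))).base := by
        rw [← c.inl_tri m l j, D.map_comp]; rfl
      rw [e1, e2]
      exact (c.isPushout _ _).flip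
    · have := congrArg Hom.base (congrArg D.map (c.inr_tri m l j))
      rw [D.map_comp, D.map_comp] at this
      exact this.symm

/-- A family over `A` with compatible morphisms to all members of the diagram satisfies the
universal property of a limit cone for morphisms over a fixed map of bases. -/
theorem existsUnique_hom {y : Rep Q d} (c : DescentDiagram D y.A) (u : ∀ j, y ⟶ D.obj j)
    (hu : ∀ j, (u j).base = c.τ j) (hun : ∀ {j j' : J} (f : j ⟶ j'), u j ≫ D.map f = u j')
    {x : Rep Q d} (f₀ : x.A ⟶ y.A) (v : ∀ j, x ⟶ D.obj j)
    (hv : ∀ j, (v j).base = f₀ ≫ c.τ j)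
    (hvn : ∀ {j j' : J} (f : j ⟶ j'), v j ≫ D.map f = v j') :
    ∃! w : x ⟶ y, w.base = f₀ ∧ ∀ j, w ≫ u j = v j := by
  obtain ⟨w, hw1, hw2⟩ := c.glueData.exists_hom (fun m => u (c.k m)) (fun m => hu _)
    (fun m l => (hun _).trans (hun _).symm) f₀ (fun m => v (c.k m)) (fun m => hv _)
    (fun m l => (hvn _).trans (hvn _).symm)
  refine ⟨w, ⟨hw1, fun j => ?_⟩, fun w' hw' => ?_⟩
  -- A member `j` outside the finite cover is covered by its overlaps with the cover, and there the
  -- equation follows from the one on the covering members.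
  · refine (c.glueDataAt j).hom_ext (fun m => D.map (c.inr (c.k m) j)) (fun m => rfl) ?_ fun m => ?_
    · change w.base ≫ (u j).base = (v j).base
      rw [hw1, hu, hv]
    · change (w ≫ u j) ≫ D.map (c.inr (c.k m) j) = v j ≫ D.map (c.inr (c.k m) j)
      rw [Category.assoc, hun, hvn, ← hun (c.inl _ _), ← hvn (c.inl _ _), ← Category.assoc]
      congr 1
      exact hw2 m
  · refine c.glueData.hom_ext (fun m => u (c.k m)) (fun m => hu _) (hw'.1.trans hw1.symm)
      fun m => ?_
    exact (hw'.2 _).trans (hw2 m).symm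

omit c in
theorem restrModule_isScalarTower {R : CommAlgCat.{0} ℂ} (hR : A ⟶ R) {y : Rep Q d}
    (hy : R ⟶ y.A) (hA : A ⟶ y.A) (e : hR ≫ hy = hA) (i : Q.V) :
    letI := algOf hR
    letI := y.restrModule hA i
    letI := y.restrModule hy i
    IsScalarTower A R (y.fam.U i) := by
  subst e
  letI := algOf hR
  letI := y.restrModule (hR ≫ hy) i
  letI := y.restrModule hy i
  refine ⟨fun r s m => ?_⟩
  change hy.hom (hR.hom r * s) • m = hy.hom (hR.hom r) • hy.hom s • m
  rw [map_mul, mul_smul]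

omit c in
theorem restrModule_isScalarTower_self {y : Rep Q d} (h : A ⟶ y.A) (i : Q.V) :
    letI := algOf h
    letI := y.restrModule h i
    IsScalarTower A y.A (y.fam.U i) := by
  letI := algOf h
  letI := y.restrModule h i
  exact ⟨fun r s m => mul_smul (h.hom r) s m⟩

omit c in
theorem isBaseChange_linOver {R : CommAlgCat.{0} ℂ} (hR : A ⟶ R) {x y : Rep Q d}
    (u : x ⟶ y) (hx : A ⟶ x.A) (hy : R ⟶ y.A) (h : CategoryTheory.IsPushout hR hx hy u.base)
    (hA : A ⟶ y.A) (e : hR ≫ hy = hA) (e' : hx ≫ u.base = hA) (i : Q.V) :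
    letI := algOf hR
    letI := x.restrModule hx i
    letI := y.restrModule hA i
    letI := y.restrModule hy i
    haveI := restrModule_isScalarTower hR hy hA e i
    IsBaseChange R (u.linOver hx hA e' i) := by
  subst e
  letI := x.restrModule hx i
  letI := y.restrModule (hR ≫ hy) i
  letI := y.restrModule hy i
  letI := u.moduleU i
  exact isBaseChange_of_isPushout h (fun _ _ => rfl) (fun _ _ => rfl) (fun _ _ => rfl)
    (fun _ _ => rfl) (u.linOver hx (hR ≫ hy) h.w.symm i) (u.mapLin i) (fun _ => rfl)
    (u.isBaseChange i)

/-- The fibres of the glued family: compatible families of elements of the fibres of the covering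
members. -/
def glueU (i : Q.V) :
    letI := fun j => (D.obj j).restrModule (c.τ j) i
    Submodule A (∀ m, (D.obj (c.k m)).fam.U i) :=
  letI := fun j => (D.obj j).restrModule (c.τ j) i
  gluedModule (fun m l => (D.map (c.inl (c.k m) (c.k l))).linOver _ _ (c.nat _) i)
    fun m l => (D.map (c.inr (c.k m) (c.k l))).linOver _ _ (c.nat _) i

theorem mem_glueU (i : Q.V) (b : ∀ m, (D.obj (c.k m)).fam.U i) :
    (letI := fun j => (D.obj j).restrModule (c.τ j) i
     b ∈ c.glueU i) ↔ ∀ m l, (D.map (c.inl (c.k m) (c.k l))).map i (b m) =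
      (D.map (c.inr (c.k m) (c.k l))).map i (b l) :=
  letI := fun j => (D.obj j).restrModule (c.τ j) i
  mem_gluedModule _ _ _

/-- The projections of the glued fibre. -/
def glueπ (i : Q.V) (m : Fin c.n) :
    letI := fun j => (D.obj j).restrModule (c.τ j) i
    c.glueU i →ₗ[A] (D.obj (c.k m)).fam.U i :=
  letI := fun j => (D.obj j).restrModule (c.τ j) i
  LinearMap.proj m ∘ₗ (c.glueU i).subtype

/-- Over a covering member `k m` the gluing problem has the tautological solution given by the fibre
of `k m` itself. The maps `δ₁` and `δ₂` are the two faces from double to triple overlaps, and `s`,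
the diagonal of the self-overlap of `k m`, supplies the one injective component needed in
`isBaseChange_gluedModule`. -/
theorem isBaseChange_glueπ (i : Q.V) (m : Fin c.n) :
    letI := fun j => (D.obj j).restrModule (c.τ j) i
    letI := algOf (c.τ (c.k m))
    haveI : IsScalarTower A (D.obj (c.k m)).A ((D.obj (c.k m)).fam.U i) :=
      restrModule_isScalarTower_self (c.τ (c.k m)) i
    IsBaseChange (D.obj (c.k m)).A (c.glueπ i m) := by
  letI I0 := fun j => (D.obj j).restrModule (c.τ j) i
  letI := algOf (c.τ (c.k m))
  have hN : IsScalarTower A (D.obj (c.k m)).A ((D.obj (c.k m)).fam.U i) :=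
    restrModule_isScalarTower_self (c.τ (c.k m)) i
  letI I1 := fun j => (D.obj (c.P (c.k m) j)).restrModule (D.map (c.inl (c.k m) j)).base i
  have hτ : ∀ j, c.τ (c.P (c.k m) j) = c.τ (c.k m) ≫ (D.map (c.inl (c.k m) j)).base :=
    fun j => (c.nat _).symm
  have I2 : ∀ j, IsScalarTower A (D.obj (c.k m)).A ((D.obj (c.P (c.k m) j)).fam.U i) :=
    fun j => restrModule_isScalarTower (c.τ (c.k m)) (D.map (c.inl (c.k m) j)).base _ (hτ j).symm i
  have hbc : ∀ j, IsBaseChange (D.obj (c.k m)).A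
      ((D.map (c.inr (c.k m) j)).linOver _ _ (c.nat _) i) :=
    fun j => isBaseChange_linOver (c.τ (c.k m)) (D.map (c.inr (c.k m) j)) (c.τ j)
      (D.map (c.inl (c.k m) j)).base (c.isPushout _ _) _ (hτ j).symm _ i
  haveI : Module.Flat A (D.obj (c.k m)).A := c.cover.flat m
  have hb : ∀ {j j' : J} (h : c.P (c.k m) j ⟶ c.P (c.k m) j') (_ : c.inl _ _ ≫ h = c.inl _ _),
      (D.map (c.inl (c.k m) j)).base ≫ (D.map h).base = (D.map (c.inl (c.k m) j')).base := by
    intro j j' h e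
    rw [← e, D.map_comp]
    rfl
  choose δ₁ hδ₁l hδ₁r using fun a b => c.exists_desc (c.inl (c.k m) (c.P (c.k a) (c.k b)))
    (c.inl (c.k a) (c.k b) ≫ c.inr _ _)
  choose δ₂ hδ₂l hδ₂r using fun a b => c.exists_desc (c.inl (c.k m) (c.P (c.k a) (c.k b)))
    (c.inr (c.k a) (c.k b) ≫ c.inr _ _)
  have hmap : ∀ {j j' j'' : J} (f : j ⟶ j') (g : j' ⟶ j'') (x : (D.obj j).fam.U i),
      (D.map g).map i ((D.map f).map i x) = (D.map (f ≫ g)).map i x := by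
    intro j j' j'' f g x
    rw [D.map_comp]
    rfl
  obtain ⟨s, hs, -⟩ := c.exists_desc (𝟙 (c.k m)) (𝟙 (c.k m))
  refine isBaseChange_gluedModule (A := A) (hN := hN) (B := (D.obj (c.k m)).A)
    (N := (D.obj (c.k m)).fam.U i) (N' := fun l => (D.obj (c.P (c.k m) (c.k l))).fam.U i)
    (T := fun a b => (D.obj (c.P (c.k m) (c.P (c.k a) (c.k b)))).fam.U i)
    (fun m l => (D.map (c.inl (c.k m) (c.k l))).linOver _ _ (c.nat _) i)
    (fun m l => (D.map (c.inr (c.k m) (c.k l))).linOver _ _ (c.nat _) i)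
    (fun l => (D.map (c.inl (c.k m) (c.k l))).linOver (𝟙 _) _ (Category.id_comp _) i)
    (fun l => (D.map (c.inr (c.k m) (c.k l))).linOver _ _ (c.nat _) i)
    (fun l => hbc _)
    (fun a b => (D.map (δ₁ a b)).linOver _ _ (hb _ (hδ₁l a b)) i)
    (fun a b => (D.map (δ₂ a b)).linOver _ _ (hb _ (hδ₂l a b)) i)
    (fun a b => (D.map (c.inr (c.k m) (c.P (c.k a) (c.k b)))).linOver _ _ (c.nat _) i)
    (fun a b => hbc _)
    (fun a b x => by
      change (D.map (δ₁ a b)).map i ((D.map (c.inr _ _)).map i x) =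
        (D.map (c.inr _ _)).map i ((D.map (c.inl _ _)).map i x)
      rw [hmap, hmap, hδ₁r])
    (fun a b x => by
      change (D.map (δ₂ a b)).map i ((D.map (c.inr _ _)).map i x) =
        (D.map (c.inr _ _)).map i ((D.map (c.inr _ _)).map i x)
      rw [hmap, hmap, hδ₂r])
    (fun a b x => by
      change (D.map (δ₁ a b)).map i ((D.map (c.inl _ _)).map i x) =
        (D.map (δ₂ a b)).map i ((D.map (c.inl _ _)).map i x)
      rw [hmap, hmap, hδ₁l, hδ₂l])
    (c.glueπ i m) (fun x l => ((c.mem_glueU i x.1).1 x.2 m l)) m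
    (fun x y hxy => by
      have h2 := congrArg ((D.map s).map i) hxy
      change (D.map s).map i ((D.map (c.inl _ _)).map i x) =
        (D.map s).map i ((D.map (c.inl _ _)).map i y) at h2
      rw [hmap, hmap, hs, D.map_id] at h2
      exact h2)

/-- The glued family. -/
def glueFam : RepFam Q d A where
  U i :=
    letI := fun j => (D.obj j).restrModule (c.τ j) i
    c.glueU i
  addCommGroup i :=
    letI := fun j => (D.obj j).restrModule (c.τ j) i
    inferInstance
  module i :=
    letI := fun j => (D.obj j).restrModule (c.τ j) i
    inferInstance
  finite i := by
    letI := fun j => (D.obj j).restrModule (c.τ j) i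
    letI := fun m => algOf (c.τ (c.k m))
    haveI := c.cover.faithfullyFlat
    haveI : ∀ m, IsScalarTower A (D.obj (c.k m)).A ((D.obj (c.k m)).fam.U i) :=
      fun m => restrModule_isScalarTower_self (c.τ (c.k m)) i
    exact (finite_projective_of_isBaseChange_pi (fun m => (D.obj (c.k m)).A) (c.glueU i)
      (c.glueπ i) (c.isBaseChange_glueπ i)).1
  projective i := by
    letI := fun j => (D.obj j).restrModule (c.τ j) i
    letI := fun m => algOf (c.τ (c.k m))
    haveI := c.cover.faithfullyFlat
    haveI : ∀ m, IsScalarTower A (D.obj (c.k m)).A ((D.obj (c.k m)).fam.U i) :=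
      fun m => restrModule_isScalarTower_self (c.τ (c.k m)) i
    exact (finite_projective_of_isBaseChange_pi (fun m => (D.obj (c.k m)).A) (c.glueU i)
      (c.glueπ i) (c.isBaseChange_glueπ i)).2
  rank i p := by
    letI := fun j => (D.obj j).restrModule (c.τ j) i
    letI := fun m => algOf (c.τ (c.k m))
    haveI := c.cover.faithfullyFlat
    haveI : ∀ m, IsScalarTower A (D.obj (c.k m)).A ((D.obj (c.k m)).fam.U i) :=
      fun m => restrModule_isScalarTower_self (c.τ (c.k m)) i
    have hfp := finite_projective_of_isBaseChange_pi (fun m => (D.obj (c.k m)).A) (c.glueU i)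
      (c.glueπ i) (c.isBaseChange_glueπ i)
    haveI := hfp.1
    haveI := hfp.2
    obtain ⟨m, p', hp⟩ := c.cover.surj p
    rw [← (D.obj (c.k m)).fam.rank i p', Module.rankAtStalk_isBaseChange
      (c.isBaseChange_glueπ i m) p']
    exact congrArg _ hp.symm
  φ a :=
    letI := fun i j => (D.obj j).restrModule (c.τ j) i
    { toFun := fun x => ⟨fun m => (D.obj (c.k m)).fam.φ a (x.1 m), (c.mem_glueU _ _).2
        fun m l => by
          rw [Hom.map_φ, Hom.map_φ, (c.mem_glueU _ _).1 x.2]⟩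
      map_add' := fun x y => Subtype.ext (funext fun m => map_add _ _ _)
      map_smul' := fun r x => Subtype.ext (funext fun m => by
        exact LinearMap.map_smul ((D.obj (c.k m)).fam.φ a) ((c.τ (c.k m)).hom r) (x.1 m)) }

/-- The projections from the glued family to the covering members. -/
def glueHom (m : Fin c.n) : (⟨A, c.glueFam⟩ : Rep Q d) ⟶ D.obj (c.k m) where
  base := c.τ (c.k m)
  map i := letI := fun j => (D.obj j).restrModule (c.τ j) i
    (c.glueπ i m).toAddMonoidHom
  map_smul i r x := rfl
  map_φ a x := rfl
  span_range i := by
    letI := fun j => (D.obj j).restrModule (c.τ j) i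
    letI := fun m => algOf (c.τ (c.k m))
    haveI : ∀ m, IsScalarTower A (D.obj (c.k m)).A ((D.obj (c.k m)).fam.U i) :=
      fun m => restrModule_isScalarTower_self (c.τ (c.k m)) i
    rw [eq_top_iff]
    intro z _
    obtain ⟨w, rfl⟩ := (c.isBaseChange_glueπ i m).equiv.surjective z
    induction w with
    | zero => rw [map_zero]; exact Submodule.zero_mem _
    | add a b ha hb => rw [map_add]; exact Submodule.add_mem _ (ha trivial) (hb trivial)
    | tmul r x =>
      refine (congrArg (· ∈ Submodule.span (D.obj (c.k m)).A (Set.range (c.glueπ i m)))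
        (IsBaseChange.equiv_tmul (c.isBaseChange_glueπ i m) r x)).mpr ?_
      exact Submodule.smul_mem _ _ (Submodule.subset_span ⟨x, rfl⟩)

/-- Families descend along flat covers. -/
theorem exists_glue : ∃ (y : RepFam Q d A) (u : ∀ j, (⟨A, y⟩ : Rep Q d) ⟶ D.obj j),
    (∀ j, (u j).base = c.τ j) ∧ ∀ {j j' : J} (f : j ⟶ j'), u j ≫ D.map f = u j' := by
  have hcomp : ∀ (j : J) (m : Fin c.n), (c.glueHom m ≫ D.map (c.inl (c.k m) j)).base =
      c.τ j ≫ (D.map (c.inr (c.k m) j)).base := fun j m => (c.isPushout _ _).w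
  have hglue : ∀ m l, c.glueHom m ≫ D.map (c.inl (c.k m) (c.k l)) =
      c.glueHom l ≫ D.map (c.inr (c.k m) (c.k l)) := by
    intro m l
    refine Hom.ext ((c.nat _).trans (c.nat _).symm) (funext fun i => AddMonoidHom.ext fun x => ?_)
    exact (c.mem_glueU i x.1).1 x.2 m l
  -- The glued family projects only to the covering members by construction. To reach an arbitrary
  -- `j`, glue the composites into its overlaps with the cover.
  choose u hu1 hu2 using fun j => (c.glueDataAt j).exists_hom
    (x := ⟨A, c.glueFam⟩) (fun m => D.map (c.inr (c.k m) j)) (fun m => rfl)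
    (fun (m l : Fin c.n) => by
      change D.map (c.inr (c.k m) j) ≫ D.map (c.tri m l j) = D.map _ ≫ D.map _
      rw [← D.map_comp, ← D.map_comp, c.inr_tri]) (c.τ j)
    (fun m => c.glueHom m ≫ D.map (c.inl (c.k m) j)) (hcomp j) (fun (m l : Fin c.n) => by
      change (c.glueHom m ≫ D.map _) ≫ D.map (c.tri m l j) =
        (c.glueHom l ≫ D.map _) ≫ D.map (c.inr _ _)
      obtain ⟨δ, hδ1, hδ2⟩ := c.exists_desc (c.inl (c.k m) (c.P (c.k l) j))
        (c.inl (c.k l) j ≫ c.inr (c.k m) (c.P (c.k l) j))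
      rw [Category.assoc, Category.assoc, ← D.map_comp, ← D.map_comp, c.inl_tri, ← hδ1, ← hδ2,
        D.map_comp, D.map_comp, ← Category.assoc, ← Category.assoc, hglue])
  refine ⟨c.glueFam, u, hu1, fun {j j'} f => ?_⟩
  refine (c.glueDataAt j').hom_ext (fun m => D.map (c.inr (c.k m) j')) (fun m => rfl) ?_ fun (m : Fin c.n) => ?_
  · change (u j).base ≫ (D.map f).base = (u j').base
    rw [hu1, hu1, c.nat]
  · change (u j ≫ D.map f) ≫ D.map (c.inr (c.k m) j') = u j' ≫ D.map (c.inr (c.k m) j')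
    obtain ⟨h, h1, h2⟩ := c.exists_desc (c.inl (c.k m) j') (f ≫ c.inr (c.k m) j')
    have e1 : u j ≫ D.map (c.inr (c.k m) j) = c.glueHom m ≫ D.map (c.inl (c.k m) j) := hu2 j m
    have e2 : u j' ≫ D.map (c.inr (c.k m) j') = c.glueHom m ≫ D.map (c.inl (c.k m) j') := hu2 j' m
    rw [e2, Category.assoc, ← D.map_comp, ← h2, ← h1, D.map_comp, D.map_comp, ← Category.assoc,
      ← Category.assoc, e1]

end DescentDiagram

end Rep

end QuiverCrit
end

noncomputable section

namespace QuiverCrit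

set_option linter.style.haveILetI false

/-! ### A criterion for stacks -/

section StackCriterion

open Functor

variable {𝒳 : Type 1} [Category.{0} 𝒳] (p : 𝒳 ⥤ CommAlgCat.{0} ℂ)

/-- Every arrow is cocartesian, and arrows of the base lift with given source. -/
structure IsCofiberedInGroupoids : Prop where
  existsUnique_fac : ∀ {x y z : 𝒳} (u : x ⟶ y) (v : x ⟶ z) (h : p.obj y ⟶ p.obj z),
    p.map u ≫ h = p.map v → ∃! c : y ⟶ z, p.map c = h ∧ u ≫ c = v
  exists_lift : ∀ (x : 𝒳) (B : CommAlgCat.{0} ℂ) (f : p.obj x ⟶ B),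
    ∃ (y : 𝒳) (u : x ⟶ y), p.IsHomLift f u

variable {p}

theorem isHomLift_op {x y : 𝒳} {A B : CommAlgCat.{0} ℂ} (f : A ⟶ B) (u : x ⟶ y)
    (h : p.IsHomLift f u) : p.op.IsHomLift f.op u.op := by
  obtain ⟨⟩ := h
  exact Functor.IsHomLift.map (p := p.op) u.op

theorem isHomLift_unop {x y : 𝒳ᵒᵖ} {A B : (CommAlgCat.{0} ℂ)ᵒᵖ} (f : A ⟶ B) (u : x ⟶ y)
    (h : p.op.IsHomLift f u) : p.IsHomLift f.unop u.unop := by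
  obtain ⟨⟩ := h
  exact Functor.IsHomLift.map (p := p) u.unop

theorem IsCofiberedInGroupoids.isStronglyCartesian (h : IsCofiberedInGroupoids p) {x y : 𝒳ᵒᵖ}
    (f : x ⟶ y) : p.op.IsStronglyCartesian (p.op.map f) f where
  universal_property' {a'} g φ' hφ' := by
    have hφ : (g ≫ p.op.map f) = p.op.map φ' := IsHomLift.eq_of_isHomLift p.op _ φ'
    obtain ⟨c, ⟨hc1, hc2⟩, hc3⟩ := h.existsUnique_fac f.unop φ'.unop g.unop
      (congrArg Quiver.Hom.unop hφ)
    refine ⟨c.op, ⟨?_, congrArg Quiver.Hom.op hc2⟩, ?_⟩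
    · have : g = p.op.map c.op := congrArg Quiver.Hom.op hc1.symm
      rw [this]; infer_instance
    · rintro χ ⟨hχ1, hχ2⟩
      refine Quiver.Hom.unop_inj (hc3 χ.unop ⟨?_, congrArg Quiver.Hom.unop hχ2⟩)
      exact (congrArg Quiver.Hom.unop (IsHomLift.eq_of_isHomLift p.op g χ)).symm

theorem IsCofiberedInGroupoids.isStronglyCartesian_of_isHomLift (h : IsCofiberedInGroupoids p)
    {x y : 𝒳ᵒᵖ} {A B : (CommAlgCat.{0} ℂ)ᵒᵖ} (g : A ⟶ B) (f : x ⟶ y) (hf : p.op.IsHomLift g f) :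
    p.op.IsStronglyCartesian g f := by
  obtain ⟨⟩ := hf
  exact h.isStronglyCartesian f

theorem IsCofiberedInGroupoids.isFibered (h : IsCofiberedInGroupoids p) : p.op.IsFibered where
  exists_isCartesian' {a R} f := by
    obtain ⟨y, u, hu⟩ := h.exists_lift a.unop R.unop f.unop
    have := h.isStronglyCartesian_of_isHomLift f u.op (isHomLift_op _ _ hu)
    exact ⟨op y, u.op, inferInstance⟩
  comp f g a b c φ ψ _ _ := by
    have := h.isStronglyCartesian_of_isHomLift (f ≫ g) (φ ≫ ψ) inferInstance
    infer_instance

theorem IsCofiberedInGroupoids.isFiberedInGroupoids (h : IsCofiberedInGroupoids p) :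
    IsFiberedInGroupoids p :=
  ⟨h.isFibered, fun f => h.isStronglyCartesian f⟩

/-- A functor on a sieve, over the base. -/
def OverSieve {T : (CommAlgCat.{0} ℂ)ᵒᵖ} {S : Sieve T} (F : S.arrows.category ⥤ 𝒳ᵒᵖ) : Prop :=
  F ⋙ p.op = (ObjectProperty.ι _ : S.arrows.category ⥤ Over T) ⋙ Over.forget T

/-- A cocone over a functor on a sieve, lying over the structure morphisms. -/
structure IsSieveCocone (p : 𝒳 ⥤ CommAlgCat.{0} ℂ) {T : (CommAlgCat.{0} ℂ)ᵒᵖ} {S : Sieve T}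
    (F : S.arrows.category ⥤ 𝒳ᵒᵖ)
    (y : 𝒳ᵒᵖ) (u : ∀ g : S.arrows.category, F.obj g ⟶ y) : Prop where
  isHomLift : ∀ g : S.arrows.category, p.op.IsHomLift g.obj.hom (u g)
  naturality : ∀ {g g' : S.arrows.category} (f : g ⟶ g'), F.map f ≫ u g' = u g

/-- Morphisms and objects glue along covering sieves. -/
structure HasDescent (p : 𝒳 ⥤ CommAlgCat.{0} ℂ) : Prop where
  hom : ∀ (T : (CommAlgCat.{0} ℂ)ᵒᵖ) (S : Sieve T),
      EtaleCovers T.unop (fun _ g => S.arrows g.op) → ∀ (F : S.arrows.category ⥤ 𝒳ᵒᵖ)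
        (_ : OverSieve (p := p) F) (y x : 𝒳ᵒᵖ)
        (u : ∀ g : S.arrows.category, F.obj g ⟶ y) (v : ∀ g : S.arrows.category, F.obj g ⟶ x),
        IsSieveCocone p F y u → IsSieveCocone p F x v → p.op.obj y = T → p.op.obj x = T →
          ∃! w : y ⟶ x, p.op.IsHomLift (𝟙 T) w ∧ ∀ g, u g ≫ w = v g
  glue : ∀ (T : (CommAlgCat.{0} ℂ)ᵒᵖ) (S : Sieve T),
      EtaleCovers T.unop (fun _ g => S.arrows g.op) → ∀ (F : S.arrows.category ⥤ 𝒳ᵒᵖ),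
        OverSieve (p := p) F → ∃ (y : 𝒳ᵒᵖ) (u : ∀ g : S.arrows.category, F.obj g ⟶ y),
          p.op.obj y = T ∧ IsSieveCocone p F y u

theorem isHomLift_comp_id {x y z : 𝒳ᵒᵖ} {A B : (CommAlgCat.{0} ℂ)ᵒᵖ} {f : A ⟶ B} {a : x ⟶ y}
    {b : y ⟶ z} (ha : p.op.IsHomLift f a) (hb : p.op.IsHomLift (𝟙 B) b) :
    p.op.IsHomLift f (a ≫ b) := by
  have h : p.op.IsHomLift (f ≫ 𝟙 B) (a ≫ b) := inferInstance
  rwa [Category.comp_id] at h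

theorem isHomLift_id_comp {x y z : 𝒳ᵒᵖ} {A B : (CommAlgCat.{0} ℂ)ᵒᵖ} {f : A ⟶ B} {a : x ⟶ y}
    {b : y ⟶ z} (ha : p.op.IsHomLift (𝟙 A) a) (hb : p.op.IsHomLift f b) :
    p.op.IsHomLift f (a ≫ b) := by
  have h : p.op.IsHomLift (𝟙 A ≫ f) (a ≫ b) := inferInstance
  rwa [Category.id_comp] at h

theorem isHomLift_comp_congr {x y z : 𝒳ᵒᵖ} {A B C : (CommAlgCat.{0} ℂ)ᵒᵖ} {f : A ⟶ B} {g : B ⟶ C}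
    {k : A ⟶ C} {a : x ⟶ y} {b : y ⟶ z} (ha : p.op.IsHomLift f a) (hb : p.op.IsHomLift g b)
    (hk : f ≫ g = k) : p.op.IsHomLift k (a ≫ b) := by
  subst hk
  infer_instance

/-- The structure morphism of a scheme over `T`, as a morphism over `T`. -/
def toTerminal {T : (CommAlgCat.{0} ℂ)ᵒᵖ} (g : Over T) : g ⟶ Over.mk (𝟙 T) :=
  Over.homMk g.hom (by simp)

theorem comp_toTerminal {T : (CommAlgCat.{0} ℂ)ᵒᵖ} {g g' : Over T} (f : g ⟶ g') :
    f ≫ toTerminal g' = toTerminal g := by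
  ext; simp [toTerminal]

section Slice

variable (h : IsCofiberedInGroupoids p) (hd : HasDescent p) {T : (CommAlgCat.{0} ℂ)ᵒᵖ}
  {S : Sieve T}

theorem isHomLift_map {F : Over T ⥤ 𝒳ᵒᵖ} (hF : F ⋙ p.op = Over.forget T) {g g' : Over T}
    (f : g ⟶ g') : p.op.IsHomLift f.left (F.map f) :=
  IsHomLift.of_fac' p.op _ _ (congrArg (fun H : Over T ⥤ (CommAlgCat.{0} ℂ)ᵒᵖ => H.obj g) hF)
    (congrArg (fun H : Over T ⥤ (CommAlgCat.{0} ℂ)ᵒᵖ => H.obj g') hF) (Functor.congr_hom hF f)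

theorem isHomLift_toTerminal {F : Over T ⥤ 𝒳ᵒᵖ} (hF : F ⋙ p.op = Over.forget T) (g : Over T) :
    p.op.IsHomLift g.hom (F.map (toTerminal g)) := isHomLift_map hF (toTerminal g)

theorem overSieve_comp {F : Over T ⥤ 𝒳ᵒᵖ} (hF : F ⋙ p.op = Over.forget T) :
    OverSieve (p := p) ((ObjectProperty.ι _ : S.arrows.category ⥤ Over T) ⋙ F) := by
  unfold OverSieve
  rw [Functor.assoc, hF]

theorem isSieveCocone_comp {F : Over T ⥤ 𝒳ᵒᵖ} (hF : F ⋙ p.op = Over.forget T) :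
    IsSieveCocone p ((ObjectProperty.ι _ : S.arrows.category ⥤ Over T) ⋙ F)
      (F.obj (Over.mk (𝟙 T))) fun g => F.map (toTerminal g.obj) where
  isHomLift g := isHomLift_toTerminal hF g.obj
  naturality {g g'} f := by
    change F.map f.hom ≫ F.map (toTerminal g'.obj) = _
    rw [← F.map_comp, comp_toTerminal]

include h

theorem slice_hom_ext {G : Over T ⥤ 𝒳ᵒᵖ} (hG : G ⋙ p.op = Over.forget T) {g : Over T} {x : 𝒳ᵒᵖ}
    {A : (CommAlgCat.{0} ℂ)ᵒᵖ} (f : A ⟶ g.left) {a b : x ⟶ G.obj g} (_ : p.op.IsHomLift f a)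
    (_ : p.op.IsHomLift f b)
    (hab : a ≫ G.map (toTerminal g) = b ≫ G.map (toTerminal g)) : a = b := by
  have := h.isStronglyCartesian_of_isHomLift _ _ (isHomLift_toTerminal hG g)
  exact IsStronglyCartesian.ext p.op g.hom (G.map (toTerminal g)) f hab

include hd

/-- A functor on the slice is governed by its value at the terminal object. The components of `α`,
followed by the structure maps, form a cocone there, which descends to one morphism `w`; its
pullbacks along the cartesian structure arrows are the components of the extension. -/
theorem exists_slice_hom (hS : EtaleCovers T.unop (fun _ g => S.arrows g.op)) {F G : Over T ⥤ 𝒳ᵒᵖ}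
    (hF : F ⋙ p.op = Over.forget T) (hG : G ⋙ p.op = Over.forget T)
    (α : (ObjectProperty.ι _ : S.arrows.category ⥤ Over T) ⋙ F ⟶ ObjectProperty.ι _ ⋙ G)
    (hα : ∀ g : S.arrows.category, p.op.IsHomLift (𝟙 g.obj.left) (α.app g)) :
    ∃ β : F ⟶ G, (∀ g : Over T, p.op.IsHomLift (𝟙 g.left) (β.app g)) ∧
      ∀ g : S.arrows.category, β.app g.obj = α.app g := by
  have hv : IsSieveCocone p ((ObjectProperty.ι _ : S.arrows.category ⥤ Over T) ⋙ F)
      (G.obj (Over.mk (𝟙 T))) fun g => α.app g ≫ G.map (toTerminal g.obj) :=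
    { isHomLift := fun g => isHomLift_id_comp (hα g) (isHomLift_toTerminal hG g.obj)
      naturality := fun {g g'} f => by
        rw [← Category.assoc, α.naturality f, Category.assoc]
        exact congrArg (α.app g ≫ ·) ((isSieveCocone_comp hG).naturality f) }
  obtain ⟨w, ⟨hw1, hw2⟩, -⟩ := hd.hom T S hS _ (overSieve_comp hF) _ _ _ _ (isSieveCocone_comp hF)
    hv (congrArg (fun H : Over T ⥤ (CommAlgCat.{0} ℂ)ᵒᵖ => H.obj (Over.mk (𝟙 T))) hF)
    (congrArg (fun H : Over T ⥤ (CommAlgCat.{0} ℂ)ᵒᵖ => H.obj (Over.mk (𝟙 T))) hG)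
  have hl : ∀ g : Over T, p.op.IsHomLift g.hom (F.map (toTerminal g) ≫ w) := fun g =>
    isHomLift_comp_id (isHomLift_toTerminal hF g) hw1
  have hc : ∀ g : Over T, ∃ b : F.obj g ⟶ G.obj g,
      p.op.IsHomLift (𝟙 g.left) b ∧ b ≫ G.map (toTerminal g) = F.map (toTerminal g) ≫ w :=
    fun g => by
      have := h.isStronglyCartesian_of_isHomLift _ _ (isHomLift_toTerminal hG g)
      have := hl g
      exact (IsStronglyCartesian.universal_property p.op g.hom (G.map (toTerminal g)) (𝟙 g.left)
        g.hom (Category.id_comp _).symm (F.map (toTerminal g) ≫ w)).exists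
  choose b hb1 hb2 using hc
  refine ⟨{ app := b, naturality := fun {g g'} f => ?_ }, hb1, fun g => ?_⟩
  · refine slice_hom_ext h hG (g := g') f.left
      (isHomLift_comp_id (isHomLift_map hF f) (hb1 g'))
      (isHomLift_id_comp (hb1 g) (isHomLift_map hG f)) ?_
    rw [Category.assoc, Category.assoc, hb2, ← Category.assoc, ← F.map_comp,
      ← G.map_comp, comp_toTerminal]
    exact (hb2 g).symm
  · exact slice_hom_ext h hG (g := g.obj) (𝟙 _) (hb1 _) (hα g) ((hb2 _).trans (hw2 g))

theorem slice_natTrans_ext (hS : EtaleCovers T.unop (fun _ g => S.arrows g.op)) {F G : Over T ⥤ 𝒳ᵒᵖ}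
    (hF : F ⋙ p.op = Over.forget T) (hG : G ⋙ p.op = Over.forget T) (α β : F ⟶ G)
    (hα : ∀ g : Over T, p.op.IsHomLift (𝟙 g.left) (α.app g))
    (hβ : ∀ g : Over T, p.op.IsHomLift (𝟙 g.left) (β.app g))
    (hαβ : ∀ g : S.arrows.category, α.app g.obj = β.app g.obj) : α = β := by
  have hv : IsSieveCocone p ((ObjectProperty.ι _ : S.arrows.category ⥤ Over T) ⋙ F)
      (G.obj (Over.mk (𝟙 T))) fun g => F.map (toTerminal g.obj) ≫ α.app (Over.mk (𝟙 T)) :=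
    { isHomLift := fun g => isHomLift_comp_id (isHomLift_toTerminal hF g.obj) (hα (Over.mk (𝟙 T)))
      naturality := fun {g g'} f => by
        rw [← Category.assoc]
        exact congrArg (· ≫ α.app (Over.mk (𝟙 T))) ((isSieveCocone_comp hF).naturality f) }
  obtain ⟨w, -, hw⟩ := hd.hom T S hS _ (overSieve_comp hF) _ _ _ _ (isSieveCocone_comp hF)
    hv (congrArg (fun H : Over T ⥤ (CommAlgCat.{0} ℂ)ᵒᵖ => H.obj (Over.mk (𝟙 T))) hF)
    (congrArg (fun H : Over T ⥤ (CommAlgCat.{0} ℂ)ᵒᵖ => H.obj (Over.mk (𝟙 T))) hG)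
  have hI : α.app (Over.mk (𝟙 T)) = β.app (Over.mk (𝟙 T)) :=
    (hw _ ⟨hα (Over.mk (𝟙 T)), fun _ => rfl⟩).trans (hw _ ⟨hβ (Over.mk (𝟙 T)), fun g => by
      rw [α.naturality, β.naturality]
      exact congrArg (· ≫ G.map (toTerminal g.obj)) (hαβ g).symm⟩).symm
  refine NatTrans.ext (funext fun g => ?_)
  exact slice_hom_ext h hG (g := g) (𝟙 _) (hα g) (hβ g) (by
    rw [← α.naturality, ← β.naturality, hI])

/-- Glue the diagram to an object over `T` and take its pullbacks along all maps to `T`; uniqueness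
of cartesian lifts makes these functorial. The cocone maps are themselves cartesian, which
identifies the result with the original diagram on the sieve. -/
theorem exists_slice_functor (hS : EtaleCovers T.unop (fun _ g => S.arrows g.op))
    (F : S.arrows.category ⥤ 𝒳ᵒᵖ) (hF : OverSieve (p := p) F) :
    ∃ (G : Over T ⥤ 𝒳ᵒᵖ) (_ : G ⋙ p.op = Over.forget T)
      (e : (ObjectProperty.ι _ : S.arrows.category ⥤ Over T) ⋙ G ≅ F),
      ∀ g : S.arrows.category, p.op.IsHomLift (𝟙 g.obj.left) (e.hom.app g) := by
  haveI := h.isFibered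
  have sc := fun {x y : 𝒳ᵒᵖ} {A B : (CommAlgCat.{0} ℂ)ᵒᵖ} (g : A ⟶ B) (f : x ⟶ y)
    (hf : p.op.IsHomLift g f) => h.isStronglyCartesian_of_isHomLift g f hf
  obtain ⟨y, u, hy, hu⟩ := hd.glue T S hS F hF
  let z : Over T → 𝒳ᵒᵖ := fun g => IsPreFibered.pullbackObj hy g.hom
  let π : ∀ g : Over T, z g ⟶ y := fun g => IsPreFibered.pullbackMap hy g.hom
  have hz : ∀ g : Over T, p.op.obj (z g) = g.left := fun g => IsPreFibered.pullbackObj_proj hy _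
  have hπ : ∀ g : Over T, p.op.IsStronglyCartesian g.hom (π g) := fun g =>
    sc _ _ (inferInstanceAs (p.op.IsHomLift g.hom (IsPreFibered.pullbackMap hy g.hom)))
  have hm : ∀ {g g' : Over T} (f : g ⟶ g'), ∃! b : z g ⟶ z g',
      p.op.IsHomLift f.left b ∧ b ≫ π g' = π g := fun {g g'} f =>
    IsStronglyCartesian.universal_property p.op g'.hom (π g') f.left g.hom (Over.w f).symm (π g)
  let m : ∀ {g g' : Over T} (f : g ⟶ g'), z g ⟶ z g' := fun f => (hm f).choose
  have hm1 : ∀ {g g' : Over T} (f : g ⟶ g'), p.op.IsHomLift f.left (m f) :=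
    fun f => (hm f).choose_spec.1.1
  have hm2 : ∀ {g g' : Over T} (f : g ⟶ g'), m f ≫ π g' = π g :=
    fun f => (hm f).choose_spec.1.2
  have hm3 : ∀ {g g' : Over T} (f : g ⟶ g') (b : z g ⟶ z g'), p.op.IsHomLift f.left b →
      b ≫ π g' = π g → b = m f := fun f b h1 h2 => (hm f).choose_spec.2 b ⟨h1, h2⟩
  let G : Over T ⥤ 𝒳ᵒᵖ :=
    { obj := z
      map := fun f => m f
      map_id := fun g => (hm3 (𝟙 g) (𝟙 _) (IsHomLift.id (hz g)) (Category.id_comp _)).symm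
      map_comp := fun {g g' g''} f f' => (hm3 (f ≫ f') (m f ≫ m f')
        (isHomLift_comp_congr (hm1 f) (hm1 f') rfl) (by rw [Category.assoc, hm2, hm2])).symm }
  have hFobj : ∀ g, p.op.obj (F.obj g) = g.obj.left := fun g =>
    congrArg (fun H : S.arrows.category ⥤ (CommAlgCat.{0} ℂ)ᵒᵖ => H.obj g) hF
  have hFl : ∀ {g g' : S.arrows.category} (f : g ⟶ g'),
      p.op.IsHomLift f.hom.left (F.map f) := fun {g g'} f =>
    IsHomLift.of_fac' p.op _ _ (hFobj g) (hFobj g') (Functor.congr_hom hF f)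
  have huc : ∀ g : S.arrows.category, p.op.IsStronglyCartesian g.obj.hom (u g) :=
    fun g => sc _ _ (hu.isHomLift g)
  let e : ∀ g : S.arrows.category, z g.obj ≅ F.obj g := fun g =>
    haveI := huc g
    haveI := hπ g.obj
    { hom := IsCartesian.map p.op g.obj.hom (u g) (π g.obj)
      inv := IsCartesian.map p.op g.obj.hom (π g.obj) (u g)
      hom_inv_id := by
        haveI : p.op.IsHomLift (𝟙 g.obj.left) (𝟙 (z g.obj)) := IsHomLift.id (hz _)
        exact IsCartesian.ext p.op g.obj.hom (π g.obj) _ _ (by simp)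
      inv_hom_id := by
        haveI : p.op.IsHomLift (𝟙 g.obj.left) (𝟙 (F.obj g)) := IsHomLift.id (hFobj g)
        exact IsCartesian.ext p.op g.obj.hom (u g) _ _ (by simp) }
  have he1 : ∀ g, p.op.IsHomLift (𝟙 g.obj.left) (e g).hom := fun g => by
    haveI := huc g
    haveI := hπ g.obj
    exact IsCartesian.map_isHomLift p.op g.obj.hom (u g) (π g.obj)
  have he2 : ∀ g, (e g).hom ≫ u g = π g.obj := fun g => by
    haveI := huc g
    haveI := hπ g.obj
    exact IsCartesian.fac p.op g.obj.hom (u g) (π g.obj)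
  refine ⟨G, CategoryTheory.Functor.ext hz fun (g g' : Over T) (f : g ⟶ g') => ?_,
    NatIso.ofComponents e fun {g g'} f => ?_, he1⟩
  · have := hm1 f
    exact IsHomLift.fac' p.op f.left (m f)
  · have := huc g'
    change m f.hom ≫ (e g').hom = (e g).hom ≫ F.map f
    have i1 : p.op.IsHomLift f.hom.left (m f.hom ≫ (e g').hom) :=
      isHomLift_comp_id (hm1 f.hom) (he1 g')
    have i2 : p.op.IsHomLift f.hom.left ((e g).hom ≫ F.map f) :=
      isHomLift_id_comp (he1 g) (hFl f)
    refine IsStronglyCartesian.ext p.op g'.obj.hom (u g') f.hom.left ?_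
    rw [Category.assoc, Category.assoc, he2, hm2, hu.naturality, he2]

end Slice

/-- A category cofibered in groupoids over complex algebras is a stack if morphisms and objects glue
along covering sieves. -/
theorem IsCofiberedInGroupoids.isStackInGroupoids (h : IsCofiberedInGroupoids p)
    (hd : HasDescent p) : IsStackInGroupoids p := by
  refine ⟨h.isFiberedInGroupoids, fun T S hS => ?_⟩
  have h1 : (Bicategory.precomp (basedOver p) (sieveIncl S)).Faithful :=
    ⟨fun {F G α β} hαβ => by
      refine BasedNatTrans.ext _ _ (slice_natTrans_ext h hd hS (F := F.toFunctor)
        (G := G.toFunctor) F.w G.w α.toNatTrans β.toNatTrans (fun g => α.isHomLift' g)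
        (fun g => β.isHomLift' g) fun g => ?_)
      exact congrArg (fun γ : (sieveIncl S ≫ F) ⟶ (sieveIncl S ≫ G) => γ.toNatTrans.app g) hαβ⟩
  have h2 : (Bicategory.precomp (basedOver p) (sieveIncl S)).Full :=
    ⟨fun {F G} α => by
      obtain ⟨β, hβ1, hβ2⟩ := exists_slice_hom h hd hS (F := F.toFunctor) (G := G.toFunctor)
        F.w G.w α.toNatTrans (fun g => α.isHomLift' g)
      exact ⟨⟨β, hβ1⟩, BasedNatTrans.ext _ _ (NatTrans.ext (funext fun g => hβ2 g))⟩⟩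
  have h3 : (Bicategory.precomp (basedOver p) (sieveIncl S)).EssSurj :=
    ⟨fun F => by
      obtain ⟨G, hG, e, he⟩ := exists_slice_functor h hd hS F.toFunctor F.w
      let G' : slice T ⟶ basedOver p := BasedFunctor.mk G hG
      exact ⟨G', ⟨BasedNatIso.mkNatIso (F := sieveIncl S ≫ G') (G := F) e he⟩⟩⟩
  exact {}

end StackCriterion

end QuiverCrit
end

/-! ### Existence of pushouts, and étale descent for families -/

noncomputable section

namespace QuiverCrit

set_option linter.style.haveILetI false

open scoped TensorProduct

theorem tensor_lift {A B C P : CommAlgCat.{0} ℂ} (b : A ⟶ B) (c : A ⟶ C) (i : B ⟶ P) (k : C ⟶ P)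
    (w : b ≫ i = c ≫ k) :
    letI := algOf b; letI := algOf c
    ∃ ψ : B ⊗[A] C →+* P, ∀ x y, ψ (x ⊗ₜ y) = i.hom x * k.hom y := by
  letI := algOf b; letI := algOf c; letI := algOf (b ≫ i)
  let ψ : B ⊗[A] C →ₐ[A] P := Algebra.TensorProduct.lift
    (⟨i.hom.toRingHom, fun _ => rfl⟩ : B →ₐ[A] P)
    (⟨k.hom.toRingHom, fun r =>
      (congrArg (fun f : A ⟶ P => f.hom r) w).symm⟩ : C →ₐ[A] P)
    fun _ _ => Commute.all _ _
  exact ⟨ψ.toRingHom, fun x y => Algebra.TensorProduct.lift_tmul _ _ _ _ _⟩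

theorem exists_isPushout {A B C : CommAlgCat.{0} ℂ} (b : A ⟶ B) (c : A ⟶ C) :
    ∃ (T : CommAlgCat.{0} ℂ) (i : B ⟶ T) (k : C ⟶ T), CategoryTheory.IsPushout b c i k := by
  letI := algOf b; letI := algOf c
  obtain ⟨T, i, k, e, hw, hi, hk⟩ := exists_tensorCocone b c
  choose ψ hψ using fun s : Limits.PushoutCocone b c => tensor_lift b c s.inl s.inr s.condition
  refine ⟨T, i, k, ⟨hw⟩, ⟨Limits.PushoutCocone.IsColimit.mk _ (fun s => ?_) (fun s => ?_)
    (fun s => ?_) fun s m h1 h2 => ?_⟩⟩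
  · exact CommAlgCat.ofHom
      { toRingHom := (ψ s).comp e.toRingHom
        commutes' := fun r => by
          change ψ s (e (algebraMap ℂ T r)) = _
          rw [← i.hom.commutes r, hi, hψ, map_one, mul_one]
          exact s.inl.hom.commutes r }
  · ext x
    exact (congrArg (ψ s) (hi x)).trans ((hψ s _ _).trans (by rw [map_one, mul_one]))
  · ext x
    exact (congrArg (ψ s) (hk x)).trans ((hψ s _ _).trans (by rw [map_one, one_mul]))
  · have key : ∀ z : B ⊗[A] C, ∀ f g : T ⟶ s.pt, i ≫ f = i ≫ g → k ≫ f = k ≫ g →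
        f.hom (e.symm z) = g.hom (e.symm z) := by
      intro z f g hf hg
      induction z with
      | zero => rw [map_zero, map_zero, map_zero]
      | add a b ha hb => rw [map_add, map_add, map_add, ha, hb]
      | tmul x y =>
        have : e.symm (x ⊗ₜ y) = i.hom x * k.hom y := by
          rw [RingEquiv.symm_apply_eq, map_mul, hi, hk]; simp
        rw [this, map_mul, map_mul]
        exact congrArg₂ (· * ·) (congrArg (fun f : B ⟶ s.pt => f.hom x) hf)
          (congrArg (fun f : C ⟶ s.pt => f.hom y) hg)
    ext z
    rw [← e.symm_apply_apply z]
    refine key (e z) m _ (h1.trans ?_) (h2.trans ?_)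
    · ext x
      exact ((congrArg (ψ s) (hi x)).trans ((hψ s _ _).trans (by rw [map_one, mul_one]))).symm
    · ext x
      exact ((congrArg (ψ s) (hk x)).trans ((hψ s _ _).trans (by rw [map_one, one_mul]))).symm

/-! ### The stack of families of representations -/

namespace Rep

variable {Q : FinQuiver} {d : Q.V → ℕ}

variable (Q d) in
theorem isCofiberedInGroupoids : IsCofiberedInGroupoids (proj Q d) where
  existsUnique_fac {x y z} u v h hh := by
    obtain ⟨c, hc1, hc2⟩ := Hom.exists_fac u v h hh
    exact ⟨c, ⟨hc1, hc2⟩, fun c' hc' =>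
      Hom.cancel u (hc'.1.trans hc1.symm) (hc'.2.trans hc2.symm)⟩
  exists_lift x B f := ⟨x.push f, x.toPush f,
    IsHomLift.map (p := proj Q d) (x.toPush f)⟩

section

variable {T : (CommAlgCat.{0} ℂ)ᵒᵖ} {S : Sieve T} {F : S.arrows.category ⥤ (Rep Q d)ᵒᵖ}
  (hF : OverSieve (p := proj Q d) F)

/-- The identification of the base of a member of a diagram of families indexed by a sieve. -/
def sieveIso (g : S.arrows.category) : g.obj.left.unop ⟶ (F.obj g).unop.A :=
  ((eqToHom hF).app g).unop

theorem sieveIso_naturality {a b : S.arrows.category} (f : a ⟶ b) :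
    sieveIso hF b ≫ (F.map f).unop.base = f.hom.left.unop ≫ sieveIso hF a :=
  congrArg Quiver.Hom.unop ((eqToHom hF).naturality f)

include hF in
theorem sieve_obj_eq (g : S.arrows.category) : (proj Q d).op.obj (F.obj g) = g.obj.left :=
  congrArg (fun H : S.arrows.category ⥤ (CommAlgCat.{0} ℂ)ᵒᵖ => H.obj g) hF

theorem sieveIso_op (g : S.arrows.category) :
    (sieveIso hF g).op = eqToHom (sieve_obj_eq hF g) := eqToHom_app hF g

instance (g : S.arrows.category) : IsIso (sieveIso hF g) := by
  have : IsIso (sieveIso hF g).op := by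
    rw [sieveIso_op]
    exact (eqToIso (sieve_obj_eq hF g)).isIso_hom
  exact isIso_of_op _

/-- The structure map of a member of a diagram of families indexed by a sieve. -/
def sieveτ (g : S.arrows.category) : T.unop ⟶ (F.obj g).unop.A := g.obj.hom.unop ≫ sieveIso hF g

/-- The hypothesis `hF` is an equality of functors, so the base of a member of the diagram equals
the expected algebra only propositionally. The resulting transports are collected in `sieveτ`, and
lifting becomes an equation between algebra maps. -/
theorem isHomLift_iff_base_eq {y : Rep Q d} (g : S.arrows.category) (hy : y.A = T.unop)
    (u : y ⟶ (F.obj g).unop) :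
    (proj Q d).op.IsHomLift g.obj.hom (show F.obj g ⟶ op y from u.op) ↔
      u.base = eqToHom hy ≫ sieveτ hF g := by
  have hT : T = op y.A := congrArg op hy.symm
  subst hT
  have e : (eqToHom hy ≫ sieveτ hF g).op = eqToHom (sieve_obj_eq hF g) ≫ g.obj.hom := by
    have : (sieveτ hF g).op = eqToHom (sieve_obj_eq hF g) ≫ g.obj.hom := by
      rw [← sieveIso_op]
      rfl
    exact (congrArg Quiver.Hom.op (Category.id_comp _)).trans this
  constructor
  · intro h
    have h2 : u.base.op = _ :=
      IsHomLift.fac' (proj Q d).op g.obj.hom (show F.obj g ⟶ op y from u.op)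
    apply Quiver.Hom.op_inj
    rw [h2, e]
    exact congrArg (eqToHom _ ≫ ·) (Category.comp_id _)
  · intro h
    refine IsHomLift.of_fac' _ _ _ (sieve_obj_eq hF g) rfl ?_
    change u.base.op = _
    rw [h, e]
    exact (congrArg (eqToHom _ ≫ ·) (Category.comp_id _)).symm

/-- The diagram of families indexed by a covering sieve. -/
theorem exists_descentDiagram (hS : EtaleCovers T.unop (fun _ g => S.arrows g.op)) :
    ∃ c : DescentDiagram F.leftOp T.unop, ∀ j, c.τ j = sieveτ hF j.unop := by
  obtain ⟨n, B, g, hg, hsurj, hmem⟩ := hS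
  let k : Fin n → S.arrows.categoryᵒᵖ := fun m => op ⟨Over.mk (g m).op, hmem m⟩
  choose P i i' hP using fun a b : S.arrows.categoryᵒᵖ =>
    exists_isPushout a.unop.obj.hom.unop b.unop.obj.hom.unop
  -- Fibre products of members remain in the sieve because sieves are closed under precomposition.
  let PP : S.arrows.categoryᵒᵖ → S.arrows.categoryᵒᵖ → S.arrows.categoryᵒᵖ := fun a b =>
    op ⟨Over.mk (a.unop.obj.hom.unop ≫ i a b).op,
      S.downward_closed a.unop.property (i a b).op⟩
  let inl : ∀ a b, a ⟶ PP a b := fun a b =>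
    (ObjectProperty.homMk (Over.homMk (i a b).op rfl) : (PP a b).unop ⟶ a.unop).op
  let inr : ∀ a b, b ⟶ PP a b := fun a b =>
    (ObjectProperty.homMk (Over.homMk (i' a b).op (congrArg Quiver.Hom.op (hP a b).w.symm)) :
      (PP a b).unop ⟶ b.unop).op
  refine ⟨{ τ := fun j => sieveτ hF j.unop, nat := ?_, n := n, k := k, cover := ⟨?_, ?_⟩,
            P := PP, inl := inl, inr := inr, isPushout := ?_, exists_desc := ?_ }, fun j => rfl⟩
  · intro j j' f
    change (_ ≫ sieveIso hF j.unop) ≫ (F.map f.unop).unop.base = _ ≫ sieveIso hF j'.unop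
    rw [Category.assoc, sieveIso_naturality, ← Category.assoc]
    exact congrArg (· ≫ sieveIso hF j'.unop) (congrArg Quiver.Hom.unop (Over.w f.unop.hom))
  · intro m
    exact RingHom.Flat.comp (RingHom.Etale.iff_flat_and_formallyUnramified.1 (hg m)).1
      (RingHom.Flat.of_bijective (ConcreteCategory.bijective_of_isIso (sieveIso hF (k m).unop)))
  · intro x
    obtain ⟨m, x', hx'⟩ := hsurj x
    let e := inv (sieveIso hF (k m).unop)
    refine ⟨m, PrimeSpectrum.comap e.hom.toRingHom x', ?_⟩
    rw [← hx']
    refine PrimeSpectrum.ext (Ideal.ext fun r => ?_)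
    change e.hom ((sieveIso hF (k m).unop).hom ((g m).hom r)) ∈ x'.asIdeal ↔
      (g m).hom r ∈ x'.asIdeal
    have h2 := congrArg (fun f : B m ⟶ B m => f.hom ((g m).hom r))
      (IsIso.hom_inv_id (sieveIso hF (k m).unop))
    exact (congrArg (· ∈ x'.asIdeal) h2).to_iff
  · intro a b
    refine (hP a b).of_iso (Iso.refl _) (asIso (sieveIso hF a.unop)) (asIso (sieveIso hF b.unop))
      (asIso (sieveIso hF (PP a b).unop)) ?_ ?_ ?_ ?_
    · exact (Category.id_comp _).symm
    · exact (Category.id_comp _).symm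
    · exact (sieveIso_naturality hF (inl a b).unop).symm
    · exact (sieveIso_naturality hF (inr a b).unop).symm
  · intro a b q f f'
    have w : a.unop.obj.hom.unop ≫ f.unop.hom.left.unop =
        b.unop.obj.hom.unop ≫ f'.unop.hom.left.unop :=
      (congrArg Quiver.Hom.unop (Over.w f.unop.hom)).trans
        (congrArg Quiver.Hom.unop (Over.w f'.unop.hom)).symm
    let l := (hP a b).desc f.unop.hom.left.unop f'.unop.hom.left.unop w
    have hl1 : i a b ≫ l = f.unop.hom.left.unop := (hP a b).inl_desc _ _ w
    have hl2 : i' a b ≫ l = f'.unop.hom.left.unop := (hP a b).inr_desc _ _ w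
    refine ⟨(ObjectProperty.homMk (Over.homMk l.op ?_) : q.unop ⟶ (PP a b).unop).op, ?_, ?_⟩
    · exact congrArg Quiver.Hom.op ((Category.assoc _ _ _).trans
        ((congrArg (a.unop.obj.hom.unop ≫ ·) hl1).trans
          (congrArg Quiver.Hom.unop (Over.w f.unop.hom))))
    · refine Quiver.Hom.unop_inj ?_
      refine ObjectProperty.hom_ext _ (Over.OverMorphism.ext (Quiver.Hom.unop_inj ?_))
      exact hl1
    · refine Quiver.Hom.unop_inj ?_
      refine ObjectProperty.hom_ext _ (Over.OverMorphism.ext (Quiver.Hom.unop_inj ?_))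
      exact hl2

end

variable (Q d) in
theorem hasDescent : HasDescent (proj Q d) where
  hom T S hS F hF y x u v hu hv hy hx := by
    subst hy
    obtain ⟨c, hc⟩ := exists_descentDiagram hF hS
    have hu1 : ∀ j, (u j.unop).unop.base = c.τ j := fun j => by
      rw [hc]
      exact ((isHomLift_iff_base_eq hF j.unop rfl _).1 (hu.isHomLift j.unop)).trans
        (Category.id_comp _)
    have hx' : x.unop.A = y.unop.A := congrArg unop hx
    have hv1 : ∀ j, (v j.unop).unop.base = eqToHom hx' ≫ c.τ j := fun j => by
      rw [hc]
      exact (isHomLift_iff_base_eq hF j.unop hx' _).1 (hv.isHomLift j.unop)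
    obtain ⟨w, ⟨hw1, hw2⟩, hw3⟩ := c.existsUnique_hom (y := y.unop) (x := x.unop)
      (fun j => (u j.unop).unop) hu1
      (fun {j j'} f => congrArg Quiver.Hom.unop (hu.naturality f.unop)) (eqToHom hx')
      (fun j => (v j.unop).unop) hv1
      (fun {j j'} f => congrArg Quiver.Hom.unop (hv.naturality f.unop))
    have key : ∀ w : x.unop ⟶ y.unop, (proj Q d).op.IsHomLift (𝟙 ((proj Q d).op.obj y))
        (show y ⟶ x from w.op) ↔ w.base = eqToHom hx' := by
      intro w
      have e : (eqToHom hx').op = eqToHom hx.symm := by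
        simp
        rfl
      constructor
      · intro h
        have h2 : w.base.op = _ := IsHomLift.fac' (proj Q d).op (𝟙 ((proj Q d).op.obj y))
          (show y ⟶ x from w.op)
        apply Quiver.Hom.op_inj
        rw [h2, e]
        simp
        rfl
      · intro h
        refine IsHomLift.of_fac' _ _ _ rfl hx ?_
        change w.base.op = _
        rw [h, e]
        simp
        rfl
    refine ⟨w.op, ⟨(key w).2 hw1, fun g => congrArg Quiver.Hom.op (hw2 (op g))⟩, fun w' hw' => ?_⟩
    exact Quiver.Hom.unop_inj (hw3 w'.unop ⟨(key w'.unop).1 hw'.1,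
      fun j => congrArg Quiver.Hom.unop (hw'.2 j.unop)⟩)
  glue T S hS F hF := by
    obtain ⟨c, hc⟩ := exists_descentDiagram hF hS
    obtain ⟨y, u, hu1, hu2⟩ := c.exists_glue
    refine ⟨op ⟨T.unop, y⟩, fun g => (u (op g)).op, rfl, fun g => ?_, fun {g g'} f => ?_⟩
    · refine (isHomLift_iff_base_eq hF g rfl (u (op g))).2 ((hu1 _).trans ?_)
      rw [hc]
      exact (Category.id_comp _).symm
    · exact congrArg Quiver.Hom.op (hu2 f.op)

end Rep

end QuiverCrit
end

/-! ### Substacks defined by étale-local conditions, and the stack of Jacobi families -/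

noncomputable section

namespace QuiverCrit

set_option linter.style.haveILetI false

section FullSubcategory

variable {𝒳 : Type 1} [Category.{0} 𝒳] {p : 𝒳 ⥤ CommAlgCat.{0} ℂ} {P : ObjectProperty 𝒳}

theorem isHomLift_ι {x y : P.FullSubcategory} {A B : CommAlgCat.{0} ℂ} {f : A ⟶ B} (u : x ⟶ y) :
    (P.ι ⋙ p).IsHomLift f u ↔ p.IsHomLift f u.hom := by
  constructor <;> rintro ⟨⟩
  · exact IsHomLift.map (p := p) u.hom
  · exact IsHomLift.map (p := P.ι ⋙ p) u

theorem isHomLift_ι_op {x y : P.FullSubcategoryᵒᵖ} {A B : (CommAlgCat.{0} ℂ)ᵒᵖ} {f : A ⟶ B}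
    (u : x ⟶ y) : (P.ι ⋙ p).op.IsHomLift f u ↔
      p.op.IsHomLift f (show op x.unop.obj ⟶ op y.unop.obj from u.unop.hom.op) := by
  constructor
  · intro h
    exact isHomLift_op _ _ ((isHomLift_ι _).1 (isHomLift_unop _ _ h))
  · intro h
    exact isHomLift_op f.unop u.unop ((isHomLift_ι _).2 (isHomLift_unop _ _ h))

theorem IsCofiberedInGroupoids.fullSubcategory (h : IsCofiberedInGroupoids p)
    (hP : ∀ {x y : 𝒳} (_ : x ⟶ y), P x → P y) : IsCofiberedInGroupoids (P.ι ⋙ p) where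
  existsUnique_fac {x y z} u v k hk := by
    obtain ⟨c, ⟨hc1, hc2⟩, hc3⟩ := h.existsUnique_fac u.hom v.hom k hk
    refine ⟨ObjectProperty.homMk c, ⟨hc1, ObjectProperty.hom_ext _ hc2⟩, fun c' hc' => ?_⟩
    exact ObjectProperty.hom_ext _ (hc3 c'.hom ⟨hc'.1, congrArg (·.hom) hc'.2⟩)
  exists_lift x B f := by
    obtain ⟨y, u, hu⟩ := h.exists_lift x.obj B f
    exact ⟨⟨y, hP u x.property⟩, ObjectProperty.homMk u, (isHomLift_ι _).2 hu⟩

/-- Fullness carries over the gluing of morphisms. An object glued in the ambient category satisfies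
`P` because it does so on a cover. -/
theorem HasDescent.fullSubcategory (hd : HasDescent p)
    (hP : ∀ y : 𝒳, (EtaleCovers (p.obj y) fun _ g => ∃ (z : 𝒳) (u : y ⟶ z), P z ∧ p.IsHomLift g u) →
      P y) : HasDescent (P.ι ⋙ p) := by
  have hc : ∀ {T : (CommAlgCat.{0} ℂ)ᵒᵖ} {S : Sieve T} {F : S.arrows.category ⥤ P.FullSubcategoryᵒᵖ}
      {y : P.FullSubcategoryᵒᵖ} {u : ∀ g : S.arrows.category, F.obj g ⟶ y},
      IsSieveCocone (P.ι ⋙ p) F y u →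
        IsSieveCocone p (F ⋙ P.ι.op) (op y.unop.obj) fun g => (u g).unop.hom.op :=
    fun {T S F y u} h =>
      { isHomLift := fun g => (isHomLift_ι_op (u g)).1 (h.isHomLift g)
        naturality := fun {g g'} f => congrArg (fun k : F.obj g ⟶ y => k.unop.hom.op)
          (h.naturality f) }
  refine ⟨fun T S hS F hF y x u v hu hv hy hx => ?_, fun T S hS F hF => ?_⟩
  · obtain ⟨w, ⟨hw1, hw2⟩, hw3⟩ := hd.hom T S hS (F ⋙ P.ι.op) hF (op y.unop.obj) (op x.unop.obj)
      _ _ (hc hu) (hc hv) hy hx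
    have hιop : ∀ {x y : P.FullSubcategoryᵒᵖ} {f g : x ⟶ y}, f.unop.hom.op = g.unop.hom.op → f = g :=
      fun h => Quiver.Hom.unop_inj (ObjectProperty.hom_ext _ (Quiver.Hom.op_inj h))
    let w' : y ⟶ x := (ObjectProperty.homMk w.unop : x.unop ⟶ y.unop).op
    refine ⟨w', ⟨(isHomLift_ι_op w').2 hw1, fun g => hιop (hw2 g)⟩, fun w'' hw'' => hιop ?_⟩
    exact hw3 w''.unop.hom.op ⟨(isHomLift_ι_op w'').1 hw''.1, fun g =>
      congrArg (fun k : F.obj g ⟶ x => k.unop.hom.op) (hw''.2 g)⟩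
  · obtain ⟨y, u, hy, hu⟩ := hd.glue T S hS (F ⋙ P.ι.op) hF
    subst hy
    have hPy : P y.unop := by
      refine hP _ ?_
      obtain ⟨n, B, g, hg, hs, hm⟩ := hS
      refine ⟨n, B, g, hg, hs, fun k => ?_⟩
      let a : S.arrows.category := ⟨Over.mk (g k).op, hm k⟩
      exact ⟨(F.obj a).unop.obj, (u a).unop, (F.obj a).unop.property,
        isHomLift_unop _ _ (hu.isHomLift a)⟩
    refine ⟨op ⟨y.unop, hPy⟩, fun g => (ObjectProperty.homMk (u g).unop :
      (⟨y.unop, hPy⟩ : P.FullSubcategory) ⟶ (F.obj g).unop).op, rfl, ⟨fun g => ?_, fun {g g'} f => ?_⟩⟩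
    · exact (isHomLift_ι_op _).2 (hu.isHomLift g)
    · refine Quiver.Hom.unop_inj (ObjectProperty.hom_ext _ ?_)
      exact congrArg Quiver.Hom.unop (hu.naturality f)

end FullSubcategory

namespace Rep

variable {Q : FinQuiver} {d : Q.V → ℕ}

/-- Vanishing on the total space may be checked on the members of a flat cover. -/
theorem total_injective_of_flatCover {y : Rep Q d} {n : ℕ} {z : Fin n → Rep Q d}
    (u : ∀ k, y ⟶ z k) (h : FlatCover y.A (fun k => (z k).A) fun k => (u k).base)
    {m m' : y.fam.Total} (hm : ∀ k, (u k).total m = (u k).total m') : m = m' := by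
  obtain ⟨β⟩ := DualBasis.nonempty y.A y.fam.Total
  rw [← β.sum_eq m, ← β.sum_eq m']
  refine Finset.sum_congr rfl fun l _ => ?_
  congr 1
  refine h.injective fun k => ?_
  rw [← (u k).pushDualBasis_ε β l, ← (u k).pushDualBasis_ε β l, hm]

/-- The relations are equalities of endomorphisms whose formation commutes with morphisms of
families, and elements of the total space are determined on a flat cover. -/
theorem relations_of_flatCover {y : Rep Q d} {n : ℕ} {z : Fin n → Rep Q d}
    (u : ∀ k, y ⟶ z k) (h : FlatCover y.A (fun k => (z k).A) fun k => (u k).base)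
    {W : Q.Potential} (hW : ∀ k, (z k).fam.Relations W) : y.fam.Relations W := by
  intro a
  refine LinearMap.ext fun m => total_injective_of_flatCover u h fun k => ?_
  rw [Hom.total_act, hW k a, LinearMap.zero_apply, LinearMap.zero_apply, Hom.total_zero]

theorem relations_of_etaleCovers {y : Rep Q d} {W : Q.Potential}
    (h : EtaleCovers ((proj Q d).obj y) fun _ g => ∃ (z : Rep Q d) (u : y ⟶ z),
      z.fam.Relations W ∧ (proj Q d).IsHomLift g u) : y.fam.Relations W := by
  obtain ⟨n, B, g, hg, hs, hm⟩ := h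
  choose z u hz hu using hm
  have hB : ∀ k, B k = (z k).A := fun k => by
    haveI := hu k
    exact (IsHomLift.codomain_eq (proj Q d) (g k) (u k)).symm
  obtain rfl : B = fun k => (z k).A := funext hB
  have hb : ∀ k, g k = (u k).base := fun k => by
    let gk : (proj Q d).obj y ⟶ (proj Q d).obj (z k) := g k
    haveI : (proj Q d).IsHomLift gk (u k) := hu k
    exact IsHomLift.eq_of_isHomLift (proj Q d) gk (u k)
  obtain rfl : g = fun k => (u k).base := funext hb
  exact relations_of_flatCover u
    ⟨fun k => (RingHom.Etale.iff_flat_and_formallyUnramified.1 (hg k)).1, hs⟩ hz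

variable (Q d) in
theorem isStackInGroupoids : IsStackInGroupoids (proj Q d) :=
  (isCofiberedInGroupoids Q d).isStackInGroupoids (hasDescent Q d)

variable (d) in
-- The predicate is left free up to equivalence because it is later instantiated with membership in
-- the critical locus.
theorem isStackInGroupoids_jacobi (W : Q.Potential) (P : ObjectProperty (Rep Q d))
    (hP : ∀ x, P x ↔ x.fam.IsJacobi W) : IsStackInGroupoids (P.ι ⋙ proj Q d) := by
  have hP' : ∀ x, P x ↔ x.fam.Relations W := fun x =>
    (hP x).trans (RepFam.isJacobi_iff_relations _ _)
  refine ((isCofiberedInGroupoids Q d).fullSubcategory fun {x y} u hx => ?_).isStackInGroupoids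
    ((hasDescent Q d).fullSubcategory fun y hy => ?_)
  · exact (hP' y).2 (Hom.relations u ((hP' x).1 hx))
  · refine (hP' y).2 (relations_of_etaleCovers ?_)
    obtain ⟨n, B, g, hg, hs, hm⟩ := hy
    refine ⟨n, B, g, hg, hs, fun k => ?_⟩
    obtain ⟨z, u, hz, hu⟩ := hm k
    exact ⟨z, u, (hP' z).1 hz, hu⟩

end Rep

end QuiverCrit
end

noncomputable section

namespace QuiverCrit

/-! ### Traces of endomorphisms of projective modules -/

section Trace

variable {A M : Type} [CommRing A] [AddCommGroup M] [Module A M]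

/-- Expanding `T (e k)` in the second family and `S (e' l)` in the first turns both sides into the
same double sum. The case `T = 1` shows that the trace is independent of the dual family, and equal
families give its cyclicity. -/
theorem sum_dual_mul_comm {ι κ : Type} [Fintype ι] [Fintype κ] {e : ι → M} {ε : ι → M →ₗ[A] A}
    (h : ∀ m, ∑ k, ε k m • e k = m) {e' : κ → M} {ε' : κ → M →ₗ[A] A}
    (h' : ∀ m, ∑ k, ε' k m • e' k = m) (S T : Module.End A M) :
    ∑ k, ε k ((S * T) (e k)) = ∑ k, ε' k ((T * S) (e' k)) := by
  have h1 : ∀ k, ε k ((S * T) (e k)) = ∑ l, ε' l (T (e k)) * ε k (S (e' l)) := fun k => by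
    conv_lhs => rw [Module.End.mul_apply, ← h' (T (e k)), map_sum, map_sum]
    simp only [map_smul, smul_eq_mul]
  have h2 : ∀ l, ε' l ((T * S) (e' l)) = ∑ k, ε' l (T (e k)) * ε k (S (e' l)) := fun l => by
    conv_lhs => rw [Module.End.mul_apply, ← h (S (e' l)), map_sum, map_sum]
    simp only [map_smul, smul_eq_mul, mul_comm]
  simp only [h1, h2]
  exact Finset.sum_comm

variable [Module.Finite A M] [Module.Projective A M]

/-- The trace of an endomorphism of a finitely generated projective module. -/
def endTrace (T : Module.End A M) : A :=
  ∑ k, (DualBasis.nonempty A M).some.ε k (T ((DualBasis.nonempty A M).some.e k))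

theorem endTrace_eq {ι : Type} [Fintype ι] {e : ι → M} {ε : ι → M →ₗ[A] A}
    (h : ∀ m, ∑ k, ε k m • e k = m) (T : Module.End A M) :
    endTrace T = ∑ k, ε k (T (e k)) := by
  have := sum_dual_mul_comm (DualBasis.nonempty A M).some.sum_eq h T 1
  rwa [mul_one, one_mul] at this

theorem endTrace_mul_comm (S T : Module.End A M) : endTrace (S * T) = endTrace (T * S) :=
  sum_dual_mul_comm (DualBasis.nonempty A M).some.sum_eq (DualBasis.nonempty A M).some.sum_eq S T

theorem endTrace_eq_trace [Module.Free A M] (T : Module.End A M) :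
    endTrace T = LinearMap.trace A M T := by
  let b := Module.Free.chooseBasis A M
  rw [LinearMap.trace_eq_matrix_trace A b, endTrace_eq (e := b) (ε := b.coord)
    (fun m => b.sum_repr m), Matrix.trace]
  refine Finset.sum_congr rfl fun k _ => ?_
  rw [Matrix.diag_apply, LinearMap.toMatrix_apply]
  rfl

end Trace

namespace RepFam

variable {Q : FinQuiver} {d : Q.V → ℕ} {A : Type} [CommRing A] (x : RepFam Q d A)

instance : Module.Finite A x.Total := inferInstance

open FinQuiver

theorem endTrace_wordEnd_of_isRotated {l m : List Q.E} (h : l ~r m) :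
    endTrace (x.wordEnd l) = endTrace (x.wordEnd m) := by
  obtain ⟨n, rfl⟩ := h
  rw [List.rotate_eq_drop_append_take_mod, wordEnd_append, endTrace_mul_comm,
    ← wordEnd_append, List.take_append_drop]

/-- The trace of a loop. -/
def loopTr : Q.Loop → A
  | Sum.inl i => endTrace (x.vertexEnd i)
  | Sum.inr c => endTrace (x.wordEnd (Quotient.out c.1))

/-- The trace of a potential. -/
def trW [Algebra ℂ A] (W : Q.Potential) : A := W.sum fun c z => algebraMap ℂ A z * x.loopTr c

/-- The trace `trW`, defined through dual bases, makes sense for all projective families and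
commutes with every morphism. It is the global function whose value on free families is the ordinary
trace `traceW`. -/
theorem trW_eq_traceW [Algebra ℂ A] [∀ i, Module.Free A (x.U i)] (W : Q.Potential) :
    x.trW W = x.traceW W := by
  refine Finsupp.sum_congr fun c _ => ?_
  congr 1
  rcases c with i | ⟨c, hc⟩
  · exact endTrace_eq_trace _
  · induction c using Quotient.inductionOn with | _ l =>
    have h : Quotient.out (Quotient.mk _ l : Cycle Q.E) ~r l :=
      Quotient.exact (Quotient.out_eq (Quotient.mk (List.IsRotated.setoid Q.E) l))
    exact (x.endTrace_wordEnd_of_isRotated h).trans (endTrace_eq_trace _)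

end RepFam

namespace Rep.Hom

variable {Q : FinQuiver} {d : Q.V → ℕ} {x y : Rep Q d} (u : Hom x y)

theorem base_endTrace {S : Module.End x.A x.fam.Total} {T : Module.End y.A y.fam.Total}
    (h : ∀ m, u.total (S m) = T (u.total m)) : u.base.hom (endTrace S) = endTrace T := by
  obtain ⟨β⟩ := DualBasis.nonempty x.A x.fam.Total
  rw [endTrace_eq β.sum_eq, endTrace_eq (u.pushDualBasis β).sum_eq, map_sum]
  refine Finset.sum_congr rfl fun k _ => ?_
  rw [← u.pushDualBasis_ε, h]
  rfl

theorem base_trW (W : Q.Potential) : u.base.hom (x.fam.trW W) = y.fam.trW W := by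
  unfold RepFam.trW Finsupp.sum
  rw [map_sum]
  refine Finset.sum_congr rfl fun c _ => ?_
  rw [map_mul]
  congr 1
  · exact u.base.hom.commutes _
  · rcases c with i | c
    · refine u.base_endTrace fun m => ?_
      simp only [RepFam.vertexEnd_apply, u.total_single]
      rfl
    · exact u.base_endTrace fun m => u.total_word _ m

end Rep.Hom

/-! ### The derivative of the trace of a potential -/

section Derivative

/-- An additive map satisfying the Leibniz rule over a ring homomorphism. -/
structure IsDerivationOver {A B : Type} [CommRing A] [CommRing B] (ρ : A →+* B) (D : A →+ B) :
    Prop where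
  leibniz : ∀ a b, D (a * b) = ρ a * D b + D a * ρ b

variable {A B : Type} [CommRing A] [CommRing B] {ρ : A →+* B} {D : A →+ B}
  (hD : IsDerivationOver ρ D)

include hD

open Matrix

theorem IsDerivationOver.matrix_mul {ι κ ν : Type} [Fintype κ] (X : Matrix ι κ A)
    (Y : Matrix κ ν A) : (X * Y).map D = X.map ρ * Y.map D + X.map D * Y.map ρ := by
  ext p q
  simp [Matrix.mul_apply, map_sum, hD.leibniz, Finset.sum_add_distrib]

theorem IsDerivationOver.map_one : D 1 = 0 := by
  have := hD.leibniz 1 1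
  simpa using this

variable {ι : Type} [Fintype ι] [DecidableEq ι]

/-- Differentiate `E * E = E` and multiply by `E` on both sides: the term `E · DE · E` then occurs
once on one side and twice on the other. -/
theorem IsDerivationOver.idempotent {E : Matrix ι ι A} (hE : E * E = E) :
    E.map ρ * E.map D * E.map ρ = 0 := by
  have h1 := congrArg (fun X => X.map D) hE
  have hρ : E.map ρ * E.map ρ = E.map ρ := by rw [← Matrix.map_mul, hE]
  simp only [hD.matrix_mul] at h1
  have h2 : E.map ρ * (E.map ρ * E.map D + E.map D * E.map ρ) * E.map ρ =
      E.map ρ * E.map D * E.map ρ + E.map ρ * E.map D * E.map ρ := by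
    rw [mul_add, add_mul, ← mul_assoc (E.map ρ) (E.map ρ), hρ, ← mul_assoc (E.map ρ) (E.map D),
      mul_assoc _ (E.map ρ) (E.map ρ), hρ]
  rw [h1] at h2
  simpa using h2

/-- The trace of an idempotent is locally constant. Algebraically, both terms of the Leibniz rule
for `E * E = E` have the trace of `E · DE · E`, which vanishes. This disposes of the empty loops in
a potential. -/
theorem IsDerivationOver.trace_idempotent {E : Matrix ι ι A} (hE : E * E = E) :
    (E.map D).trace = 0 := by
  have h1 := congrArg (fun X => X.map D) hE
  have hρ : E.map ρ * E.map ρ = E.map ρ := by rw [← Matrix.map_mul, hE]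
  simp only [hD.matrix_mul] at h1
  have h2 : (E.map ρ * E.map D).trace = 0 := by
    have := congrArg Matrix.trace (hD.idempotent hE)
    rwa [Matrix.trace_mul_comm, ← mul_assoc, hρ, Matrix.trace_zero] at this
  rw [← h1, Matrix.trace_add, Matrix.trace_mul_comm (E.map D), h2, add_zero]

/-- Differentiating `E X = X` leaves the extra term `tr(DE · X)`, and moving `E` around the trace
exhibits `E · DE · E` in it. This is needed for loops of length one, whose cyclic derivative is an
empty path and therefore acts as a vertex idempotent. -/
theorem IsDerivationOver.trace_corner {E X : Matrix ι ι A} (hE : E * E = E) (h1 : E * X = X)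
    (h2 : X * E = X) : (E.map ρ * X.map D).trace = (X.map D).trace := by
  have hρ1 : E.map ρ * X.map ρ = X.map ρ := by rw [← Matrix.map_mul, h1]
  have hρ2 : X.map ρ * E.map ρ = X.map ρ := by rw [← Matrix.map_mul, h2]
  have h3 := congrArg (fun X => (X.map D).trace) h1
  simp only [hD.matrix_mul, Matrix.trace_add] at h3
  have h4 : (E.map D * X.map ρ).trace = 0 := by
    have := congrArg (fun Y => (Y * X.map ρ).trace) (hD.idempotent hE)
    simp only [zero_mul, Matrix.trace_zero] at this
    rwa [mul_assoc, hρ1, mul_assoc, Matrix.trace_mul_comm, mul_assoc, hρ2] at this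
  rwa [h4, add_zero] at h3

/-- The product of the matrices attached to the letters of a word, the last letter acting last. -/
def wordMat {E : Type} (X : E → Matrix ι ι A) : List E → Matrix ι ι A
  | [] => 1
  | a :: l => wordMat X l * X a

omit hD in
theorem wordMat_append {E : Type} (X : E → Matrix ι ι A) (l m : List E) :
    wordMat X (l ++ m) = wordMat X m * wordMat X l := by
  induction l with
  | nil => simp [wordMat]
  | cons a l ih => simp [wordMat, ih, mul_assoc]

theorem IsDerivationOver.wordMat {E : Type} (X : E → Matrix ι ι A) (l : List E) :
    (wordMat X l).map D = ∑ i : Fin l.length, (wordMat X (l.drop (i + 1))).map ρ *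
      (X (l.get i)).map D * (wordMat X (l.take i)).map ρ := by
  induction l with
  | nil =>
    ext p q
    by_cases h : p = q
    · subst h; simp [QuiverCrit.wordMat, hD.map_one]
    · simp [QuiverCrit.wordMat, h]
  | cons a l ih =>
    have e : (Matrix.map (1 : Matrix ι ι A) ρ) = 1 := by simp
    rw [QuiverCrit.wordMat, hD.matrix_mul, ih, Finset.sum_mul]
    refine Eq.trans ?_ (Fin.sum_univ_succ (n := l.length) _).symm
    congr 1
    · simp [QuiverCrit.wordMat, e]
    · refine Finset.sum_congr rfl fun i _ => ?_
      simp only [Fin.val_succ, List.drop_succ_cons, List.take_succ_cons, QuiverCrit.wordMat,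
        Matrix.map_mul, List.get_eq_getElem, List.getElem_cons_succ, mul_assoc]

/-- In each Leibniz term, cyclicity brings the differentiated letter to the end. What remains is the
word read once around from just after position `i`, exactly as in the cyclic derivative. -/
theorem IsDerivationOver.trace_wordMat {E : Type} (X : E → Matrix ι ι A) (l : List E) :
    D (QuiverCrit.wordMat X l).trace = ∑ i : Fin l.length,
      ((QuiverCrit.wordMat X (l.drop (i + 1) ++ l.take i)).map ρ * (X (l.get i)).map D).trace := by
  have : D (QuiverCrit.wordMat X l).trace = ((QuiverCrit.wordMat X l).map D).trace := by
    simp [Matrix.trace, map_sum]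
  rw [this, hD.wordMat, Matrix.trace_sum]
  refine Finset.sum_congr rfl fun i _ => ?_
  rw [Matrix.trace_mul_comm, wordMat_append, Matrix.map_mul, mul_assoc]

end Derivative

end QuiverCrit
end

/-! ### Cyclic derivatives as derivatives of traces -/

noncomputable section

namespace QuiverCrit

namespace FinQuiver

variable {Q : FinQuiver}

theorem composable_of_isChain (l : List Q.E) : ∀ {a : Q.E},
    (a :: l).IsChain (fun a b => Q.head a = Q.tail b) → Q.Composable (Q.head a) l := by
  induction l with
  | nil => intro a _; trivial
  | cons b l ih =>
    intro a h
    rw [List.isChain_cons_cons] at h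
    exact ⟨h.1.symm, ih h.2⟩

theorem composable_of_cycle_chain {a : Q.E} {l : List Q.E}
    (h : Cycle.Chain (fun a b => Q.head a = Q.tail b) ((a :: l : List Q.E) : Cycle Q.E)) :
    Q.Composable (Q.head a) l ∧ Q.tail a = Q.endpoint (Q.head a) l := by
  rw [Cycle.chain_coe_cons] at h
  have := composable_append.1 (composable_of_isChain _ h)
  exact ⟨this.1, this.2.1⟩

open Classical in
-- Rotations are indexed by positions, with repetitions for periodic words, so the sum has the same
-- index set as the Leibniz expansion of the trace.
theorem Loop.cyclicDeriv_inr (a : Q.E) (l : List Q.E) (hl : l ≠ [])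
    (h : (l : Cycle Q.E) ≠ Cycle.nil ∧ (l : Cycle Q.E).Chain (fun a b => Q.head a = Q.tail b)) :
    Loop.cyclicDeriv a (Sum.inr ⟨l, h⟩ : Q.Loop) = ∑ i : Fin l.length,
      if l.get i = a then PathAlgebra.ofWord (Q.head a) (l.drop (i + 1) ++ l.take i) else 0 := by
  have e : l.cyclicPermutations = List.ofFn fun i : Fin l.length => l.rotate i := by
    refine List.ext_getElem (by simp [hl]) fun n h1 h2 => ?_
    simp
  unfold Loop.cyclicDeriv
  simp only [Cycle.lists_coe, e, Multiset.map_coe, Multiset.sum_coe, List.map_ofFn,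
    List.sum_ofFn]
  refine Finset.sum_congr rfl fun i _ => ?_
  have e2 : l.rotate i = l.get i :: (l.drop (i + 1) ++ l.take i) := by
    rw [List.rotate_eq_drop_append_take i.2.le, List.drop_eq_getElem_cons i.2]
    rfl
  simp only [Function.comp_apply, e2]

end FinQuiver

namespace RepFam

open FinQuiver Matrix

variable {Q : FinQuiver} {d : Q.V → ℕ} {A : Type} [CommRing A] (x : RepFam Q d A)

theorem wordEnd_mul_vertexEnd_of_composable {l : List Q.E} (hl : l ≠ []) {i : Q.V}
    (h : Q.Composable i l) : x.wordEnd l * x.vertexEnd i = x.wordEnd l := by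
  cases l with
  | nil => exact (hl rfl).elim
  | cons a l =>
    obtain ⟨rfl, -⟩ := h
    rw [wordEnd, mul_assoc, arrowEnd_mul_vertexEnd]

section

variable {M : Type} [AddCommGroup M] [Module A M] {ι : Type} (e : ι → M) (ε : ι → M →ₗ[A] A)

/-- The matrix of an endomorphism with respect to a dual family. -/
def dualMat (T : Module.End A M) : Matrix ι ι A := Matrix.of fun p q => ε p (T (e q))

theorem dualMat_mul [Fintype ι] {e : ι → M} {ε : ι → M →ₗ[A] A}
    (h : ∀ m, ∑ k, ε k m • e k = m) (S T : Module.End A M) :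
    dualMat e ε (S * T) = dualMat e ε S * dualMat e ε T := by
  ext p q
  rw [Matrix.mul_apply]
  change ε p (S (T (e q))) = ∑ k, ε p (S (e k)) * ε k (T (e q))
  conv_lhs => rw [← h (T (e q)), map_sum, map_sum]
  simp only [map_smul, smul_eq_mul, mul_comm]

theorem dualMat_sum {κ : Type} (s : Finset κ) (T : κ → Module.End A M) :
    dualMat e ε (∑ k ∈ s, T k) = ∑ k ∈ s, dualMat e ε (T k) := by
  ext p q
  simp [dualMat, Matrix.sum_apply, LinearMap.sum_apply]

end

section

variable {ι : Type} [Fintype ι] {e : ι → x.Total} {ε : ι → x.Total →ₗ[A] A}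
  (h : ∀ m, ∑ k, ε k m • e k = m)

include h

/-- The empty word is excluded because the identity has only an idempotent matrix with respect to a
dual family, whereas `wordMat` starts from the identity matrix. -/
theorem dualMat_wordEnd [DecidableEq ι] {l : List Q.E} (hl : l ≠ []) :
    dualMat e ε (x.wordEnd l) = wordMat (fun a => dualMat e ε (x.arrowEnd a)) l := by
  induction l with
  | nil => exact (hl rfl).elim
  | cons a l ih =>
    by_cases hl' : l = []
    · subst hl'
      simp [wordEnd, wordMat]
    · rw [wordEnd, dualMat_mul h, ih hl', wordMat]

variable [Algebra ℂ A] {B : Type} [CommRing B] {ρ : A →+* B} {D : A →+ B}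
  (hD : IsDerivationOver ρ D)

include hD

/-- The Leibniz expansion is a sum over positions. Sorting the positions by the arrow found there
turns it into the sum over arrows of the cyclic derivatives. -/
theorem derivation_loopTr (c : Q.Loop) :
    D (x.loopTr c) = ∑ a, ((dualMat e ε (x.act (c.cyclicDeriv a))).map ρ *
      (dualMat e ε (x.arrowEnd a)).map D).trace := by
  classical
  have htr : ∀ T : Module.End A x.Total, endTrace T = (dualMat e ε T).trace := fun T =>
    endTrace_eq h T
  have hDtr : ∀ X : Matrix ι ι A, D X.trace = (X.map D).trace := fun X => by
    simp [Matrix.trace, map_sum]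
  have hE : ∀ i, dualMat e ε (x.vertexEnd i) * dualMat e ε (x.vertexEnd i) =
      dualMat e ε (x.vertexEnd i) := fun i => by rw [← dualMat_mul h, vertexEnd_mul_self]
  rcases c with i | ⟨c, hc⟩
  · have e0 : ∀ a, Loop.cyclicDeriv a (Sum.inl i : Q.Loop) = 0 := fun a => rfl
    simp only [e0, act_zero]
    have e1 : (dualMat e ε (0 : Module.End A x.Total)).map ρ = 0 := by
      ext p q; simp [dualMat]
    simp only [e1, zero_mul, Matrix.trace_zero, Finset.sum_const_zero]
    change D (endTrace _) = 0
    rw [htr, hDtr, hD.trace_idempotent (hE i)]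
  · induction c using Quotient.inductionOn with | _ l =>
    have hl : l ≠ [] := fun h0 => hc.1 (by subst h0; rfl)
    have h1 : x.loopTr (Sum.inr ⟨(l : Cycle Q.E), hc⟩) = endTrace (x.wordEnd l) :=
      x.endTrace_wordEnd_of_isRotated
        (Quotient.exact (Quotient.out_eq (Quotient.mk (List.IsRotated.setoid Q.E) l)))
    refine (congrArg D h1).trans ?_
    rw [htr, x.dualMat_wordEnd h hl, hD.trace_wordMat]
    have h2 : ∀ a, ((dualMat e ε (x.act (Loop.cyclicDeriv a (Sum.inr ⟨(l : Cycle Q.E), hc⟩)))).map ρ *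
        (dualMat e ε (x.arrowEnd a)).map D).trace = ∑ i : Fin l.length, if l.get i = a then
          ((dualMat e ε (x.wordEnd (l.drop (i + 1) ++ l.take i) * x.vertexEnd (Q.head (l.get i)))).map
            ρ * (dualMat e ε (x.arrowEnd (l.get i))).map D).trace else 0 := by
      intro a
      rw [Loop.cyclicDeriv_inr a l hl hc, act_sum, dualMat_sum]
      have e1 : ∀ X : Fin l.length → Matrix ι ι A, (∑ i, X i).map ρ = ∑ i, (X i).map ρ := fun X => by
        ext p q; simp [Matrix.sum_apply, map_sum]
      rw [e1, Finset.sum_mul, Matrix.trace_sum]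
      refine Finset.sum_congr rfl fun i _ => ?_
      split_ifs with hi
      · subst hi
        rw [act_ofWord]
      · rw [act_zero]
        have e2 : (dualMat e ε (0 : Module.End A x.Total)).map ρ = 0 := by
          ext p q; simp [dualMat]
        rw [e2, zero_mul, Matrix.trace_zero]
    refine Eq.trans ?_ (Finset.sum_congr rfl fun a _ => h2 a).symm
    rw [Finset.sum_comm]
    refine Finset.sum_congr rfl fun i _ => ?_
    rw [Finset.sum_ite_eq, if_pos (Finset.mem_univ _)]
    have h3 : ((l.get i :: (l.drop (i + 1) ++ l.take i) : List Q.E) : Cycle Q.E) = l := by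
      rw [Cycle.coe_eq_coe]
      refine List.IsRotated.symm ⟨i, ?_⟩
      rw [List.rotate_eq_drop_append_take i.2.le, List.drop_eq_getElem_cons i.2]
      rfl
    have h4 := composable_of_cycle_chain (h3 ▸ hc.2 : Cycle.Chain (fun a b => Q.head a = Q.tail b)
      ((l.get i :: (l.drop (i + 1) ++ l.take i) : List Q.E) : Cycle Q.E))
    generalize l.drop (i + 1) ++ l.take i = r at h4 ⊢
    generalize l.get i = b at h4 ⊢
    -- For a loop of length one nothing remains after removing the differentiated arrow: the cyclic
    -- derivative gives a vertex idempotent while the Leibniz term contains the identity matrix, and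
    -- `trace_corner` reconciles the two.
    by_cases hr : r = []
    · subst hr
      have hb : Q.tail b = Q.head b := h4.2
      have e1 : dualMat e ε (x.wordEnd [] * x.vertexEnd (Q.head b)) =
          dualMat e ε (x.vertexEnd (Q.head b)) := congrArg _ (one_mul _)
      have e2 : (wordMat (fun a => dualMat e ε (x.arrowEnd a)) ([] : List Q.E)).map ρ = 1 := by
        simp [wordMat]
      rw [e1, e2, one_mul, hD.trace_corner (hE _)]
      · rw [← dualMat_mul h, vertexEnd_mul_arrowEnd]
      · rw [← dualMat_mul h, ← hb, arrowEnd_mul_vertexEnd]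
    · rw [x.wordEnd_mul_vertexEnd_of_composable hr h4.1, x.dualMat_wordEnd h hr]

/-- The derivative of the trace of a potential, in terms of the cyclic derivatives. -/
theorem derivation_trW (hD0 : ∀ z, D (algebraMap ℂ A z) = 0) (W : Q.Potential) :
    D (x.trW W) = ∑ a, ((dualMat e ε (x.act (FinQuiver.cyclicDeriv a W))).map ρ *
      (dualMat e ε (x.arrowEnd a)).map D).trace := by
  have h1 : ∀ a, ((dualMat e ε (x.act (FinQuiver.cyclicDeriv a W))).map ρ *
      (dualMat e ε (x.arrowEnd a)).map D).trace = ∑ c ∈ W.support,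
        ρ (algebraMap ℂ A (W c)) * ((dualMat e ε (x.act (c.cyclicDeriv a))).map ρ *
          (dualMat e ε (x.arrowEnd a)).map D).trace := by
    intro a
    have e1 : (dualMat e ε (x.act (FinQuiver.cyclicDeriv a W))).map ρ = ∑ c ∈ W.support,
        ρ (algebraMap ℂ A (W c)) • (dualMat e ε (x.act (c.cyclicDeriv a))).map ρ := by
      rw [FinQuiver.cyclicDeriv, Finsupp.sum, act_sum, dualMat_sum]
      ext p q
      simp [Matrix.sum_apply, map_sum, act_smul, dualMat]
    rw [e1, Finset.sum_mul, Matrix.trace_sum]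
    refine Finset.sum_congr rfl fun c _ => ?_
    rw [smul_mul_assoc, Matrix.trace_smul, smul_eq_mul]
  simp only [h1]
  rw [Finset.sum_comm, trW, Finsupp.sum, map_sum]
  refine Finset.sum_congr rfl fun c _ => ?_
  rw [hD.leibniz, hD0, zero_mul, add_zero, x.derivation_loopTr h hD, Finset.mul_sum]

end

end RepFam

end QuiverCrit
end

noncomputable section

namespace QuiverCrit

set_option linter.style.haveILetI false

open scoped TensorProduct

/-! ### Zariski coverings -/

/-- The localization of an algebra away from an element. -/
def awayAlg {A : CommAlgCat.{0} ℂ} (f : A) : CommAlgCat.{0} ℂ := CommAlgCat.of ℂ (Localization.Away f)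

/-- The localization map. -/
def toAway {A : CommAlgCat.{0} ℂ} (f : A) : A ⟶ awayAlg f :=
  CommAlgCat.ofHom (IsScalarTower.toAlgHom ℂ A (Localization.Away f))

theorem exists_away_lift {A B : CommAlgCat.{0} ℂ} (f : A) (h : A ⟶ B) (hf : IsUnit (h.hom f)) :
    ∃ k : awayAlg f ⟶ B, toAway f ≫ k = h := by
  let k : Localization.Away f →+* B := IsLocalization.Away.lift (g := h.hom.toRingHom) f hf
  have hk : ∀ r, k (algebraMap A _ r) = h.hom r := fun r => IsLocalization.Away.lift_eq f hf r
  have hc : ∀ z, k (algebraMap ℂ (Localization.Away f) z) = algebraMap ℂ B z := fun z => by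
    rw [IsScalarTower.algebraMap_apply ℂ A (Localization.Away f), hk]
    exact h.hom.commutes z
  refine ⟨CommAlgCat.ofHom ({ toRingHom := k, commutes' := hc } : Localization.Away f →ₐ[ℂ] B), ?_⟩
  ext r
  exact hk r

theorem isUnit_toAway {A : CommAlgCat.{0} ℂ} (f : A) : IsUnit ((toAway f).hom f) :=
  IsLocalization.Away.algebraMap_isUnit (S := Localization.Away f) f

/-- The chosen elements generate the unit ideal, hence finitely many of them do, and localizations
at single elements are étale. Local statements can therefore be supplied prime by prime. -/
theorem EtaleCovers.of_away {A : CommAlgCat.{0} ℂ} {R : ∀ B : CommAlgCat.{0} ℂ, (A ⟶ B) → Prop}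
    (h : ∀ p : PrimeSpectrum A, ∃ f ∉ p.asIdeal, R (awayAlg f) (toAway f)) : EtaleCovers A R := by
  choose f hf hR using h
  have hspan : Ideal.span (Set.range f) = ⊤ := by
    by_contra hne
    obtain ⟨m, hm, hle⟩ := Ideal.exists_le_maximal _ hne
    exact hf ⟨m, hm.isPrime⟩ (hle (Ideal.subset_span ⟨_, rfl⟩))
  obtain ⟨s, hs, hs'⟩ := (Ideal.span_eq_top_iff_finite _).1 hspan
  choose p hp using fun r : s => hs r.2
  let e := s.equivFin.symm
  refine ⟨s.card, fun k => awayAlg (f (p (e k))), fun k => toAway _, fun k => ?_, fun P => ?_,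
    fun k => hR _⟩
  · have : Algebra.Etale A (Localization.Away (f (p (e k)))) :=
      Algebra.Etale.of_isLocalizationAway (f (p (e k)))
    change (algebraMap A (Localization.Away (f (p (e k))))).Etale
    exact RingHom.etale_algebraMap.2 this
  · have : ∃ r : s, (r : A) ∉ P.asIdeal := by
      by_contra! hall
      refine P.2.ne_top (top_le_iff.1 (hs' ▸ Ideal.span_le.2 fun r hr => hall ⟨r, hr⟩))
    obtain ⟨r, hr⟩ := this
    refine ⟨e.symm r, ?_⟩
    have hr' : f (p (e (e.symm r))) ∉ P.asIdeal := by
      rw [Equiv.apply_symm_apply, hp]; exact hr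
    have := PrimeSpectrum.localization_away_comap_range
      (Localization.Away (f (p (e (e.symm r))))) (f (p (e (e.symm r))))
    have h2 : P ∈ Set.range (PrimeSpectrum.comap
      (algebraMap A (Localization.Away (f (p (e (e.symm r))))))) := by
      rw [this]; exact hr'
    obtain ⟨P', hP'⟩ := h2
    exact ⟨P', hP'⟩

namespace Rep

variable {Q : FinQuiver} {d : Q.V → ℕ}

theorem Hom.free {x y : Rep Q d} (u : Hom x y) (i : Q.V) [Module.Free x.A (x.fam.U i)] :
    Module.Free y.A (y.fam.U i) := by
  letI := u.algebra
  letI := u.moduleU i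
  haveI := u.isScalarTower i
  exact Module.Free.of_equiv (u.isBaseChange i).equiv

theorem isHomLift_of_base_eq {x y : Rep Q d} (u : x ⟶ y) (f : x.A ⟶ y.A) (h : u.base = f) :
    (proj Q d).IsHomLift f u := by
  subst h
  exact IsHomLift.map (p := proj Q d) u

/-- A finite projective module of constant rank is free near each prime. The product of the elements
found at the finitely many vertices works for all vertices at once. -/
theorem exists_free_away (x : Rep Q d) (p : PrimeSpectrum x.A) :
    ∃ f ∉ p.asIdeal, ∀ i, Module.Free (x.push (toAway f)).A ((x.push (toAway f)).fam.U i) := by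
  have h1 : ∀ i, ∃ f ∉ p.asIdeal, Module.Free (x.push (toAway f)).A ((x.push (toAway f)).fam.U i) := by
    intro i
    obtain ⟨f, hf, hfree⟩ := Module.Free.away_of_finite_of_flat_of_rankAtStalk_constant
      (x.fam.U i) p.asIdeal fun m _ => by rw [x.fam.rank, x.fam.rank]
    refine ⟨f, hf, ?_⟩
    have key : ∀ I : Algebra x.A (Localization.Away f), I = OreLocalization.instAlgebra →
        Module.Free (Localization.Away f)
          ((@RepFam.baseChange Q d x.A _ x.fam (Localization.Away f) _ I).U i) := by
      rintro _ rfl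
      exact Module.Free.of_equiv (LocalizedModule.isBaseChange (Submonoid.powers f)
        (x.fam.U i)).equiv.symm
    exact key (algOf (toAway f)) (Algebra.algebra_ext _ _ fun r => rfl)
  choose f hf hfree using h1
  refine ⟨∏ i, f i, fun h => ?_, fun i => ?_⟩
  · obtain ⟨i, -, hi⟩ := (p.2.prod_mem_iff).1 h
    exact hf i hi
  · obtain ⟨k, hk⟩ := exists_away_lift (f i) (toAway (∏ i, f i))
      (isUnit_of_dvd_unit (map_dvd _ (Finset.dvd_prod_of_mem f (Finset.mem_univ i)))
        (isUnit_toAway _))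
    obtain ⟨v, -, -⟩ := Hom.exists_fac (x.toPush (toAway (f i))) (x.toPush (toAway (∏ i, f i))) k hk
    exact @Hom.free Q d _ _ v i (hfree i)

/-- A family with `d i` generators of every fibre is isomorphic to a tautological one. -/
theorem exists_std_hom (y : Rep Q d) (m : ∀ i, Fin (d i) → y.fam.U i)
    (hm : ∀ i, Submodule.span y.A (Set.range (m i)) = ⊤) :
    ∃ (φ : RepSpace Q d y.A) (c : (⟨y.A, φ.std⟩ : Rep Q d) ⟶ y), c.base = 𝟙 y.A ∧
      ∀ i (v : Fin (d i) → y.A), c.map i v = ∑ k, v k • m i k := by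
  let l : ∀ i, (Fin (d i) → y.A) →ₗ[y.A] y.fam.U i := fun i => Fintype.linearCombination y.A (m i)
  have hs : ∀ i, Function.Surjective (l i) := fun i => by
    rw [← LinearMap.range_eq_top, Fintype.range_linearCombination, hm]
  have hb : ∀ i, Function.Bijective (l i) := fun i =>
    Module.bijective_of_surjective_of_rankAtStalk_eq (hs i) fun p hp => by
      rw [y.fam.rank]
      exact (RepSpace.std (d := d) (Q := Q) (A := y.A) (fun _ => 0)).rank i _
  let e := fun i => LinearEquiv.ofBijective (l i) (hb i)
  let φ : RepSpace Q d y.A := fun a => LinearMap.toMatrix'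
    ((e (Q.head a)).symm.toLinearMap ∘ₗ y.fam.φ a ∘ₗ (e (Q.tail a)).toLinearMap)
  have hφ : ∀ a v, (φ a).mulVec v = (e (Q.head a)).symm (y.fam.φ a (e (Q.tail a) v)) := fun a v => by
    rw [← Matrix.toLin'_apply, Matrix.toLin'_toMatrix']
    rfl
  refine ⟨φ, { base := 𝟙 y.A
               map := fun i => (l i).toAddMonoidHom
               map_smul := fun i r v => (l i).map_smul r v
               map_φ := fun a v => ?_
               span_range := fun i => ?_ }, rfl, fun i v => ?_⟩
  · refine (congrArg (l (Q.head a)) (hφ a v)).trans ?_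
    exact (e (Q.head a)).apply_symm_apply _
  · exact eq_top_iff.2 fun v _ => Submodule.subset_span (hs i v)
  · rfl

theorem exists_frame_of_free (y : Rep Q d) [∀ i, Module.Free y.A (y.fam.U i)] (i : Q.V) :
    ∃ m : Fin (d i) → y.fam.U i, Submodule.span y.A (Set.range m) = ⊤ := by
  -- Over the zero ring there is no prime at which to read off the rank, but there any family spans.
  rcases subsingleton_or_nontrivial y.A with h | h
  · have := Module.subsingleton y.A (y.fam.U i)
    exact ⟨0, Subsingleton.elim _ _⟩
  · obtain ⟨p⟩ := (inferInstance : Nonempty (PrimeSpectrum y.A))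
    have hr : Module.finrank y.A (y.fam.U i) = d i := by
      rw [← y.fam.rank i p, Module.rankAtStalk_eq_finrank_of_free]
      rfl
    let b := Module.finBasisOfFinrankEq y.A (y.fam.U i) hr
    exact ⟨b, b.span_eq⟩

/-- Étale locally, even Zariski locally, every family is tautological. -/
theorem exists_std_away (x : Rep Q d) (p : PrimeSpectrum x.A) :
    ∃ f ∉ p.asIdeal, ∃ (φ : RepSpace Q d (awayAlg f)) (u : x ⟶ (⟨awayAlg f, φ.std⟩ : Rep Q d)),
      u.base = toAway f := by
  obtain ⟨f, hf, hfree⟩ := x.exists_free_away p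
  choose m hm using fun i => exists_frame_of_free (x.push (toAway f)) i
  obtain ⟨φ, c, hc, -⟩ := exists_std_hom _ m hm
  obtain ⟨c', hc', -, -⟩ := Hom.exists_inverse c (𝟙 _)
    (by rw [hc]; exact Category.comp_id _) (by rw [hc]; exact Category.comp_id _)
  refine ⟨f, hf, φ, x.toPush (toAway f) ≫ c', ?_⟩
  change toAway f ≫ c'.base = _
  rw [hc']
  exact Category.comp_id _

end Rep

/-! ### The quotient stack -/

section Quotient

variable {Q : FinQuiver} {d : Q.V → ℕ}

theorem stdHom_map {A B : CommAlgCat.{0} ℂ} (f : A ⟶ B) (g : GLProd Q d B) {φ : RepSpace Q d A}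
    {ψ : RepSpace Q d B} (h : g • RepSpace.map f.hom.toRingHom φ = ψ) (i : Q.V) (m : Fin (d i) → A) :
    (stdHom f g h).map i m = (g i).1.mulVec (fun k => f.hom (m k)) := rfl

theorem hom_single {A B : CommAlgCat.{0} ℂ} (f : A ⟶ B) {n : ℕ} (k : Fin n) :
    (fun l => f.hom ((Pi.single k 1 : Fin n → A) l)) = Pi.single k 1 := by
  funext l
  by_cases hl : l = k
  · subst hl; simp
  · simp [Pi.single_eq_of_ne hl]

/-- Morphisms between tautological families come from the group. -/
theorem exists_stdHom {A B : CommAlgCat.{0} ℂ} {φ : RepSpace Q d A} {ψ : RepSpace Q d B}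
    (v : Rep.Hom (⟨A, φ.std⟩ : Rep Q d) ⟨B, ψ.std⟩) :
    ∃ (g : GLProd Q d B) (h : g • RepSpace.map v.base.hom.toRingHom φ = ψ),
      stdHom v.base g h = v := by
  let col : ∀ i, Fin (d i) → Fin (d i) → B := fun i k =>
    (v.map i : (Fin (d i) → A) → (Fin (d i) → B)) (Pi.single k 1)
  let G : ∀ i, Matrix (Fin (d i)) (Fin (d i)) B := fun i => Matrix.of fun r k => col i k r
  have hG : ∀ i (m : Fin (d i) → A), (v.map i : (Fin (d i) → A) → (Fin (d i) → B)) m =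
      (G i).mulVec (fun k => v.base.hom (m k)) := by
    intro i m
    have e1 : (v.map i : (Fin (d i) → A) → (Fin (d i) → B)) m =
        ∑ k, v.base.hom (m k) • col i k := by
      conv_lhs => rw [pi_eq_sum_univ' m]
      refine (map_sum (v.map i) _ _).trans (Finset.sum_congr rfl fun k _ => v.map_smul i _ _)
    rw [e1]
    funext r
    simp [Matrix.mulVec, dotProduct, G, Finset.sum_apply, mul_comm]
  have hu : ∀ i, IsUnit (G i) := fun i => by
    rw [← Matrix.mulVec_surjective_iff_isUnit]
    have h1 : LinearMap.range (G i).mulVecLin = ⊤ := by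
      rw [eq_top_iff]
      refine (le_of_eq (v.span_range i).symm).trans (Submodule.span_le.2 ?_)
      rintro _ ⟨m, rfl⟩
      exact ⟨_, (hG i m).symm⟩
    exact LinearMap.range_eq_top.1 h1
  have hφ : ∀ a, (G (Q.head a)) * (φ a).map v.base.hom.toRingHom = ψ a * G (Q.tail a) := by
    intro a
    refine Matrix.ext_of_mulVec_single fun k => ?_
    have := v.map_φ a (Pi.single k 1 : Fin (d (Q.tail a)) → A)
    have e1 := (hG _ _).symm.trans (this.trans (congrArg (ψ a).mulVec (hG _ _)))
    rw [hom_single] at e1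
    have e2 : (fun r => v.base.hom ((φ a).mulVec (Pi.single k 1) r)) =
        ((φ a).map v.base.hom.toRingHom).mulVec (Pi.single k 1) := by
      funext r; simp
    rw [← Matrix.mulVec_mulVec, ← Matrix.mulVec_mulVec, ← e2]
    exact e1
  refine ⟨fun i => (hu i).unit, ?_, ?_⟩
  · funext a
    rw [RepSpace.smul_apply]
    change G _ * (φ a).map v.base.hom.toRingHom * _ = _
    rw [hφ, Matrix.mul_assoc]
    exact (congrArg (ψ a * ·) (hu (Q.tail a)).mul_val_inv).trans (Matrix.mul_one _)
  · refine Rep.Hom.ext rfl (funext fun i => AddMonoidHom.ext fun m => ?_)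
    exact (hG i m).symm

theorem stdHom_injective {A B : CommAlgCat.{0} ℂ} {f : A ⟶ B} {g g' : GLProd Q d B}
    {φ : RepSpace Q d A} {ψ : RepSpace Q d B} {h : g • RepSpace.map f.hom.toRingHom φ = ψ}
    {h' : g' • RepSpace.map f.hom.toRingHom φ = ψ} (e : stdHom f g h = stdHom f g' h') : g = g' := by
  funext i
  refine Units.ext (Matrix.ext_of_mulVec_single fun k => ?_)
  have := DFunLike.congr_fun (congrFun (congrArg Rep.Hom.map e) i)
    (Pi.single k 1 : Fin (d i) → A)
  have h2 : (g i).1.mulVec _ = (g' i).1.mulVec _ := this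
  rwa [hom_single] at h2

instance : (stdFunctor Q d).Full where
  map_surjective {x y} v := by
    obtain ⟨g, h, e⟩ := exists_stdHom v
    exact ⟨⟨v.base, g, h⟩, e⟩

instance : (stdFunctor Q d).Faithful where
  map_injective {x y} u v e := by
    obtain ⟨b, g, h⟩ := u
    obtain ⟨b', g', h'⟩ := v
    obtain rfl : b = b' := congrArg Rep.Hom.base e
    obtain rfl : g = g' := stdHom_injective (f := b) (h := h) (h' := h') e
    rfl

variable (Q d) in
theorem isQuotientStack_std :
    IsQuotientStack (Rep.proj Q d) (repAction Q d) (stdFunctor Q d) where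
  stack := Rep.isStackInGroupoids Q d
  over_base := rfl
  full := inferInstance
  faithful := inferInstance
  locally_surjective x := EtaleCovers.of_away fun p => by
    obtain ⟨f, hf, φ, u, hu⟩ := x.exists_std_away p
    exact ⟨f, hf, ⟨awayAlg f, φ⟩, u, Rep.isHomLift_of_base_eq u _ hu⟩

theorem isQuotientStack_jacobi (W : Q.Potential) (P : ObjectProperty (Rep Q d))
    (hP : ∀ x, P x ↔ x.fam.IsJacobi W) :
    ∃ F : (jacobiAction d W).Prestack ⥤ P.FullSubcategory,
      F ⋙ P.ι = (repAction Q d).prestackIncl (InM W) (inM_stable W) ⋙ stdFunctor Q d ∧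
        IsQuotientStack (P.ι ⋙ Rep.proj Q d) (jacobiAction d W) F := by
  have hP' : ∀ x, P x ↔ x.fam.Relations W := fun x =>
    (hP x).trans (RepFam.isJacobi_iff_relations _ _)
  let I : (jacobiAction d W).Prestack ⥤ (repAction Q d).Prestack :=
    (repAction Q d).prestackIncl (InM W) (inM_stable W)
  let F : (jacobiAction d W).Prestack ⥤ P.FullSubcategory :=
    P.lift (I ⋙ stdFunctor Q d) fun o => (hP' _).2 o.pt.2
  have hI1 : I.Full := ⟨fun {x y} u => ⟨⟨u.base, u.g, Subtype.ext u.smul_eq⟩, rfl⟩⟩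
  have hI2 : I.Faithful := ⟨fun {x y} u v e => by
    obtain ⟨b, g, h⟩ := u
    obtain ⟨b', g', h'⟩ := v
    obtain rfl : b = b' := congrArg GroupAction.PrestackHom.base e
    obtain rfl : g = g' := congrArg GroupAction.PrestackHom.g e
    rfl⟩
  have h1 : (I ⋙ stdFunctor Q d).Full := inferInstance
  have h2 : (I ⋙ stdFunctor Q d).Faithful := inferInstance
  refine ⟨F, rfl, Rep.isStackInGroupoids_jacobi d W P hP, rfl,
    inferInstanceAs (P.lift (I ⋙ stdFunctor Q d) _).Full,
    inferInstanceAs (P.lift (I ⋙ stdFunctor Q d) _).Faithful,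
    fun x => ?_⟩
  refine EtaleCovers.of_away (A := x.obj.A) fun p => ?_
  obtain ⟨f, hf, φ, u, hu⟩ := x.obj.exists_std_away p
  refine ⟨f, hf, ⟨awayAlg f, ⟨φ, Rep.Hom.relations u ((hP' _).1 x.property)⟩⟩,
    ObjectProperty.homMk u, (isHomLift_ι _).2 (Rep.isHomLift_of_base_eq u _ hu)⟩

end Quotient

end QuiverCrit
end

/-! ### The algebra representing isomorphisms of families -/

noncomputable section

namespace QuiverCrit

set_option linter.style.haveILetI false

open scoped TensorProduct

section Polynomial

variable {σ A A' B : Type} [CommRing A] [CommRing A'] [CommRing B] [Algebra ℂ A] [Algebra ℂ A']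
  [Algebra ℂ B]

theorem exists_polynomial_lift (a : A →ₐ[ℂ] B) (b : A' →ₐ[ℂ] B) (val : σ → B) :
    ∃ e : MvPolynomial σ (A ⊗[ℂ] A') →ₐ[ℂ] B, (∀ r, e (MvPolynomial.C (r ⊗ₜ 1)) = a r) ∧
      (∀ r, e (MvPolynomial.C (1 ⊗ₜ r)) = b r) ∧ ∀ s, e (MvPolynomial.X s) = val s := by
  let t : A ⊗[ℂ] A' →ₐ[ℂ] B := Algebra.TensorProduct.lift a b fun _ _ => Commute.all _ _
  have ht : ∀ r r', t (r ⊗ₜ r') = a r * b r' := fun r r' =>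
    Algebra.TensorProduct.lift_tmul _ _ _ _ _
  have hc : ∀ z, MvPolynomial.eval₂Hom t.toRingHom val
      (algebraMap ℂ (MvPolynomial σ (A ⊗[ℂ] A')) z) = algebraMap ℂ B z := fun z => by
    rw [IsScalarTower.algebraMap_apply ℂ (A ⊗[ℂ] A'), MvPolynomial.algebraMap_eq,
      MvPolynomial.eval₂Hom_C]
    exact t.commutes z
  refine ⟨{ toRingHom := MvPolynomial.eval₂Hom t.toRingHom val, commutes' := hc },
    fun r => ?_, fun r => ?_, fun s => ?_⟩
  · exact (MvPolynomial.eval₂Hom_C t.toRingHom val _).trans ((ht r 1).trans (by simp))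
  · exact (MvPolynomial.eval₂Hom_C t.toRingHom val _).trans ((ht 1 r).trans (by simp))
  · exact MvPolynomial.eval₂Hom_X' t.toRingHom val s

theorem polynomial_hom_ext {e e' : MvPolynomial σ (A ⊗[ℂ] A') →ₐ[ℂ] B}
    (h1 : ∀ r, e (MvPolynomial.C (r ⊗ₜ 1)) = e' (MvPolynomial.C (r ⊗ₜ 1)))
    (h2 : ∀ r, e (MvPolynomial.C (1 ⊗ₜ r)) = e' (MvPolynomial.C (1 ⊗ₜ r)))
    (h3 : ∀ s, e (MvPolynomial.X s) = e' (MvPolynomial.X s)) : e = e' := by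
  refine AlgHom.coe_ringHom_injective (MvPolynomial.ringHom_ext (fun t => ?_) h3)
  induction t using TensorProduct.induction_on with
  | zero => simp
  | add a b ha hb => rw [map_add, map_add, map_add, ha, hb]
  | tmul b a =>
    have : (b ⊗ₜ[ℂ] a : A ⊗[ℂ] A') = (b ⊗ₜ[ℂ] (1 : A')) * ((1 : A) ⊗ₜ[ℂ] a) := by simp
    rw [this, map_mul, map_mul, map_mul]
    exact congrArg₂ (· * ·) (h1 b) (h2 a)

/-- Polynomial algebras over the tensor product of two algebras, by their universal property. -/
theorem exists_polynomialAlgebra (σ : Type) [Finite σ] (A A' : CommAlgCat.{0} ℂ) :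
    ∃ (S : CommAlgCat.{0} ℂ) (f : A ⟶ S) (g : A' ⟶ S) (X : σ → S),
      (∀ (B : CommAlgCat.{0} ℂ) (f' : A ⟶ B) (g' : A' ⟶ B) (val : σ → B),
        ∃ h : S ⟶ B, f ≫ h = f' ∧ g ≫ h = g' ∧ ∀ s, h.hom (X s) = val s) ∧
      (∀ (B : CommAlgCat.{0} ℂ) (h h' : S ⟶ B), f ≫ h = f ≫ h' → g ≫ h = g ≫ h' →
        (∀ s, h.hom (X s) = h'.hom (X s)) → h = h') ∧
      (Algebra.FinitePresentation ℂ A' → f.hom.toRingHom.FinitePresentation) := by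
  refine ⟨CommAlgCat.of ℂ (MvPolynomial σ (A ⊗[ℂ] A')),
    CommAlgCat.ofHom ((IsScalarTower.toAlgHom ℂ (A ⊗[ℂ] A') _).comp
      Algebra.TensorProduct.includeLeft),
    CommAlgCat.ofHom ((IsScalarTower.toAlgHom ℂ (A ⊗[ℂ] A') _).comp
      Algebra.TensorProduct.includeRight), MvPolynomial.X, fun B f' g' val => ?_,
      fun B h h' h1 h2 h3 => ?_, fun hfp => ?_⟩
  · obtain ⟨e, e1, e2, e3⟩ := exists_polynomial_lift f'.hom g'.hom val
    exact ⟨CommAlgCat.ofHom e, CommAlgCat.hom_ext (AlgHom.ext e1),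
      CommAlgCat.hom_ext (AlgHom.ext e2), e3⟩
  · exact CommAlgCat.hom_ext (polynomial_hom_ext
      (fun r => congrArg (fun k : A ⟶ B => k.hom r) h1)
      (fun r => congrArg (fun k : A' ⟶ B => k.hom r) h2) h3)
  · have : Algebra.FinitePresentation A (MvPolynomial σ (A ⊗[ℂ] A')) :=
      Algebra.FinitePresentation.trans A (A ⊗[ℂ] A') _
    exact RingHom.finitePresentation_algebraMap.2 this

end Polynomial

/-! ### The scheme of isomorphisms between two families -/

namespace RepFam

variable {Q : FinQuiver} {d : Q.V → ℕ} {A : Type} [CommRing A] (x : RepFam Q d A)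

/-- The projectors to the vertices and the arrows, as endomorphisms of the total space. -/
def opEnd : Q.V ⊕ Q.E → Module.End A x.Total := Sum.elim x.vertexEnd x.arrowEnd

end RepFam

namespace Rep

variable {Q : FinQuiver} {d : Q.V → ℕ} {x y : Rep Q d}

theorem Hom.total_opEnd (u : Hom x y) (s : Q.V ⊕ Q.E) (m : x.fam.Total) :
    u.total (x.fam.opEnd s m) = y.fam.opEnd s (u.total m) := by
  rcases s with i | a
  · exact u.total_single i _
  · change u.total (Pi.single _ _) = Pi.single _ _
    rw [u.total_single]
    exact congrArg _ (u.map_φ a _)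

variable (β : DualBasis x.A x.fam.Total) (β' : DualBasis y.A y.fam.Total)

/-- The matrix of an endomorphism of the total space with respect to a dual basis. -/
abbrev mat {A M : Type} [CommRing A] [AddCommGroup M] [Module A M] (β : DualBasis A M)
    (T : Module.End A M) : Matrix (Fin β.n) (Fin β.n) A := RepFam.dualMat β.e β.ε T

/-- The equations on a pair of matrices expressing that they are mutually inverse isomorphisms
between the base changes of two families. -/
def isoRel {B : Type} [CommRing B] (f : x.A →+* B) (g : y.A →+* B)
    (P : Matrix (Fin β'.n) (Fin β.n) B) (R : Matrix (Fin β.n) (Fin β'.n) B) :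
    (Fin β'.n × Fin β.n) ⊕ (Fin β.n × Fin β'.n) ⊕ (Fin β.n × Fin β.n) ⊕ (Fin β'.n × Fin β'.n) ⊕
      ((Q.V ⊕ Q.E) × Fin β'.n × Fin β.n) → B
  | Sum.inl k => (P * (mat β 1).map f - P) k.1 k.2
  | Sum.inr (Sum.inl k) => (R * (mat β' 1).map g - R) k.1 k.2
  | Sum.inr (Sum.inr (Sum.inl k)) => (R * P - (mat β 1).map f) k.1 k.2
  | Sum.inr (Sum.inr (Sum.inr (Sum.inl k))) => (P * R - (mat β' 1).map g) k.1 k.2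
  | Sum.inr (Sum.inr (Sum.inr (Sum.inr k))) =>
    (P * (mat β (x.fam.opEnd k.1)).map f - (mat β' (y.fam.opEnd k.1)).map g * P) k.2.1 k.2.2

theorem map_isoRel {B B' : Type} [CommRing B] [CommRing B'] (h : B →+* B') (f : x.A →+* B)
    (g : y.A →+* B) (P : Matrix (Fin β'.n) (Fin β.n) B) (R : Matrix (Fin β.n) (Fin β'.n) B) (k) :
    h (isoRel β β' f g P R k) = isoRel β β' (h.comp f) (h.comp g) (P.map h) (R.map h) k := by
  rcases k with k | k | k | k | k <;>
    simp [isoRel, Matrix.mul_apply, map_sum]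

/-- The pair of matrices defines mutually inverse isomorphisms. -/
def IsIsoPair {B : Type} [CommRing B] (f : x.A →+* B) (g : y.A →+* B)
    (P : Matrix (Fin β'.n) (Fin β.n) B) (R : Matrix (Fin β.n) (Fin β'.n) B) : Prop :=
  ∀ k, isoRel β β' f g P R k = 0

section

variable {β β'} {B : Type} [CommRing B] {f : x.A →+* B} {g : y.A →+* B}
  {P : Matrix (Fin β'.n) (Fin β.n) B} {R : Matrix (Fin β.n) (Fin β'.n) B}

theorem isIsoPair_iff : IsIsoPair β β' f g P R ↔ P * (mat β 1).map f = P ∧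
    R * (mat β' 1).map g = R ∧ R * P = (mat β 1).map f ∧ P * R = (mat β' 1).map g ∧
      ∀ s, P * (mat β (x.fam.opEnd s)).map f = (mat β' (y.fam.opEnd s)).map g * P := by
  constructor
  · intro h
    refine ⟨?_, ?_, ?_, ?_, fun s => ?_⟩ <;> ext q p <;> refine sub_eq_zero.1 ?_
    · exact h (Sum.inl (q, p))
    · exact h (Sum.inr (Sum.inl (q, p)))
    · exact h (Sum.inr (Sum.inr (Sum.inl (q, p))))
    · exact h (Sum.inr (Sum.inr (Sum.inr (Sum.inl (q, p)))))
    · exact h (Sum.inr (Sum.inr (Sum.inr (Sum.inr (s, q, p)))))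
  · rintro ⟨h1, h2, h3, h4, h5⟩ (k | k | k | k | k)
    · simp [isoRel, h1]
    · simp [isoRel, h2]
    · simp [isoRel, h3]
    · simp [isoRel, h4]
    · simp [isoRel, h5]

/-- The matrices of the identity in the two dual bases act as two-sided units for matrices
normalised by the first two equations, so this is the usual uniqueness of an inverse. -/
theorem IsIsoPair.eq_right {R' : Matrix (Fin β.n) (Fin β'.n) B} (h : IsIsoPair β β' f g P R)
    (h' : IsIsoPair β β' f g P R') : R = R' := by
  obtain ⟨-, h2, h3, h4, -⟩ := isIsoPair_iff.1 h
  obtain ⟨-, h2', h3', h4', -⟩ := isIsoPair_iff.1 h'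
  rw [← h2, ← h4', ← Matrix.mul_assoc, h3, ← h3', Matrix.mul_assoc, h4', h2']

end

/-- The algebra representing isomorphisms between the base changes of two families. -/
theorem exists_isoAlgebra : ∃ (C : CommAlgCat.{0} ℂ) (f : x.A ⟶ C) (g : y.A ⟶ C)
    (P : Matrix (Fin β'.n) (Fin β.n) C) (R : Matrix (Fin β.n) (Fin β'.n) C),
    IsIsoPair β β' f.hom.toRingHom g.hom.toRingHom P R ∧
    (∀ (B : CommAlgCat.{0} ℂ) (f' : x.A ⟶ B) (g' : y.A ⟶ B) (P' : Matrix (Fin β'.n) (Fin β.n) B)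
      (R' : Matrix (Fin β.n) (Fin β'.n) B),
      IsIsoPair β β' f'.hom.toRingHom g'.hom.toRingHom P' R' →
      ∃ h : C ⟶ B, f ≫ h = f' ∧ g ≫ h = g' ∧ P.map h.hom = P' ∧ R.map h.hom = R') ∧
    (∀ (B : CommAlgCat.{0} ℂ) (h h' : C ⟶ B), f ≫ h = f ≫ h' → g ≫ h = g ≫ h' →
      P.map h.hom = P.map h'.hom → R.map h.hom = R.map h'.hom → h = h') ∧
    (Algebra.FinitePresentation ℂ x.A → g.hom.toRingHom.FinitePresentation) := by
  let σ := (Fin β'.n × Fin β.n) ⊕ (Fin β.n × Fin β'.n)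
  obtain ⟨S, jy, jx, X, hS, hext, hfp⟩ := exists_polynomialAlgebra σ y.A x.A
  let P0 : Matrix (Fin β'.n) (Fin β.n) S := Matrix.of fun q p => X (Sum.inl (q, p))
  let R0 : Matrix (Fin β.n) (Fin β'.n) S := Matrix.of fun p q => X (Sum.inr (p, q))
  let I : Ideal S :=
    Ideal.span (Set.range (isoRel β β' jx.hom.toRingHom jy.hom.toRingHom P0 R0))
  let π : S ⟶ CommAlgCat.of ℂ (S ⧸ I) := CommAlgCat.ofHom (Ideal.Quotient.mkₐ ℂ I)
  have h0 : IsIsoPair β β' (π.hom.toRingHom.comp jx.hom.toRingHom)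
      (π.hom.toRingHom.comp jy.hom.toRingHom) (P0.map π.hom.toRingHom) (R0.map π.hom.toRingHom) := by
    intro k
    rw [← map_isoRel β β' π.hom.toRingHom jx.hom.toRingHom jy.hom.toRingHom P0 R0 k]
    exact Ideal.Quotient.eq_zero_iff_mem.2 (Ideal.subset_span ⟨k, rfl⟩)
  refine ⟨CommAlgCat.of ℂ (S ⧸ I), jx ≫ π, jy ≫ π, P0.map π.hom, R0.map π.hom, h0,
    fun B f' g' P' R' hPR => ?_, fun B h h' h1 h2 h3 h4 => ?_, fun hx => ?_⟩
  · obtain ⟨e, ey, ex, e3⟩ := hS B g' f'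
      (Sum.elim (fun k => P' k.1 k.2) fun k => R' k.1 k.2 : σ → B)
    have eP : P0.map e.hom = P' := by
      ext q p
      exact e3 (Sum.inl (q, p))
    have eR : R0.map e.hom = R' := by
      ext q p
      exact e3 (Sum.inr (q, p))
    have hI : ∀ s ∈ I, e.hom s = 0 := by
      intro s hs
      have : I ≤ RingHom.ker e.hom.toRingHom := by
        refine Ideal.span_le.2 ?_
        rintro _ ⟨k, rfl⟩
        refine (map_isoRel β β' e.hom.toRingHom jx.hom.toRingHom jy.hom.toRingHom P0 R0 k).trans ?_
        have h1 : e.hom.toRingHom.comp jx.hom.toRingHom = f'.hom.toRingHom :=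
          congrArg (fun k : x.A ⟶ B => k.hom.toRingHom) ex
        have h2 : e.hom.toRingHom.comp jy.hom.toRingHom = g'.hom.toRingHom :=
          congrArg (fun k : y.A ⟶ B => k.hom.toRingHom) ey
        rw [h1, h2]
        have := hPR k
        rw [← eP, ← eR] at this
        exact this
      exact this hs
    refine ⟨CommAlgCat.ofHom (Ideal.Quotient.liftₐ I e.hom hI), ?_, ?_, ?_, ?_⟩
    · rw [← ex]; rfl
    · rw [← ey]; rfl
    · rw [← eP]; rfl
    · rw [← eR]; rfl
  · have : π ≫ h = π ≫ h' := by
      refine hext B _ _ h2 h1 fun s => ?_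
      rcases s with ⟨q, p⟩ | ⟨p, q⟩
      · exact congrFun (congrFun h3 q) p
      · exact congrFun (congrFun h4 p) q
    ext s
    obtain ⟨s, rfl⟩ := Ideal.Quotient.mk_surjective s
    exact congrArg (fun k : S ⟶ B => k.hom s) this
  · refine RingHom.FinitePresentation.comp (g := π.hom.toRingHom) ?_ (hfp hx)
    refine RingHom.FinitePresentation.of_surjective _ Ideal.Quotient.mk_surjective ?_
    have hk : RingHom.ker π.hom.toRingHom = I := Ideal.mk_ker
    rw [hk]
    exact ⟨(Set.finite_range _).toFinset, by rw [Set.Finite.coe_toFinset]⟩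

end Rep

end QuiverCrit
end

/-! ### Fibre products of affine schemes over the stack -/

noncomputable section

namespace QuiverCrit

namespace Rep

variable {Q : FinQuiver} {d : Q.V → ℕ}

section PairMat

variable {A M : Type} [CommRing A] [AddCommGroup M] [Module A M] {ι κ ν : Type}

/-- The matrix of an endomorphism with respect to a family of vectors and a family of functionals. -/
def pairMat (ε : ι → M →ₗ[A] A) (e : κ → M) (T : Module.End A M) : Matrix ι κ A :=
  Matrix.of fun i k => ε i (T (e k))

theorem pairMat_mul [Fintype κ] {ε : κ → M →ₗ[A] A} {e : κ → M}
    (h : ∀ m, ∑ k, ε k m • e k = m) (ε' : ι → M →ₗ[A] A) (e' : ν → M) (S T : Module.End A M) :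
    pairMat ε' e S * pairMat ε e' T = pairMat ε' e' (S * T) := by
  ext p q
  rw [Matrix.mul_apply]
  change ∑ k, ε' p (S (e k)) * ε k (T (e' q)) = ε' p (S (T (e' q)))
  conv_rhs => rw [← h (T (e' q)), map_sum, map_sum]
  simp only [map_smul, smul_eq_mul, mul_comm]

end PairMat

variable {x y : Rep Q d}

/-- The total map as an additive map. -/
def Hom.totalHom (u : Hom x y) : x.fam.Total →+ y.fam.Total := ⟨⟨u.total, u.total_zero⟩, u.total_add⟩

theorem Hom.total_sum (u : Hom x y) {ι : Type} (s : Finset ι) (r : ι → x.A) (m : ι → x.fam.Total) :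
    u.total (∑ k ∈ s, r k • m k) = ∑ k ∈ s, u.base.hom (r k) • u.total (m k) := by
  refine (map_sum u.totalHom _ _).trans (Finset.sum_congr rfl fun k _ => u.total_smul _ _)

theorem Hom.map_mat (u : Hom x y) (β : DualBasis x.A x.fam.Total)
    {ε : Fin β.n → y.fam.Total →ₗ[y.A] y.A} (hε : ∀ k m, ε k (u.total m) = u.base.hom (β.ε k m))
    {S : Module.End x.A x.fam.Total}
    {T : Module.End y.A y.fam.Total} (h : ∀ m, u.total (S m) = T (u.total m)) :
    (mat β S).map u.base.hom.toRingHom = pairMat ε (fun k => u.total (β.e k)) T := by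
  ext p q
  change u.base.hom (β.ε p (S (β.e q))) = ε p (T (u.total (β.e q)))
  rw [← h, hε]

variable (β : DualBasis x.A x.fam.Total) (β' : DualBasis y.A y.fam.Total)

/-- Both base changes are identified with the common target `w`. The two matrices express the images
of the generators of each family in terms of the generators of the other. -/
theorem isIsoPair_of_hom {w : Rep Q d} (a : Hom x w) (b : Hom y w)
    {ε : Fin β.n → w.fam.Total →ₗ[w.A] w.A} (hε : ∀ k m, ε k (a.total m) = a.base.hom (β.ε k m))
    (h1 : ∀ m, ∑ k, ε k m • a.total (β.e k) = m)
    {ε' : Fin β'.n → w.fam.Total →ₗ[w.A] w.A}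
    (hε' : ∀ k m, ε' k (b.total m) = b.base.hom (β'.ε k m))
    (h2 : ∀ m, ∑ k, ε' k m • b.total (β'.e k) = m) :
    IsIsoPair β β' a.base.hom.toRingHom b.base.hom.toRingHom
      (pairMat ε' (fun k => a.total (β.e k)) 1)
      (pairMat ε (fun k => b.total (β'.e k)) 1) := by
  have ha : (mat β 1).map a.base.hom.toRingHom = _ :=
    a.map_mat β hε (S := 1) (T := 1) fun _ => rfl
  have hb : (mat β' 1).map b.base.hom.toRingHom = _ :=
    b.map_mat β' hε' (S := 1) (T := 1) fun _ => rfl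
  refine isIsoPair_iff.2 ⟨?_, ?_, ?_, ?_, fun s => ?_⟩
  · rw [ha, pairMat_mul h1, mul_one]
  · rw [hb, pairMat_mul h2, mul_one]
  · rw [ha, pairMat_mul h2, mul_one]
  · rw [hb, pairMat_mul h1, mul_one]
  · rw [a.map_mat β hε (a.total_opEnd s), b.map_mat β' hε' (b.total_opEnd s), pairMat_mul h1,
      pairMat_mul h2, one_mul, mul_one]

section

variable {β β'} {z : Rep Q d} {f : x.A ⟶ z.A} {b : y ⟶ z}
  {P : Matrix (Fin β'.n) (Fin β.n) z.A} {R : Matrix (Fin β.n) (Fin β'.n) z.A}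
  (h : IsIsoPair β β' f.hom.toRingHom b.base.hom.toRingHom P R)

/-- The vector of coefficients of an element of the total space. -/
def coeffs (β : DualBasis x.A x.fam.Total) (f : x.A ⟶ z.A) (m : x.fam.Total) : Fin β.n → z.A :=
  fun p => f.hom (β.ε p m)

theorem coeffs_end (T : Module.End x.A x.fam.Total) (m : x.fam.Total) :
    coeffs β f (T m) = ((mat β T).map f.hom.toRingHom).mulVec (coeffs β f m) := by
  funext p
  change f.hom (β.ε p (T m)) = ∑ r, f.hom (β.ε p (T (β.e r))) * f.hom (β.ε r m)
  conv_lhs => rw [← β.sum_eq m, map_sum, map_sum, map_sum]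
  refine Finset.sum_congr rfl fun r _ => ?_
  rw [map_smul, map_smul, smul_eq_mul, map_mul, mul_comm]

theorem coeffs_e (p : Fin β.n) :
    coeffs β f (β.e p) = ((mat β 1).map f.hom.toRingHom).mulVec (Pi.single p 1) := by
  funext q
  rw [Matrix.mulVec_single_one]
  rfl

variable (β' b) in
/-- The combination of the images of the generators with given coefficients. -/
def vec : (Fin β'.n → z.A) →ₗ[z.A] z.fam.Total :=
  Fintype.linearCombination z.A fun q => b.total (β'.e q)

theorem vec_apply (w : Fin β'.n → z.A) :
    vec β' b w = ∑ q, w q • b.total (β'.e q) := rfl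

theorem vec_end {T : Module.End y.A y.fam.Total} {T' : Module.End z.A z.fam.Total}
    (hT : ∀ m, b.total (T m) = T' (b.total m)) (w : Fin β'.n → z.A) :
    T' (vec β' b w) = vec β' b (((mat β' T).map b.base.hom.toRingHom).mulVec w) := by
  have h1 : ∀ q, T' (b.total (β'.e q)) =
      ∑ q', b.base.hom (β'.ε q' (T (β'.e q))) •
        b.total (β'.e q') := fun q => by
    rw [← hT, ← β'.sum_eq (T (β'.e q)), Hom.total_sum]
    rw [β'.sum_eq]
  rw [vec_apply, vec_apply]
  refine (map_sum T' _ _).trans ?_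
  have h2 : ∀ q, T' (w q • b.total (β'.e q)) =
      ∑ q', (w q * b.base.hom (β'.ε q' (T (β'.e q)))) •
        b.total (β'.e q') := fun q => by
    refine (T'.map_smul (w q) _).trans ?_
    rw [h1, Finset.smul_sum]
    exact Finset.sum_congr rfl fun q' _ => smul_smul _ _ _
  refine (Finset.sum_congr rfl fun q _ => h2 q).trans ?_
  rw [Finset.sum_comm]
  refine Finset.sum_congr rfl fun q' _ => ?_
  rw [← Finset.sum_smul]
  congr 1
  change _ = ∑ q, b.base.hom (β'.ε q' (T (β'.e q))) * w q
  exact Finset.sum_congr rfl fun q _ => mul_comm _ _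

theorem vec_unit (w : Fin β'.n → z.A) :
    vec β' b (((mat β' 1).map b.base.hom.toRingHom).mulVec w) = vec β' b w :=
  (vec_end (T := 1) (T' := 1) (fun _ => rfl) w).symm

variable (β f β' b P) in
/-- The map between total spaces given by a matrix. -/
def isoTotal : x.fam.Total →+ z.fam.Total where
  toFun m := vec β' b (P.mulVec (coeffs β f m))
  map_zero' := by
    have : coeffs β f 0 = 0 := by funext p; simp [coeffs]
    rw [this, Matrix.mulVec_zero, map_zero]
  map_add' m n := by
    have : coeffs β f (m + n) = coeffs β f m + coeffs β f n := by funext p; simp [coeffs]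
    rw [this, Matrix.mulVec_add, map_add]

include h

theorem isoTotal_opEnd (s : Q.V ⊕ Q.E) (m : x.fam.Total) :
    isoTotal β β' f b P (x.fam.opEnd s m) =
      z.fam.opEnd s (isoTotal β β' f b P m) := by
  obtain ⟨h1, h2, h3, h4, h5⟩ := isIsoPair_iff.1 h
  change vec β' b (P.mulVec (coeffs β f (x.fam.opEnd s m))) =
    z.fam.opEnd s (vec β' b (P.mulVec (coeffs β f m)))
  refine Eq.trans ?_ (vec_end (T := y.fam.opEnd s) (T' := z.fam.opEnd s)
    (b.total_opEnd s) _).symm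
  rw [coeffs_end, Matrix.mulVec_mulVec, h5, ← Matrix.mulVec_mulVec]

theorem isoTotal_e (p : Fin β.n) :
    isoTotal β β' f b P (β.e p) = vec β' b (P.mulVec (Pi.single p 1)) := by
  obtain ⟨h1, h2, h3, h4, h5⟩ := isIsoPair_iff.1 h
  change vec β' b (P.mulVec (coeffs β f (β.e p))) = _
  rw [coeffs_e, Matrix.mulVec_mulVec, h1]

/-- Commuting with the vertex projectors makes the total map block diagonal, so it splits into
components, and commuting with the arrows makes these a morphism. The inverse matrix `R` enters only
through the spanning condition. -/
theorem exists_isoHom : ∃ a : x ⟶ z, a.base = f ∧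
    ∀ m, a.total m = isoTotal β β' f b P m := by
  obtain ⟨h1, h2, h3, h4, h5⟩ := isIsoPair_iff.1 h
  let t := isoTotal β β' f b P
  let mp : ∀ i, x.fam.U i →+ z.fam.U i := fun i =>
    { toFun := fun m => t (Pi.single i m) i
      map_zero' := by rw [Pi.single_zero, map_zero]; rfl
      map_add' := fun m n => by rw [Pi.single_add, map_add]; rfl }
  have hs : ∀ i m, t (Pi.single i m) = Pi.single i (mp i m) := fun i m => by
    have := isoTotal_opEnd h (Sum.inl i) (Pi.single i m)
    have e : x.fam.opEnd (Sum.inl i) (Pi.single i m) = Pi.single i m := by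
      change x.fam.vertexEnd i _ = _
      rw [RepFam.vertexEnd_apply, Pi.single_eq_same]
    rw [e] at this
    exact this
  have ht : ∀ m i, t m i = mp i (m i) := fun m i => by
    conv_lhs => rw [← Finset.univ_sum_single m, map_sum]
    rw [Finset.sum_apply, Finset.sum_eq_single i]
    · rfl
    · intro k _ hk
      rw [hs, Pi.single_eq_of_ne hk.symm]
    · simp
  have hsm : ∀ (r : x.A) m, t (r • m) = f.hom r • t m := fun r m => by
    have : coeffs β f (r • m) = f.hom r • coeffs β f m := by funext p; simp [coeffs]
    change vec β' b (P.mulVec (coeffs β f (r • m))) = _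
    rw [this, Matrix.mulVec_smul]
    exact (vec β' b).map_smul (f.hom r) _
  refine ⟨{ base := f
            map := mp
            map_smul := fun i r m => ?_
            map_φ := fun a m => ?_
            span_range := fun i => ?_ }, rfl, fun m => funext fun i => (ht m i).symm⟩
  · change t (Pi.single i (r • m)) i = _
    rw [Pi.single_smul, hsm]
    rfl
  · have := isoTotal_opEnd h (Sum.inr a) (Pi.single (Q.tail a) m)
    have e : x.fam.opEnd (Sum.inr a) (Pi.single (Q.tail a) m) =
        Pi.single (Q.head a) (x.fam.φ a m) := by
      change x.fam.arrowEnd a _ = _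
      rw [RepFam.arrowEnd_apply, Pi.single_eq_same]
    rw [e] at this
    have e2 : isoTotal β β' f b P (Pi.single (Q.tail a) m) = _ := hs (Q.tail a) m
    rw [e2] at this
    have e3 := congrFun this (Q.head a)
    refine e3.trans ?_
    change (Pi.single (Q.head a) (z.fam.φ a _) : z.fam.Total) (Q.head a) = _
    rw [Pi.single_eq_same]
    congr 1
    exact Pi.single_eq_same _ _
  · let N : Submodule z.A z.fam.Total :=
      Submodule.pi Set.univ fun i => Submodule.span z.A (Set.range (mp i))
    have hN : N = ⊤ := by
      refine b.total_range N fun m => ?_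
      have e1 : ∀ p, t (β.e p) ∈ N := fun p i _ =>
        Submodule.subset_span ⟨β.e p i, (ht _ i).symm⟩
      have e2 : ∀ q, b.total (β'.e q) ∈ N := fun q => by
        have e3 : b.total (β'.e q) = vec β' b (Pi.single q 1) := by
          rw [vec_apply, Finset.sum_eq_single q]
          · rw [Pi.single_eq_same]; exact (one_smul z.A _).symm
          · intro k _ hk
            rw [Pi.single_eq_of_ne hk]
            exact zero_smul z.A _
          · simp
        -- Writing the unit as `P R` expresses the image of a generator of `y` through images of
        -- generators of `x`.
        rw [e3, ← vec_unit, ← h4, ← Matrix.mulVec_mulVec, pi_eq_sum_univ' (R.mulVec _),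
          Matrix.mulVec_sum, map_sum]
        refine N.sum_mem fun p _ => ?_
        rw [Matrix.mulVec_smul]
        have e4 : t (β.e p) = _ := isoTotal_e h p
        refine (congrArg (· ∈ N) (LinearMap.map_smul (vec β' b) _ _)).mpr (N.smul_mem _ ?_)
        exact e4 ▸ e1 p
      rw [← β'.sum_eq m, Hom.total_sum]
      exact N.sum_mem fun q _ => N.smul_mem _ (e2 q)
    rw [eq_top_iff]
    intro n _
    have : (Pi.single i n : z.fam.Total) ∈ N := by rw [hN]; trivial
    have := this i trivial
    rwa [Pi.single_eq_same] at this

end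

/-- Arrows from `x` and `y` to `w` give an iso pair over the base of `w`, hence a base map by
`hlift`; cocartesianness of `b` turns it into an arrow out of `z`. For uniqueness, the image of `P`
is read off from the coordinates of the images of the `β.e p`, the image of `R` is then forced, and
`hext` shows that the base maps agree. -/
theorem isFibreProduct_of_isIsoPair {z : Rep Q d} {f : x.A ⟶ z.A} {b : y ⟶ z}
    {P : Matrix (Fin β'.n) (Fin β.n) z.A} {R : Matrix (Fin β.n) (Fin β'.n) z.A}
    (hPR : IsIsoPair β β' f.hom.toRingHom b.base.hom.toRingHom P R)
    (hlift : ∀ (B : CommAlgCat.{0} ℂ) (f' : x.A ⟶ B) (g' : y.A ⟶ B)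
      (P' : Matrix (Fin β'.n) (Fin β.n) B) (R' : Matrix (Fin β.n) (Fin β'.n) B),
      IsIsoPair β β' f'.hom.toRingHom g'.hom.toRingHom P' R' →
      ∃ h : z.A ⟶ B, f ≫ h = f' ∧ b.base ≫ h = g' ∧ P.map h.hom = P' ∧ R.map h.hom = R')
    (hext : ∀ (B : CommAlgCat.{0} ℂ) (h h' : z.A ⟶ B), f ≫ h = f ≫ h' →
      b.base ≫ h = b.base ≫ h' → P.map h.hom = P.map h'.hom → R.map h.hom = R.map h'.hom → h = h')
    {a : x ⟶ z} (ha : a.base = f) (hat : ∀ m, a.total m = isoTotal β β' f b P m) :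
    IsFibreProduct a b := by
  obtain ⟨h1, h2, h3, h4, -⟩ := isIsoPair_iff.1 hPR
  intro w a' b'
  obtain ⟨ε, hε, hεs⟩ := a'.exists_dualBasis β
  obtain ⟨ε', hε', hεs'⟩ := b'.exists_dualBasis β'
  have hpair := isIsoPair_of_hom β β' a' b' hε hεs hε' hεs'
  have hsum : ∀ (c : z ⟶ w), b ≫ c = b' → ∀ v : Fin β'.n → z.A,
      c.total (vec β' b v) = ∑ q, c.base.hom (v q) • b'.total (β'.e q) := by
    intro c hc v
    rw [vec_apply, Hom.total_sum, ← hc]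
    rfl
  have hvec : ∀ c : z ⟶ w, b ≫ c = b' → ∀ m,
      (a ≫ c).total m = ∑ q, c.base.hom (P.mulVec (coeffs β f m) q) • b'.total (β'.e q) := by
    intro c hc m
    change c.total (a.total m) = _
    rw [hat]
    exact hsum c hc _
  obtain ⟨k, hk1, hk2, hk3, hk4⟩ := hlift w.A a'.base b'.base _ _ hpair
  obtain ⟨c, hc1, hc2⟩ := b.exists_fac b' k hk2
  have hac : a ≫ c = a' := by
    refine Hom.ext ?_ (funext fun i => AddMonoidHom.ext fun m => ?_)
    · change a.base ≫ c.base = a'.base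
      rw [ha, hc1]
      exact hk1
    have e : (a ≫ c).total (Pi.single i m) = a'.total (Pi.single i m) := by
      rw [hvec c hc2, ← hεs' (a'.total (Pi.single i m))]
      refine Finset.sum_congr rfl fun q _ => ?_
      congr 1
      rw [hc1]
      have e1 : k.hom (P.mulVec (coeffs β f (Pi.single i m)) q) =
          ∑ p, k.hom (P q p) * k.hom (f.hom (β.ε p (Pi.single i m))) := by
        rw [Matrix.mulVec, dotProduct, map_sum]
        exact Finset.sum_congr rfl fun p _ => map_mul _ _ _
      rw [e1, ← β.sum_eq (Pi.single i m), a'.total_sum, map_sum, β.sum_eq]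
      refine Finset.sum_congr rfl fun p _ => ?_
      rw [LinearMap.map_smul, smul_eq_mul, mul_comm]
      congr 1
      · exact congrArg (fun l : x.A ⟶ w.A => l.hom (β.ε p (Pi.single i m))) hk1
      · exact congrFun (congrFun hk3 q) p
    rw [Hom.total_single, Hom.total_single] at e
    exact Pi.single_injective i e
  refine ⟨c, ⟨hac, hc2⟩, fun c' hc' => ?_⟩
  have hP : P.map c'.base.hom = P.map c.base.hom := by
    have hEP : (mat β' 1).map b.base.hom.toRingHom * P = P := by
      rw [← h4, Matrix.mul_assoc, h3, h1]
    have key : ∀ c : z ⟶ w, b ≫ c = b' → a ≫ c = a' → ∀ q p,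
        c.base.hom (P q p) = ε' q (a'.total (β.e p)) := by
      intro c hcb hca q p
      have e1 : a'.total (β.e p) = ∑ q', c.base.hom (P q' p) • b'.total (β'.e q') := by
        rw [← hca]
        change c.total (a.total (β.e p)) = _
        rw [hat, isoTotal_e hPR, hsum c hcb]
        refine Finset.sum_congr rfl fun q' _ => ?_
        rw [Matrix.mulVec_single_one]
        rfl
      rw [e1, map_sum]
      conv_lhs => rw [← hEP, Matrix.mul_apply]
      rw [map_sum]
      refine Finset.sum_congr rfl fun q' _ => ?_
      rw [LinearMap.map_smul, smul_eq_mul, map_mul, mul_comm, hε']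
      congr 1
      rw [← hcb]
      rfl
    ext q p
    exact (key c' hc'.2 hc'.1 q p).trans (key c hc2 hac q p).symm
  refine b.cancel ?_ (hc'.2.trans hc2.symm)
  have hb1 : f ≫ c'.base = f ≫ c.base := by
    rw [← ha]
    exact congrArg Hom.base (hc'.1.trans hac.symm)
  have hb2 : b.base ≫ c'.base = b.base ≫ c.base := congrArg Hom.base (hc'.2.trans hc2.symm)
  refine hext _ _ _ hb1 hb2 hP ?_
  have r1 : IsIsoPair β β' (c.base.hom.toRingHom.comp f.hom.toRingHom)
      (c.base.hom.toRingHom.comp b.base.hom.toRingHom) (P.map c.base.hom.toRingHom)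
      (R.map c.base.hom.toRingHom) := fun k => by
    rw [← map_isoRel, hPR k, map_zero]
  have r2 : IsIsoPair β β' (c'.base.hom.toRingHom.comp f.hom.toRingHom)
      (c'.base.hom.toRingHom.comp b.base.hom.toRingHom) (P.map c'.base.hom.toRingHom)
      (R.map c'.base.hom.toRingHom) := fun k => by
    rw [← map_isoRel, hPR k, map_zero]
  have eb1 : c'.base.hom.toRingHom.comp f.hom.toRingHom =
      c.base.hom.toRingHom.comp f.hom.toRingHom :=
    congrArg (fun l : x.A ⟶ w.A => l.hom.toRingHom) hb1
  have eb2 : c'.base.hom.toRingHom.comp b.base.hom.toRingHom =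
      c.base.hom.toRingHom.comp b.base.hom.toRingHom :=
    congrArg (fun l : y.A ⟶ w.A => l.hom.toRingHom) hb2
  have hP' : P.map c'.base.hom.toRingHom = P.map c.base.hom.toRingHom := hP
  rw [eb1, eb2, hP'] at r2
  exact r2.eq_right r1

/-- The fibre product of two affine schemes over the stack of families of representations. -/
theorem exists_isFibreProduct (x y : Rep Q d) : ∃ (z : Rep Q d) (a : x ⟶ z) (b : y ⟶ z),
    IsFibreProduct a b ∧
      (Algebra.FinitePresentation ℂ x.A → b.base.hom.toRingHom.FinitePresentation) := by
  obtain ⟨β⟩ := DualBasis.nonempty x.A x.fam.Total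
  obtain ⟨β'⟩ := DualBasis.nonempty y.A y.fam.Total
  obtain ⟨C, f, g, P, R, hPR, hlift, hext, hfp⟩ := exists_isoAlgebra β β'
  obtain ⟨a, ha, hat⟩ := exists_isoHom (z := y.push g) (f := f) (b := y.toPush g) (P := P) (R := R)
    hPR
  exact ⟨y.push g, a, y.toPush g, isFibreProduct_of_isIsoPair (z := y.push g) (f := f)
    (b := y.toPush g) (P := P) (R := R) β β' hPR hlift hext ha hat, hfp⟩

end Rep

end QuiverCrit
end

noncomputable section

namespace QuiverCrit

set_option linter.style.haveILetI false

/-! ### The tautological family over the affine space of representations -/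

section Universal

variable (Q : FinQuiver) (d : Q.V → ℕ)

/-- Coordinates on the space of representations: the entries of the matrices. -/
abbrev Coord : Type := Σ a : Q.E, Fin (d (Q.head a)) × Fin (d (Q.tail a))

/-- The coordinate ring of the space of representations. -/
def repAlg : CommAlgCat.{0} ℂ := CommAlgCat.of ℂ (MvPolynomial (Coord Q d) ℂ)

/-- The tautological point of the space of representations. -/
def univRep : RepSpace Q d (repAlg Q d) := fun a => Matrix.of fun l k =>
  (MvPolynomial.X ⟨a, l, k⟩ : MvPolynomial (Coord Q d) ℂ)

variable {Q d}

theorem exists_eval {B : CommAlgCat.{0} ℂ} (φ : RepSpace Q d B) :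
    ∃ h : repAlg Q d ⟶ B, RepSpace.map h.hom.toRingHom (univRep Q d) = φ := by
  refine ⟨CommAlgCat.ofHom (MvPolynomial.aeval fun s : Coord Q d => φ s.1 s.2.1 s.2.2), ?_⟩
  funext a
  ext l k
  exact MvPolynomial.aeval_X _ (⟨a, l, k⟩ : Coord Q d)

theorem eval_ext {B : CommAlgCat.{0} ℂ} {h h' : repAlg Q d ⟶ B}
    (e : RepSpace.map h.hom.toRingHom (univRep Q d) = RepSpace.map h'.hom.toRingHom (univRep Q d)) :
    h = h' :=
  CommAlgCat.hom_ext (MvPolynomial.algHom_ext fun s =>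
    congrFun (congrFun (congrFun e s.1) s.2.1) s.2.2)

variable (Q d) in
theorem smooth_repAlg : Algebra.Smooth ℂ (repAlg Q d) :=
  (⟨inferInstance, inferInstance⟩ : Algebra.Smooth ℂ (MvPolynomial (Coord Q d) ℂ))

end Universal

namespace Rep

variable {Q : FinQuiver} {d : Q.V → ℕ}

/-! ### Morphisms from tautological families -/

section Frame

variable {A : CommAlgCat.{0} ℂ} {φ : RepSpace Q d A} {w : Rep Q d}

/-- The frame of the target of a morphism from a tautological family. -/
def frame (c : (⟨A, φ.std⟩ : Rep Q d) ⟶ w) (i : Q.V) (k : Fin (d i)) : w.fam.U i :=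
  c.map i (Pi.single k 1 : Fin (d i) → A)

theorem map_eq_sum_frame (c : (⟨A, φ.std⟩ : Rep Q d) ⟶ w) (i : Q.V) (m : Fin (d i) → A) :
    c.map i m = ∑ k, c.base.hom (m k) • frame c i k := by
  have e : c.map i m = c.map i (∑ k, m k • (Pi.single k 1 : Fin (d i) → A)) :=
    congrArg (c.map i) (pi_eq_sum_univ' m)
  rw [e]
  exact (map_sum (c.map i) _ _).trans (Finset.sum_congr rfl fun k _ => c.map_smul i _ _)

theorem span_frame (c : (⟨A, φ.std⟩ : Rep Q d) ⟶ w) (i : Q.V) :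
    Submodule.span w.A (Set.range (frame c i)) = ⊤ := by
  rw [eq_top_iff, ← c.span_range i, Submodule.span_le]
  rintro _ ⟨m, rfl⟩
  have e : c.map i m = _ := map_eq_sum_frame c i m
  rw [SetLike.mem_coe, e]
  exact Submodule.sum_mem _ fun k _ => Submodule.smul_mem _ _ (Submodule.subset_span ⟨k, rfl⟩)

theorem φ_frame (c : (⟨A, φ.std⟩ : Rep Q d) ⟶ w) (a : Q.E) (k : Fin (d (Q.tail a))) :
    w.fam.φ a (frame c (Q.tail a) k) =
      ∑ l, c.base.hom (φ a l k) • frame c (Q.head a) l := by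
  refine (c.map_φ a (Pi.single k 1 : Fin (d (Q.tail a)) → A)).symm.trans ?_
  refine (map_eq_sum_frame c (Q.head a) ((φ a).mulVec (Pi.single k 1))).trans ?_
  rw [Matrix.mulVec_single_one]
  rfl

/-- A spanning family with as many vectors as the rank is linearly independent. -/
theorem eq_of_sum_smul_eq {i : Q.V} {m : Fin (d i) → w.fam.U i}
    (hm : Submodule.span w.A (Set.range m) = ⊤) {r r' : Fin (d i) → w.A}
    (h : ∑ k, r k • m k = ∑ k, r' k • m k) : r = r' := by
  have hs : Function.Surjective (Fintype.linearCombination w.A m) := by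
    rw [← LinearMap.range_eq_top, Fintype.range_linearCombination, hm]
  refine (Module.bijective_of_surjective_of_rankAtStalk_eq hs fun p hp => ?_).1 h
  rw [w.fam.rank]
  exact (RepSpace.std (d := d) (Q := Q) (A := w.A) (fun _ => 0)).rank i _

theorem hom_eq_of_frame {c c' : (⟨A, φ.std⟩ : Rep Q d) ⟶ w} (hb : c.base = c'.base)
    (h : frame c = frame c') : c = c' := by
  refine Hom.ext hb (funext fun i => AddMonoidHom.ext fun m => ?_)
  refine (map_eq_sum_frame c i m).trans (Eq.trans ?_ (map_eq_sum_frame c' i m).symm)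
  rw [h, hb]

/-- Expressing the arrows in a frame determines their matrix entries, because a spanning family of
the right size is independent. -/
theorem map_base_eq_of_frame {c c' : (⟨A, φ.std⟩ : Rep Q d) ⟶ w} (h : frame c = frame c') :
    RepSpace.map c.base.hom.toRingHom φ = RepSpace.map c'.base.hom.toRingHom φ := by
  funext a
  ext l k
  have := (φ_frame c a k).symm.trans
    ((congrArg (fun f => w.fam.φ a (f (Q.tail a) k)) h).trans (φ_frame c' a k))
  rw [← h] at this
  exact congrFun (eq_of_sum_smul_eq (span_frame c (Q.head a)) this) l

end Frame

variable (Q d) in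
/-- The tautological family over the affine space of representations. -/
def univ : Rep Q d := ⟨repAlg Q d, (univRep Q d).std⟩

/-- Together with `univ_hom_ext` this says that morphisms out of the tautological family are the
same as frames: a frame determines the matrices of the arrows, and these determine the map from the
polynomial ring. -/
theorem exists_univ_hom {w : Rep Q d} {m : ∀ i, Fin (d i) → w.fam.U i}
    (hm : ∀ i, Submodule.span w.A (Set.range (m i)) = ⊤) :
    ∃ c : univ Q d ⟶ w, ∀ i k, frame c i k = m i k := by
  obtain ⟨φ, c, hc, hcm⟩ := exists_std_hom w m hm
  obtain ⟨h, hh⟩ := exists_eval φ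
  have hh' : (1 : GLProd Q d w.A) • RepSpace.map h.hom.toRingHom (univRep Q d) = φ := by
    rw [one_smul, hh]
  let e : univ Q d ⟶ ⟨w.A, φ.std⟩ := stdHom h 1 hh'
  refine ⟨e ≫ c, fun i k => ?_⟩
  have e1 : e.map i (Pi.single k 1 : Fin (d i) → repAlg Q d) = (Pi.single k 1 : Fin (d i) → w.A) := by
    refine (stdHom_map h 1 hh' i _).trans ?_
    rw [hom_single]
    exact Matrix.one_mulVec _
  change c.map i (e.map i (Pi.single k 1 : Fin (d i) → repAlg Q d)) = _
  rw [e1]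
  refine (hcm i _).trans ?_
  rw [Finset.sum_eq_single k]
  · rw [Pi.single_eq_same, one_smul]
  · intro l _ hl
    rw [Pi.single_eq_of_ne hl, zero_smul]
  · simp

theorem univ_hom_ext {w : Rep Q d} {c c' : univ Q d ⟶ w} (h : frame c = frame c') : c = c' :=
  hom_eq_of_frame (eval_ext (map_base_eq_of_frame h)) h

theorem frame_comp {A : CommAlgCat.{0} ℂ} {φ : RepSpace Q d A} {w w' : Rep Q d}
    (c : (⟨A, φ.std⟩ : Rep Q d) ⟶ w) (e : w ⟶ w') (i : Q.V) (k : Fin (d i)) :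
    frame (c ≫ e) i k = e.map i (frame c i k) := rfl

theorem exists_univ_hom_of_free (w : Rep Q d) [∀ i, Module.Free w.A (w.fam.U i)] :
    Nonempty (univ Q d ⟶ w) := by
  choose m hm using fun i => exists_frame_of_free w i
  exact ⟨(exists_univ_hom hm).choose⟩

/-! ### Lifting frames -/

section Lift

variable {x y : Rep Q d} (u : x ⟶ y) (hu : Function.Surjective u.base.hom)

include hu in
theorem Hom.map_surjective (i : Q.V) : Function.Surjective (u.map i) := by
  intro n
  have hn : n ∈ Submodule.span y.A (Set.range (u.map i)) := by rw [u.span_range i]; trivial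
  induction hn using Submodule.span_induction with
  | mem n hn => exact hn
  | zero => exact ⟨0, map_zero _⟩
  | add a b _ _ ha hb =>
    obtain ⟨a, rfl⟩ := ha
    obtain ⟨b, rfl⟩ := hb
    exact ⟨a + b, map_add _ _ _⟩
  | smul r a _ ha =>
    obtain ⟨a, rfl⟩ := ha
    obtain ⟨r, rfl⟩ := hu r
    exact ⟨r • a, u.map_smul i r a⟩

/-- The coefficients of `m` in a dual basis have images equal to the coefficients of its image,
which vanish. This provides the hypothesis of Nakayama's lemma for lifting frames. -/
theorem Hom.mem_ker_smul {i : Q.V} {m : x.fam.U i} (h : u.map i m = 0) :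
    m ∈ RingHom.ker u.base.hom.toRingHom • (⊤ : Submodule x.A (x.fam.U i)) := by
  obtain ⟨β⟩ := DualBasis.nonempty x.A x.fam.Total
  obtain ⟨ε, hε, -⟩ := Hom.exists_dualBasis u β
  have e : m = ∑ k, β.ε k (Pi.single i m) • β.e k i := by
    have := congrFun (β.sum_eq (Pi.single i m)) i
    rw [Pi.single_eq_same] at this
    conv_lhs => rw [← this]
    rw [Finset.sum_apply]
    rfl
  rw [e]
  refine Submodule.sum_mem _ fun k _ => Submodule.smul_mem_smul ?_ trivial
  change u.base.hom (β.ε k (Pi.single i m)) = 0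
  rw [← hε, Hom.total_single, h, Pi.single_zero, map_zero]

include hu in
/-- Along a nilpotent thickening, lifts of generators are generators. -/
theorem Hom.span_of_span_map (hn : IsNilpotent (RingHom.ker u.base.hom.toRingHom)) {i : Q.V}
    {n : ℕ} {m : Fin n → x.fam.U i}
    (h : Submodule.span y.A (Set.range fun k => u.map i (m k)) = ⊤) :
    Submodule.span x.A (Set.range m) = ⊤ := by
  rw [eq_top_iff]
  refine Submodule.le_of_le_smul_of_le_jacobson_bot (I := RingHom.ker u.base.hom.toRingHom)
    Module.Finite.fg_top ?_ fun v _ => ?_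
  · obtain ⟨k, hk⟩ := hn
    intro r hr
    have := Ideal.pow_mem_pow hr k
    rw [hk] at this
    have hr' : IsNilpotent r := ⟨k, this⟩
    exact Ideal.mem_jacobson_bot.2 fun s => (Commute.isNilpotent_mul_right (Commute.all r s) hr').isUnit_add_one
  · have hv : u.map i v ∈ Submodule.span y.A (Set.range fun k => u.map i (m k)) := by
      rw [h]; trivial
    obtain ⟨r, hr⟩ := (Submodule.mem_span_range_iff_exists_fun _).1 hv
    choose s hs using fun k => hu (r k)
    have e : v = (∑ k, s k • m k) + (v - ∑ k, s k • m k) := by abel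
    rw [e]
    refine Submodule.add_mem_sup (Submodule.sum_mem _ fun k _ => Submodule.smul_mem _ _
      (Submodule.subset_span ⟨k, rfl⟩)) (u.mem_ker_smul ?_)
    rw [map_sub, map_sum, sub_eq_zero, ← hr]
    refine Finset.sum_congr rfl fun k _ => ?_
    rw [u.map_smul, hs]

end Lift

/-! ### The atlas -/

/-- A map out of the fibre product with the tautological family is a frame together with a map from
`y`. Vectors lift through the surjection, and over a nilpotent kernel lifts of a frame are a frame
by Nakayama's lemma, so maps lift. -/
theorem exists_lift_of_isFibreProduct {y z w w' : Rep Q d} {a : univ Q d ⟶ z} {b : y ⟶ z}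
    (h : IsFibreProduct a b) (v : y ⟶ w) (p : w ⟶ w') (hp : Function.Surjective p.base.hom)
    (hn : IsNilpotent (RingHom.ker p.base.hom.toRingHom)) (c₁ : z ⟶ w') (hbc : b ≫ c₁ = v ≫ p) :
    ∃ c : z ⟶ w, b ≫ c = v ∧ c ≫ p = c₁ := by
  choose m hm using fun i k => Hom.map_surjective p hp i (frame (a ≫ c₁) i k)
  have hspan : ∀ i, Submodule.span w.A (Set.range (m i)) = ⊤ := fun i => by
    refine Hom.span_of_span_map p hp hn ?_
    simp only [hm]
    exact span_frame (a ≫ c₁) i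
  obtain ⟨u', hu'⟩ := exists_univ_hom hspan
  obtain ⟨c, ⟨hc1, hc2⟩, -⟩ := h w u' v
  obtain ⟨_, -, huniq⟩ := h w' (a ≫ c₁) (v ≫ p)
  refine ⟨c, hc2, (huniq _ ⟨?_, ?_⟩).trans (huniq _ ⟨rfl, hbc⟩).symm⟩
  · rw [← Category.assoc, hc1]
    refine univ_hom_ext (funext fun i => funext fun k => ?_)
    refine (frame_comp u' p i k).trans ?_
    rw [hu', hm]
    rfl
  · rw [← Category.assoc, hc2]

/-- A lifting problem for algebras over a square-zero quotient `C → C ⧸ I` becomes one for arrows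
out of `z`, by base changing `y` to both algebras. -/
theorem formallySmooth_of_isFibreProduct {y z : Rep Q d} {a : univ Q d ⟶ z} {b : y ⟶ z}
    (h : IsFibreProduct a b) : b.base.hom.toRingHom.FormallySmooth := by
  letI := b.base.hom.toRingHom.toAlgebra
  refine Algebra.FormallySmooth.of_comp_surjective fun C _ _ I hI f => ?_
  letI : Algebra ℂ C := ((algebraMap y.A C).comp (algebraMap ℂ y.A)).toAlgebra
  let g : y.A ⟶ CommAlgCat.of ℂ C :=
    CommAlgCat.ofHom { algebraMap y.A C with commutes' := fun _ => rfl }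
  let π : (y.push g).A ⟶ CommAlgCat.of ℂ (C ⧸ I) := CommAlgCat.ofHom (Ideal.Quotient.mkₐ ℂ I)
  let q : z.A ⟶ CommAlgCat.of ℂ (C ⧸ I) := CommAlgCat.ofHom
    { f.toRingHom with
      commutes' := fun r => by
        have e : algebraMap ℂ z.A r = algebraMap y.A z.A (algebraMap ℂ y.A r) :=
          (b.base.hom.commutes r).symm
        change f (algebraMap ℂ z.A r) = _
        rw [e, f.commutes]
        rfl }
  have hq : b.base ≫ q = g ≫ π := by
    ext r
    exact f.commutes r
  let p : y.push g ⟶ (y.push g).push π := (y.push g).toPush π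
  obtain ⟨c₁, hc₁, hbc₁⟩ := Hom.exists_fac b (z := (y.push g).push π) (y.toPush g ≫ p) q hq
  have hker : RingHom.ker p.base.hom.toRingHom ^ 2 = ⊥ :=
    (congrArg (fun J : Ideal C => J ^ 2) (Ideal.mk_ker (I := I))).trans hI
  obtain ⟨c, hc2, key⟩ := exists_lift_of_isFibreProduct h (y.toPush g) p
    (Ideal.Quotient.mk_surjective (I := I)) ⟨2, hker⟩ c₁ hbc₁
  refine ⟨{ c.base.hom.toRingHom with commutes' := fun r => ?_ }, AlgHom.ext fun r => ?_⟩
  · exact congrArg (fun l : y ⟶ y.push g => l.base.hom r) hc2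
  · have e1 := congrArg (fun l : z ⟶ (y.push g).push π => l.base.hom r) key
    have e2 : c₁.base.hom r = q.hom r := congrArg (fun l => l.hom r) hc₁
    exact e1.trans e2

variable (Q d)

theorem isSmoothChart_univ : IsSmoothChart (proj Q d) (univ Q d) := fun y => by
  obtain ⟨z, a, b, h, hfp⟩ := exists_isFibreProduct (univ Q d) y
  have := smooth_repAlg Q d
  exact ⟨z, a, b, h, RingHom.smooth_def.2 ⟨formallySmooth_of_isFibreProduct h,
    hfp (Algebra.Smooth.finitePresentation (R := ℂ) (A := repAlg Q d))⟩⟩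

/-- Over the residue field of a prime of `y` the family is free and so has a frame. This frame
defines a point of the fibre product above the prime. -/
theorem isSurjectiveChart_univ : IsSurjectiveChart (proj Q d) (univ Q d) := by
  intro (y : Rep Q d) (z : Rep Q d) (a : univ Q d ⟶ z) (b : y ⟶ z) h (p : PrimeSpectrum y.A)
  letI : Algebra ℂ p.asIdeal.ResidueField :=
    ((algebraMap y.A p.asIdeal.ResidueField).comp (algebraMap ℂ y.A)).toAlgebra
  let K : CommAlgCat.{0} ℂ := CommAlgCat.of ℂ p.asIdeal.ResidueField
  let g : y.A ⟶ K :=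
    CommAlgCat.ofHom { algebraMap y.A p.asIdeal.ResidueField with commutes' := fun _ => rfl }
  have hK : IsField (y.push g).A := Field.toIsField p.asIdeal.ResidueField
  letI := hK.toField
  obtain ⟨u'⟩ := exists_univ_hom_of_free (y.push g)
  obtain ⟨c, ⟨-, hc2⟩, -⟩ := h _ u' (y.toPush g)
  let P' : PrimeSpectrum (y.push g).A := ⟨⊥, Ideal.isPrime_bot⟩
  refine ⟨PrimeSpectrum.comap c.base.hom.toRingHom P', ?_⟩
  have e : c.base.hom.toRingHom.comp b.base.hom.toRingHom = algebraMap y.A p.asIdeal.ResidueField :=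
    congrArg (fun l : y ⟶ y.push g => l.base.hom.toRingHom) hc2
  refine (PrimeSpectrum.comap_comp_apply b.base.hom.toRingHom c.base.hom.toRingHom P').symm.trans ?_
  refine PrimeSpectrum.ext ?_
  change Ideal.comap (c.base.hom.toRingHom.comp b.base.hom.toRingHom) ⊥ = _
  rw [e]
  exact Ideal.ker_algebraMap_residueField p.asIdeal

theorem isSmoothAlgebraicStack : IsSmoothAlgebraicStack (proj Q d) where
  stack := isStackInGroupoids Q d
  diagonal x y := by
    obtain ⟨z, a, b, h, -⟩ := exists_isFibreProduct x y
    exact ⟨z, a, b, h⟩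
  atlas := ⟨univ Q d, isSmoothChart_univ Q d, isSurjectiveChart_univ Q d, smooth_repAlg Q d⟩

end Rep

end QuiverCrit
end

/-! ### Matrix entries of the relations, and the critical locus on the stack -/

noncomputable section

namespace QuiverCrit

namespace RepFam

open FinQuiver

variable {Q : FinQuiver} {d : Q.V → ℕ} {A : Type} [CommRing A] [Algebra ℂ A] (x : RepFam Q d A)

theorem vertexEnd_mul_act_loop (a : Q.E) (c : Q.Loop) :
    x.vertexEnd (Q.tail a) * x.act (c.cyclicDeriv a) = x.act (c.cyclicDeriv a) ∧
      x.act (c.cyclicDeriv a) * x.vertexEnd (Q.head a) = x.act (c.cyclicDeriv a) := by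
  classical
  rcases c with i | ⟨c, hc⟩
  · have e0 : Loop.cyclicDeriv a (Sum.inl i : Q.Loop) = 0 := rfl
    rw [e0, act_zero, mul_zero, zero_mul]
    exact ⟨rfl, rfl⟩
  · induction c using Quotient.inductionOn with | _ l =>
    have hl : l ≠ [] := fun h0 => hc.1 (by subst h0; rfl)
    have key : ∀ i : Fin l.length,
        x.vertexEnd (Q.tail a) * x.act (if l.get i = a then
            PathAlgebra.ofWord (Q.head a) (l.drop (i + 1) ++ l.take i) else 0) =
          x.act (if l.get i = a then
            PathAlgebra.ofWord (Q.head a) (l.drop (i + 1) ++ l.take i) else 0) ∧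
        x.act (if l.get i = a then
            PathAlgebra.ofWord (Q.head a) (l.drop (i + 1) ++ l.take i) else 0) *
            x.vertexEnd (Q.head a) = x.act (if l.get i = a then
            PathAlgebra.ofWord (Q.head a) (l.drop (i + 1) ++ l.take i) else 0) := fun i => by
      split_ifs with hi
      · have h3 : ((l.get i :: (l.drop (i + 1) ++ l.take i) : List Q.E) : Cycle Q.E) = l := by
          rw [Cycle.coe_eq_coe]
          refine List.IsRotated.symm ⟨i, ?_⟩
          rw [List.rotate_eq_drop_append_take i.2.le, List.drop_eq_getElem_cons i.2]
          rfl
        have h4 := composable_of_cycle_chain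
          (h3 ▸ hc.2 : Cycle.Chain (fun a b => Q.head a = Q.tail b)
            ((l.get i :: (l.drop (i + 1) ++ l.take i) : List Q.E) : Cycle Q.E))
        rw [hi] at h4
        rw [act_ofWord, mul_assoc, vertexEnd_mul_self]
        refine ⟨?_, rfl⟩
        conv_lhs => rw [h4.2]
        exact x.vertexEnd_mul_wordEnd _ h4.1
      · rw [act_zero, mul_zero, zero_mul]
        exact ⟨rfl, rfl⟩
    have e : x.act (Loop.cyclicDeriv a (Sum.inr ⟨(l : Cycle Q.E), hc⟩ : Q.Loop)) = _ :=
      (congrArg x.act (Loop.cyclicDeriv_inr a l hl hc)).trans (x.act_sum _ _)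
    refine ⟨(congrArg (x.vertexEnd (Q.tail a) * ·) e).trans (Eq.trans ?_ e.symm),
      (congrArg (· * x.vertexEnd (Q.head a)) e).trans (Eq.trans ?_ e.symm)⟩
    · rw [Finset.mul_sum]
      exact Finset.sum_congr rfl fun i _ => (key i).1
    · rw [Finset.sum_mul]
      exact Finset.sum_congr rfl fun i _ => (key i).2

/-- The cyclic derivative along an arrow consists of paths from its head to its tail. -/
theorem vertexEnd_mul_act_mul_vertexEnd (a : Q.E) (W : Q.Potential) :
    x.vertexEnd (Q.tail a) * x.act (cyclicDeriv a W) * x.vertexEnd (Q.head a) =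
      x.act (cyclicDeriv a W) := by
  have e : x.act (cyclicDeriv a W) =
      ∑ c ∈ W.support, algebraMap ℂ A (W c) • x.act (c.cyclicDeriv a) := by
    rw [cyclicDeriv, Finsupp.sum, act_sum]
    exact Finset.sum_congr rfl fun c _ => x.act_smul _ _
  rw [e, Finset.mul_sum, Finset.sum_mul]
  refine Finset.sum_congr rfl fun c _ => ?_
  rw [mul_smul_comm, smul_mul_assoc, (x.vertexEnd_mul_act_loop a c).1,
    (x.vertexEnd_mul_act_loop a c).2]

end RepFam

namespace RepSpace

open FinQuiver

variable {Q : FinQuiver} {d : Q.V → ℕ} {A : Type} [CommRing A]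

/-- The standard basis of the total space of a tautological family. -/
def stdE (φ : RepSpace Q d A) (p : Σ i, Fin (d i)) : φ.std.Total :=
  Pi.single p.1 (Pi.single p.2 1 : Fin (d p.1) → A)

/-- The coordinates of the total space of a tautological family. -/
def stdε (φ : RepSpace Q d A) (p : Σ i, Fin (d i)) : φ.std.Total →ₗ[A] A where
  toFun m := (m p.1 : Fin (d p.1) → A) p.2
  map_add' _ _ := rfl
  map_smul' _ _ := rfl

theorem std_sum (φ : RepSpace Q d A) (m : φ.std.Total) : ∑ p, φ.stdε p m • φ.stdE p = m := by
  rw [Fintype.sum_sigma]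
  conv_rhs => rw [← Finset.univ_sum_single m]
  refine Finset.sum_congr rfl fun i _ => ?_
  have e : (m i : Fin (d i) → A) = ∑ k, (m i : Fin (d i) → A) k • (Pi.single k 1 : Fin (d i) → A) :=
    pi_eq_sum_univ' _
  refine Eq.trans ?_ (congrArg (Pi.single (M := φ.std.U) i) e.symm)
  refine Eq.trans ?_ (map_sum (AddMonoidHom.single φ.std.U i) _ _).symm
  exact Finset.sum_congr rfl fun k _ => (Pi.single_smul i _ _).symm

theorem stdE_same (φ : RepSpace Q d A) (i : Q.V) (k : Fin (d i)) :
    φ.stdE ⟨i, k⟩ i = (Pi.single k 1 : Fin (d i) → A) :=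
  Pi.single_eq_same (M := φ.std.U) i (Pi.single k 1 : Fin (d i) → A)

theorem stdE_of_ne (φ : RepSpace Q d A) {i i' : Q.V} (h : i' ≠ i) (k : Fin (d i)) :
    φ.stdE ⟨i, k⟩ i' = 0 :=
  Pi.single_eq_of_ne (M := φ.std.U) h (Pi.single k 1 : Fin (d i) → A)

theorem arrowEnd_stdE_same (φ : RepSpace Q d A) (a : Q.E) (l : Fin (d (Q.head a)))
    (k : Fin (d (Q.tail a))) :
    φ.stdε ⟨Q.head a, l⟩ (φ.std.arrowEnd a (φ.stdE ⟨Q.tail a, k⟩)) = φ a l k := by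
  have e1 : φ.std.arrowEnd a (φ.stdE ⟨Q.tail a, k⟩) (Q.head a) =
      (φ a).mulVec (φ.stdE ⟨Q.tail a, k⟩ (Q.tail a)) :=
    Pi.single_eq_same (M := φ.std.U) (Q.head a) _
  have e2 : (φ a).mulVec (φ.stdE ⟨Q.tail a, k⟩ (Q.tail a)) = (φ a).col k :=
    (congrArg (φ a).mulVec (φ.stdE_same _ k)).trans (Matrix.mulVec_single_one _ _)
  exact congrFun (e1.trans e2) l

theorem arrowEnd_stdE_of_ne_head (φ : RepSpace Q d A) (a : Q.E) {i : Q.V} (h : i ≠ Q.head a)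
    (l : Fin (d i)) (p : Σ i, Fin (d i)) : φ.stdε ⟨i, l⟩ (φ.std.arrowEnd a (φ.stdE p)) = 0 := by
  have e1 : φ.std.arrowEnd a (φ.stdE p) i = 0 := Pi.single_eq_of_ne (M := φ.std.U) h _
  exact congrFun e1 l

theorem arrowEnd_stdE_of_ne_tail (φ : RepSpace Q d A) (a : Q.E) {i : Q.V} (h : i ≠ Q.tail a)
    (k : Fin (d i)) : φ.std.arrowEnd a (φ.stdE ⟨i, k⟩) = 0 := by
  rw [RepFam.arrowEnd_apply, φ.stdE_of_ne h.symm, map_zero, Pi.single_zero]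

/-- An entry of the cyclic derivative of a potential. -/
def entry [Algebra ℂ A] (φ : RepSpace Q d A) (W : Q.Potential) (a : Q.E)
    (k : Fin (d (Q.tail a))) (l : Fin (d (Q.head a))) : A :=
  φ.stdε ⟨Q.tail a, k⟩ (φ.std.act (cyclicDeriv a W) (φ.stdE ⟨Q.head a, l⟩))

/-- The cyclic derivative along `a` consists of paths from the head of `a` to its tail, so only the
corresponding block of its matrix can be nonzero. -/
theorem relations_iff_entry [Algebra ℂ A] (φ : RepSpace Q d A) (W : Q.Potential) :
    φ.std.Relations W ↔ ∀ a k l, φ.entry W a k l = 0 := by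
  constructor
  · intro h a k l
    rw [entry, h a]
    rfl
  · intro h a
    have e := φ.std.vertexEnd_mul_act_mul_vertexEnd a W
    refine LinearMap.ext fun m => ?_
    rw [← φ.std_sum m, map_sum]
    refine (Finset.sum_eq_zero fun q _ => ?_).trans (LinearMap.zero_apply _).symm
    rw [_root_.map_smul]
    have h0 : φ.std.act (cyclicDeriv a W) (φ.stdE q) = 0 := by
      obtain ⟨i, l⟩ := q
      by_cases hi : Q.head a = i
      · subst hi
        funext i'
        by_cases hi' : i' = Q.tail a
        · subst hi'
          exact funext fun k => h a k l
        · rw [← e, Module.End.mul_apply, Module.End.mul_apply, RepFam.vertexEnd_apply,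
            Pi.single_eq_of_ne hi']
          rfl
      · rw [← e, Module.End.mul_apply, RepFam.vertexEnd_apply, φ.stdE_of_ne hi,
          Pi.single_zero, map_zero]
    rw [h0, smul_zero]

/-- The derivative of the trace of a potential on a tautological family. -/
theorem derivation_trW [Algebra ℂ A] {B : Type} [CommRing B] {ρ : A →+* B} {D : A →+ B}
    (hD : IsDerivationOver ρ D) (hD0 : ∀ z, D (algebraMap ℂ A z) = 0) (φ : RepSpace Q d A)
    (W : Q.Potential) :
    D (φ.std.trW W) = ∑ a, ∑ k, ∑ l, ρ (φ.entry W a k l) * D (φ a l k) := by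
  rw [φ.std.derivation_trW φ.std_sum hD hD0 W]
  refine Finset.sum_congr rfl fun a _ => ?_
  simp only [Matrix.trace, Matrix.diag_apply, Matrix.mul_apply]
  rw [Fintype.sum_sigma, Finset.sum_eq_single (Q.tail a)]
  · refine Finset.sum_congr rfl fun k _ => ?_
    rw [Fintype.sum_sigma, Finset.sum_eq_single (Q.head a)]
    · refine Finset.sum_congr rfl fun l _ => congrArg₂ (· * ·) rfl ?_
      exact congrArg D (φ.arrowEnd_stdE_same a l k)
    · intro i _ hi
      refine Finset.sum_eq_zero fun l _ => mul_eq_zero_of_right _ ?_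
      exact (congrArg D (φ.arrowEnd_stdE_of_ne_head a hi l _)).trans (map_zero D)
    · simp
  · intro i _ hi
    refine Finset.sum_eq_zero fun k _ => Finset.sum_eq_zero fun q _ => mul_eq_zero_of_right _ ?_
    exact (congrArg D ((congrArg (φ.stdε q) (φ.arrowEnd_stdE_of_ne_tail a hi k)).trans
      (map_zero _))).trans (map_zero D)
  · simp

theorem map_entry {A B : CommAlgCat.{0} ℂ} (f : A ⟶ B) (φ : RepSpace Q d A) (W : Q.Potential)
    (a : Q.E) (k : Fin (d (Q.tail a))) (l : Fin (d (Q.head a))) :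
    f.hom (φ.entry W a k l) = (RepSpace.map f.hom.toRingHom φ).entry W a k l := by
  let c : Rep.Hom (⟨A, φ.std⟩ : Rep Q d) ⟨B, (RepSpace.map f.hom.toRingHom φ).std⟩ :=
    stdHom f 1 (one_smul _ _)
  have hc : ∀ i (m : Fin (d i) → A), c.map i m = fun k => f.hom (m k) := fun i m =>
    (stdHom_map f 1 (one_smul _ _) i m).trans (Matrix.one_mulVec _)
  have h1 : c.total (φ.stdE ⟨Q.head a, l⟩) =
      (RepSpace.map f.hom.toRingHom φ).stdE ⟨Q.head a, l⟩ := by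
    refine (c.total_single _ _).trans (congrArg _ ?_)
    exact (hc _ _).trans (hom_single f l)
  have h2 := c.total_act (cyclicDeriv a W) (φ.stdE ⟨Q.head a, l⟩)
  rw [h1] at h2
  have h3 := congrFun (congrFun h2 (Q.tail a) : _ = (_ : Fin (d (Q.tail a)) → B)) k
  refine Eq.trans ?_ h3
  exact (congrFun (hc _ _) k).symm

end RepSpace

theorem sum_mul_coord_single {Q : FinQuiver} {d : Q.V → ℕ} {A : Type} [CommRing A]
    (F : ∀ a : Q.E, Fin (d (Q.tail a)) → Fin (d (Q.head a)) → A) (a : Q.E)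
    (k : Fin (d (Q.tail a))) (l : Fin (d (Q.head a))) [DecidableEq (Coord Q d)] :
    ∑ a', ∑ k', ∑ l', F a' k' l' * (if (⟨a', l', k'⟩ : Coord Q d) = ⟨a, l, k⟩ then 1 else 0) =
      F a k l := by
  rw [Finset.sum_eq_single a, Finset.sum_eq_single k, Finset.sum_eq_single l, if_pos rfl, mul_one]
  · intro l' _ hl
    rw [if_neg, mul_zero]
    intro h
    simp at h
    exact hl h
  · simp
  · intro k' _ hk
    refine Finset.sum_eq_zero fun l' _ => ?_
    rw [if_neg, mul_zero]
    intro h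
    simp at h
    exact hk h.2
  · simp
  · intro a' _ ha
    refine Finset.sum_eq_zero fun k' _ => Finset.sum_eq_zero fun l' _ => ?_
    rw [if_neg, mul_zero]
    intro h
    exact ha (congrArg Sigma.fst h)
  · simp

/-! ### The critical locus of the trace of the potential on the stack -/

namespace Rep

variable {Q : FinQuiver} {d : Q.V → ℕ}

/-- The trace of the potential as a regular function on the stack of families. -/
def trFunction (d : Q.V → ℕ) (W : Q.Potential) : RegularFunction (proj Q d) where
  val x := x.fam.trW W
  map_val u := Hom.base_trW u W

/-- Derivations kill the trace of the potential on families satisfying the relations. -/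
theorem derivation_trW_eq_zero {u w : Rep Q d} (b : u ⟶ w) {W : Q.Potential}
    (hw : w.fam.Relations W) (D : Derivation ℂ u.A u.A) : b.base.hom (D (u.fam.trW W)) = 0 := by
  obtain ⟨β⟩ := DualBasis.nonempty u.A u.fam.Total
  obtain ⟨ε, hε, -⟩ := Hom.exists_dualBasis b β
  let D' : u.A →+ w.A := b.base.hom.toRingHom.toAddMonoidHom.comp D.toLinearMap.toAddMonoidHom
  have hD : IsDerivationOver b.base.hom.toRingHom D' := ⟨fun r s => by
    change b.base.hom (D (r * s)) = b.base.hom r * b.base.hom (D s) + b.base.hom (D r) * b.base.hom s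
    rw [D.leibniz, smul_eq_mul, smul_eq_mul, map_add, map_mul, map_mul]
    ring⟩
  refine (u.fam.derivation_trW β.sum_eq hD (fun z => ?_) W).trans (Finset.sum_eq_zero fun a _ => ?_)
  · change b.base.hom (D (algebraMap ℂ u.A z)) = 0
    rw [D.map_algebraMap, map_zero]
  · have : (RepFam.dualMat β.e β.ε (u.fam.act (FinQuiver.cyclicDeriv a W))).map
        b.base.hom.toRingHom = 0 := by
      ext p q
      change b.base.hom (β.ε p (u.fam.act _ (β.e q))) = 0
      rw [← hε, Hom.total_act, hw a, LinearMap.zero_apply, map_zero]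
    rw [this, Matrix.zero_mul, Matrix.trace_zero]

/-- The derivative formula is valid on every smooth chart, since it needs only a dual basis. After
pullback to the fibre product the matrices of the cyclic derivatives vanish. -/
theorem inCriticalLocus_of_relations {x : Rep Q d} {W : Q.Potential} (hx : x.fam.Relations W) :
    InCriticalLocus (trFunction d W) x := by
  intro u _ w a b r hr
  have hw : w.fam.Relations W := Hom.relations a hx
  have hle : criticalIdeal (algebraMap ℂ u.A) (u.fam.trW W) ≤
      RingHom.ker b.base.hom.toRingHom := by
    refine Ideal.span_le.2 ?_
    rintro _ ⟨D, rfl⟩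
    -- The critical ideal rebuilds the algebra structure from its structure map. It equals the given
    -- one only propositionally, so it is generalised and substituted before derivations can be
    -- compared.
    have hI : ∀ (I : Algebra ℂ u.A), I = u.A.algebra →
        ∀ D : @Derivation ℂ u.A u.A _ _ _ I _ I.toModule, b.base.hom (D (u.fam.trW W)) = 0 := by
      rintro _ rfl D
      exact derivation_trW_eq_zero b hw D
    exact hI (algebraMap ℂ u.A).toAlgebra (Algebra.algebra_ext _ _ fun _ => rfl) D
  exact hle hr

theorem derivation_mem_criticalIdeal {A : Type} [CommRing A] [hA : Algebra ℂ A] (D : Derivation ℂ A A)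
    (f : A) : D f ∈ criticalIdeal (algebraMap ℂ A) f := by
  have hI : ∀ (I J : Algebra ℂ A), I = J →
      ∀ D : @Derivation ℂ A A _ _ _ I _ I.toModule,
        D f ∈ Ideal.span (Set.range fun D : @Derivation ℂ A A _ _ _ J _ J.toModule => D f) := by
    rintro _ _ rfl D
    exact Ideal.subset_span ⟨D, rfl⟩
  exact hI hA (algebraMap ℂ A).toAlgebra (Algebra.algebra_ext _ _ fun _ => rfl) D

/-- A partial derivative kills all coordinates but one, so a single term of the derivative formula
survives. The indices are transposed because the trace pairs the matrix of `∂ₐW` with that of `φₐ`.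
-/
theorem pderiv_trW (W : Q.Potential) (a : Q.E) (l : Fin (d (Q.head a))) (k : Fin (d (Q.tail a))) :
    MvPolynomial.pderiv (R := ℂ) (⟨a, l, k⟩ : Coord Q d) ((univRep Q d).std.trW W) =
      (univRep Q d).entry W a k l := by
  classical
  let D : repAlg Q d →+ repAlg Q d :=
    (MvPolynomial.pderiv (R := ℂ) (⟨a, l, k⟩ : Coord Q d)).toLinearMap.toAddMonoidHom
  have hD : IsDerivationOver (RingHom.id (repAlg Q d)) D := ⟨fun r s => by
    refine ((MvPolynomial.pderiv (R := ℂ) (⟨a, l, k⟩ : Coord Q d)).leibniz r s).trans ?_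
    exact congrArg₂ (· + ·) rfl (mul_comm (G := repAlg Q d) s _)⟩
  refine ((univRep Q d).derivation_trW hD (fun z =>
    (MvPolynomial.pderiv (R := ℂ) (⟨a, l, k⟩ : Coord Q d)).map_algebraMap z) W).trans ?_
  have hX : ∀ a' l' k', D (univRep Q d a' l' k') =
      if (⟨a', l', k'⟩ : Coord Q d) = ⟨a, l, k⟩ then 1 else 0 := fun a' l' k' => by
    refine (MvPolynomial.pderiv_X (R := ℂ) (⟨a, l, k⟩ : Coord Q d) ⟨a', l', k'⟩).trans ?_
    rw [Pi.single_apply]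
    rfl
  simp only [hX]
  exact sum_mul_coord_single _ a k l

/-- Zariski-locally the family is pulled back from `N_d`, whose critical ideal contains all entries
of the relations. Testing criticality on this one chart is enough. -/
theorem relations_of_inCriticalLocus {x : Rep Q d} {W : Q.Potential}
    (hx : InCriticalLocus (trFunction d W) x) : x.fam.Relations W := by
  refine relations_of_etaleCovers (EtaleCovers.of_away (A := x.A) fun p => ?_)
  obtain ⟨f, hf, φ, u, hu⟩ := x.exists_std_away p
  refine ⟨f, hf, ⟨awayAlg f, φ.std⟩, u, ?_, isHomLift_of_base_eq u _ hu⟩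
  obtain ⟨h, hh⟩ := exists_eval φ
  let b : univ Q d ⟶ (⟨awayAlg f, φ.std⟩ : Rep Q d) :=
    stdHom h 1 ((one_smul _ _).trans hh)
  rw [RepSpace.relations_iff_entry]
  intro a k l
  have h1 : h.hom ((univRep Q d).entry W a k l) = 0 := by
    rw [← pderiv_trW]
    exact hx (univ Q d) (isSmoothChart_univ Q d) _ u b _
      (derivation_mem_criticalIdeal (A := MvPolynomial (Coord Q d) ℂ) _ _)
  rw [RepSpace.map_entry, hh] at h1
  exact h1

theorem inCriticalLocus_iff (x : Rep Q d) (W : Q.Potential) :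
    InCriticalLocus (trFunction d W) x ↔ x.fam.IsJacobi W := by
  rw [RepFam.isJacobi_iff_relations]
  exact ⟨relations_of_inCriticalLocus, inCriticalLocus_of_relations⟩

/-- The stack of families of representations and the critical locus of the trace of a potential. -/
theorem stack_part (d : Q.V → ℕ) (W : Q.Potential) :
    IsQuotientStack (proj Q d) (repAction Q d) (stdFunctor Q d) ∧
      IsSmoothAlgebraicStack (proj Q d) ∧
      ∃ f : RegularFunction (proj Q d),
        (∀ x : Rep Q d, (∀ i, Module.Free x.A (x.fam.U i)) → f.val x = x.fam.traceW W) ∧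
        (∀ x : Rep Q d, InCriticalLocus f x ↔ x.fam.IsJacobi W) ∧
        (∃ F : (jacobiAction d W).Prestack ⥤
            ObjectProperty.FullSubcategory (fun x : Rep Q d => InCriticalLocus f x),
          F ⋙ ObjectProperty.ι _ =
            (repAction Q d).prestackIncl (InM W) (inM_stable W) ⋙ stdFunctor Q d ∧
          IsQuotientStack (ObjectProperty.ι _ ⋙ proj Q d) (jacobiAction d W) F) :=
  ⟨isQuotientStack_std Q d, isSmoothAlgebraicStack Q d, trFunction d W,
    fun x _ => x.fam.trW_eq_traceW W, fun x => inCriticalLocus_iff x W,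
    isQuotientStack_jacobi W _ fun x => inCriticalLocus_iff x W⟩

end Rep

end QuiverCrit
end

/-! ### Framed families: rigidity and descent -/

noncomputable section

namespace QuiverCrit

variable {Q : FinQuiver} {d : Q.V → ℕ} {j : Q.V}

namespace FramedRep

/-- The underlying family of a framed family. -/
abbrev rep {A : CommAlgCat.{0} ℂ} (x : FramedRep Q d j A) : Rep Q d := ⟨A, x.fam⟩

/-- There is a morphism of framed families over a given algebra map. -/
def Lifts {A B : CommAlgCat.{0} ℂ} (f : A ⟶ B) (x : FramedRep Q d j A) (y : FramedRep Q d j B) :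
    Prop :=
  ∃ u : x.rep ⟶ y.rep, u.base = f ∧ u.map j x.v = y.v

section

variable {A B C : CommAlgCat.{0} ℂ} {f : A ⟶ B} {g : B ⟶ C} {x : FramedRep Q d j A}
  {y : FramedRep Q d j B} {z : FramedRep Q d j C}

/-- Morphisms commute with words and the words applied to the framing vector span everything. This
rigidity makes the framed problem set-valued: local morphisms and local families glue without a
cocycle condition to check. -/
theorem hom_unique {u u' : x.rep ⟶ y.rep} (hb : u.base = u'.base) (hu : u.map j x.v = u'.map j x.v) :
    u = u' := by
  have key : ∀ m, u.total m = u'.total m := by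
    intro m
    have hm : m ∈ Submodule.span A
        (Set.range fun l : List Q.E => x.fam.wordEnd l (Pi.single j x.v)) := by
      rw [show Submodule.span A _ = ⊤ from x.cyclic]; trivial
    induction hm using Submodule.span_induction with
    | mem m hm =>
      obtain ⟨l, rfl⟩ := hm
      rw [u.total_word, u'.total_word, Rep.Hom.total_single, Rep.Hom.total_single, hu]
    | zero => rw [u.total_zero, u'.total_zero]
    | add a b _ _ ha hb => rw [u.total_add, u'.total_add, ha, hb]
    | smul r a _ ha => rw [Rep.Hom.total_smul u r a, Rep.Hom.total_smul u' r a, ha, hb]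
  refine Rep.Hom.ext hb (funext fun i => AddMonoidHom.ext fun m => ?_)
  have := key (Pi.single i m)
  rw [u.total_single, u'.total_single] at this
  exact Pi.single_injective i this

theorem Lifts.refl (x : FramedRep Q d j A) : Lifts (𝟙 A) x x := ⟨𝟙 x.rep, rfl, rfl⟩

theorem Lifts.trans (h : Lifts f x y) (h' : Lifts g y z) : Lifts (f ≫ g) x z := by
  obtain ⟨u, rfl, hu⟩ := h
  obtain ⟨v, rfl, hv⟩ := h'
  refine ⟨u ≫ v, rfl, ?_⟩
  rw [← hv, ← hu]
  rfl

theorem Lifts.cancel (h : Lifts f x y) (h' : Lifts (f ≫ g) x z) : Lifts g y z := by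
  obtain ⟨u, rfl, hu⟩ := h
  obtain ⟨v, hv, hv'⟩ := h'
  obtain ⟨c, hc, hc'⟩ := Rep.Hom.exists_fac u v g hv.symm
  refine ⟨c, hc, ?_⟩
  rw [← hv', ← hc', ← hu]
  rfl

theorem Lifts.cancel' {h : A ⟶ C} (hf : Lifts f x y) (h' : Lifts h x z) (e : f ≫ g = h) :
    Lifts g y z := by
  subst e
  exact hf.cancel h'

theorem Lifts.symm {y : FramedRep Q d j A} (h : Lifts (𝟙 A) x y) : Lifts (𝟙 A) y x :=
  h.cancel' (Lifts.refl x) (Category.id_comp _)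

/-- The push-forward of a framed family. -/
theorem exists_lifts (x : FramedRep Q d j A) (f : A ⟶ B) : ∃ y : FramedRep Q d j B, Lifts f x y :=
  ⟨⟨(x.rep.push f).fam, (x.rep.toPush f).map j x.v, Rep.Hom.isCyclic (x.rep.toPush f) x.cyclic⟩,
    x.rep.toPush f, rfl, rfl⟩

theorem Lifts.existsUnique (h : Lifts f x y) :
    ∃! u : Rep.Hom (⟨A, x.fam⟩ : Rep Q d) ⟨B, y.fam⟩, u.base = f ∧ u.map j x.v = y.v := by
  obtain ⟨u, hu⟩ := h
  exact ⟨u, hu, fun u' hu' => hom_unique (hu'.1.trans hu.1.symm) (hu'.2.trans hu.2.symm)⟩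

theorem Lifts.relations (h : Lifts f x y) {W : Q.Potential} (hx : x.fam.Relations W) :
    y.fam.Relations W := by
  obtain ⟨u, -, -⟩ := h
  exact Rep.Hom.relations u hx

end

theorem _root_.QuiverCrit.EtaleCovers.flatCover {A : CommAlgCat.{0} ℂ} {n : ℕ}
    {B : Fin n → CommAlgCat.{0} ℂ} {g : ∀ k, A ⟶ B k} (hg : ∀ k, (g k).hom.toRingHom.Etale)
    (hs : ∀ P : PrimeSpectrum A, ∃ (k : Fin n) (P' : PrimeSpectrum (B k)),
      PrimeSpectrum.comap (g k).hom.toRingHom P' = P) : FlatCover A B g :=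
  ⟨fun k => (RingHom.Etale.iff_flat_and_formallyUnramified.1 (hg k)).1, hs⟩

/-- Overlaps of framed families over the members of a flat cover. -/
theorem exists_glueData {B : CommAlgCat.{0} ℂ} {n : ℕ} {C : Fin n → CommAlgCat.{0} ℂ}
    {τ : ∀ k, B ⟶ C k} (z : ∀ k, FramedRep Q d j (C k))
    (hz : ∀ k l (P : CommAlgCat.{0} ℂ) (a : C k ⟶ P) (b : C l ⟶ P), τ k ≫ a = τ l ≫ b →
      ∃ t, Lifts a (z k) t ∧ Lifts b (z l) t) :
    ∃ (yy : Fin n → Fin n → Rep Q d) (v : ∀ k l, (yy k l).fam.U j)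
      (a : ∀ k l, (z k).rep ⟶ yy k l) (b : ∀ k l, (z l).rep ⟶ yy k l),
      (∀ k l, CategoryTheory.IsPushout (τ k) (τ l) (a k l).base (b k l).base) ∧
      (∀ k l, (a k l).map j (z k).v = v k l) ∧ ∀ k l, (b k l).map j (z l).v = v k l := by
  have key : ∀ k l, ∃ (P : CommAlgCat.{0} ℂ) (t : FramedRep Q d j P) (a : (z k).rep ⟶ t.rep)
      (b : (z l).rep ⟶ t.rep), CategoryTheory.IsPushout (τ k) (τ l) a.base b.base ∧
      a.map j (z k).v = t.v ∧ b.map j (z l).v = t.v := fun k l => by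
    obtain ⟨P, a, b, h⟩ := exists_isPushout (τ k) (τ l)
    obtain ⟨t, ⟨u, rfl, hu⟩, ⟨v, rfl, hv⟩⟩ := hz k l P a b h.w
    exact ⟨P, t, u, v, h, hu, hv⟩
  choose P t a b h h1 h2 using key
  exact ⟨fun k l => (t k l).rep, fun k l => (t k l).v, a, b, h, h1, h2⟩

/-- Morphisms of framed families exist as soon as they exist étale-locally. -/
theorem lifts_of_etaleCovers {A B : CommAlgCat.{0} ℂ} {f : A ⟶ B} {x : FramedRep Q d j A}
    {y : FramedRep Q d j B} (h : EtaleCovers B fun C g => ∃ z : FramedRep Q d j C,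
      Lifts g y z ∧ Lifts (f ≫ g) x z) : Lifts f x y := by
  obtain ⟨n, C, τ, hg, hs, hm⟩ := h
  choose z hyz hxz using hm
  have hτ := EtaleCovers.flatCover hg hs
  obtain ⟨yy, t, a, b, hp, ha, hb⟩ := exists_glueData z fun k l P a b e => by
    obtain ⟨t, ht⟩ := exists_lifts (z k) a
    refine ⟨t, ht, ?_⟩
    exact (hyz l).cancel (g := b) (e ▸ (hyz k).trans ht)
  choose u hu huv using hyz
  choose v hv hvv using hxz
  let G : Rep.GlueData Q d B :=
    { n := n, y := fun k => (z k).rep, τ := τ, cover := hτ, yy := yy, f := a, g := b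
      isPushout := hp }
  -- Agreement on overlaps is automatic, since morphisms of framed families over a given base map
  -- are unique.
  have huu : ∀ k l, u k ≫ a k l = u l ≫ b k l := fun k l => by
    let T : FramedRep Q d j (yy k l).A := ⟨(yy k l).fam, t k l, by
      rw [← ha]; exact Rep.Hom.isCyclic (a k l) (z k).cyclic⟩
    refine hom_unique (y := T) ?_ ?_
    · change (u k).base ≫ (a k l).base = (u l).base ≫ (b k l).base
      rw [hu, hu, (hp k l).w]
    · change (a k l).map j ((u k).map j y.v) = (b k l).map j ((u l).map j y.v)
      rw [huv, huv, ha, hb]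
  have hvv' : ∀ k l, v k ≫ a k l = v l ≫ b k l := fun k l => by
    let T : FramedRep Q d j (yy k l).A := ⟨(yy k l).fam, t k l, by
      rw [← ha]; exact Rep.Hom.isCyclic (a k l) (z k).cyclic⟩
    refine hom_unique (y := T) ?_ ?_
    · change (v k).base ≫ (a k l).base = (v l).base ≫ (b k l).base
      rw [hv, hv, Category.assoc, Category.assoc, (hp k l).w]
    · change (a k l).map j ((v k).map j x.v) = (b k l).map j ((v l).map j x.v)
      rw [hvv, hvv, ha, hb]
  obtain ⟨w, hw1, hw2⟩ := G.exists_hom (y := y.rep) u hu huu (x := x.rep) f v hv hvv'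
  refine ⟨w, hw1, G.map_injective (y := y.rep) u hu j fun k => ?_⟩
  refine Eq.trans ?_ ((hvv k).trans (huv k).symm)
  rw [← hw2 k]
  rfl

/-- A vector which is cyclic Zariski-locally is cyclic. -/
theorem isCyclic_of_away {y : Rep Q d} {v : y.fam.U j}
    (h : ∀ p : PrimeSpectrum y.A, ∃ f ∉ p.asIdeal, ∃ (z : Rep Q d) (u : y ⟶ z)
      (e : z.A = awayAlg f), u.base ≫ eqToHom e = toAway f ∧ z.fam.IsCyclic j (u.map j v)) :
    y.fam.IsCyclic j v := by
  let N := Submodule.span y.A (Set.range fun l : List Q.E => y.fam.wordEnd l (Pi.single j v))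
  refine (eq_top_iff.2 fun m _ => ?_ : N = ⊤)
  -- The ideal of functions multiplying `m` into the span `N` of the words. At a maximal ideal
  -- containing it, clearing denominators in the localization shows that it contains a power of some
  -- `f` outside that maximal ideal, a contradiction.
  let I : Ideal y.A := N.colon {m}
  have hI : I = ⊤ := by
    by_contra hne
    obtain ⟨M, hM, hle⟩ := Ideal.exists_le_maximal I hne
    obtain ⟨f, hf, ⟨A', z⟩, u, e, hu, hz⟩ := h ⟨M, hM.isPrime⟩
    obtain rfl : A' = awayAlg f := e
    have hu' : u.base = toAway f := by rw [← hu]; exact (Category.comp_id _).symm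
    obtain ⟨β⟩ := DualBasis.nonempty y.A y.fam.Total
    obtain ⟨ε, hε, -⟩ := Rep.Hom.exists_dualBasis u β
    have hpow : ∀ m' : y.fam.Total, u.total m' = 0 → ∃ n, f ^ n • m' = 0 := fun m' hm' => by
      have h1 : ∀ k, ∃ n : ℕ, f ^ n * β.ε k m' = 0 := fun k => by
        have h2 : algebraMap y.A (Localization.Away f) (β.ε k m') =
            algebraMap y.A (Localization.Away f) 0 := by
          have h3 : u.base.hom (β.ε k m') = 0 := by rw [← hε, hm', map_zero]
          rw [hu'] at h3
          exact h3.trans (map_zero _).symm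
        obtain ⟨⟨c, n, rfl⟩, hc⟩ := (IsLocalization.eq_iff_exists (Submonoid.powers f) _).1 h2
        exact ⟨n, by rw [hc, mul_zero]⟩
      choose n hn using h1
      refine ⟨∑ k, n k, ?_⟩
      rw [← β.sum_eq m', Finset.smul_sum]
      refine Finset.sum_eq_zero fun k _ => ?_
      rw [smul_smul, ← Finset.prod_pow_eq_pow_sum, ← Finset.mul_prod_erase _ _ (Finset.mem_univ k),
        mul_right_comm, hn, zero_mul, zero_smul]
    have hden : ∀ t : z.Total, ∃ n, ∃ m' ∈ N, (u.base.hom f) ^ n • t = u.total m' := by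
      intro t
      have ht : t ∈ Submodule.span (awayAlg f)
          (Set.range fun l : List Q.E => z.wordEnd l (Pi.single j (u.map j v))) := by
        rw [show Submodule.span (awayAlg f) _ = ⊤ from hz]; trivial
      induction ht using Submodule.span_induction with
      | mem t ht =>
        obtain ⟨l, rfl⟩ := ht
        refine ⟨0, _, Submodule.subset_span ⟨l, rfl⟩, ?_⟩
        rw [pow_zero, one_smul, u.total_word, u.total_single]
      | zero => exact ⟨0, 0, N.zero_mem, by rw [smul_zero, u.total_zero]⟩
      | add a b _ _ ha hb =>
        obtain ⟨n, a', ha', ha⟩ := ha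
        obtain ⟨k, b', hb', hb⟩ := hb
        refine ⟨n + k, f ^ k • a' + f ^ n • b', N.add_mem (N.smul_mem _ ha') (N.smul_mem _ hb'), ?_⟩
        rw [u.total_add, u.total_smul, u.total_smul, ← ha, ← hb, map_pow, map_pow, smul_smul,
          smul_smul, ← pow_add, ← pow_add, smul_add, add_comm k n]
      | smul r a _ ha =>
        obtain ⟨n, a', ha', ha⟩ := ha
        obtain ⟨⟨s, c, k, rfl⟩, hs⟩ := IsLocalization.surj (Submonoid.powers f)
          (show Localization.Away f from r)
        have hs' : r * (u.base.hom f) ^ k = u.base.hom s := by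
          rw [hu', ← map_pow]
          exact hs
        refine ⟨k + n, s • a', N.smul_mem _ ha', ?_⟩
        rw [u.total_smul, ← ha, ← hs', smul_smul, smul_smul]
        congr 1
        ring
    obtain ⟨n, m', hm', hmm⟩ := hden (u.total m)
    obtain ⟨k, hk⟩ := hpow (f ^ n • m - m') (by
      have : u.total (f ^ n • m - m') + u.total m' = u.total m' := by
        rw [← u.total_add, sub_add_cancel, u.total_smul, map_pow, hmm]
      exact left_eq_add.1 (this.symm.trans (add_comm _ _)))
    have hfI : f ^ (k + n) ∈ I := by
      rw [Submodule.mem_colon_singleton, pow_add, mul_smul]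
      rw [smul_sub, sub_eq_zero] at hk
      rw [hk]
      exact N.smul_mem _ hm'
    exact hf (hM.isPrime.mem_of_pow_mem _ (hle hfI))
  have h1 : (1 : y.A) ∈ I := by rw [hI]; trivial
  rw [Submodule.mem_colon_singleton, one_smul] at h1
  exact h1

/-! ### Descent of framed families -/

section Descent

variable {A : CommAlgCat.{0} ℂ} (P : ∀ B : CommAlgCat.{0} ℂ, (A ⟶ B) → Prop)

/-- The algebras over `A` over which a framed family is given. -/
structure Piece where
  B : CommAlgCat.{0} ℂ
  g : A ⟶ B
  hg : P B g

instance : Category (Piece P) where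
  Hom a b := {h : a.B ⟶ b.B // a.g ≫ h = b.g}
  id a := ⟨𝟙 _, Category.comp_id _⟩
  comp f g := ⟨f.1 ≫ g.1, by rw [← Category.assoc, f.2, g.2]⟩

variable {P} (z : ∀ b : Piece P, FramedRep Q d j b.B)
  (hz : ∀ {a b : Piece P} (h : a.B ⟶ b.B), a.g ≫ h = b.g → Lifts h (z a) (z b))

/-- The morphisms between the members of a compatible system of framed families. -/
def pieceHom {a b : Piece P} (h : a ⟶ b) : (z a).rep ⟶ (z b).rep := (hz h.1 h.2).choose

theorem pieceHom_base {a b : Piece P} (h : a ⟶ b) : (pieceHom z hz h).base = h.1 :=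
  (hz h.1 h.2).choose_spec.1

theorem pieceHom_map {a b : Piece P} (h : a ⟶ b) : (pieceHom z hz h).map j (z a).v = (z b).v :=
  (hz h.1 h.2).choose_spec.2

/-- The diagram of families underlying a compatible system of framed families. -/
def pieceFunctor : Piece P ⥤ Rep Q d where
  obj b := (z b).rep
  map h := pieceHom z hz h
  map_id a := hom_unique (pieceHom_base z hz (𝟙 a)) (pieceHom_map z hz (𝟙 a))
  map_comp {a b c} f g := by
    refine hom_unique ((pieceHom_base z hz (f ≫ g)).trans ?_)
      ((pieceHom_map z hz (f ≫ g)).trans ?_)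
    · exact (congrArg₂ (· ≫ ·) (pieceHom_base z hz f) (pieceHom_base z hz g)).symm
    · refine (pieceHom_map z hz g).symm.trans ?_
      exact congrArg ((pieceHom z hz g).map j) (pieceHom_map z hz f).symm

include hz in
/-- Compatible framed families over the members of a Zariski cover and over their overlaps come
from a framed family. -/
theorem exists_descent (hP : ∀ {B C : CommAlgCat.{0} ℂ} (g : A ⟶ B) (h : B ⟶ C), P B g → P C (g ≫ h))
    (hcov : ∀ p : PrimeSpectrum A, ∃ f ∉ p.asIdeal, P _ (toAway f)) :
    ∃ y : FramedRep Q d j A, ∀ b : Piece P, Lifts b.g y (z b) := by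
  obtain ⟨n, C, τ, hτ, hs, hm⟩ := EtaleCovers.of_away hcov
  have key : ∀ a b : Piece P, ∃ (c : Piece P) (f : a ⟶ c) (g : b ⟶ c),
      CategoryTheory.IsPushout a.g b.g f.1 g.1 := fun a b => by
    obtain ⟨R, f, g, h⟩ := exists_isPushout a.g b.g
    exact ⟨⟨R, a.g ≫ f, hP _ _ a.hg⟩, ⟨f, rfl⟩, ⟨g, h.w.symm⟩, h⟩
  choose R inl inr hR using key
  let D := pieceFunctor z hz
  have hD : ∀ {a b : Piece P} (f : a ⟶ b), (D.map f).base = f.1 := fun f =>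
    pieceHom_base z hz f
  have hDv : ∀ {a b : Piece P} (f : a ⟶ b), (D.map f).map j (z a).v = (z b).v := fun f =>
    pieceHom_map z hz f
  let c : Rep.DescentDiagram D A :=
    { τ := fun b => b.g
      nat := fun f => (congrArg (_ ≫ ·) (hD f)).trans f.2
      n := n
      k := fun m => ⟨C m, τ m, hm m⟩
      cover := EtaleCovers.flatCover hτ hs
      P := R
      inl := inl
      inr := inr
      isPushout := fun a b => by
        rw [hD, hD]
        exact hR a b
      exists_desc := fun {a b q} f g => by
        have e : a.g ≫ f.1 = b.g ≫ g.1 := f.2.trans g.2.symm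
        refine ⟨⟨(hR a b).desc f.1 g.1 e, ?_⟩, Subtype.ext ((hR a b).inl_desc _ _ _),
          Subtype.ext ((hR a b).inr_desc _ _ _)⟩
        refine (congrArg (· ≫ _) (inl a b).2.symm).trans ((Category.assoc _ _ _).trans ?_)
        exact (congrArg (a.g ≫ ·) ((hR a b).inl_desc _ _ _)).trans f.2 }
  obtain ⟨y, u, hu1, hu2⟩ := c.exists_glue
  obtain ⟨v, hv⟩ := c.glueData.exists_map (y := ⟨A, y⟩) (fun m => u (c.k m)) (fun m => hu1 _)
    (fun m l => (hu2 _).trans (hu2 _).symm) j (fun m => (z (c.k m)).v)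
    (fun m l => (hDv _).trans (hDv _).symm)
  -- The framing vector was glued from the finite cover only. On any other piece it is compared on
  -- the overlaps with that cover.
  have hv' : ∀ b : Piece P, (u b).map j v = (z b).v := fun b => by
    refine (c.glueDataAt b).map_injective (y := (z b).rep) (fun m => D.map (inr (c.k m) b))
      (fun m => rfl) j fun m => ?_
    have e1 : (D.map (inr (c.k m) b)).map j ((u b).map j v) = (u (R (c.k m) b)).map j v := by
      rw [← hu2 (inr (c.k m) b)]
      rfl
    have e2 : (u (R (c.k m) b)).map j v = (D.map (inl (c.k m) b)).map j ((u (c.k m)).map j v) := by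
      rw [← hu2 (inl (c.k m) b)]
      rfl
    have e3 : (u (c.k m)).map j v = (z (c.k m)).v := hv m
    change (D.map (inr (c.k m) b)).map j ((u b).map j v) = (D.map (inr (c.k m) b)).map j (z b).v
    rw [e1, e2, e3, hDv, hDv]
  have hcyc : y.IsCyclic j v := by
    refine isCyclic_of_away (y := ⟨A, y⟩) (v := v) fun p => ?_
    obtain ⟨f, hf, hPf⟩ := hcov p
    let b : Piece P := ⟨awayAlg f, toAway f, hPf⟩
    refine ⟨f, hf, (z b).rep, u b, rfl, ?_, ?_⟩
    · rw [hu1]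
      exact Category.comp_id _
    · exact (congrArg ((z b).fam.IsCyclic j) (hv' b)).mpr (z b).cyclic
  exact ⟨⟨y, v, hcyc⟩, fun b => ⟨u b, hu1 b, hv' b⟩⟩

end Descent

end FramedRep

end QuiverCrit
end

/-! ### Words applied to the framing vector, and their determinants -/

noncomputable section

namespace QuiverCrit

set_option linter.style.haveILetI false

variable {Q : FinQuiver} {d : Q.V → ℕ} {j : Q.V}

namespace RepFam

variable {A : Type} [CommRing A] (x : RepFam Q d A)

/-- A composable word ends at one vertex and any other word kills the framing vector, so a vertex
projector fixes or kills its image. Hence each component separately lies in the span of the words.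
-/
theorem vertexEnd_wordEnd (l : List Q.E) (v : x.U j) (i : Q.V) :
    x.vertexEnd i (x.wordEnd l (Pi.single j v)) = x.wordEnd l (Pi.single j v) ∨
      x.vertexEnd i (x.wordEnd l (Pi.single j v)) = 0 := by
  have hj : x.vertexEnd j (Pi.single j v) = Pi.single j v := by
    rw [vertexEnd_apply, Pi.single_eq_same]
  have e : x.wordEnd l (Pi.single j v) = (x.wordEnd l * x.vertexEnd j) (Pi.single j v) := by
    rw [Module.End.mul_apply, hj]
  rw [e, ← Module.End.mul_apply]
  by_cases h : Q.Composable j l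
  · rw [← x.vertexEnd_mul_wordEnd l h]
    by_cases hi : i = Q.endpoint j l
    · left
      rw [← mul_assoc, hi, ← mul_assoc, x.vertexEnd_mul_self, mul_assoc]
    · right
      rw [← mul_assoc, ← mul_assoc, x.vertexEnd_mul_of_ne hi, zero_mul, zero_mul,
        LinearMap.zero_apply]
  · right
    rw [x.wordEnd_mul_vertexEnd_of_not_composable l h, mul_zero, LinearMap.zero_apply]

end RepFam

namespace FramedSpace

section

variable {A B : Type} [CommRing A] [CommRing B]

/-- The image of a framed point under a ring map. -/
def map (f : A →+* B) (x : FramedSpace Q d j A) : FramedSpace Q d j B :=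
  ⟨RepSpace.map f x.φ, fun k => f (x.v k)⟩

variable (x : FramedSpace Q d j A)

/-- The component at a vertex of the image of the framing vector under a word. -/
def wordVec (l : List Q.E) (i : Q.V) : Fin (d i) → A :=
  (x.φ.std.wordEnd l (Pi.single j x.v : x.φ.std.Total)) i

theorem single_wordVec_mem (l : List Q.E) (i : Q.V) :
    (Pi.single i (x.wordVec l i) : x.φ.std.Total) ∈ Submodule.span A
      (Set.range fun l : List Q.E => x.φ.std.wordEnd l (Pi.single j x.v)) := by
  have e : (Pi.single i (x.wordVec l i) : x.φ.std.Total) =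
    x.φ.std.vertexEnd i (x.φ.std.wordEnd l (Pi.single j x.v)) := rfl
  rw [e]
  rcases x.φ.std.vertexEnd_wordEnd l x.v i with h | h
  · rw [h]; exact Submodule.subset_span ⟨l, rfl⟩
  · rw [h]; exact Submodule.zero_mem _

theorem wordVec_nil : x.wordVec [] j = x.v := Pi.single_eq_same (M := x.φ.std.U) j x.v

theorem wordVec_append (l : List Q.E) (a : Q.E) :
    x.wordVec (l ++ [a]) (Q.head a) = (x.φ a).mulVec (x.wordVec l (Q.tail a)) := by
  unfold wordVec
  rw [RepFam.wordEnd_append]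
  exact Pi.single_eq_same (M := x.φ.std.U) (Q.head a) _

/-- The matrix whose columns are the images of the framing vector under some words. -/
def wordMat (S : ∀ i, Fin (d i) → List Q.E) (i : Q.V) : Matrix (Fin (d i)) (Fin (d i)) A :=
  Matrix.of fun r k => x.wordVec (S i k) i r

/-- The product over all vertices of the determinants of the matrices given by words. -/
def wordDet (S : ∀ i, Fin (d i) → List Q.E) : A := ∏ i, (x.wordMat S i).det

/-- The words `S` applied to the framing vector give the standard bases. -/
def IsNormal (S : ∀ i, Fin (d i) → List Q.E) : Prop := ∀ i, x.wordMat S i = 1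

variable {x}

theorem IsNormal.wordDet {S : ∀ i, Fin (d i) → List Q.E} (h : x.IsNormal S) : x.wordDet S = 1 :=
  Finset.prod_eq_one fun i _ => by rw [h i, Matrix.det_one]

theorem isCyclic_of_isUnit {S : ∀ i, Fin (d i) → List Q.E} (h : IsUnit (x.wordDet S)) :
    x.φ.std.IsCyclic j x.v := by
  refine eq_top_iff.2 fun m _ => ?_
  rw [← Finset.univ_sum_single m]
  refine Submodule.sum_mem _ fun i _ => ?_
  have hi : IsUnit (x.wordMat S i).det :=
    isUnit_of_dvd_unit (Finset.dvd_prod_of_mem (fun i => (x.wordMat S i).det)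
      (Finset.mem_univ i)) h
  have e : (m i : Fin (d i) → A) = ∑ k, ((x.wordMat S i)⁻¹.mulVec (m i)) k • x.wordVec (S i k) i := by
    have h1 : (x.wordMat S i).mulVec ((x.wordMat S i)⁻¹.mulVec (m i)) = (m i : Fin (d i) → A) := by
      refine (Matrix.mulVec_mulVec (m i : Fin (d i) → A) _ _).trans ?_
      rw [Matrix.mul_nonsing_inv _ hi]
      exact Matrix.one_mulVec _
    conv_lhs => rw [← h1]
    rw [Matrix.mulVec_eq_sum]
    simp only [op_smul_eq_smul]
    rfl
  have e2 : (Pi.single i (m i) : x.φ.std.Total) =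
      ∑ k, ((x.wordMat S i)⁻¹.mulVec (m i)) k • Pi.single i (x.wordVec (S i k) i) := by
    refine (congrArg (Pi.single (M := x.φ.std.U) i) e).trans ?_
    refine (map_sum (AddMonoidHom.single x.φ.std.U i) _ _).trans ?_
    exact Finset.sum_congr rfl fun k _ => Pi.single_smul i _ _
  rw [e2]
  exact Submodule.sum_mem _ fun k _ => Submodule.smul_mem _ _ (x.single_wordVec_mem _ _)

end

section

variable {A B : CommAlgCat.{0} ℂ} (x : FramedSpace Q d j A)

theorem wordVec_smul_map (f : A ⟶ B) (g : GLProd Q d B) (l : List Q.E) (i : Q.V) :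
    (g • x.map f.hom.toRingHom).wordVec l i = (g i).1.mulVec fun k => f.hom (x.wordVec l i k) := by
  let u : Rep.Hom (⟨A, x.φ.std⟩ : Rep Q d) ⟨B, (g • x.map f.hom.toRingHom).φ.std⟩ := stdHom f g rfl
  have e := u.total_word l (Pi.single j x.v : x.φ.std.Total)
  have e1 := e.trans (congrArg _ (u.total_single j x.v))
  exact (congrFun e1 i).symm

theorem wordMat_smul_map (f : A ⟶ B) (g : GLProd Q d B) (S : ∀ i, Fin (d i) → List Q.E) (i : Q.V) :
    (g • x.map f.hom.toRingHom).wordMat S i = (g i).1 * (x.wordMat S i).map f.hom := by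
  ext r k
  exact congrFun (x.wordVec_smul_map f g (S i k) i) r

/-- All these functions transform by the same character, the product of the determinants. They
therefore serve as homogeneous coordinates on the quotient. -/
theorem wordDet_smul_map (f : A ⟶ B) (g : GLProd Q d B) (S : ∀ i, Fin (d i) → List Q.E) :
    (g • x.map f.hom.toRingHom).wordDet S = (∏ i, (g i).1.det) * f.hom (x.wordDet S) := by
  unfold wordDet
  rw [map_prod, ← Finset.prod_mul_distrib]
  refine Finset.prod_congr rfl fun i _ => ?_
  rw [wordMat_smul_map, Matrix.det_mul]
  congr 1
  exact (RingHom.map_det f.hom.toRingHom _).symm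

theorem wordMat_map (f : A ⟶ B) (S : ∀ i, Fin (d i) → List Q.E) (i : Q.V) :
    (x.map f.hom.toRingHom).wordMat S i = (x.wordMat S i).map f.hom := by
  have := x.wordMat_smul_map f 1 S i
  rw [one_smul] at this
  exact this.trans (one_mul _)

theorem wordDet_map (f : A ⟶ B) (S : ∀ i, Fin (d i) → List Q.E) :
    (x.map f.hom.toRingHom).wordDet S = f.hom (x.wordDet S) := by
  have := x.wordDet_smul_map f 1 S
  rw [one_smul] at this
  refine this.trans ?_
  have e : ∏ i, ((1 : GLProd Q d B) i).1.det = 1 := Finset.prod_eq_one fun i _ => Matrix.det_one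
  rw [e, one_mul]

theorem exists_normal {S : ∀ i, Fin (d i) → List Q.E} (h : IsUnit (x.wordDet S)) :
    ∃ g : GLProd Q d A, (g • x).IsNormal S ∧ ∀ i, (g i)⁻¹.1 = x.wordMat S i := by
  have hi : ∀ i, IsUnit (x.wordMat S i) := fun i => (Matrix.isUnit_iff_isUnit_det _).2
    (isUnit_of_dvd_unit (Finset.dvd_prod_of_mem (fun i => (x.wordMat S i).det)
      (Finset.mem_univ i)) h)
  refine ⟨fun i => (hi i).unit⁻¹, fun i => ?_, fun i => by rw [inv_inv]; rfl⟩
  have := x.wordMat_smul_map (𝟙 A) (fun i => (hi i).unit⁻¹) S i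
  refine this.trans ?_
  exact (hi i).unit.inv_mul

/-- Changing one word replaces one column of an identity matrix; by Cramer's rule the determinant is
then a coordinate of the new column. -/
theorem wordDet_update {S : ∀ i, Fin (d i) → List Q.E} (h : x.IsNormal S) (i : Q.V) (l : Fin (d i))
    (w : List Q.E) :
    x.wordDet (Function.update S i (Function.update (S i) l w)) = x.wordVec w i l := by
  unfold wordDet
  rw [Finset.prod_eq_single i]
  · have e : x.wordMat (Function.update S i (Function.update (S i) l w)) i =
        (1 : Matrix (Fin (d i)) (Fin (d i)) A).updateCol l (x.wordVec w i) := by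
      rw [← h i]
      ext r k
      simp only [wordMat, Matrix.of_apply, Function.update_self, Matrix.updateCol_apply]
      by_cases hk : k = l
      · subst hk; simp
      · simp [hk]
    rw [e, ← Matrix.cramer_apply, Matrix.cramer_one]
    rfl
  · intro i' _ hi
    have e : x.wordMat (Function.update S i (Function.update (S i) l w)) i' = x.wordMat S i' := by
      unfold wordMat
      rw [Function.update_of_ne hi]
    rw [e, h i', Matrix.det_one]
  · simp

/-- At a normal point the `k`-th standard vector at the tail of `a` is a word applied to the framing
vector, so the `k`-th column of `φ a` is that word prolonged by `a`. Thus all matrix entries are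
among the homogeneous coordinates. -/
theorem φ_eq_wordDet {S : ∀ i, Fin (d i) → List Q.E} (h : x.IsNormal S) (a : Q.E)
    (l : Fin (d (Q.head a))) (k : Fin (d (Q.tail a))) :
    x.φ a l k = x.wordDet (Function.update S (Q.head a)
      (Function.update (S (Q.head a)) l (S (Q.tail a) k ++ [a]))) := by
  rw [x.wordDet_update h, wordVec_append]
  have e : x.wordVec (S (Q.tail a) k) (Q.tail a) = Pi.single k 1 := by
    funext r
    have := congrFun (congrFun (h (Q.tail a)) r) k
    refine this.trans ?_
    rw [Matrix.one_apply, Pi.single_apply]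
  rw [e, Matrix.mulVec_single_one]
  rfl

theorem v_eq_wordDet {S : ∀ i, Fin (d i) → List Q.E} (h : x.IsNormal S) (l : Fin (d j)) :
    x.v l = x.wordDet (Function.update S j (Function.update (S j) l [])) := by
  rw [x.wordDet_update h, wordVec_nil]

/-- Over a field, a cyclic vector generates bases by words. -/
theorem exists_wordDet_ne_zero {F : CommAlgCat.{0} ℂ} (hF : IsField F) (y : FramedSpace Q d j F)
    (hy : y.φ.std.IsCyclic j y.v) : ∃ S, y.wordDet S ≠ 0 := by
  letI := hF.toField
  have key : ∀ i, ∃ s : Fin (d i) → List Q.E,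
      LinearIndependent F fun k => y.wordVec (s k) i := fun i => by
    have hspan : Submodule.span F (Set.range fun l => y.wordVec l i) = ⊤ := by
      have h1 := congrArg (Submodule.map (LinearMap.proj (R := F) (φ := y.φ.std.U) i)) hy
      rw [Submodule.map_span, Submodule.map_top, LinearMap.range_eq_top.2
        (LinearMap.proj_surjective i), ← Set.range_comp] at h1
      exact h1
    obtain ⟨f, hf1, hf2, hf3⟩ := Submodule.exists_fun_fin_finrank_span_eq F (Set.range fun l => y.wordVec l i)
    have hr : Module.finrank F (Submodule.span F (Set.range fun l => y.wordVec l i)) = d i := by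
      rw [hspan, finrank_top, Module.finrank_fin_fun]
    choose s hs using hf1
    refine ⟨fun k => s (Fin.cast hr.symm k), ?_⟩
    simp only [hs]
    exact hf3.comp _ (Fin.cast_injective _)
  choose S hS using key
  refine ⟨S, ?_⟩
  rw [wordDet, Finset.prod_ne_zero_iff]
  intro i _
  have h1 : LinearIndependent F (y.wordMat S i).col := hS i
  rw [Matrix.linearIndependent_cols_iff_isUnit, Matrix.isUnit_iff_isUnit_det] at h1
  exact h1.ne_zero

theorem exists_wordDet_notMem (hx : x.φ.std.IsCyclic j x.v) (p : PrimeSpectrum A) :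
    ∃ S, x.wordDet S ∉ p.asIdeal := by
  letI : Algebra ℂ p.asIdeal.ResidueField :=
    ((algebraMap A p.asIdeal.ResidueField).comp (algebraMap ℂ A)).toAlgebra
  let f : A ⟶ CommAlgCat.of ℂ p.asIdeal.ResidueField :=
    CommAlgCat.ofHom { algebraMap A p.asIdeal.ResidueField with commutes' := fun _ => rfl }
  have hc : (x.map f.hom.toRingHom).φ.std.IsCyclic j (x.map f.hom.toRingHom).v := by
    have := inNj_stable j f 1 x hx
    rw [one_smul] at this
    exact this
  obtain ⟨S, hS⟩ := exists_wordDet_ne_zero (Field.toIsField p.asIdeal.ResidueField) _ hc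
  refine ⟨S, fun h => hS ?_⟩
  rw [wordDet_map]
  exact (Ideal.algebraMap_residueField_eq_zero).2 h

end

end FramedSpace

end QuiverCrit
end

noncomputable section

namespace QuiverCrit

set_option linter.style.haveILetI false

/-! ### Slices for the action on framed representations -/

/-- Systems of words, one for each basis vector of each `U i`. -/
abbrev WordSystem (Q : FinQuiver) (d : Q.V → ℕ) : Type := ∀ i, Fin (d i) → List Q.E

section Universal

variable (Q : FinQuiver) (d : Q.V → ℕ) (j : Q.V)

/-- The coordinate ring of the space of representations with a vector. -/
def framedAlg : CommAlgCat.{0} ℂ := CommAlgCat.of ℂ (MvPolynomial (Coord Q d ⊕ Fin (d j)) ℂ)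

/-- The tautological point of the space of representations with a vector. -/
def univFramed : FramedSpace Q d j (framedAlg Q d j) where
  φ := fun a => Matrix.of fun l k =>
    (MvPolynomial.X (Sum.inl ⟨a, l, k⟩) : MvPolynomial (Coord Q d ⊕ Fin (d j)) ℂ)
  v := fun k => (MvPolynomial.X (Sum.inr k) : MvPolynomial (Coord Q d ⊕ Fin (d j)) ℂ)

variable {Q d j}

theorem exists_framed_eval {B : CommAlgCat.{0} ℂ} (x : FramedSpace Q d j B) :
    ∃ h : framedAlg Q d j ⟶ B, (univFramed Q d j).map h.hom.toRingHom = x := by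
  refine ⟨CommAlgCat.ofHom (MvPolynomial.aeval (Sum.elim
    (fun s : Coord Q d => x.φ s.1 s.2.1 s.2.2) x.v)), FramedSpace.ext ?_ ?_⟩
  · funext a
    ext l k
    exact MvPolynomial.aeval_X _ (Sum.inl ⟨a, l, k⟩ : Coord Q d ⊕ Fin (d j))
  · funext k
    exact MvPolynomial.aeval_X _ (Sum.inr k : Coord Q d ⊕ Fin (d j))

theorem framed_eval_ext {B : CommAlgCat.{0} ℂ} {h h' : framedAlg Q d j ⟶ B}
    (e : (univFramed Q d j).map h.hom.toRingHom = (univFramed Q d j).map h'.hom.toRingHom) :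
    h = h' := by
  refine CommAlgCat.hom_ext (MvPolynomial.algHom_ext fun s => ?_)
  rcases s with ⟨a, l, k⟩ | k
  · exact congrFun (congrFun (congrFun (congrArg FramedSpace.φ e) a) l) k
  · exact congrFun (congrArg FramedSpace.v e) k

variable (Q d j) in
/-- The field of rational functions on the space of representations with a vector. -/
def framedField : CommAlgCat.{0} ℂ :=
  CommAlgCat.of ℂ (FractionRing (MvPolynomial (Coord Q d ⊕ Fin (d j)) ℂ))

variable (Q d j) in
/-- The inclusion of the polynomial ring into its field of fractions. -/
def toFramedField : framedAlg Q d j ⟶ framedField Q d j :=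
  CommAlgCat.ofHom (IsScalarTower.toAlgHom ℂ (MvPolynomial (Coord Q d ⊕ Fin (d j)) ℂ)
    (FractionRing (MvPolynomial (Coord Q d ⊕ Fin (d j)) ℂ)))

theorem toFramedField_injective : Function.Injective (toFramedField Q d j).hom :=
  IsFractionRing.injective (MvPolynomial (Coord Q d ⊕ Fin (d j)) ℂ)
    (FractionRing (MvPolynomial (Coord Q d ⊕ Fin (d j)) ℂ))

theorem isField_framedField : IsField (framedField Q d j) :=
  Field.toIsField (FractionRing (MvPolynomial (Coord Q d ⊕ Fin (d j)) ℂ))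

variable (Q d j) in
/-- The generic framed representation. -/
def genFramed : FramedSpace Q d j (framedField Q d j) :=
  (univFramed Q d j).map (toFramedField Q d j).hom.toRingHom

end Universal

variable {Q : FinQuiver} {d : Q.V → ℕ} {j : Q.V}

theorem FramedSpace.map_comp {A B C : CommAlgCat.{0} ℂ} (x : FramedSpace Q d j A) (f : A ⟶ B)
    (g : B ⟶ C) : x.map (f ≫ g).hom.toRingHom = (x.map f.hom.toRingHom).map g.hom.toRingHom := rfl

theorem FramedSpace.map_smul {A B : CommAlgCat.{0} ℂ} (f : A ⟶ B) (g : GLProd Q d A)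
    (x : FramedSpace Q d j A) : (g • x).map f.hom.toRingHom =
      GLProd.map f.hom.toRingHom g • x.map f.hom.toRingHom :=
  (framedSpaceAction d j).mapX_smul f g x

theorem FramedSpace.IsNormal.map {A B : CommAlgCat.{0} ℂ} {x : FramedSpace Q d j A}
    {S : WordSystem Q d} (h : x.IsNormal S) (f : A ⟶ B) : (x.map f.hom.toRingHom).IsNormal S :=
  fun i => by
    rw [FramedSpace.wordMat_map, h i]
    exact Matrix.map_one f.hom (map_zero _) (map_one _)

/-- The group multiplies the word matrices from the left, so only the identity carries a normal
point to a normal point: each orbit meets the slice at most once. -/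
theorem FramedSpace.IsNormal.smul_eq {A : CommAlgCat.{0} ℂ} {x : FramedSpace Q d j A}
    {S : WordSystem Q d} (h : x.IsNormal S) {g : GLProd Q d A} (hg : (g • x).IsNormal S) :
    g • x = x := by
  have e : g = 1 := by
    funext i
    refine Units.ext ?_
    have h1 := x.wordMat_smul_map (𝟙 A) g S i
    have h2 : (x.wordMat S i).map (𝟙 A : A ⟶ A).hom = 1 := h i
    rw [h2, mul_one] at h1
    exact h1.symm.trans (hg i)
  rw [e, one_smul]

section Slice

variable (j) (S : WordSystem Q d)

/-- The ideal of the slice of framed representations whose words `S` give the standard bases. -/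
def sliceIdeal : Ideal (framedAlg Q d j) :=
  Ideal.span (Set.range fun s : Σ i, Fin (d i) × Fin (d i) =>
    (univFramed Q d j).wordMat S s.1 s.2.1 s.2.2 -
      (1 : Matrix (Fin (d s.1)) (Fin (d s.1)) (framedAlg Q d j)) s.2.1 s.2.2)

/-- The coordinate ring of the slice. -/
def sliceAlg : CommAlgCat.{0} ℂ :=
  CommAlgCat.of ℂ ((MvPolynomial (Coord Q d ⊕ Fin (d j)) ℂ) ⧸ sliceIdeal j S)

/-- The restriction of functions to the slice. -/
def toSlice : framedAlg Q d j ⟶ sliceAlg j S := CommAlgCat.ofHom (Ideal.Quotient.mkₐ ℂ (sliceIdeal j S))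

/-- The tautological point of the slice. -/
def slicePt : FramedSpace Q d j (sliceAlg j S) := (univFramed Q d j).map (toSlice j S).hom.toRingHom

theorem toSlice_surjective : Function.Surjective (toSlice j S).hom :=
  Ideal.Quotient.mk_surjective

theorem slicePt_isNormal : (slicePt j S).IsNormal S := fun i => by
  unfold slicePt
  rw [FramedSpace.wordMat_map]
  ext r k
  rw [Matrix.map_apply]
  have h1 : (univFramed Q d j).wordMat S i r k - (1 : Matrix (Fin (d i)) (Fin (d i)) (framedAlg Q d j)) r k
    ∈ sliceIdeal j S := Ideal.subset_span ⟨⟨i, r, k⟩, rfl⟩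
  have h2 := Ideal.Quotient.eq.2 h1
  refine Eq.trans h2 ?_
  change (toSlice j S).hom _ = _
  rw [Matrix.one_apply, Matrix.one_apply]
  split_ifs
  · exact map_one _
  · exact map_zero _

variable {j S}

theorem slice_ext {B : CommAlgCat.{0} ℂ} {h h' : sliceAlg j S ⟶ B}
    (e : (slicePt j S).map h.hom.toRingHom = (slicePt j S).map h'.hom.toRingHom) : h = h' := by
  have e1 : toSlice j S ≫ h = toSlice j S ≫ h' := framed_eval_ext e
  refine CommAlgCat.hom_ext (AlgHom.ext fun r => ?_)
  obtain ⟨r, rfl⟩ := toSlice_surjective j S r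
  exact congrArg (fun u : framedAlg Q d j ⟶ B => u.hom r) e1

theorem exists_slice_eval {B : CommAlgCat.{0} ℂ} {x : FramedSpace Q d j B} (hx : x.IsNormal S) :
    ∃ h : sliceAlg j S ⟶ B, (slicePt j S).map h.hom.toRingHom = x := by
  obtain ⟨h, rfl⟩ := exists_framed_eval x
  have hk : ∀ r ∈ sliceIdeal j S, h.hom r = 0 := by
    intro r hr
    have : sliceIdeal j S ≤ RingHom.ker h.hom.toRingHom := by
      refine Ideal.span_le.2 ?_
      rintro _ ⟨⟨i, r, k⟩, rfl⟩
      have e := hx i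
      rw [FramedSpace.wordMat_map] at e
      have e1 := congrFun (congrFun e r) k
      change h.hom (_ - _) = 0
      rw [map_sub, sub_eq_zero]
      refine e1.trans ?_
      rw [Matrix.one_apply, Matrix.one_apply]
      split_ifs
      · exact (map_one _).symm
      · exact (map_zero _).symm
    exact this hr
  exact ⟨CommAlgCat.ofHom (Ideal.Quotient.liftₐ (sliceIdeal j S) h.hom hk), rfl⟩

/-- The slice is a retract of the open subset where the words `S` give bases. -/
theorem exists_slice_retraction : ∃ (ρ : sliceAlg j S ⟶ awayAlg ((univFramed Q d j).wordDet S))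
    (σ : awayAlg ((univFramed Q d j).wordDet S) ⟶ sliceAlg j S)
    (g : GLProd Q d (awayAlg ((univFramed Q d j).wordDet S))), ρ ≫ σ = 𝟙 _ ∧
      (slicePt j S).map ρ.hom.toRingHom =
        g • (univFramed Q d j).map (toAway ((univFramed Q d j).wordDet S)).hom.toRingHom := by
  have hu : IsUnit (((univFramed Q d j).map
      (toAway ((univFramed Q d j).wordDet S)).hom.toRingHom).wordDet S) := by
    rw [FramedSpace.wordDet_map]
    exact isUnit_toAway _
  obtain ⟨g, hg, -⟩ := FramedSpace.exists_normal _ hu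
  obtain ⟨ρ, hρ⟩ := exists_slice_eval hg
  obtain ⟨σ, hσ⟩ := exists_away_lift ((univFramed Q d j).wordDet S) (toSlice j S) (by
    have := (univFramed Q d j).wordDet_map (toSlice j S) S
    rw [← this]
    exact (slicePt_isNormal j S).wordDet ▸ isUnit_one)
  refine ⟨ρ, σ, g, slice_ext ?_, hρ⟩
  -- Restricting the normalisation of the universal point to the slice gives a translate of the
  -- slice point that is again normal, hence the slice point itself.
  have e1 : (slicePt j S).map (ρ ≫ σ).hom.toRingHom = GLProd.map σ.hom.toRingHom g • slicePt j S := by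
    rw [FramedSpace.map_comp, hρ, FramedSpace.map_smul, ← FramedSpace.map_comp, hσ]
    rfl
  refine e1.trans ((slicePt_isNormal j S).smul_eq ?_)
  rw [← e1]
  exact (slicePt_isNormal j S).map _

/-- Lift the composite with `σ`, then restrict along `ρ`. Slices inherit smoothness from open
subsets of affine space in this way. -/
theorem formallySmooth_of_retraction {A B : CommAlgCat.{0} ℂ} (ρ : A ⟶ B) (σ : B ⟶ A)
    (h : ρ ≫ σ = 𝟙 A) (hB : Algebra.FormallySmooth ℂ B) : Algebra.FormallySmooth ℂ A := by
  refine Algebra.FormallySmooth.of_comp_surjective fun C _ _ I hI f => ?_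
  obtain ⟨k, hk⟩ := Algebra.FormallySmooth.comp_surjective ℂ B I hI (f.comp σ.hom)
  refine ⟨k.comp ρ.hom, ?_⟩
  rw [← AlgHom.comp_assoc, hk, AlgHom.comp_assoc]
  have e : σ.hom.comp ρ.hom = AlgHom.id ℂ A := congrArg CommAlgCat.Hom.hom h
  rw [e, AlgHom.comp_id]

theorem smooth_sliceAlg : Algebra.Smooth ℂ (sliceAlg j S) := by
  obtain ⟨ρ, σ, -, h, -⟩ := exists_slice_retraction (j := j) (S := S)
  refine ⟨formallySmooth_of_retraction ρ σ h ?_, ?_⟩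
  · exact (inferInstance : Algebra.FormallySmooth ℂ
      (Localization (Submonoid.powers (M := MvPolynomial (Coord Q d ⊕ Fin (d j)) ℂ) _)))
  · have h : Algebra.FinitePresentation ℂ (framedAlg Q d j) :=
      (inferInstance : Algebra.FinitePresentation ℂ (MvPolynomial (Coord Q d ⊕ Fin (d j)) ℂ))
    have h1 : IsNoetherianRing (framedAlg Q d j) :=
      (inferInstance : IsNoetherianRing (MvPolynomial (Coord Q d ⊕ Fin (d j)) ℂ))
    exact Algebra.FinitePresentation.of_surjective (toSlice_surjective j S) (h1.noetherian _)

/-- The generic framed representation can be moved into the slice. -/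
theorem exists_slice_generic (hS : (univFramed Q d j).wordDet S ≠ 0) :
    ∃ (ν : sliceAlg j S ⟶ framedField Q d j) (g : GLProd Q d (framedField Q d j)),
      Function.Injective ν.hom ∧ (slicePt j S).map ν.hom.toRingHom = g • genFramed Q d j := by
  obtain ⟨ρ, σ, g, h, hg⟩ := exists_slice_retraction (j := j) (S := S)
  have hu : IsUnit ((toFramedField Q d j).hom ((univFramed Q d j).wordDet S)) := by
    letI := (isField_framedField (Q := Q) (d := d) (j := j)).toField
    refine IsUnit.mk0 _ fun e => hS (toFramedField_injective ?_)
    exact e.trans (map_zero _).symm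
  obtain ⟨k, hk⟩ := exists_away_lift _ (toFramedField Q d j) hu
  have hinj : Function.Injective k.hom := by
    refine (injective_iff_map_eq_zero k.hom).2 fun z hz => ?_
    obtain ⟨⟨r, s⟩, e⟩ := IsLocalization.surj (M := Submonoid.powers ((univFramed Q d j).wordDet S))
      (S := Localization.Away ((univFramed Q d j).wordDet S)) z
    have e1 : z * (toAway ((univFramed Q d j).wordDet S)).hom s.1 =
      (toAway ((univFramed Q d j).wordDet S)).hom r := e
    have e2 : (toFramedField Q d j).hom r = 0 := by
      rw [← hk]
      change k.hom ((toAway ((univFramed Q d j).wordDet S)).hom r) = 0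
      rw [← e1, map_mul, hz, zero_mul]
    have e3 : r = 0 := toFramedField_injective (e2.trans (map_zero _).symm)
    have hsu : IsUnit ((toAway ((univFramed Q d j).wordDet S)).hom s.1) :=
      IsLocalization.map_units (M := Submonoid.powers ((univFramed Q d j).wordDet S))
      (Localization.Away ((univFramed Q d j).wordDet S)) s
    rw [e3, map_zero] at e1
    exact (hsu.mul_left_eq_zero).1 e1
  refine ⟨ρ ≫ k, GLProd.map k.hom.toRingHom g, ?_, ?_⟩
  · refine hinj.comp (Function.LeftInverse.injective (g := σ.hom) fun r => ?_)
    exact congrArg (fun u : sliceAlg j S ⟶ sliceAlg j S => u.hom r) h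
  · rw [FramedSpace.map_comp, hg, FramedSpace.map_smul, ← FramedSpace.map_comp, hk]
    rfl

/-- The ring is generated by the entries of `φ` and `v`, and on the slice each of these is the
determinant of a modified word system. -/
theorem adjoin_slice {s : Set (WordSystem Q d)}
    (h1 : ∀ a l k, Function.update S (Q.head a)
      (Function.update (S (Q.head a)) l (S (Q.tail a) k ++ [a])) ∈ s)
    (h2 : ∀ l, Function.update S j (Function.update (S j) l []) ∈ s) :
    Algebra.adjoin ℂ ((slicePt j S).wordDet '' s) = ⊤ := by
  rw [eq_top_iff]
  rintro r -
  obtain ⟨r, rfl⟩ := toSlice_surjective j S r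
  induction r using MvPolynomial.induction_on with
  | C z => exact Subalgebra.algebraMap_mem _ z
  | add p q hp hq =>
    have e := map_add (toSlice j S).hom p q
    exact e ▸ Subalgebra.add_mem _ hp hq
  | mul_X p c hp =>
    have e := map_mul (toSlice j S).hom p (MvPolynomial.X c)
    refine e ▸ Subalgebra.mul_mem _ hp ?_
    rcases c with ⟨a, l, k⟩ | l
    · have e1 := FramedSpace.φ_eq_wordDet _ (slicePt_isNormal j S) a l k
      refine Algebra.subset_adjoin ⟨_, h1 a l k, e1.symm⟩
    · have e1 := FramedSpace.v_eq_wordDet _ (slicePt_isNormal j S) l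
      refine Algebra.subset_adjoin ⟨_, h2 l, e1.symm⟩

end Slice

/-- Finitely many slices covering the space of framed representations, and finitely many determinants
generating all their coordinate rings. -/
structure SliceData (Q : FinQuiver) (d : Q.V → ℕ) (j : Q.V) where
  n : ℕ
  t : Fin (n + 1) → WordSystem Q d
  ι : Type
  k : ι → Fin (n + 1)
  ne : ∀ i, (univFramed Q d j).wordDet (t (k i)) ≠ 0
  adjoin : ∀ i, Algebra.adjoin ℂ (Set.range fun l => (slicePt j (t (k i))).wordDet (t l)) = ⊤
  cover : ∀ (A : CommAlgCat.{0} ℂ) (x : FramedSpace Q d j A), x.φ.std.IsCyclic j x.v →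
    ∀ p : PrimeSpectrum A, ∃ i, x.wordDet (t (k i)) ∉ p.asIdeal

/-- The determinants of all word systems generate an ideal of a noetherian ring, so finitely many
generate it; their slices cover, because some determinant is nonzero at every point with a cyclic
vector. The list `t` also contains the modified systems needed to generate the coordinate rings of
these slices. -/
theorem nonempty_sliceData : Nonempty (SliceData Q d j) := by
  classical
  have h1 : IsNoetherianRing (MvPolynomial (Coord Q d ⊕ Fin (d j)) ℂ) := inferInstance
  have hfg : (Submodule.span (framedAlg Q d j) (Set.range (univFramed Q d j).wordDet)).FG :=
    h1.noetherian _
  obtain ⟨s, hs, hspan⟩ := (Submodule.fg_span_iff_fg_span_finset_subset _).1 hfg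
  choose T hT using fun e : s => hs e.2
  let F : Set (WordSystem Q d) := Set.range T ∪
    (Set.range fun u : s × Σ a : Q.E, Fin (d (Q.head a)) × Fin (d (Q.tail a)) =>
      Function.update (T u.1) (Q.head u.2.1) (Function.update (T u.1 (Q.head u.2.1)) u.2.2.1
        (T u.1 (Q.tail u.2.1) u.2.2.2 ++ [u.2.1]))) ∪
    (Set.range fun u : s × Fin (d j) =>
      Function.update (T u.1) j (Function.update (T u.1 j) u.2 [])) ∪ {fun _ _ => []}
  have hF : F.Finite := (((Set.finite_range _).union (Set.finite_range _)).union
    (Set.finite_range _)).union (Set.finite_singleton _)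
  obtain ⟨n, t, -, ht⟩ := hF.fin_param
  -- The trivial word system was added so that the list is nonempty, as the index type `Fin (n + 1)`
  -- of homogeneous coordinates requires.
  have hn : n ≠ 0 := by
    rintro rfl
    have h : (fun _ _ => [] : WordSystem Q d) ∈ F := Or.inr rfl
    rw [← ht] at h
    exact h.choose.elim0
  obtain ⟨n, rfl⟩ := Nat.exists_eq_succ_of_ne_zero hn
  have hk : ∀ e : s, ∃ k, t k = T e := fun e => by
    have h : T e ∈ F := Or.inl (Or.inl (Or.inl ⟨e, rfl⟩))
    rw [← ht] at h
    exact h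
  choose k hk using hk
  -- A zero determinant would give an empty slice, which does not contain the generic point, so it
  -- is dropped.
  refine ⟨⟨n, t, {e : s // e.1 ≠ 0}, fun e => k e.1, fun e => ?_, fun e => ?_,
    fun A x hx p => ?_⟩⟩
  · rw [hk, hT]
    exact e.2
  · rw [Set.range_comp' (slicePt j (t (k e.1))).wordDet t, ht]
    rw [hk]
    exact adjoin_slice (fun a l k => Or.inl (Or.inl (Or.inr ⟨⟨e.1, a, l, k⟩, rfl⟩)))
      fun l => Or.inl (Or.inr ⟨⟨e.1, l⟩, rfl⟩)
  · obtain ⟨S, hS⟩ := FramedSpace.exists_wordDet_notMem x hx p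
    obtain ⟨h, rfl⟩ := exists_framed_eval x
    by_contra! hcon
    apply hS
    rw [FramedSpace.wordDet_map]
    have hle : Submodule.span (framedAlg Q d j) (s : Set (framedAlg Q d j)) ≤
        p.asIdeal.comap h.hom.toRingHom := by
      refine Submodule.span_le.2 fun e he => ?_
      by_cases he0 : e = 0
      · rw [he0]; exact Submodule.zero_mem _
      · have := hcon ⟨⟨e, he⟩, he0⟩
        rw [hk, FramedSpace.wordDet_map, hT] at this
        exact this
    rw [← hspan] at hle
    exact hle (Submodule.subset_span ⟨S, rfl⟩)

end QuiverCrit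
end

noncomputable section

namespace QuiverCrit

set_option linter.style.haveILetI false

/-! ### Points of projective space -/

section ProjectivePoints

attribute [local instance] MvPolynomial.gradedAlgebra

/-- The grading of the homogeneous coordinate ring of projective space. -/
abbrev coordGrading (n : ℕ) : ℕ → Submodule ℂ (MvPolynomial (Fin (n + 1)) ℂ) :=
  MvPolynomial.homogeneousSubmodule (Fin (n + 1)) ℂ

variable {n : ℕ}



section

variable {A : Type} [CommRing A] (u : MvPolynomial (Fin (n + 1)) ℂ →+* A)
  {f : MvPolynomial (Fin (n + 1)) ℂ}

/-- Evaluation of homogeneous fractions with denominators the powers of `f`. -/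
def awayEval (hu : IsUnit (u f)) : HomogeneousLocalization.Away (coordGrading n) f →+* A :=
  (IsLocalization.Away.lift (S := Localization.Away f) f hu).comp
    (algebraMap (HomogeneousLocalization.Away (coordGrading n) f) (Localization.Away f))

theorem awayEval_mk (hu : IsUnit (u f)) {m : ℕ} (hf : f ∈ coordGrading n m) (k : ℕ)
    (p : MvPolynomial (Fin (n + 1)) ℂ) (hp : p ∈ coordGrading n (k • m)) :
    awayEval u hu (HomogeneousLocalization.Away.mk (coordGrading n) hf k p hp) * u f ^ k = u p := by
  unfold awayEval
  rw [RingHom.comp_apply, HomogeneousLocalization.algebraMap_apply,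
    HomogeneousLocalization.Away.val_mk]
  have e : Localization.mk p (⟨f ^ k, k, rfl⟩ : Submonoid.powers f) *
      algebraMap _ (Localization.Away f) (f ^ k) = algebraMap _ (Localization.Away f) p := by
    rw [Localization.mk_eq_mk']
    exact IsLocalization.mk'_spec (Localization.Away f) p (⟨f ^ k, k, rfl⟩ : Submonoid.powers f)
  have e1 := congrArg (IsLocalization.Away.lift (S := Localization.Away f) f hu) e
  rwa [map_mul, IsLocalization.Away.lift_eq, IsLocalization.Away.lift_eq, map_pow] at e1

theorem awayEval_ext {R : Type} [CommRing R] {m : ℕ} (hf : f ∈ coordGrading n m)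
    {h h' : HomogeneousLocalization.Away (coordGrading n) f →+* R}
    (e : ∀ k p hp, h (HomogeneousLocalization.Away.mk (coordGrading n) hf k p hp) =
      h' (HomogeneousLocalization.Away.mk (coordGrading n) hf k p hp)) : h = h' := by
  refine RingHom.ext fun z => ?_
  obtain ⟨k, p, hp, rfl⟩ := HomogeneousLocalization.Away.mk_surjective (coordGrading n) hf z
  exact e k p hp

theorem awayEval_awayMap (hu : IsUnit (u f)) {g x : MvPolynomial (Fin (n + 1)) ℂ} {m m' : ℕ}
    (hf : f ∈ coordGrading n m) (hg : g ∈ coordGrading n m') (hx : x = f * g)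
    (hux : IsUnit (u x)) :
    (awayEval u hux).comp (HomogeneousLocalization.awayMap (coordGrading n) hg hx) =
      awayEval u hu := by
  refine awayEval_ext hf fun k p hp => ?_
  rw [RingHom.comp_apply, HomogeneousLocalization.awayMap_mk]
  have hxm : x ∈ coordGrading n (m + m') := hx ▸ SetLike.mul_mem_graded hf hg
  have h1 := awayEval_mk u hux hxm k (p * g ^ k) (by
    rw [smul_add]
    exact SetLike.mul_mem_graded hp (SetLike.pow_mem_graded k hg))
  have h2 := awayEval_mk u hu hf k p hp
  refine (hux.pow k).mul_right_cancel (h1.trans ?_)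
  rw [hx, map_mul, map_mul, mul_pow, ← mul_assoc, h2, map_pow]

/-- The point of projective space with given homogeneous coordinates. -/
def projPt (u : MvPolynomial (Fin (n + 1)) ℂ →+* A) {m : ℕ} (hm : 0 < m)
    (hf : f ∈ coordGrading n m) (hu : IsUnit (u f)) :
    Spec (CommRingCat.of A) ⟶ Proj (coordGrading n) :=
  Spec.map (CommRingCat.ofHom (awayEval u hu)) ≫ Proj.awayι (coordGrading n) f hf hm

/-- The chart of a product is contained in the chart of each factor. The degree `k` is arbitrary so
that products in either order can be compared; `Proj.awayι` does not depend on the degree chosen. -/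
theorem projPt_mul {g x : MvPolynomial (Fin (n + 1)) ℂ} {m m' k : ℕ} (hm : 0 < m)
    (hf : f ∈ coordGrading n m) (hg : g ∈ coordGrading n m') (hk : 0 < k)
    (hx' : x ∈ coordGrading n k) (hx : x = f * g) (hu : IsUnit (u f)) (hux : IsUnit (u x)) :
    projPt u hm hf hu = projPt u hk hx' hux := by
  unfold projPt
  rw [← awayEval_awayMap u hu hf hg hx hux, CommRingCat.ofHom_comp, Spec.map_comp, Category.assoc,
    Proj.SpecMap_awayMap_awayι (coordGrading n) hf hm hg hx]
  have hx1 : x ∈ coordGrading n (m + m') := hx ▸ SetLike.mul_mem_graded hf hg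
  have key : ∀ {a b : ℕ} (ha : x ∈ coordGrading n a) (hb : x ∈ coordGrading n b) (ha' : 0 < a)
      (hb' : 0 < b), Proj.awayι (coordGrading n) x ha ha' = Proj.awayι (coordGrading n) x hb hb' := by
    intro a b ha hb ha' hb'
    rw [← cancel_epi (Proj.basicOpenIsoSpec (coordGrading n) x ha ha').hom]
    unfold Proj.awayι
    rw [Iso.hom_inv_id_assoc, Proj.basicOpenIsoSpec_hom, ← Proj.basicOpenIsoSpec_hom _ _ hb hb',
      Iso.hom_inv_id_assoc]
  congr 1

/-- Both points are compared on the common chart of `f * g`. -/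
theorem projPt_eq {g : MvPolynomial (Fin (n + 1)) ℂ} {m m' : ℕ} (hm : 0 < m)
    (hf : f ∈ coordGrading n m) (hm' : 0 < m') (hg : g ∈ coordGrading n m') (hu : IsUnit (u f))
    (hu' : IsUnit (u g)) : projPt u hm hf hu = projPt u hm' hg hu' := by
  have h : IsUnit (u (f * g)) := by rw [map_mul]; exact hu.mul hu'
  rw [projPt_mul u hm hf hg (Nat.add_pos_left hm m') (SetLike.mul_mem_graded hf hg) rfl hu h,
    projPt_mul u hm' hg hf (Nat.add_pos_left hm m') (SetLike.mul_mem_graded hf hg)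
      (mul_comm f g) hu' h]

end

section

variable {A B : CommAlgCat.{0} ℂ}

theorem X_mem_coordGrading (k : Fin (n + 1)) : MvPolynomial.X k ∈ coordGrading n 1 :=
  MvPolynomial.isHomogeneous_X ℂ k

/-- The point of projective space with homogeneous coordinates `c`, of which `c k` is invertible. -/
def coordPt (c : Fin (n + 1) → A) (k : Fin (n + 1)) (h : IsUnit (c k)) : specAlg A ⟶ projSpace n :=
  projPt (MvPolynomial.aeval (R := ℂ) c).toRingHom (f := MvPolynomial.X k) one_pos (X_mem_coordGrading k)
    (by
      have e : (MvPolynomial.aeval (R := ℂ) c).toRingHom (MvPolynomial.X k) = c k :=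
        MvPolynomial.aeval_X c k
      rwa [e])

theorem coordPt_eq (c : Fin (n + 1) → A) {k l : Fin (n + 1)} (hk : IsUnit (c k)) (hl : IsUnit (c l)) :
    coordPt c k hk = coordPt c l hl :=
  projPt_eq (MvPolynomial.aeval (R := ℂ) c).toRingHom _ _ _ _ _ _

/-- Evaluation of the affine coordinates on a standard chart of projective space. -/
def coordEval (c : Fin (n + 1) → A) (k : Fin (n + 1)) (h : IsUnit (c k)) :
    HomogeneousLocalization.Away (coordGrading n) (MvPolynomial.X k) →+* A :=
  awayEval (MvPolynomial.aeval (R := ℂ) c).toRingHom (by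
    have e : (MvPolynomial.aeval (R := ℂ) c).toRingHom (MvPolynomial.X k) = c k :=
      MvPolynomial.aeval_X c k
    rwa [e])

/-- The quotient of two homogeneous coordinates. -/
def coordQuot (k l : Fin (n + 1)) :
    HomogeneousLocalization.Away (coordGrading n) (MvPolynomial.X k) :=
  HomogeneousLocalization.Away.mk (coordGrading n) (X_mem_coordGrading k) 1 (MvPolynomial.X l)
    (X_mem_coordGrading l)

variable (n) in
/-- The standard charts of projective space. -/
def chartι (k : Fin (n + 1)) :
    Spec (CommRingCat.of (HomogeneousLocalization.Away (coordGrading n) (MvPolynomial.X k))) ⟶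
      projSpace n :=
  Proj.awayι (coordGrading n) (MvPolynomial.X k) (X_mem_coordGrading k) one_pos

instance (k : Fin (n + 1)) : IsOpenImmersion (chartι n k) :=
  inferInstanceAs (IsOpenImmersion (Proj.awayι (coordGrading n) _ (X_mem_coordGrading k) one_pos))

theorem coordPt_def (c : Fin (n + 1) → A) (k : Fin (n + 1)) (h : IsUnit (c k)) :
    coordPt c k h = Spec.map (CommRingCat.ofHom (coordEval c k h)) ≫ chartι n k := rfl

theorem coordEval_mk (c : Fin (n + 1) → A) (k : Fin (n + 1)) (h : IsUnit (c k)) (m : ℕ)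
    (p : MvPolynomial (Fin (n + 1)) ℂ) (hp : p ∈ coordGrading n (m • 1)) :
    coordEval c k h (HomogeneousLocalization.Away.mk (coordGrading n) (X_mem_coordGrading k) m p hp) *
      c k ^ m = MvPolynomial.aeval c p := by
  have e := awayEval_mk (MvPolynomial.aeval (R := ℂ) c).toRingHom (f := MvPolynomial.X k) (by
    have e : (MvPolynomial.aeval (R := ℂ) c).toRingHom (MvPolynomial.X k) = c k :=
      MvPolynomial.aeval_X c k
    rwa [e]) (X_mem_coordGrading k) m p hp
  have e1 : (MvPolynomial.aeval (R := ℂ) c).toRingHom (MvPolynomial.X k) = c k :=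
    MvPolynomial.aeval_X c k
  exact (congrArg (fun z => coordEval c k h _ * z ^ m) e1.symm).trans e

theorem coordEval_coordQuot (c : Fin (n + 1) → A) (k : Fin (n + 1)) (h : IsUnit (c k))
    (l : Fin (n + 1)) : coordEval c k h (coordQuot k l) * c k = c l := by
  have := coordEval_mk c k h 1 (MvPolynomial.X l) (X_mem_coordGrading l)
  rwa [pow_one, MvPolynomial.aeval_X] at this

theorem coordEval_comp (c : Fin (n + 1) → A) (k : Fin (n + 1)) (h : IsUnit (c k)) (f : A ⟶ B)
    (h' : IsUnit (f.hom (c k))) :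
    f.hom.toRingHom.comp (coordEval c k h) = coordEval (fun l => f.hom (c l)) k h' := by
  refine awayEval_ext (X_mem_coordGrading k) fun m p hp => ?_
  refine (h'.pow m).mul_right_cancel ?_
  rw [coordEval_mk (fun l => f.hom (c l)) k h' m p hp]
  have e := congrArg f.hom (coordEval_mk c k h m p hp)
  rw [map_mul, map_pow] at e
  refine e.trans ?_
  exact (MvPolynomial.comp_aeval_apply c f.hom p).symm ▸ rfl

theorem specMap_coordPt (c : Fin (n + 1) → A) (k : Fin (n + 1)) (h : IsUnit (c k)) (f : A ⟶ B)
    (h' : IsUnit (f.hom (c k))) :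
    specMap f ≫ coordPt c k h = coordPt (fun l => f.hom (c l)) k h' := by
  rw [coordPt_def, coordPt_def, ← coordEval_comp c k h f h', CommRingCat.ofHom_comp, Spec.map_comp]
  exact (Category.assoc _ _ _).symm

/-- In a homogeneous fraction of degree zero the factor `r ^ m` cancels between numerator and
denominator. -/
theorem coordPt_smul (c : Fin (n + 1) → A) (k : Fin (n + 1)) (h : IsUnit (c k)) (r : A)
    (h' : IsUnit (r * c k)) : coordPt (fun l => r * c l) k h' = coordPt c k h := by
  have e : coordEval (fun l => r * c l) k h' = coordEval c k h := by
    refine awayEval_ext (X_mem_coordGrading k) fun m p hp => ?_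
    refine (h'.pow m).mul_right_cancel ?_
    rw [coordEval_mk (fun l => r * c l) k h' m p hp, mul_pow, mul_left_comm, coordEval_mk]
    have hp' : p.IsHomogeneous m := by
      have : p ∈ coordGrading n (m • 1) := hp
      rwa [smul_eq_mul, mul_one] at this
    rw [MvPolynomial.aeval_def, MvPolynomial.aeval_def, MvPolynomial.eval₂_eq, MvPolynomial.eval₂_eq,
      Finset.mul_sum]
    refine Finset.sum_congr rfl fun s hs => ?_
    have hd := hp' (MvPolynomial.mem_support_iff.1 hs)
    rw [Finsupp.weight_apply, Finsupp.sum] at hd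
    simp only [Pi.one_apply, smul_eq_mul, mul_one] at hd
    rw [mul_left_comm, ← hd, ← Finset.prod_pow_eq_pow_sum, ← Finset.prod_mul_distrib]
    congr 1
    exact Finset.prod_congr rfl fun l _ => (mul_pow _ _ _)
  rw [coordPt_def, coordPt_def, e]

theorem coordPt_comp_str (c : Fin (n + 1) → A) (k : Fin (n + 1)) (h : IsUnit (c k)) :
    coordPt c k h ≫ projSpaceStr n = specStr A := by
  have e : chartι n k ≫ projSpaceStr n = Spec.map (CommRingCat.ofHom
      ((HomogeneousLocalization.fromZeroRingHom (coordGrading n) _).comp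
        (algebraMap ℂ (coordGrading n 0)))) := by
    refine (Proj.awayι_toSpecZero_assoc (coordGrading n) (MvPolynomial.X k) (X_mem_coordGrading k)
      one_pos _).trans ?_
    rw [← Spec.map_comp]
    rfl
  rw [coordPt_def, Category.assoc, e, ← Spec.map_comp]
  refine congrArg Spec.map (CommRingCat.hom_ext (RingHom.ext fun z => ?_))
  change coordEval c k h (HomogeneousLocalization.fromZeroRingHom (coordGrading n)
    (Submonoid.powers (MvPolynomial.X k)) (algebraMap ℂ (coordGrading n 0) z)) = algebraMap ℂ A z
  have hz : (MvPolynomial.C z : MvPolynomial (Fin (n + 1)) ℂ) ∈ coordGrading n (0 • 1) := by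
    rw [zero_smul]
    exact MvPolynomial.isHomogeneous_C _ z
  have e1 : HomogeneousLocalization.fromZeroRingHom (coordGrading n)
      (Submonoid.powers (MvPolynomial.X k)) (algebraMap ℂ (coordGrading n 0) z) =
      HomogeneousLocalization.Away.mk (coordGrading n) (X_mem_coordGrading k) 0 (MvPolynomial.C z) hz := by
    apply HomogeneousLocalization.val_injective
    rw [HomogeneousLocalization.Away.val_mk]
    refine congrArg (Localization.mk _) (Subtype.ext ?_)
    exact (pow_zero _).symm
  have e2 := coordEval_mk c k h 0 (MvPolynomial.C z) hz
  rw [pow_zero, mul_one, MvPolynomial.aeval_C] at e2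
  rw [e1, e2]

theorem chartι_preimage (k l : Fin (n + 1)) :
    chartι n l ⁻¹ᵁ (chartι n k).opensRange = PrimeSpectrum.basicOpen (coordQuot l k) := by
  have e := Proj.awayι_preimage_basicOpen (coordGrading n)
    (X_mem_coordGrading l) one_pos (X_mem_coordGrading k) one_pos
  rw [← Proj.opensRange_awayι _ _ (X_mem_coordGrading k) one_pos] at e
  refine Eq.trans e ?_
  congr 1
  unfold HomogeneousLocalization.Away.isLocalizationElem coordQuot
  congr 1
  exact pow_one _

/-- The common point lies in the chart `k`. Seen from the chart `l`, this means that the ratio of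
the coordinates `k` and `l` of `c'` is invertible. Thus equality of points in projective space
detects when a framed point can be normalised in another slice. -/
theorem isUnit_of_coordPt_eq {c c' : Fin (n + 1) → A} {k l : Fin (n + 1)} {h : IsUnit (c k)}
    {h' : IsUnit (c' l)} (e : coordPt c k h = coordPt c' l h') : IsUnit (c' k) := by
  rw [coordPt_def, coordPt_def] at e
  have h1 : (Spec.map (CommRingCat.ofHom (coordEval c' l h')) ≫ chartι n l) ⁻¹ᵁ
      (chartι n k).opensRange = ⊤ := by
    rw [← e, Scheme.Hom.comp_preimage, Scheme.Hom.preimage_opensRange]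
    rfl
  rw [Scheme.Hom.comp_preimage, chartι_preimage] at h1
  have h2 : PrimeSpectrum.basicOpen (coordEval c' l h' (coordQuot l k)) = ⊤ := h1
  have h3 : IsUnit (coordEval c' l h' (coordQuot l k)) := by
    rw [← Ideal.span_singleton_eq_top, ← Set.range_const (ι := Unit),
      ← PrimeSpectrum.iSup_basicOpen_eq_top_iff, iSup_const]
    exact h2
  rw [← coordEval_coordQuot c' l h' k]
  exact h3.mul h'

end

end ProjectivePoints

end QuiverCrit
end

/-! ### Construction of the moduli scheme inside projective space -/

noncomputable section

namespace QuiverCrit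

set_option linter.style.haveILetI false

theorem specMap_id (A : CommAlgCat.{0} ℂ) : specMap (𝟙 A) = 𝟙 (specAlg A) := Spec.map_id _

theorem specMap_comp {A B C : CommAlgCat.{0} ℂ} (f : A ⟶ B) (g : B ⟶ C) :
    specMap (f ≫ g) = specMap g ≫ specMap f :=
  Spec.map_comp (CommRingCat.ofHom f.hom.toRingHom) (CommRingCat.ofHom g.hom.toRingHom)

theorem specMap_str {A B : CommAlgCat.{0} ℂ} (f : A ⟶ B) : specMap f ≫ specStr A = specStr B := by
  unfold specMap specStr
  rw [← Spec.map_comp, ← CommRingCat.ofHom_comp]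
  congr 2
  exact f.hom.comp_algebraMap

/-! ### Locally closed subschemes glued from charts -/

/-- This computes, over an affine open, the ideal of the scheme-theoretic image of a `K`-point
factoring through that open. -/
theorem ker_app_eq {X : Scheme.{0}} {K : CommRingCat.{0}} {U : X.Opens} (hU : IsAffineOpen U)
    (a : Γ(X, U) ⟶ K) (g : Spec K ⟶ X) (hg : g = Spec.map a ≫ hU.fromSpec) :
    RingHom.ker (g.app U).hom = RingHom.ker a.hom := by
  have hV : g ⁻¹ᵁ U = ⊤ := by
    rw [hg, Scheme.Hom.comp_preimage, hU.fromSpec_preimage_self]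
    rfl
  have e := hU.SpecMap_appLE_fromSpec g (isAffineOpen_top (Spec K)) hV.ge
  have e0 : (isAffineOpen_top (Spec K)).fromSpec ≫ g =
      Spec.map (a ≫ (Scheme.ΓSpecIso K).inv) ≫ hU.fromSpec := by
    rw [IsAffineOpen.fromSpec_top, Scheme.isoSpec_Spec_inv, Spec.map_comp, Category.assoc, ← hg]
  rw [e0, cancel_mono] at e
  have e1 := Spec.map_injective e
  have e2 : g.app U = a ≫ (Scheme.ΓSpecIso K).inv ≫ (Spec K).presheaf.map (eqToHom hV).op := by
    have := congrArg (· ≫ (Spec K).presheaf.map (eqToHom hV).op) e1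
    simp only [Category.assoc] at this
    rw [← this, Scheme.Hom.appLE, Category.assoc, ← Functor.map_comp]
    refine (Category.comp_id _).symm.trans (congrArg (g.app U ≫ ·) ?_)
    exact ((Spec K).presheaf.map_id _).symm
  have hi : Function.Injective ((Scheme.ΓSpecIso K).inv ≫ (Spec K).presheaf.map (eqToHom hV).op).hom :=
    (ConcreteCategory.bijective_of_isIso _).1
  rw [e2]
  ext z
  exact ⟨fun h => hi (h.trans (map_zero _).symm), fun h =>
    (congrArg ((Scheme.ΓSpecIso K).inv ≫ (Spec K).presheaf.map (eqToHom hV).op).hom h).trans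
      (map_zero _)⟩

/-- The affine charts of a closed subscheme. -/
def subschemeChart {X : Scheme.{0}} (I : X.IdealSheafData) (U : X.affineOpens) :
    Spec (CommRingCat.of (Γ(X, U) ⧸ I.ideal U)) ⟶ I.subscheme := I.subschemeCover.f U

instance {X : Scheme.{0}} (I : X.IdealSheafData) (U : X.affineOpens) :
    IsOpenImmersion (subschemeChart I U) := I.subschemeCover.map_prop U

theorem subschemeChart_ι {X : Scheme.{0}} (I : X.IdealSheafData) (U : X.affineOpens) :
    subschemeChart I U ≫ I.subschemeι =
      Spec.map (CommRingCat.ofHom (Ideal.Quotient.mk (I.ideal U))) ≫ U.2.fromSpec :=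
  (I.subschemeCover_map_subschemeι U).trans (I.glueDataObjι_ι U)

/-- An affine chart of a subscheme. -/
theorem exists_subscheme_chart {X : Scheme.{0}} [QuasiSeparatedSpace X] {Λ S K : CommRingCat.{0}} (χ : Spec Λ ⟶ X)
    [IsOpenImmersion χ] (θ : Λ ⟶ S) (hθ : Function.Surjective θ.hom) (ν : S ⟶ K)
    (hν : Function.Injective ν.hom) (g : Spec K ⟶ X) (hg : Spec.map (θ ≫ ν) ≫ χ = g) :
    ∃ q : Spec S ⟶ g.ker.subscheme, IsOpenImmersion q ∧
      q ≫ g.ker.subschemeι = Spec.map θ ≫ χ := by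
  have hU : IsAffineOpen χ.opensRange := isAffineOpen_opensRange χ
  let e := IsOpenImmersion.isoOfRangeEq χ hU.fromSpec (by
    rw [hU.range_fromSpec]; rfl)
  have he : e.hom ≫ hU.fromSpec = χ := IsOpenImmersion.isoOfRangeEq_hom_fac _ _ _
  obtain ⟨a, ha⟩ : ∃ a, Spec.map a = e.hom := ⟨Spec.preimage e.hom, Spec.map_preimage _⟩
  have hbij : Function.Bijective a.hom := by
    have : IsIso (Spec.map a) := by rw [ha]; infer_instance
    exact isIso_SpecMap_iff.1 this
  have hsurj : Function.Surjective (a ≫ θ).hom := hθ.comp hbij.2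
  have hqc : QuasiCompact g := quasiCompact_of_compactSpace g
  let U : X.affineOpens := ⟨χ.opensRange, hU⟩
  -- Because `S` embeds in `K`, the functions on this chart killed at the generic point are exactly
  -- those vanishing on `Spec S`.
  have hker : g.ker.ideal U = RingHom.ker (a ≫ θ).hom := by
    rw [Scheme.Hom.ker_apply]
    refine (ker_app_eq hU (a ≫ θ ≫ ν) g ?_).trans ?_
    · rw [Spec.map_comp, Category.assoc, ha, he, hg]
    · ext z
      exact ⟨fun h => hν (h.trans (map_zero _).symm), fun h => (congrArg ν.hom h).trans (map_zero _)⟩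
  let ψ : (Γ(X, U) ⧸ g.ker.ideal U) ≃+* S :=
    (Ideal.quotEquivOfEq hker).trans (RingHom.quotientKerEquivOfSurjective hsurj)
  have hψ : CommRingCat.ofHom (Ideal.Quotient.mk (g.ker.ideal U)) ≫ CommRingCat.ofHom ψ.toRingHom =
      a ≫ θ := rfl
  have hψ' : IsIso (CommRingCat.ofHom ψ.toRingHom) := ψ.toCommRingCatIso.isIso_hom
  refine ⟨Spec.map (CommRingCat.ofHom ψ.toRingHom) ≫ subschemeChart g.ker U,
    IsOpenImmersion.comp _ _, ?_⟩
  rw [Category.assoc, subschemeChart_ι, ← Category.assoc]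
  refine (congrArg (· ≫ hU.fromSpec) ((Spec.map_comp _ _).symm.trans (congrArg Spec.map hψ))).trans ?_
  rw [Spec.map_comp, Category.assoc, ha, he]

/-- All charts have the same `K`-point, dense in each because the rings `S i` embed in `K`. Its
scheme-theoretic image restricts to `Spec (S i)` on each chart, so the `Spec (S i)` are open in one
closed subscheme and `R` is their union. No transition maps have to be constructed. -/
theorem exists_glued_charts {X : Scheme.{0}} [QuasiSeparatedSpace X] {ι : Type} {Λ S : ι → CommRingCat.{0}} {K : CommRingCat.{0}}
    (χ : ∀ i, Spec (Λ i) ⟶ X) (hχ : ∀ i, IsOpenImmersion (χ i)) (θ : ∀ i, Λ i ⟶ S i)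
    (hθ : ∀ i, Function.Surjective (θ i).hom) (ν : ∀ i, S i ⟶ K)
    (hν : ∀ i, Function.Injective (ν i).hom)
    (hg : ∀ i l, Spec.map (θ i ≫ ν i) ≫ χ i = Spec.map (θ l ≫ ν l) ≫ χ l) :
    ∃ (R : Scheme.{0}) (m : R ⟶ X) (q : ∀ i, Spec (S i) ⟶ R), IsImmersion m ∧
      (∀ i, IsOpenImmersion (q i)) ∧ (∀ r : R, ∃ i, r ∈ Set.range (q i)) ∧
      ∀ i, q i ≫ m = Spec.map (θ i) ≫ χ i := by
  -- Without charts there is no point to take the image of; the empty open subscheme serves.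
  rcases isEmpty_or_nonempty ι with h | ⟨⟨i₀⟩⟩
  · refine ⟨(⊥ : X.Opens).toScheme, (⊥ : X.Opens).ι, fun i => (h.false i).elim, inferInstance,
      fun i => (h.false i).elim, fun r => r.2.elim, fun i => (h.false i).elim⟩
  let g := Spec.map (θ i₀ ≫ ν i₀) ≫ χ i₀
  choose q hq hqι using fun i => exists_subscheme_chart (χ i) (θ i) (hθ i) (ν i) (hν i) g (hg i i₀)
  let V : g.ker.subscheme.Opens := ⨆ i, (q i).opensRange
  have hV : ∀ i, Set.range (q i) ⊆ Set.range V.ι := fun i => by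
    rw [Scheme.Opens.range_ι]
    exact le_iSup (fun i => (q i).opensRange) i
  have hl : ∀ i, IsOpenImmersion.lift V.ι (q i) (hV i) ≫ V.ι = q i := fun i =>
    IsOpenImmersion.lift_fac _ _ _
  refine ⟨V.toScheme, V.ι ≫ g.ker.subschemeι, fun i => IsOpenImmersion.lift V.ι (q i) (hV i),
    inferInstance, fun i => ?_, fun r => ?_, fun i => ?_⟩
  · have : IsOpenImmersion (IsOpenImmersion.lift V.ι (q i) (hV i) ≫ V.ι) := by
      rw [hl]; exact hq i
    exact IsOpenImmersion.of_comp _ V.ι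
  · obtain ⟨i, z, hz⟩ := TopologicalSpace.Opens.mem_iSup.1 r.2
    refine ⟨i, z, ?_⟩
    apply V.ι.isOpenEmbedding.injective
    rw [← Scheme.Hom.comp_apply, hl]
    exact hz
  · rw [← Category.assoc, hl, hqι]

/-! ### The moduli space of framed representations -/

attribute [local instance] MvPolynomial.gradedAlgebra

/-- With the `k`-th coordinate normalised to one, the affine coordinates map to the `c l`, which
generate the algebra. This makes a slice closed in a standard chart. -/
theorem coordEval_surjective {n : ℕ} {A : CommAlgCat.{0} ℂ} {c : Fin (n + 1) → A} {k : Fin (n + 1)}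
    (hk : c k = 1) (hc : Algebra.adjoin ℂ (Set.range c) = ⊤) (h : IsUnit (c k)) :
    Function.Surjective (coordEval c k h) := by
  intro r
  have hr : r ∈ Algebra.adjoin ℂ (Set.range c) := by rw [hc]; trivial
  obtain ⟨p, rfl⟩ : ∃ p, MvPolynomial.aeval c p = r := by
    rw [Algebra.adjoin_range_eq_range_aeval] at hr
    exact hr
  induction p using MvPolynomial.induction_on with
  | C z =>
    refine ⟨HomogeneousLocalization.Away.mk (coordGrading n) (X_mem_coordGrading k) 0
      (MvPolynomial.C z) ?_, ?_⟩
    · rw [zero_smul]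
      exact MvPolynomial.isHomogeneous_C _ z
    · have := coordEval_mk c k h 0 (MvPolynomial.C z) (by
        rw [zero_smul]
        exact MvPolynomial.isHomogeneous_C _ z)
      rwa [pow_zero, mul_one] at this
  | add p q hp hq =>
    obtain ⟨y, hy⟩ := hp (by rw [hc]; trivial)
    obtain ⟨z, hz⟩ := hq (by rw [hc]; trivial)
    exact ⟨y + z, by rw [map_add, map_add, hy, hz]⟩
  | mul_X p l hp =>
    obtain ⟨y, hy⟩ := hp (by rw [hc]; trivial)
    refine ⟨y * coordQuot k l, ?_⟩
    have := coordEval_coordQuot c k h l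
    rw [hk, mul_one] at this
    rw [map_mul, map_mul, hy, this, MvPolynomial.aeval_X]

variable {Q : FinQuiver} {d : Q.V → ℕ} {j : Q.V}

theorem coordPt_congr {n : ℕ} {A : CommAlgCat.{0} ℂ} {c c' : Fin (n + 1) → A} {k l : Fin (n + 1)}
    (e : c = c') (h : IsUnit (c k)) (h' : IsUnit (c' l)) : coordPt c k h = coordPt c' l h' := by
  subst e
  exact coordPt_eq c h h'

namespace SliceData

variable (D : SliceData Q d j)

/-- The coordinate ring of a slice. -/
abbrev alg (i : D.ι) : CommAlgCat.{0} ℂ := sliceAlg j (D.t (D.k i))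

/-- The tautological point of a slice. -/
abbrev pt (i : D.ι) : FramedSpace Q d j (D.alg i) := slicePt j (D.t (D.k i))

variable {D} in
/-- The homogeneous coordinates of a framed representation. -/
abbrev coord {A : Type} [CommRing A] (x : FramedSpace Q d j A) : Fin (D.n + 1) → A :=
  fun l => x.wordDet (D.t l)

theorem coord_k (i : D.ι) : (D.pt i).wordDet (D.t (D.k i)) = 1 := (slicePt_isNormal j _).wordDet

theorem isUnit_coord (i : D.ι) : IsUnit ((D.pt i).wordDet (D.t (D.k i))) := by
  rw [D.coord_k]; exact isUnit_one

/-- The point of projective space given by the homogeneous coordinates of a framed representation. -/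
def projPoint {A : CommAlgCat.{0} ℂ} (x : FramedSpace Q d j A) (k : Fin (D.n + 1))
    (h : IsUnit (x.wordDet (D.t k))) : specAlg A ⟶ projSpace D.n := coordPt (coord (D := D) x) k h

theorem projPoint_smul_map {A B : CommAlgCat.{0} ℂ} (x : FramedSpace Q d j A) (f : A ⟶ B)
    (g : GLProd Q d B) {k l : Fin (D.n + 1)} (h : IsUnit (x.wordDet (D.t k)))
    (h' : IsUnit ((g • x.map f.hom.toRingHom).wordDet (D.t l))) :
    D.projPoint (g • x.map f.hom.toRingHom) l h' = specMap f ≫ D.projPoint x k h := by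
  have hk : IsUnit (f.hom (coord (D := D) x k)) := h.map f.hom
  have e : coord (D := D) (g • x.map f.hom.toRingHom) =
      fun l => (∏ i, (g i).1.det) * f.hom (coord (D := D) x l) :=
    funext fun l => x.wordDet_smul_map f g (D.t l)
  have hg : IsUnit (∏ i, (g i).1.det) :=
    IsUnit.prod_univ_iff.2 fun i => (Matrix.isUnit_iff_isUnit_det _).1 (g i).isUnit
  unfold projPoint
  rw [specMap_coordPt _ k h f hk, ← coordPt_smul _ k hk _ (hg.mul hk)]
  exact coordPt_congr e _ _

theorem projPoint_map {A B : CommAlgCat.{0} ℂ} (x : FramedSpace Q d j A) (f : A ⟶ B)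
    {k l : Fin (D.n + 1)} (h : IsUnit (x.wordDet (D.t k)))
    (h' : IsUnit ((x.map f.hom.toRingHom).wordDet (D.t l))) :
    D.projPoint (x.map f.hom.toRingHom) l h' = specMap f ≫ D.projPoint x k h := by
  rw [← D.projPoint_smul_map x f 1 h (l := l) (by rwa [one_smul])]
  exact coordPt_congr (by rw [one_smul]) _ _

theorem projPoint_smul {A : CommAlgCat.{0} ℂ} (x : FramedSpace Q d j A) (g : GLProd Q d A)
    {k l : Fin (D.n + 1)} (h : IsUnit (x.wordDet (D.t k)))
    (h' : IsUnit ((g • x).wordDet (D.t l))) : D.projPoint (g • x) l h' = D.projPoint x k h := by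
  refine (D.projPoint_smul_map x (𝟙 A) g h h').trans ?_
  rw [specMap_id, Category.id_comp]

/-- A complex scheme glued from the slices, locally closed in projective space. -/
structure Gluing where
  R : Scheme.{0}
  m : R ⟶ projSpace D.n
  q : ∀ i, specAlg (D.alg i) ⟶ R
  immersion : IsImmersion m
  isOpen : ∀ i, IsOpenImmersion (q i)
  covers : ∀ r : R, ∃ i, r ∈ Set.range (q i)
  q_m : ∀ i, q i ≫ m = D.projPoint (D.pt i) (D.k i) (D.isUnit_coord i)

/-- The generic framed representation can be moved into every slice, and its homogeneous coordinates
do not see the group. Hence all slices have the same generic point in projective space. -/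
theorem nonempty_gluing : Nonempty D.Gluing := by
  have hsep : QuasiSeparatedSpace (projSpace D.n) := by
    have : (projSpace D.n).IsSeparated :=
      inferInstanceAs (Proj (coordGrading D.n)).IsSeparated
    infer_instance
  choose ν g hν hg using fun i => exists_slice_generic (D.ne i)
  obtain ⟨R, m, q, hm, hq, hc, hqm⟩ := exists_glued_charts (X := projSpace D.n) (ι := D.ι)
    (fun i => chartι D.n (D.k i)) (fun i => inferInstance)
    (fun i => CommRingCat.ofHom (coordEval (coord (D := D) (D.pt i)) (D.k i) (D.isUnit_coord i)))
    (fun i => coordEval_surjective (D.coord_k i) (D.adjoin i) (D.isUnit_coord i))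
    (fun i => CommRingCat.ofHom (ν i).hom.toRingHom) hν (by
      have key : ∀ i, ∃ h, specMap (ν i) ≫ D.projPoint (D.pt i) (D.k i) (D.isUnit_coord i) =
          D.projPoint (genFramed Q d j) (D.k i) h := fun i => by
        letI := (isField_framedField (Q := Q) (d := d) (j := j)).toField
        have h : IsUnit ((genFramed Q d j).wordDet (D.t (D.k i))) := by
          refine IsUnit.mk0 _ fun e => D.ne i (toFramedField_injective ?_)
          rw [map_zero, ← FramedSpace.wordDet_map]
          exact e
        have h1 : IsUnit ((g i • genFramed Q d j).wordDet (D.t (D.k i))) := by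
          rw [← hg, FramedSpace.wordDet_map]
          exact (D.isUnit_coord i).map (ν i).hom
        refine ⟨h, ?_⟩
        rw [← D.projPoint_smul _ _ h h1]
        refine (D.projPoint_map (l := D.k i) _ _ _ (hg i ▸ h1)).symm.trans ?_
        exact coordPt_congr (congrArg coord (hg i)) _ _
      intro i l
      obtain ⟨h, e⟩ := key i
      obtain ⟨h', e'⟩ := key l
      have := (e.trans (coordPt_congr rfl _ _)).trans e'.symm
      rw [Spec.map_comp, Spec.map_comp, Category.assoc, Category.assoc]
      exact this)
  exact ⟨⟨R, m, q, hm, hq, hc, hqm⟩⟩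

end SliceData

end QuiverCrit
end

noncomputable section

namespace QuiverCrit

set_option linter.style.haveILetI false

/-! ### Morphisms from affine complex schemes -/

theorem specMap_injective {A B : CommAlgCat.{0} ℂ} {f g : A ⟶ B} (h : specMap f = specMap g) :
    f = g := by
  have e := Spec.map_injective h
  refine CommAlgCat.hom_ext (AlgHom.ext fun a => ?_)
  exact congrArg (fun u : CommRingCat.of A ⟶ CommRingCat.of B => u.hom a) e

theorem exists_specMap {A B : CommAlgCat.{0} ℂ} (r : specAlg B ⟶ specAlg A)
    (h : r ≫ specStr A = specStr B) : ∃ f : A ⟶ B, specMap f = r := by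
  let f := Spec.preimage r
  have hf : Spec.map f = r := Spec.map_preimage r
  have hc : ∀ z, f.hom (algebraMap ℂ A z) = algebraMap ℂ B z := fun z => by
    have e : Spec.map (CommRingCat.ofHom (algebraMap ℂ A) ≫ f) =
        Spec.map (CommRingCat.ofHom (algebraMap ℂ B)) := by
      rw [Spec.map_comp, hf]
      exact h
    exact congrArg (fun u : CommRingCat.of ℂ ⟶ CommRingCat.of B => u.hom z) (Spec.map_injective e)
  exact ⟨CommAlgCat.ofHom { f.hom with commutes' := hc }, hf⟩

/-- Morphisms out of a complex scheme are determined by their values on points over complex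
algebras. -/
theorem hom_ext_points {P R : Scheme.{0}} (p : P ⟶ SpecC) {a b : P ⟶ R}
    (h : ∀ (B : CommAlgCat.{0} ℂ) (t : specAlg B ⟶ P), t ≫ p = specStr B → t ≫ a = t ≫ b) :
    a = b := by
  refine P.affineCover.hom_ext _ _ fun i => ?_
  obtain ⟨c, hc⟩ : ∃ c, Spec.map c = P.affineCover.f i ≫ p := ⟨_, Spec.map_preimage _⟩
  letI : Algebra ℂ (P.affineOpenCover.X i) := c.hom.toAlgebra
  exact h (CommAlgCat.of ℂ (P.affineOpenCover.X i)) (P.affineCover.f i) hc.symm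

/-- Agreement on a fibre product is tested on points over complex algebras, so overlaps of charts
never have to be computed as schemes. -/
theorem comp_eq_comp_of_points {A S T : CommAlgCat.{0} ℂ} {P R : Scheme.{0}} (f : A ⟶ S) (g : A ⟶ T)
    {a : P ⟶ specAlg S} {b : P ⟶ specAlg T} (e : a ≫ specMap f = b ≫ specMap g)
    {r : specAlg S ⟶ R} {r' : specAlg T ⟶ R}
    (h : ∀ (B : CommAlgCat.{0} ℂ) (k : S ⟶ B) (k' : T ⟶ B), f ≫ k = g ≫ k' →
      specMap k ≫ r = specMap k' ≫ r') : a ≫ r = b ≫ r' := by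
  refine hom_ext_points (a ≫ specStr S) fun B t ht => ?_
  obtain ⟨k, hk⟩ := exists_specMap (t ≫ a) ((Category.assoc _ _ _).trans ht)
  obtain ⟨k', hk'⟩ := exists_specMap (t ≫ b) (by
    rw [Category.assoc, ← specMap_str g, ← Category.assoc b, ← e, Category.assoc, specMap_str]
    exact ht)
  rw [← Category.assoc, ← Category.assoc, ← hk, ← hk']
  refine h B k k' (specMap_injective ?_)
  rw [specMap_comp, specMap_comp, hk, hk', Category.assoc, Category.assoc, e]

section Away

variable {A : CommAlgCat.{0} ℂ} {R : Scheme.{0}}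

theorem span_range_eq_top {I : Type} {f : I → A} (hf : ∀ p : PrimeSpectrum A, ∃ i, f i ∉ p.asIdeal) :
    Ideal.span (Set.range f) = ⊤ := by
  by_contra hne
  obtain ⟨m, hm, hle⟩ := Ideal.exists_le_maximal _ hne
  obtain ⟨i, hi⟩ := hf ⟨m, hm.isPrime⟩
  exact hi (hle (Ideal.subset_span ⟨i, rfl⟩))

/-- The cover of an affine scheme by localizations. -/
def awayCover {I : Type} (f : I → A) (hf : ∀ p : PrimeSpectrum A, ∃ i, f i ∉ p.asIdeal) :
    (specAlg A).OpenCover :=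
  (Scheme.affineOpenCoverOfSpanRangeEqTop (R := CommRingCat.of A) f
    (span_range_eq_top hf)).openCover

theorem hom_ext_away {r r' : specAlg A ⟶ R}
    (h : ∀ p : PrimeSpectrum A, ∃ f ∉ p.asIdeal, specMap (toAway f) ≫ r = specMap (toAway f) ≫ r') :
    r = r' := by
  choose f hf hr using h
  exact (awayCover f fun p => ⟨p, hf p⟩).hom_ext _ _ hr

theorem exists_glue_away {I : Type} (f : I → A) (hf : ∀ p : PrimeSpectrum A, ∃ i, f i ∉ p.asIdeal)
    (r : ∀ i, specAlg (awayAlg (f i)) ⟶ R)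
    (hr : ∀ (i i' : I) (B : CommAlgCat.{0} ℂ) (b : awayAlg (f i) ⟶ B)
      (b' : awayAlg (f i') ⟶ B), toAway (f i) ≫ b = toAway (f i') ≫ b' →
        specMap b ≫ r i = specMap b' ≫ r i') :
    ∃ r' : specAlg A ⟶ R, ∀ i, specMap (toAway (f i)) ≫ r' = r i := by
  refine ⟨(awayCover f hf).glueMorphisms r fun i i' => ?_,
    fun i => (awayCover f hf).ι_glueMorphisms r _ i⟩
  exact comp_eq_comp_of_points (toAway (f i)) (toAway (f i')) Limits.pullback.condition (hr i i')

/-- A morphism to a scheme locally factors through the members of an open cover. -/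
theorem exists_away_factor {ι : Type} {S : ι → CommAlgCat.{0} ℂ} {s : R ⟶ SpecC}
    (q : ∀ i, specAlg (S i) ⟶ R) (hq : ∀ i, IsOpenImmersion (q i)) (hs : ∀ i, q i ≫ s = specStr (S i))
    (hc : ∀ r : R, ∃ i, r ∈ Set.range (q i)) (r : specAlg A ⟶ R) (hr : r ≫ s = specStr A)
    (p : PrimeSpectrum A) : ∃ f ∉ p.asIdeal, ∃ (i : ι) (l : S i ⟶ awayAlg f),
      specMap (toAway f) ≫ r = specMap l ≫ q i := by
  obtain ⟨i, hi⟩ := hc (r p)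
  have ho : IsOpen (X := PrimeSpectrum A) (r ⁻¹ᵁ (q i).opensRange).1 := (r ⁻¹ᵁ (q i).opensRange).2
  obtain ⟨_, ⟨f, rfl⟩, hf, hle⟩ := PrimeSpectrum.isTopologicalBasis_basic_opens.exists_subset_of_mem_open
    (show p ∈ (r ⁻¹ᵁ (q i).opensRange).1 from hi) ho
  refine ⟨f, hf, i, ?_⟩
  have := hq i
  have hrange : Set.range (specMap (toAway f) ≫ r) ⊆ Set.range (q i) := by
    rintro _ ⟨z, rfl⟩
    rw [Scheme.Hom.comp_apply]
    refine hle ?_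
    have h1 : (specMap (toAway f)) z ∈
        Set.range (PrimeSpectrum.comap (algebraMap A (Localization.Away f))) := ⟨z, rfl⟩
    rw [PrimeSpectrum.localization_away_comap_range (Localization.Away f) f] at h1
    exact h1
  have hfac := IsOpenImmersion.lift_fac (q i) (specMap (toAway f) ≫ r) hrange
  obtain ⟨l, hl⟩ := exists_specMap (A := S i) (B := awayAlg f)
    (IsOpenImmersion.lift (q i) (specMap (toAway f) ≫ r) hrange) (by
      rw [← hs, ← Category.assoc, hfac, Category.assoc, hr, specMap_str])
  exact ⟨l, by rw [hl, hfac]⟩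

end Away

end QuiverCrit
end

noncomputable section

namespace QuiverCrit

set_option linter.style.haveILetI false

variable {Q : FinQuiver} {d : Q.V → ℕ} {j : Q.V}

/-! ### The functor of points of the moduli space -/

/-- The framed family given by a point with a cyclic vector. -/
def framedOf {A : CommAlgCat.{0} ℂ} (x : FramedSpace Q d j A) (hx : x.φ.std.IsCyclic j x.v) :
    FramedRep Q d j A := ⟨x.φ.std, x.v, hx⟩

open FramedRep (Lifts)

theorem lifts_framedOf_iff {A B : CommAlgCat.{0} ℂ} {f : A ⟶ B} {x : FramedSpace Q d j A}
    {y : FramedSpace Q d j B} {hx : x.φ.std.IsCyclic j x.v} {hy : y.φ.std.IsCyclic j y.v} :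
    Lifts f (framedOf x hx) (framedOf y hy) ↔
      ∃ g : GLProd Q d B, g • x.map f.hom.toRingHom = y := by
  constructor
  · rintro ⟨u, rfl, hu⟩
    obtain ⟨g, h, hg⟩ := exists_stdHom (φ := x.φ) (ψ := y.φ) u
    refine ⟨g, FramedSpace.ext h ?_⟩
    refine Eq.trans ?_ hu
    exact congrArg (fun c : Rep.Hom (⟨A, x.φ.std⟩ : Rep Q d) ⟨B, y.φ.std⟩ => c.map j x.v) hg
  · rintro ⟨g, rfl⟩
    exact ⟨stdHom f g rfl, rfl, rfl⟩

/-- Uniqueness is the freeness of the action: two group elements with the same effect give two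
morphisms of framed families, which coincide by rigidity. -/
theorem existsUnique_gl_iff {A B : CommAlgCat.{0} ℂ} {f : A ⟶ B} {x : FramedSpace Q d j A}
    {y : FramedSpace Q d j B} (hx : x.φ.std.IsCyclic j x.v) (hy : y.φ.std.IsCyclic j y.v) :
    Lifts f (framedOf x hx) (framedOf y hy) ↔
      ∃! g : GLProd Q d B, g • x.map f.hom.toRingHom = y := by
  refine ⟨fun h => ?_, fun h => lifts_framedOf_iff.2 h.exists⟩
  obtain ⟨g, rfl⟩ := lifts_framedOf_iff.1 h
  refine ⟨g, rfl, fun g' hg' => ?_⟩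
  have h1 : g' • RepSpace.map f.hom.toRingHom x.φ = g • RepSpace.map f.hom.toRingHom x.φ :=
    congrArg FramedSpace.φ hg'
  refine stdHom_injective (h := h1) (h' := rfl) ?_
  exact FramedRep.hom_unique (x := framedOf x hx) (y := framedOf _ hy) (u := stdHom f g' h1)
    (u' := stdHom f g rfl) rfl (congrArg FramedSpace.v hg')

/-- Framed families are locally trivial. -/
theorem exists_framedOf_away {A : CommAlgCat.{0} ℂ} (y : FramedRep Q d j A) (p : PrimeSpectrum A) :
    ∃ f ∉ p.asIdeal, ∃ (x : FramedSpace Q d j (awayAlg f)) (hx : x.φ.std.IsCyclic j x.v),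
      Lifts (toAway f) y (framedOf x hx) := by
  obtain ⟨f, hf, φ, u, hu⟩ := y.rep.exists_std_away p
  exact ⟨f, hf, ⟨φ, u.map j y.v⟩, Rep.Hom.isCyclic u y.cyclic, u, hu, rfl⟩

namespace SliceData

variable (D : SliceData Q d j)

/-- The tautological framed family over a slice. -/
def framed (i : D.ι) : FramedRep Q d j (D.alg i) :=
  framedOf (D.pt i) (FramedSpace.isCyclic_of_isUnit (D.isUnit_coord i))

/-- Trivialise the bundles near `p`, choose a system of words whose determinant does not vanish
there, invert it, and normalise by the group. -/
theorem exists_slice_away {A : CommAlgCat.{0} ℂ} (y : FramedRep Q d j A) (p : PrimeSpectrum A) :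
    ∃ f ∉ p.asIdeal, ∃ (i : D.ι) (l : D.alg i ⟶ awayAlg f) (z : FramedRep Q d j (awayAlg f)),
      Lifts (toAway f) y z ∧ Lifts l (D.framed i) z := by
  obtain ⟨f, hf, x, hx, h⟩ := exists_framedOf_away y p
  obtain ⟨p', hp'⟩ : ∃ p' : PrimeSpectrum (awayAlg f),
      PrimeSpectrum.comap (toAway f).hom.toRingHom p' = p := by
    have h1 : p ∈ Set.range (PrimeSpectrum.comap (algebraMap A (Localization.Away f))) := by
      rw [PrimeSpectrum.localization_away_comap_range (Localization.Away f) f]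
      exact hf
    exact h1
  obtain ⟨i, hi⟩ := D.cover _ x hx p'
  -- The determinant lives on the localization at `f`; clearing denominators gives an element `a` of
  -- `A`, so a single localization at `f * a` suffices.
  obtain ⟨⟨a, m⟩, e⟩ := IsLocalization.surj (M := Submonoid.powers f) (S := Localization.Away f)
    (x.wordDet (D.t (D.k i)))
  have e' : x.wordDet (D.t (D.k i)) * (toAway f).hom m = (toAway f).hom a := e
  have hm : IsUnit ((toAway f).hom m) :=
    IsLocalization.map_units (M := Submonoid.powers f) (Localization.Away f) m
  have ha : a ∉ p.asIdeal := by
    rw [← hp']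
    intro h1
    have h2 : (toAway f).hom a ∈ p'.asIdeal := h1
    rw [← e'] at h2
    rcases p'.isPrime.mem_or_mem h2 with h3 | h3
    · exact hi h3
    · exact p'.isPrime.ne_top (Ideal.eq_top_of_isUnit_mem _ h3 hm)
  have hfa : IsUnit ((toAway (f * a)).hom f * (toAway (f * a)).hom a) := by
    rw [← map_mul]
    exact isUnit_toAway (f * a)
  obtain ⟨k, hk⟩ := exists_away_lift f (toAway (f * a)) (isUnit_of_mul_isUnit_left hfa)
  have hu : IsUnit ((x.map k.hom.toRingHom).wordDet (D.t (D.k i))) := by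
    rw [FramedSpace.wordDet_map]
    have e1 := congrArg k.hom e'
    rw [map_mul] at e1
    have e2 : k.hom ((toAway f).hom a) = (toAway (f * a)).hom a :=
      congrArg (fun u : A ⟶ _ => u.hom a) hk
    rw [e2] at e1
    exact isUnit_of_mul_isUnit_left (e1 ▸ isUnit_of_mul_isUnit_right hfa)
  obtain ⟨g, hg, -⟩ := FramedSpace.exists_normal _ hu
  obtain ⟨l, hl⟩ := exists_slice_eval hg
  have hc : (g • x.map k.hom.toRingHom).φ.std.IsCyclic j (g • x.map k.hom.toRingHom).v :=
    FramedSpace.isCyclic_of_isUnit (hg.wordDet ▸ isUnit_one)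
  refine ⟨f * a, fun hfa => (p.isPrime.mem_or_mem hfa).elim hf ha, i, l, framedOf _ hc, ?_, ?_⟩
  · rw [← hk]
    exact h.trans (lifts_framedOf_iff.2 ⟨g, rfl⟩)
  · exact lifts_framedOf_iff.2 ⟨1, by rw [one_smul, hl]⟩

namespace Gluing

variable {D} (G : D.Gluing)

instance : Mono G.m := by
  have := G.immersion
  infer_instance

/-- The structure morphism. -/
def s : G.R ⟶ SpecC := G.m ≫ projSpaceStr D.n

theorem q_s (i : D.ι) : G.q i ≫ G.s = specStr (D.alg i) := by
  unfold s
  rw [← Category.assoc, G.q_m]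
  exact coordPt_comp_str _ _ _

/-- Two points of the slices give the same point exactly if the framed families are isomorphic. -/
theorem lifts_iff {B : CommAlgCat.{0} ℂ} {i i' : D.ι} {l : D.alg i ⟶ B} {l' : D.alg i' ⟶ B}
    {z : FramedRep Q d j B} (hz : Lifts l (D.framed i) z) :
    Lifts l' (D.framed i') z ↔ specMap l' ≫ G.q i' = specMap l ≫ G.q i := by
  have hu : ∀ {i : D.ι} (l : D.alg i ⟶ B), IsUnit (((D.pt i).map l.hom.toRingHom).wordDet
      (D.t (D.k i))) := fun {i} l => by
    rw [FramedSpace.wordDet_map]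
    exact (D.isUnit_coord i).map l.hom
  have hm : ∀ {i : D.ι} (l : D.alg i ⟶ B), (specMap l ≫ G.q i) ≫ G.m =
      D.projPoint ((D.pt i).map l.hom.toRingHom) (D.k i) (hu l) := fun {i} l => by
    rw [Category.assoc, G.q_m]
    exact (D.projPoint_map _ l _ _).symm
  let y := framedOf ((D.pt i).map l.hom.toRingHom) (FramedSpace.isCyclic_of_isUnit (hu l))
  have hy : Lifts l (D.framed i) y := lifts_framedOf_iff.2 ⟨1, one_smul _ _⟩
  have hyz : Lifts (𝟙 B) y z := hy.cancel' hz (Category.comp_id _)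
  have hiff : ∀ l' : D.alg i' ⟶ B, Lifts l' (D.framed i') z ↔ Lifts l' (D.framed i') y := fun l' =>
    ⟨fun h => by simpa using h.trans hyz.symm, fun h => by simpa using h.trans hyz⟩
  have hmp : ∀ l' : D.alg i' ⟶ B, Lifts l' (D.framed i') z →
      specMap l' ≫ G.q i' = specMap l ≫ G.q i := fun l' h => by
    obtain ⟨g, hg⟩ := lifts_framedOf_iff.1 ((hiff l').1 h)
    rw [← cancel_mono G.m, hm, hm]
    rw [← D.projPoint_smul _ g (hu l') (by rw [hg]; exact hu l)]
    exact coordPt_congr (congrArg coord hg) _ _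
  refine ⟨hmp l', fun h => ?_⟩
  have h1 := congrArg (· ≫ G.m) h
  simp only [hm] at h1
  -- Equality in projective space makes the determinant of the slice `i'` invertible, so the family
  -- also comes from a point `l''` of that slice. It has the same image in `R` as `l'`, and the
  -- chart `q i'` is a monomorphism, so `l'' = l'`.
  obtain ⟨g, hg, -⟩ := FramedSpace.exists_normal _ (isUnit_of_coordPt_eq h1)
  obtain ⟨l'', hl⟩ := exists_slice_eval hg
  have h2 : Lifts l'' (D.framed i') z := by
    refine (hiff l'').2 ?_
    have h3 : Lifts l'' (D.framed i') (framedOf _ (FramedSpace.isCyclic_of_isUnit (hu l''))) :=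
      lifts_framedOf_iff.2 ⟨1, one_smul _ _⟩
    have h4 : Lifts (𝟙 B) y (framedOf _ (FramedSpace.isCyclic_of_isUnit (hu l''))) :=
      lifts_framedOf_iff.2 ⟨g, hl.symm⟩
    simpa using h3.trans h4.symm
  have h5 := (hmp l'' h2).trans h.symm
  have := G.isOpen i'
  rw [cancel_mono] at h5
  exact specMap_injective h5 ▸ h2

end Gluing

end SliceData

end QuiverCrit
end

/-! ### Classifying maps of framed families -/

noncomputable section

namespace QuiverCrit

set_option linter.style.haveILetI false

variable {Q : FinQuiver} {d : Q.V → ℕ} {j : Q.V}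

open FramedRep (Lifts exists_lifts)

/-- A localization of the source of an algebra map, on the target. -/
theorem exists_away_map {A B : CommAlgCat.{0} ℂ} (f : A ⟶ B) (a : A) :
    ∃ k : awayAlg a ⟶ awayAlg (f.hom a), toAway a ≫ k = f ≫ toAway (f.hom a) :=
  exists_away_lift a _ (isUnit_toAway (f.hom a))

namespace SliceData.Gluing

variable {D : SliceData Q d j} (G : D.Gluing)

theorem comp_q_eq {B : CommAlgCat.{0} ℂ} {i i' : D.ι} {l : D.alg i ⟶ B} {l' : D.alg i' ⟶ B}
    {z : FramedRep Q d j B} (hz : Lifts l (D.framed i) z) (hz' : Lifts l' (D.framed i') z) :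
    specMap l ≫ G.q i = specMap l' ≫ G.q i' := ((G.lifts_iff hz).1 hz').symm

/-- A map to the glued scheme classifies a framed family. -/
def Classifies {A : CommAlgCat.{0} ℂ} (y : FramedRep Q d j A) (r : specAlg A ⟶ G.R) : Prop :=
  ∀ (i : D.ι) (B : CommAlgCat.{0} ℂ) (f : A ⟶ B) (l : D.alg i ⟶ B) (z : FramedRep Q d j B),
    Lifts f y z → Lifts l (D.framed i) z → specMap f ≫ r = specMap l ≫ G.q i

/-- Locally the family comes from a slice, and maps obtained from different slices agree after every
common base change. They therefore glue, and the local conditions determine the result. -/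
theorem existsUnique_classifies {A : CommAlgCat.{0} ℂ} (y : FramedRep Q d j A) :
    ∃! r, G.Classifies y r := by
  choose f hf i l z hyz hz using D.exists_slice_away y
  have hcomp : ∀ (p : PrimeSpectrum A) (B : CommAlgCat.{0} ℂ) (b : awayAlg (f p) ⟶ B) (i' : D.ι)
      (l' : D.alg i' ⟶ B) (w : FramedRep Q d j B), Lifts (toAway (f p) ≫ b) y w →
      Lifts l' (D.framed i') w → specMap b ≫ specMap (l p) ≫ G.q (i p) = specMap l' ≫ G.q i' := by
    intro p B b i' l' w hw hl'
    rw [← Category.assoc, ← specMap_comp]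
    exact G.comp_q_eq ((hz p).trans ((hyz p).cancel' hw rfl)) hl'
  obtain ⟨r, hr⟩ := exists_glue_away f (fun p => ⟨p, hf p⟩) (fun p => specMap (l p) ≫ G.q (i p))
    (fun p p' B b b' e => by
      obtain ⟨w, hw⟩ := exists_lifts (z p') b'
      rw [hcomp p B b (i p') (l p' ≫ b') w (e ▸ (hyz p').trans hw) ((hz p').trans hw),
        specMap_comp, Category.assoc])
  refine ⟨r, fun i' B g l' w hw hl' => hom_ext_away fun p => ?_, fun r' hr' =>
    hom_ext_away fun p => ⟨f p, hf p, ?_⟩⟩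
  · let p' : PrimeSpectrum A := PrimeSpectrum.comap g.hom.toRingHom p
    obtain ⟨k, hk⟩ := exists_away_map g (f p')
    refine ⟨g.hom (f p'), hf p', ?_⟩
    obtain ⟨w', hw'⟩ := exists_lifts w (toAway (g.hom (f p')))
    rw [← Category.assoc, ← specMap_comp, ← hk, specMap_comp, Category.assoc, hr,
      hcomp p' _ k i' (l' ≫ toAway _) w' (hk ▸ hw.trans hw') (hl'.trans hw'), specMap_comp,
      Category.assoc]
  · rw [hr]
    exact hr' _ _ _ _ _ (hyz p) (hz p)

/-- The classifying map of a framed family. -/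
def κ {A : CommAlgCat.{0} ℂ} (y : FramedRep Q d j A) : specAlg A ⟶ G.R :=
  (G.existsUnique_classifies y).choose

theorem classifies_κ {A : CommAlgCat.{0} ℂ} (y : FramedRep Q d j A) : G.Classifies y (G.κ y) :=
  (G.existsUnique_classifies y).choose_spec.1

theorem eq_κ {A : CommAlgCat.{0} ℂ} {y : FramedRep Q d j A} {r : specAlg A ⟶ G.R}
    (h : G.Classifies y r) : r = G.κ y := (G.existsUnique_classifies y).choose_spec.2 r h

theorem κ_eq {A B : CommAlgCat.{0} ℂ} {f : A ⟶ B} {x : FramedRep Q d j A} {y : FramedRep Q d j B}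
    (h : Lifts f x y) : G.κ y = specMap f ≫ G.κ x :=
  (G.eq_κ fun i C g l z hz hl => by
    rw [← Category.assoc, ← specMap_comp]
    exact G.classifies_κ x i C _ l z (h.trans hz) hl).symm

theorem κ_framed (i : D.ι) : G.κ (D.framed i) = G.q i :=
  (G.eq_κ fun _ _ _ _ _ hz hl => G.comp_q_eq hz hl).symm

theorem κ_eq_of_slice {A : CommAlgCat.{0} ℂ} {y : FramedRep Q d j A} {i : D.ι} {l : D.alg i ⟶ A}
    (h : Lifts l (D.framed i) y) : G.κ y = specMap l ≫ G.q i := by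
  rw [G.κ_eq h, κ_framed]

theorem κ_comp_s {A : CommAlgCat.{0} ℂ} (y : FramedRep Q d j A) : G.κ y ≫ G.s = specStr A := by
  refine hom_ext_away fun p => ?_
  obtain ⟨f, hf, i, l, z, hyz, hz⟩ := D.exists_slice_away y p
  refine ⟨f, hf, ?_⟩
  rw [← Category.assoc, ← G.κ_eq hyz, G.κ_eq_of_slice hz, Category.assoc, q_s, specMap_str,
    specMap_str]

/-- Equality of classifying maps gives isomorphisms locally, by `lifts_iff`; these glue because
framed morphisms are unique. -/
theorem lifts_slice_of_κ_eq {A : CommAlgCat.{0} ℂ} {y : FramedRep Q d j A} {i : D.ι}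
    {l : D.alg i ⟶ A} (h : G.κ y = specMap l ≫ G.q i) : Lifts l (D.framed i) y := by
  refine FramedRep.lifts_of_etaleCovers (EtaleCovers.of_away fun p => ?_)
  obtain ⟨f, hf, i', l', z, hyz, hz⟩ := D.exists_slice_away y p
  refine ⟨f, hf, z, hyz, (G.lifts_iff hz).2 ?_⟩
  rw [← G.κ_eq_of_slice hz, G.κ_eq hyz, h, specMap_comp, Category.assoc]

theorem κ_eq_iff {A B : CommAlgCat.{0} ℂ} {f : A ⟶ B} {x : FramedRep Q d j A}
    {y : FramedRep Q d j B} : G.κ y = specMap f ≫ G.κ x ↔ Lifts f x y := by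
  refine ⟨fun h => FramedRep.lifts_of_etaleCovers (EtaleCovers.of_away fun p => ?_), G.κ_eq⟩
  obtain ⟨g, hg, i, l, z, hyz, hz⟩ := D.exists_slice_away y p
  refine ⟨g, hg, z, hyz, ?_⟩
  obtain ⟨x', hx'⟩ := exists_lifts x (f ≫ toAway g)
  have h1 : Lifts l (D.framed i) x' := G.lifts_slice_of_κ_eq (by
    rw [G.κ_eq hx', specMap_comp, Category.assoc, ← h, ← G.κ_eq hyz, G.κ_eq_of_slice hz])
  have h2 : Lifts (𝟙 _) x' z := h1.cancel' hz (Category.comp_id _)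
  simpa using hx'.trans h2

/-- Where the map factors through a slice, pull back the tautological framed family. Since
classifying maps detect morphisms, equality of the restricted maps supplies all transition
morphisms, and the family descends. -/
theorem exists_κ_eq {A : CommAlgCat.{0} ℂ} (r : specAlg A ⟶ G.R) (hr : r ≫ G.s = specStr A) :
    ∃ y : FramedRep Q d j A, G.κ y = r := by
  let P : ∀ B : CommAlgCat.{0} ℂ, (A ⟶ B) → Prop := fun B g =>
    ∃ (i : D.ι) (l : D.alg i ⟶ B), specMap g ≫ r = specMap l ≫ G.q i
  have key : ∀ b : FramedRep.Piece P, ∃ z : FramedRep Q d j b.B, G.κ z = specMap b.g ≫ r := fun b => by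
    obtain ⟨i, l, h⟩ := b.hg
    obtain ⟨z, hz⟩ := exists_lifts (D.framed i) l
    exact ⟨z, by rw [h, G.κ_eq_of_slice hz]⟩
  choose z hz using key
  have hcov : ∀ p : PrimeSpectrum A, ∃ f ∉ p.asIdeal, P _ (toAway f) :=
    exists_away_factor G.q G.isOpen G.q_s G.covers r hr
  obtain ⟨y, hy⟩ := FramedRep.exists_descent z (fun {a b} h e => G.κ_eq_iff.1 (by
      rw [hz, hz, ← e, specMap_comp, Category.assoc]))
    (fun {B C} g h ⟨i, l, e⟩ => ⟨i, l ≫ h, by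
      rw [specMap_comp, Category.assoc, e, specMap_comp, Category.assoc]⟩) hcov
  refine ⟨y, hom_ext_away fun p => ?_⟩
  obtain ⟨f, hf, h⟩ := hcov p
  exact ⟨f, hf, by rw [← G.κ_eq (hy ⟨_, _, h⟩), hz]⟩

theorem isFineModuli : IsFineModuli (Q := Q) (d := d) (j := j) (fun _ _ => True) G.s
    (fun _ y => G.κ y.1) where
  over_base _ y := G.κ_comp_s y.1
  eq_iff f x y := G.κ_eq_iff.trans ⟨Lifts.existsUnique, fun h => h.exists⟩
  surjective A r hr := by
    obtain ⟨y, hy⟩ := G.exists_κ_eq r hr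
    exact ⟨⟨y, trivial⟩, hy⟩

theorem isFreeQuotient : IsFreeQuotient (framedAction d j) G.s
    (fun _ x => G.κ (stdFramed x)) where
  over_base _ x := G.κ_comp_s _
  natural {A B} f x := G.κ_eq (lifts_framedOf_iff (hx := x.2)
    (hy := ((framedAction d j).mapX f x).2) |>.2 ⟨1, one_smul _ _⟩)
  eq_iff {A} x y := by
    have h := G.κ_eq_iff (f := 𝟙 A) (x := stdFramed x) (y := stdFramed y)
    rw [specMap_id, Category.id_comp] at h
    refine eq_comm.trans (h.trans ((existsUnique_gl_iff x.2 y.2).trans ?_))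
    exact existsUnique_congr fun g => ⟨fun h => Subtype.ext h, fun h => congrArg Subtype.val h⟩
  locally_surjective A r hr := by
    obtain ⟨y, rfl⟩ := G.exists_κ_eq r hr
    refine EtaleCovers.of_away fun p => ?_
    obtain ⟨f, hf, x, hx, h⟩ := exists_framedOf_away y p
    exact ⟨f, hf, ⟨x, hx⟩, G.κ_eq h⟩

theorem isQuasiprojective : IsQuasiprojective G.s := ⟨D.n, G.m, G.immersion, rfl⟩

end SliceData.Gluing

end QuiverCrit
end

noncomputable section

namespace QuiverCrit

set_option linter.style.haveILetI false

variable {Q : FinQuiver} {d : Q.V → ℕ} {j : Q.V}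

open FramedRep (Lifts exists_lifts)

/-! ### Functions on schemes over the complex numbers -/

section Functions

variable {R : Scheme.{0}}

theorem evalAt_comp {A B : CommAlgCat.{0} ℂ} (w : Γ(R, ⊤)) (f : A ⟶ B) (r : specAlg A ⟶ R) :
    evalAt w (specMap f ≫ r) = f.hom (evalAt w r) := by
  unfold evalAt
  rw [Scheme.Hom.comp_appTop]
  exact congrArg (fun u : _ ⟶ CommRingCat.of B => u.hom (r.appTop.hom w))
    (Scheme.ΓSpecIso_naturality (CommRingCat.ofHom f.hom.toRingHom))

/-- The coordinate ring of the affine line. -/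
abbrev lineAlg : CommAlgCat.{0} ℂ := CommAlgCat.of ℂ (Polynomial ℂ)

/-- A function, as an algebra map from the coordinate ring of the affine line. -/
abbrev toLine {A : CommAlgCat.{0} ℂ} (a : A) : lineAlg ⟶ A := CommAlgCat.ofHom (Polynomial.aeval a)

theorem toLine_comp {A B : CommAlgCat.{0} ℂ} (a : A) (f : A ⟶ B) :
    toLine a ≫ f = toLine (f.hom a) :=
  CommAlgCat.hom_ext (Polynomial.algHom_ext (by
    change f.hom (Polynomial.aeval a Polynomial.X) = Polynomial.aeval (f.hom a) Polynomial.X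
    rw [Polynomial.aeval_X, Polynomial.aeval_X]))

/-- A function is a map to the affine line, so locality for functions is a case of locality for
morphisms of schemes. -/
theorem evalAt_ext_away {A : CommAlgCat.{0} ℂ} {a b : A}
    (h : ∀ p : PrimeSpectrum A, ∃ f ∉ p.asIdeal, (toAway f).hom a = (toAway f).hom b) : a = b := by
  have e : specMap (toLine a) = specMap (toLine b) := hom_ext_away fun p => by
    obtain ⟨f, hf, hab⟩ := h p
    exact ⟨f, hf, by rw [← specMap_comp, ← specMap_comp, toLine_comp, toLine_comp, hab]⟩
  have e1 := congrArg (fun u : lineAlg ⟶ A => u.hom (Polynomial.X : Polynomial ℂ)) (specMap_injective e)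
  exact ((Polynomial.aeval_X a).symm.trans e1).trans (Polynomial.aeval_X b)

/-- Compatibility of two morphisms on a fibre product over a complex scheme, on points. -/
theorem comp_eq_comp_of_points_over {S T : CommAlgCat.{0} ℂ} {P R' : Scheme.{0}} {s : R ⟶ SpecC}
    {q : specAlg S ⟶ R} {q' : specAlg T ⟶ R} (hq : q ≫ s = specStr S) (hq' : q' ≫ s = specStr T)
    {a : P ⟶ specAlg S} {b : P ⟶ specAlg T} (e : a ≫ q = b ≫ q')
    {r : specAlg S ⟶ R'} {r' : specAlg T ⟶ R'}
    (h : ∀ (B : CommAlgCat.{0} ℂ) (k : S ⟶ B) (k' : T ⟶ B), specMap k ≫ q = specMap k' ≫ q' →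
      specMap k ≫ r = specMap k' ≫ r') : a ≫ r = b ≫ r' := by
  refine hom_ext_points (a ≫ specStr S) fun B t ht => ?_
  obtain ⟨k, hk⟩ := exists_specMap (t ≫ a) ((Category.assoc _ _ _).trans ht)
  obtain ⟨k', hk'⟩ := exists_specMap (t ≫ b) (by
    rw [Category.assoc, ← hq', ← Category.assoc b, ← e, Category.assoc, hq]
    exact ht)
  rw [← Category.assoc, ← Category.assoc, ← hk, ← hk']
  exact h B k k' (by rw [hk, hk', Category.assoc, Category.assoc, e])

theorem exists_evalAt_eq (h : R ⟶ specAlg lineAlg) : ∃ w : Γ(R, ⊤),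
    ∀ (A : CommAlgCat.{0} ℂ) (r : specAlg A ⟶ R) (a : A), r ≫ h = specMap (toLine a) →
      evalAt w r = a := by
  refine ⟨h.appTop.hom ((Scheme.ΓSpecIso (CommRingCat.of lineAlg)).inv.hom
    (Polynomial.X : Polynomial ℂ)), fun A r a e => ?_⟩
  have h1 : evalAt (R := specAlg lineAlg) ((Scheme.ΓSpecIso (CommRingCat.of lineAlg)).inv.hom
    (Polynomial.X : Polynomial ℂ)) (r ≫ h) = a := by
    rw [e]
    have h2 := evalAt_comp ((Scheme.ΓSpecIso (CommRingCat.of lineAlg)).inv.hom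
      (Polynomial.X : Polynomial ℂ)) (toLine a) (𝟙 _)
    rw [Category.comp_id] at h2
    refine h2.trans ?_
    have h3 : evalAt (R := specAlg lineAlg) ((Scheme.ΓSpecIso (CommRingCat.of lineAlg)).inv.hom
      (Polynomial.X : Polynomial ℂ)) (𝟙 _) = (Polynomial.X : Polynomial ℂ) :=
      congrArg (fun u : CommRingCat.of lineAlg ⟶ CommRingCat.of lineAlg => u.hom
        (Polynomial.X : Polynomial ℂ)) (Scheme.ΓSpecIso (CommRingCat.of lineAlg)).inv_hom_id
    rw [h3]
    exact Polynomial.aeval_X a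
  refine Eq.trans ?_ h1
  unfold evalAt
  rw [Scheme.Hom.comp_appTop]
  rfl

end Functions

namespace SliceData.Gluing

variable {D : SliceData Q d j} (G : D.Gluing)

/-- The cover by slices. -/
def cover : G.R.OpenCover :=
  Scheme.Cover.mkOfCovers D.ι (fun i => specAlg (D.alg i)) G.q G.covers G.isOpen

theorem smooth : AlgebraicGeometry.Smooth G.s := by
  have h : IsZariskiLocalAtSource @AlgebraicGeometry.Smooth.{0} :=
    HasRingHomProperty.instIsZariskiLocalAtSource (Q := RingHom.Smooth)
  refine (IsZariskiLocalAtSource.iff_of_openCover (P := @AlgebraicGeometry.Smooth) G.cover).2 fun i => ?_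
  refine (G.q_s i).symm ▸ (?_ : AlgebraicGeometry.Smooth (specStr (D.alg i)))
  refine (HasRingHomProperty.Spec_iff (P := @AlgebraicGeometry.Smooth)).2 ?_
  exact (RingHom.smooth_algebraMap (R := ℂ) (S := D.alg i)).2 smooth_sliceAlg

/-- A function which is compatibly given on the slices. -/
theorem exists_function (c : ∀ i, D.alg i)
    (hc : ∀ (i i' : D.ι) (B : CommAlgCat.{0} ℂ) (k : D.alg i ⟶ B) (k' : D.alg i' ⟶ B),
      specMap k ≫ G.q i = specMap k' ≫ G.q i' → k.hom (c i) = k'.hom (c i')) :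
    ∃ w : Γ(G.R, ⊤), ∀ i, evalAt w (G.q i) = c i := by
  let h : G.R ⟶ specAlg lineAlg := G.cover.glueMorphisms (fun i => specMap (toLine (c i))) fun i i' => by
    exact comp_eq_comp_of_points_over (G.q_s i) (G.q_s i') Limits.pullback.condition fun B k k' e => by
      rw [← specMap_comp, ← specMap_comp, toLine_comp, toLine_comp, hc i i' B k k' e]
  obtain ⟨w, hw⟩ := exists_evalAt_eq h
  exact ⟨w, fun i => hw _ (G.q i) (c i) (G.cover.ι_glueMorphisms _ _ i)⟩

/-- The trace is preserved by morphisms of families, so its values on the slices agree wherever two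
slices meet in `R`. -/
theorem exists_trace (W : Q.Potential) : ∃ w : Γ(G.R, ⊤), ∀ (A : CommAlgCat.{0} ℂ)
    (y : FramedRep Q d j A), evalAt w (G.κ y) = y.fam.trW W := by
  have htr : ∀ {A B : CommAlgCat.{0} ℂ} {f : A ⟶ B} {x : FramedRep Q d j A} {y : FramedRep Q d j B},
      Lifts f x y → f.hom (x.fam.trW W) = y.fam.trW W := by
    rintro A B f x y ⟨u, rfl, -⟩
    exact Rep.Hom.base_trW u W
  obtain ⟨w, hw⟩ := G.exists_function (fun i => (D.framed i).fam.trW W) fun i i' B k k' e => by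
    obtain ⟨z, hz⟩ := exists_lifts (D.framed i) k
    rw [htr hz, htr ((G.lifts_iff hz).2 e.symm)]
  refine ⟨w, fun A y => evalAt_ext_away fun p => ?_⟩
  obtain ⟨f, hf, i, l, z, hyz, hz⟩ := D.exists_slice_away y p
  refine ⟨f, hf, ?_⟩
  rw [htr hyz, ← evalAt_comp, ← G.κ_eq hyz, G.κ_eq_of_slice hz, evalAt_comp, hw, htr hz]

/-- The slices have a common generic point. -/
theorem exists_generic (i₀ : D.ι) : ∃ γ : specAlg (framedField Q d j) ⟶ G.R, ∀ i,
    ∃ ν : D.alg i ⟶ framedField Q d j, Function.Injective ν.hom ∧ specMap ν ≫ G.q i = γ := by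
  choose ν g hν hg using fun i => exists_slice_generic (D.ne i)
  refine ⟨specMap (ν i₀) ≫ G.q i₀, fun i => ⟨ν i, hν i, ?_⟩⟩
  have hc : ∀ i, ((D.pt i).map (ν i).hom.toRingHom).φ.std.IsCyclic j
      ((D.pt i).map (ν i).hom.toRingHom).v := fun i => FramedSpace.isCyclic_of_isUnit (by
    rw [FramedSpace.wordDet_map]
    exact (D.isUnit_coord i).map (ν i).hom)
  have h1 : Lifts (ν i₀) (D.framed i₀) (framedOf _ (hc i₀)) :=
    lifts_framedOf_iff.2 ⟨1, one_smul _ _⟩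
  refine (G.lifts_iff h1).1 (lifts_framedOf_iff.2 ⟨g i₀ * (g i)⁻¹, ?_⟩)
  rw [hg i, hg i₀, mul_smul, inv_smul_smul]

theorem isDomain_alg (i : D.ι) : IsDomain (D.alg i) := by
  obtain ⟨ν, -, hν, -⟩ := exists_slice_generic (D.ne i)
  letI := (isField_framedField (Q := Q) (d := d) (j := j)).toField
  exact hν.isDomain ν.hom.toRingHom

theorem isReduced : IsReduced G.R := by
  have : ∀ i, IsReduced (G.cover.X i) := fun i => by
    have := isDomain_alg (D := D) i
    exact (inferInstance : IsReduced (specAlg (D.alg i)))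
  exact IsReduced.of_openCover _ G.cover

/-- The common generic point of the slices specialises to every point of `R`, because each slice
ring embeds in the field of that point. Reducedness is local, and the slice rings are domains. -/
theorem isEmpty_or_isIntegral : IsEmpty G.R ∨ IsIntegral G.R := by
  rcases isEmpty_or_nonempty G.R with h | ⟨⟨r₀⟩⟩
  · exact Or.inl h
  obtain ⟨i₀, -⟩ := G.covers r₀
  obtain ⟨γ, hγ⟩ := G.exists_generic i₀
  letI := (isField_framedField (Q := Q) (d := d) (j := j)).toField
  let o : specAlg (framedField Q d j) := (⟨⊥, Ideal.isPrime_bot⟩ : PrimeSpectrum (framedField Q d j))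
  have hs : ∀ r, γ o ⤳ r := fun r => by
    obtain ⟨i, z, rfl⟩ := G.covers r
    obtain ⟨ν, hν, h⟩ := hγ i
    rw [← h, Scheme.Hom.comp_apply]
    refine Specializes.map ?_ (G.q i).continuous
    refine (PrimeSpectrum.le_iff_specializes (R := D.alg i) _ _).1 ?_
    intro a ha
    have h0 : ν.hom a = 0 := ha
    rw [hν (h0.trans (map_zero _).symm)]
    exact Ideal.zero_mem _
  have hcl : closure {γ o} = (Set.univ : Set G.R) :=
    Set.eq_univ_of_forall fun r => (hs r).mem_closure
  have hirr : IrreducibleSpace G.R :=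
    (irreducibleSpace_def _).2 (by
    have h := (isIrreducible_singleton (x := γ o)).closure
    rwa [hcl] at h)
  have := G.isReduced
  exact Or.inr (isIntegral_of_irreducibleSpace_of_isReduced _)

end SliceData.Gluing

end QuiverCrit
end

noncomputable section

namespace QuiverCrit

set_option linter.style.haveILetI false

/-! ### Localization of critical ideals -/

open KaehlerDifferential in
/-- Critical ideals are compatible with localization. -/
theorem criticalIdeal_map_away {A B : Type} [CommRing A] [CommRing B] [Algebra A B] (g : A)
    [IsLocalization.Away g B] (c : ℂ →+* A) (hc : c.FiniteType) (f : A) :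
    (criticalIdeal c f).map (algebraMap A B) =
      criticalIdeal ((algebraMap A B).comp c) (algebraMap A B f) := by
  letI := c.toAlgebra
  letI := ((algebraMap A B).comp c).toAlgebra
  have : IsScalarTower ℂ A B := IsScalarTower.of_algebraMap_eq fun _ => rfl
  have hft : Algebra.FiniteType ℂ A := hc
  have : IsNoetherianRing A := Algebra.FiniteType.isNoetherianRing ℂ A
  have : Module.FinitePresentation A (Ω[A⁄ℂ]) := Module.finitePresentation_of_finite A _
  let M : Submonoid A := Submonoid.powers g
  have hloc := KaehlerDifferential.isLocalizedModule_map ℂ A B M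
  -- Derivations are functionals on the differentials, which are finitely presented here, so
  -- functionals commute with localization. Every derivation of `B` is, up to an invertible
  -- denominator, induced by one of `A`.
  let Φ := IsLocalizedModule.mapExtendScalars M (KaehlerDifferential.map ℂ ℂ A B)
    (Algebra.linearMap A B) B
  have hΦ : IsLocalizedModule M Φ := inferInstance
  have hΦD : ∀ (φ : Ω[A⁄ℂ] →ₗ[A] A) (a : A), Φ φ (D ℂ B (algebraMap A B a)) =
      algebraMap A B (φ (D ℂ A a)) := fun φ a => by
    rw [← KaehlerDifferential.map_D ℂ ℂ A B a]
    exact IsLocalizedModule.map_apply M (KaehlerDifferential.map ℂ ℂ A B)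
      (Algebra.linearMap A B) φ (D ℂ A a)
  apply le_antisymm
  · refine Ideal.map_le_iff_le_comap.2 (Ideal.span_le.2 ?_)
    rintro _ ⟨δ, rfl⟩
    refine Ideal.subset_span ⟨(Φ δ.liftKaehlerDifferential).compDer (D ℂ B), ?_⟩
    refine (hΦD _ f).trans ?_
    rw [Derivation.liftKaehlerDifferential_comp_D]
  · refine Ideal.span_le.2 ?_
    rintro _ ⟨δ, rfl⟩
    obtain ⟨⟨φ, s⟩, hs⟩ := IsLocalizedModule.surj M Φ δ.liftKaehlerDifferential
    have h1 : algebraMap A B s.1 * δ (algebraMap A B f) = algebraMap A B (φ (D ℂ A f)) := by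
      rw [← hΦD, ← hs, ← Derivation.liftKaehlerDifferential_comp_D δ, ← Algebra.smul_def]
      rfl
    have h2 : algebraMap A B (φ (D ℂ A f)) ∈ (criticalIdeal c f).map (algebraMap A B) :=
      Ideal.mem_map_of_mem _ (Ideal.subset_span ⟨φ.compDer (D ℂ A), rfl⟩)
    rw [← h1] at h2
    exact (Ideal.unit_mul_mem_iff_mem _ (IsLocalization.map_units B s)).1 h2

/-- Critical ideals are compatible with isomorphisms. -/
theorem criticalIdeal_map_equiv {A B : Type} [CommRing A] [CommRing B] (e : A ≃+* B) (c : ℂ →+* A)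
    (hc : c.FiniteType) (f : A) :
    (criticalIdeal c f).map (e : A →+* B) = criticalIdeal ((e : A →+* B).comp c) (e f) := by
  letI := (e : A →+* B).toAlgebra
  have : IsLocalization.Away (1 : A) B := IsLocalization.away_of_isUnit_of_bijective B isUnit_one e.bijective
  exact criticalIdeal_map_away 1 c hc f

/-! ### The critical ideal of a slice -/

variable {Q : FinQuiver} {d : Q.V → ℕ} {j : Q.V}

section DualNumbers

variable (A : CommAlgCat.{0} ℂ)

/-- The dual numbers over a complex algebra. -/
def dualAlg : CommAlgCat.{0} ℂ := CommAlgCat.of ℂ (DualNumber A)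

/-- The reduction of dual numbers. -/
def dualFst : dualAlg A ⟶ A := CommAlgCat.ofHom (TrivSqZeroExt.fstHom ℂ A A)

/-- The coefficient of `ε`. -/
def dualSnd : dualAlg A →+ A := (TrivSqZeroExt.sndHom A A).toAddMonoidHom

theorem isDerivationOver_dualSnd : IsDerivationOver (dualFst A).hom.toRingHom (dualSnd A) :=
  ⟨fun a b => by
    refine (TrivSqZeroExt.snd_mul (R := A) (M := A) a b).trans ?_
    exact congrArg₂ (· + ·) rfl rfl⟩

variable {A}

/-- The dual number `a + b ε`. -/
def dualMk (a b : A) : dualAlg A := (TrivSqZeroExt.inl a + TrivSqZeroExt.inr b : DualNumber A)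

theorem dualFst_dualMk (a b : A) : (dualFst A).hom.toRingHom (dualMk a b) = a := by
  refine (TrivSqZeroExt.fst_add (R := A) (M := A) _ _).trans ?_
  rw [TrivSqZeroExt.fst_inl, TrivSqZeroExt.fst_inr, add_zero]

theorem dualSnd_dualMk (a b : A) : dualSnd A (dualMk a b) = b := by
  refine (TrivSqZeroExt.snd_add (R := A) (M := A) _ _).trans ?_
  rw [TrivSqZeroExt.snd_inl, TrivSqZeroExt.snd_inr, zero_add]

/-- The derivation given by a point over the dual numbers. -/
theorem exists_derivation (h : A ⟶ dualAlg A) (hh : h ≫ dualFst A = 𝟙 A) :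
    ∃ D : Derivation ℂ A A, ∀ a, D a = dualSnd A (h.hom a) := by
  have hf : ∀ a, (dualFst A).hom (h.hom a) = a := fun a =>
    congrArg (fun u : A ⟶ A => u.hom a) hh
  refine ⟨Derivation.mk' ((TrivSqZeroExt.sndHom A A).restrictScalars ℂ ∘ₗ h.hom.toLinearMap)
    fun a b => ?_, fun a => rfl⟩
  change dualSnd A (h.hom (a * b)) = a * dualSnd A (h.hom b) + b * dualSnd A (h.hom a)
  rw [map_mul, (isDerivationOver_dualSnd A).leibniz]
  change (dualFst A).hom (h.hom a) * _ + _ * (dualFst A).hom (h.hom b) = _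
  rw [hf, hf, mul_comm b]

end DualNumbers

/-- The first order deformation of a framed representation in a direction. -/
def deform {A : CommAlgCat.{0} ℂ} (x : FramedSpace Q d j A) (e : RepSpace Q d A) :
    FramedSpace Q d j (dualAlg A) where
  φ a := Matrix.of fun l k => dualMk (x.φ a l k) (e a l k)
  v l := dualMk (x.v l) 0

theorem deform_map {A : CommAlgCat.{0} ℂ} (x : FramedSpace Q d j A) (e : RepSpace Q d A) :
    (deform x e).map (dualFst A).hom.toRingHom = x :=
  FramedSpace.ext (funext fun _ => Matrix.ext fun _ _ => dualFst_dualMk _ _)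
    (funext fun _ => dualFst_dualMk _ _)

theorem dualSnd_deform {A : CommAlgCat.{0} ℂ} (x : FramedSpace Q d j A) (e : RepSpace Q d A)
    (a : Q.E) (l : Fin (d (Q.head a))) (k : Fin (d (Q.tail a))) :
    dualSnd A ((deform x e).φ a l k) = e a l k := dualSnd_dualMk _ _

theorem dualFst_entry_deform {A : CommAlgCat.{0} ℂ} (x : FramedSpace Q d j A) (e : RepSpace Q d A)
    (W : Q.Potential) (a : Q.E) (k : Fin (d (Q.tail a))) (l : Fin (d (Q.head a))) :
    (dualFst A).hom.toRingHom ((deform x e).φ.entry W a k l) = x.φ.entry W a k l := by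
  have h : RepSpace.map (dualFst A).hom.toRingHom (deform x e).φ = x.φ :=
    congrArg FramedSpace.φ (deform_map x e)
  have h2 := RepSpace.map_entry (dualFst A) (deform x e).φ W a k l
  rw [h] at h2
  exact h2

theorem dualSnd_algebraMap (A : CommAlgCat.{0} ℂ) (z : ℂ) :
    dualSnd A (algebraMap ℂ (dualAlg A) z) = 0 :=
  TrivSqZeroExt.snd_inl (R := A) A (algebraMap ℂ A z)

theorem dualSnd_trW_deform {A : CommAlgCat.{0} ℂ} (x : FramedSpace Q d j A) (e : RepSpace Q d A)
    (W : Q.Potential) : dualSnd A ((deform x e).φ.std.trW W) =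
      ∑ a, ∑ k, ∑ l, x.φ.entry W a k l * e a l k := by
  have h := (deform x e).φ.derivation_trW (isDerivationOver_dualSnd A) (dualSnd_algebraMap A) W
  refine h.trans (Finset.sum_congr rfl fun a _ => Finset.sum_congr rfl fun k _ =>
    Finset.sum_congr rfl fun l _ => ?_)
  exact congrArg₂ (· * ·) (dualFst_entry_deform x e W a k l) (dualSnd_deform x e a l k)

/-- The relations of the Jacobi algebra lie in the critical ideal of a slice. -/
theorem entry_mem_criticalIdeal (S : WordSystem Q d) (W : Q.Potential) (a : Q.E)
    (k : Fin (d (Q.tail a))) (l : Fin (d (Q.head a))) :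
    (slicePt j S).φ.entry W a k l ∈
      criticalIdeal (algebraMap ℂ (sliceAlg j S)) ((slicePt j S).φ.std.trW W) := by
  classical
  -- The elementary direction for which the derivative formula returns the single desired entry.
  let e : RepSpace Q d (sliceAlg j S) := fun a' => Matrix.of fun l' k' =>
    if (⟨a', l', k'⟩ : Coord Q d) = ⟨a, l, k⟩ then 1 else 0
  obtain ⟨y, hy, hyW⟩ : ∃ y : FramedSpace Q d j (dualAlg (sliceAlg j S)),
      y.map (dualFst _).hom.toRingHom = slicePt j S ∧
        dualSnd _ (y.φ.std.trW W) = (slicePt j S).φ.entry W a k l :=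
    ⟨deform _ e, deform_map _ e, (dualSnd_trW_deform _ e W).trans
      (sum_mul_coord_single (fun a k l => (slicePt j S).φ.entry W a k l) a k l)⟩
  have hu : IsUnit (y.wordDet S) := by
    refine TrivSqZeroExt.isUnit_iff_isUnit_fst.2 ?_
    have h1 := y.wordDet_map (dualFst (sliceAlg j S)) S
    rw [hy, (slicePt_isNormal j S).wordDet] at h1
    exact (congrArg IsUnit h1).mp isUnit_one
  -- The deformed point generally leaves the slice, but its determinant is a unit modulo `ε`, hence
  -- a unit. Normalising returns it to the slice without changing the trace, and its reduction is
  -- still the tautological point, so it defines a derivation of the slice ring.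
  obtain ⟨g, hg, -⟩ := FramedSpace.exists_normal _ hu
  obtain ⟨h, hh⟩ := exists_slice_eval hg
  have hred : h ≫ dualFst _ = 𝟙 _ := slice_ext (by
    have e : (slicePt j S).map (h ≫ dualFst _).hom.toRingHom =
        GLProd.map (dualFst _).hom.toRingHom g • slicePt j S := by
      rw [FramedSpace.map_comp, hh, FramedSpace.map_smul, hy]
    refine e.trans ((slicePt_isNormal j S).smul_eq ?_)
    rw [← e]
    exact (slicePt_isNormal j S).map _)
  obtain ⟨D, hD⟩ := exists_derivation h hred
  have h1 : h.hom ((slicePt j S).φ.std.trW W) = (g • y).φ.std.trW W := by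
    refine Rep.Hom.base_trW (stdHom (φ := (slicePt j S).φ) (ψ := (g • y).φ) h 1 ?_) W
    rw [one_smul]
    exact congrArg FramedSpace.φ hh
  have h2 : y.φ.std.trW W = (g • y).φ.std.trW W :=
    Rep.Hom.base_trW (stdHom (φ := y.φ) (ψ := (g • y).φ) (𝟙 _) g rfl) W
  rw [← hyW, h2, ← h1, ← hD]
  exact Rep.derivation_mem_criticalIdeal D _

namespace SliceData

variable (D : SliceData Q d j)

open FramedRep (Lifts)

/-- A point of a slice satisfies the relations of the Jacobi algebra exactly if it lies in the
critical locus of the trace of the potential. -/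
theorem relations_iff_critical (W : Q.Potential) {B : CommAlgCat.{0} ℂ} {i : D.ι} {l : D.alg i ⟶ B}
    {z : FramedRep Q d j B} (hz : Lifts l (D.framed i) z) :
    z.fam.Relations W ↔ ∀ r ∈ criticalIdeal (algebraMap ℂ (D.alg i)) ((D.framed i).fam.trW W),
      l.hom r = 0 := by
  constructor
  · intro h
    obtain ⟨u, rfl, -⟩ := hz
    have hle : criticalIdeal (algebraMap ℂ (D.alg i)) ((D.framed i).fam.trW W) ≤
        RingHom.ker u.base.hom.toRingHom := by
      refine Ideal.span_le.2 ?_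
      rintro _ ⟨δ, rfl⟩
      have hI : ∀ (I : Algebra ℂ (D.alg i)), I = (D.alg i).algebra →
          ∀ δ : @Derivation ℂ (D.alg i) (D.alg i) _ _ _ I _ I.toModule,
            u.base.hom (δ ((D.framed i).fam.trW W)) = 0 := by
        rintro _ rfl δ
        exact Rep.derivation_trW_eq_zero u h δ
      exact hI (algebraMap ℂ (D.alg i)).toAlgebra (Algebra.algebra_ext _ _ fun _ => rfl) δ
    exact fun r hr => hle hr
  · intro h
    let x := (D.pt i).map l.hom.toRingHom
    have hx : x.φ.std.Relations W := by
      rw [RepSpace.relations_iff_entry]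
      intro a k m
      exact (RepSpace.map_entry l (D.pt i).φ W a k m).symm.trans (h _ (entry_mem_criticalIdeal _ W a k m))
    have hc : x.φ.std.IsCyclic j x.v := FramedSpace.isCyclic_of_isUnit (by
      rw [FramedSpace.wordDet_map]
      exact (D.isUnit_coord i).map l.hom)
    have h1 : Lifts l (D.framed i) (framedOf x hc) := lifts_framedOf_iff.2 ⟨1, one_smul _ _⟩
    exact (h1.cancel' hz (Category.comp_id l)).relations hx

end SliceData

end QuiverCrit
end

noncomputable section

namespace QuiverCrit

set_option linter.style.haveILetI false

/-! ### Critical loci on schemes -/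

section Schemes

variable {R : Scheme.{0}}

theorem le_preimage_top {S : Scheme.{0}} (s : R ⟶ S) (U : R.Opens) : U ≤ s ⁻¹ᵁ ⊤ := fun _ _ => trivial

theorem appLE_top_top {S : Scheme.{0}} (s : R ⟶ S) (h : ⊤ ≤ s ⁻¹ᵁ ⊤) : s.appLE ⊤ ⊤ h = s.appTop :=
  (congrArg (s.app ⊤ ≫ ·) (R.presheaf.map_id _)).trans (Category.comp_id _)

theorem constants_eq (s : R ⟶ SpecC) (U : R.Opens) (h : U ≤ s ⁻¹ᵁ ⊤) : constants s U =
    ((Scheme.ΓSpecIso (CommRingCat.of ℂ)).inv ≫ s.appLE ⊤ U h).hom := rfl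

theorem constants_map (s : R ⟶ SpecC) {U V : R.Opens} (h : V ≤ U) :
    (R.presheaf.map (homOfLE h).op).hom.comp (constants s U) = constants s V := by
  rw [constants_eq s U (le_preimage_top s U), constants_eq s V (le_preimage_top s V),
    ← CommRingCat.hom_comp, Category.assoc, Scheme.Hom.appLE_map]

theorem constants_finiteType (s : R ⟶ SpecC) [LocallyOfFiniteType s] (U : R.affineOpens) :
    (constants s U.1).FiniteType := by
  unfold constants
  rw [CommRingCat.hom_comp]
  refine RingHom.FiniteType.comp (s.finiteType_appLE (isAffineOpen_top _) U.2 le_top) ?_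
  exact RingHom.FiniteType.of_surjective _ (ConcreteCategory.bijective_of_isIso
    (Scheme.ΓSpecIso (CommRingCat.of ℂ)).inv).2

/-- The critical locus of a function exists. -/
theorem exists_criticalLocus (s : R ⟶ SpecC) [LocallyOfFiniteType s] (w : Γ(R, ⊤)) :
    ∃ I : R.IdealSheafData, IsCriticalLocus s w I :=
  ⟨{ ideal := fun U => criticalIdeal (constants s U.1)
        ((R.presheaf.map (homOfLE le_top : U.1 ⟶ ⊤).op).hom w)
     map_ideal_basicOpen := fun U f => by
        have := U.2.isLocalization_basicOpen f
        have h := criticalIdeal_map_away (B := Γ(R, R.basicOpen f)) f (constants s U.1)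
          (constants_finiteType s U) ((R.presheaf.map (homOfLE le_top : U.1 ⟶ ⊤).op).hom w)
        refine h.trans ?_
        have h1 := constants_map s (R.basicOpen_le f)
        have h2 : (R.presheaf.map (homOfLE (R.basicOpen_le f)).op).hom
            ((R.presheaf.map (homOfLE le_top : U.1 ⟶ ⊤).op).hom w) =
            (R.presheaf.map (homOfLE le_top : R.basicOpen f ⟶ ⊤).op).hom w := by
          rw [← CommRingCat.comp_apply, ← Functor.map_comp]
          rfl
        exact congrArg₂ criticalIdeal h1 h2 }, fun _ => rfl⟩

variable {A : CommAlgCat.{0} ℂ} (q : specAlg A ⟶ R)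

/-- The restriction of functions along a map from an affine scheme. -/
def restr (U : R.Opens) (h : ⊤ ≤ q ⁻¹ᵁ U) : Γ(R, U) ⟶ CommRingCat.of A :=
  q.appLE U ⊤ h ≫ (Scheme.ΓSpecIso (CommRingCat.of A)).hom

theorem restr_map_top (U : R.Opens) (h : ⊤ ≤ q ⁻¹ᵁ U) (w : Γ(R, ⊤)) :
    (restr q U h).hom ((R.presheaf.map (homOfLE le_top : U ⟶ ⊤).op).hom w) = evalAt w q := by
  unfold restr evalAt
  have e : R.presheaf.map (homOfLE le_top : U ⟶ ⊤).op ≫ q.appLE U ⊤ h = q.appTop := by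
    rw [Scheme.Hom.map_appLE]
    exact appLE_top_top q _
  exact congrArg (fun u : Γ(R, ⊤) ⟶ Γ(specAlg A, ⊤) =>
    (Scheme.ΓSpecIso (CommRingCat.of A)).hom.hom (u.hom w)) e

theorem restr_constants {s : R ⟶ SpecC} (hq : q ≫ s = specStr A) (U : R.Opens)
    (h : ⊤ ≤ q ⁻¹ᵁ U) : (restr q U h).hom.comp (constants s U) = algebraMap ℂ A := by
  have e : (Scheme.ΓSpecIso (CommRingCat.of ℂ)).inv ≫
      s.appLE ⊤ U (le_preimage_top s U) ≫ q.appLE U ⊤ h =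
      CommRingCat.ofHom (algebraMap ℂ A) ≫ (Scheme.ΓSpecIso (CommRingCat.of A)).inv := by
    rw [Scheme.Hom.appLE_comp_appLE, Scheme.ΓSpecIso_inv_naturality]
    congr 1
    have : ∀ (t : specAlg A ⟶ SpecC) (e : ⊤ ≤ t ⁻¹ᵁ ⊤), t = specStr A →
        t.appLE ⊤ ⊤ e = (specStr A).appTop := by
      rintro _ e rfl
      exact appLE_top_top _ e
    exact this _ _ hq
  rw [constants_eq s U (le_preimage_top s U), restr, ← CommRingCat.hom_comp, Category.assoc, ← Category.assoc (s.appLE _ _ _), ← Category.assoc, e,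
    Category.assoc, Iso.inv_hom_id, Category.comp_id]
  rfl

theorem restr_fac (U : R.Opens) (hU : IsAffineOpen U) (h : ⊤ ≤ q ⁻¹ᵁ U) :
    Spec.map (restr q U h) ≫ hU.fromSpec = q := by
  unfold restr
  rw [Spec.map_comp, Category.assoc, hU.SpecMap_appLE_fromSpec q (isAffineOpen_top _) h,
    IsAffineOpen.fromSpec_top, Scheme.isoSpec_Spec_inv, ← Category.assoc, ← Spec.map_comp,
    Iso.inv_hom_id, Spec.map_id, Category.id_comp]

theorem restr_comp {B : CommAlgCat.{0} ℂ} (l : A ⟶ B) (U : R.Opens) (h : ⊤ ≤ q ⁻¹ᵁ U)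
    (h' : ⊤ ≤ (specMap l ≫ q) ⁻¹ᵁ U) (a : Γ(R, U)) :
    (restr (specMap l ≫ q) U h').hom a = l.hom ((restr q U h).hom a) := by
  have e : restr (specMap l ≫ q) U h' = restr q U h ≫ CommRingCat.ofHom l.hom.toRingHom := by
    unfold restr
    rw [Category.assoc, ← Scheme.ΓSpecIso_naturality, ← Category.assoc]
    congr 1
  rw [e]
  rfl

variable [IsOpenImmersion q]

theorem top_le_preimage_opensRange : ⊤ ≤ q ⁻¹ᵁ q.opensRange := fun z _ => ⟨z, rfl⟩

theorem restr_bijective :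
    Function.Bijective (restr q q.opensRange (top_le_preimage_opensRange q)).hom := by
  have h : IsIso (restr q q.opensRange (top_le_preimage_opensRange q)) := by
    have h1 := q.isIso_app q.opensRange le_rfl
    have h2 : q ⁻¹ᵁ q.opensRange = ⊤ := top_le_iff.1 (top_le_preimage_opensRange q)
    have h3 : IsIso (homOfLE (top_le_preimage_opensRange q)) := by
      exact ⟨homOfLE h2.le, rfl, rfl⟩
    unfold restr Scheme.Hom.appLE
    infer_instance
  exact ConcreteCategory.bijective_of_isIso _

/-- The ideal of the critical locus on an affine chart. -/
theorem criticalLocus_chart {s : R ⟶ SpecC} [LocallyOfFiniteType s] {w : Γ(R, ⊤)}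
    {I : R.IdealSheafData} (hI : IsCriticalLocus s w I) (hq : q ≫ s = specStr A) :
    (I.ideal ⟨q.opensRange, isAffineOpen_opensRange q⟩).map
      (restr q q.opensRange (top_le_preimage_opensRange q)).hom =
        criticalIdeal (algebraMap ℂ A) (evalAt w q) := by
  rw [hI]
  let e := RingEquiv.ofBijective (restr q q.opensRange (top_le_preimage_opensRange q)).hom
    (restr_bijective q)
  have h := criticalIdeal_map_equiv e (constants s q.opensRange)
    (constants_finiteType s ⟨q.opensRange, isAffineOpen_opensRange q⟩)
    ((R.presheaf.map (homOfLE le_top : q.opensRange ⟶ ⊤).op).hom w)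
  refine h.trans (congrArg₂ criticalIdeal ?_ ?_)
  · exact restr_constants q hq _ _
  · exact restr_map_top q _ _ w

/-- A point of an affine chart lies on the critical locus exactly if it kills the critical ideal. -/
theorem exists_fac_criticalLocus_iff {s : R ⟶ SpecC} [LocallyOfFiniteType s] {w : Γ(R, ⊤)}
    {I : R.IdealSheafData} (hI : IsCriticalLocus s w I) (hq : q ≫ s = specStr A)
    {B : CommAlgCat.{0} ℂ} (l : A ⟶ B) :
    (∃ r : specAlg B ⟶ I.subscheme, r ≫ I.subschemeι = specMap l ≫ q) ↔
      ∀ a ∈ criticalIdeal (algebraMap ℂ A) (evalAt w q), l.hom a = 0 := by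
  let U : R.affineOpens := ⟨q.opensRange, isAffineOpen_opensRange q⟩
  have hU := top_le_preimage_opensRange q
  have hlU : ⊤ ≤ (specMap l ≫ q) ⁻¹ᵁ U.1 := fun z _ => ⟨specMap l z, rfl⟩
  rw [← criticalLocus_chart q hI hq]
  constructor
  · rintro ⟨r, hr⟩ a ha
    have hle : (I.ideal U).map (restr q q.opensRange hU).hom ≤ RingHom.ker l.hom.toRingHom := by
      refine Ideal.map_le_iff_le_comap.2 fun b hb => ?_
      have h1 : (I.subschemeι.app U.1).hom b = 0 := by
        rw [← I.ker_subschemeι_app U] at hb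
        exact hb
      have h2 := restr_comp q l U.1 hU hlU b
      refine h2.symm.trans ?_
      have h3 : ∀ (t : specAlg B ⟶ R) (h : ⊤ ≤ t ⁻¹ᵁ U.1), t = r ≫ I.subschemeι →
          (restr t U.1 h).hom b = 0 := by
        rintro _ h rfl
        unfold restr Scheme.Hom.appLE
        rw [Scheme.Hom.comp_app]
        refine (congrArg (fun b => (Scheme.ΓSpecIso (CommRingCat.of B)).hom.hom
          (((specAlg B).presheaf.map (homOfLE h).op).hom ((r.app (I.subschemeι ⁻¹ᵁ U.1)).hom b))) h1).trans ?_
        rw [map_zero]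
        exact (congrArg _ (map_zero _)).trans (map_zero _)
      exact h3 _ hlU hr.symm
    exact hle ha
  · intro h
    let φ : (Γ(R, U) ⧸ I.ideal U) →+* B := Ideal.Quotient.lift _
      (l.hom.toRingHom.comp (restr q q.opensRange hU).hom)
      fun b hb => h _ (Ideal.mem_map_of_mem _ hb)
    refine ⟨Spec.map (CommRingCat.ofHom φ) ≫ subschemeChart I U, ?_⟩
    rw [Category.assoc, subschemeChart_ι, ← Category.assoc]
    have e : CommRingCat.ofHom (Ideal.Quotient.mk (I.ideal U)) ≫ CommRingCat.ofHom φ =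
        restr q q.opensRange hU ≫ CommRingCat.ofHom l.hom.toRingHom := rfl
    refine (congrArg (· ≫ U.2.fromSpec) ((Spec.map_comp _ _).symm.trans (congrArg Spec.map e))).trans ?_
    rw [Spec.map_comp, Category.assoc]
    exact congrArg (specMap l ≫ ·) (restr_fac q _ (isAffineOpen_opensRange q) hU)

end Schemes

variable {Q : FinQuiver} {d : Q.V → ℕ} {j : Q.V}

open FramedRep (Lifts exists_lifts)

namespace SliceData.Gluing

variable {D : SliceData Q d j} (G : D.Gluing)

/-- A framed family is classified by a point of the critical locus exactly if it satisfies the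
relations of the Jacobi algebra. -/
theorem exists_fac_iff_relations {W : Q.Potential} {w : Γ(G.R, ⊤)}
    (hw : ∀ (A : CommAlgCat.{0} ℂ) (y : FramedRep Q d j A), evalAt w (G.κ y) = y.fam.trW W)
    {I : G.R.IdealSheafData} (hI : IsCriticalLocus G.s w I) {A : CommAlgCat.{0} ℂ}
    (y : FramedRep Q d j A) :
    (∃ r : specAlg A ⟶ I.subscheme, r ≫ I.subschemeι = G.κ y) ↔ y.fam.Relations W := by
  have := G.smooth
  have := G.isOpen
  have key : ∀ {B : CommAlgCat.{0} ℂ} {i : D.ι} {l : D.alg i ⟶ B} {z : FramedRep Q d j B},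
      Lifts l (D.framed i) z →
      ((∃ r : specAlg B ⟶ I.subscheme, r ≫ I.subschemeι = G.κ z) ↔ z.fam.Relations W) := by
    intro B i l z hz
    rw [G.κ_eq_of_slice hz, exists_fac_criticalLocus_iff (G.q i) hI (G.q_s i) l,
      D.relations_iff_critical W hz, ← G.κ_framed i, hw]
  choose f hf i l z hyz hz using D.exists_slice_away y
  constructor
  · rintro ⟨r, hr⟩
    refine Rep.relations_of_etaleCovers (y := y.rep) (EtaleCovers.of_away fun p => ?_)
    obtain ⟨u, hu, -⟩ := hyz p
    refine ⟨f p, hf p, (z p).rep, u, (key (hz p)).1 ⟨specMap (toAway (f p)) ≫ r, ?_⟩,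
      Rep.isHomLift_of_base_eq u _ hu⟩
    rw [Category.assoc, hr, G.κ_eq (hyz p)]
  · intro h
    choose r hr using fun p => (key (hz p)).2 ((hyz p).relations h)
    -- The local factorisations agree on overlaps because a closed immersion is a monomorphism, so
    -- they glue.
    obtain ⟨r', hr'⟩ := exists_glue_away f (fun p => ⟨p, hf p⟩) r fun p p' B b b' e => by
      rw [← cancel_mono I.subschemeι, Category.assoc, Category.assoc, hr, hr, G.κ_eq (hyz p),
        G.κ_eq (hyz p'), ← Category.assoc, ← Category.assoc, ← specMap_comp, ← specMap_comp, e]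
    refine ⟨r', hom_ext_away fun p => ⟨f p, hf p, ?_⟩⟩
    rw [← Category.assoc, hr', hr, G.κ_eq (hyz p)]

end SliceData.Gluing

end QuiverCrit
end

/-! ### The framed critical locus as a free quotient and fine moduli space -/

noncomputable section

namespace QuiverCrit

set_option linter.style.haveILetI false

variable {Q : FinQuiver} {d : Q.V → ℕ} {j : Q.V}

open FramedRep (Lifts)

namespace SliceData.Gluing

variable {D : SliceData Q d j} (G : D.Gluing)

variable {W : Q.Potential} {w : Γ(G.R, ⊤)}
  (hw : ∀ (A : CommAlgCat.{0} ℂ) (y : FramedRep Q d j A), evalAt w (G.κ y) = y.fam.trW W)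
  {I : G.R.IdealSheafData} (hI : IsCriticalLocus G.s w I)

/-- The classifying map of a framed family of representations of the Jacobi algebra. -/
def κJacobi {A : CommAlgCat.{0} ℂ} (y : FramedRep Q d j A) (hy : y.fam.Relations W) :
    specAlg A ⟶ I.subscheme := ((G.exists_fac_iff_relations hw hI y).2 hy).choose

theorem κJacobi_ι {A : CommAlgCat.{0} ℂ} (y : FramedRep Q d j A) (hy : y.fam.Relations W) :
    G.κJacobi hw hI y hy ≫ I.subschemeι = G.κ y :=
  ((G.exists_fac_iff_relations hw hI y).2 hy).choose_spec

theorem κJacobi_eq_iff {A B : CommAlgCat.{0} ℂ} {f : A ⟶ B} {x : FramedRep Q d j A}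
    {y : FramedRep Q d j B} (hx : x.fam.Relations W) (hy : y.fam.Relations W) :
    G.κJacobi hw hI y hy = specMap f ≫ G.κJacobi hw hI x hx ↔ Lifts f x y := by
  rw [← G.κ_eq_iff, ← cancel_mono I.subschemeι, Category.assoc, κJacobi_ι, κJacobi_ι]

theorem κJacobi_over_base {A : CommAlgCat.{0} ℂ} (y : FramedRep Q d j A)
    (hy : y.fam.Relations W) : G.κJacobi hw hI y hy ≫ I.subschemeι ≫ G.s = specStr A := by
  rw [← Category.assoc, κJacobi_ι, κ_comp_s]

include hI in
theorem exists_κJacobi_eq {A : CommAlgCat.{0} ℂ} (r : specAlg A ⟶ I.subscheme)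
    (hr : r ≫ I.subschemeι ≫ G.s = specStr A) :
    ∃ (y : FramedRep Q d j A) (hy : y.fam.Relations W), G.κJacobi hw hI y hy = r := by
  obtain ⟨y, hy⟩ := G.exists_κ_eq (r ≫ I.subschemeι) ((Category.assoc _ _ _).trans hr)
  have h := (G.exists_fac_iff_relations hw hI y).1 ⟨r, hy.symm⟩
  exact ⟨y, h, by rw [← cancel_mono I.subschemeι, κJacobi_ι, hy]⟩

theorem isFineModuli_jacobi : IsFineModuli (Q := Q) (d := d) (j := j)
    (fun _ x => x.fam.IsJacobi W) (I.subschemeι ≫ G.s)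
    (fun _ y => G.κJacobi hw hI y.1 ((RepFam.isJacobi_iff_relations _ _).1 y.2)) where
  over_base _ y := G.κJacobi_over_base hw hI y.1 _
  eq_iff f x y := (G.κJacobi_eq_iff hw hI _ _).trans ⟨Lifts.existsUnique, fun h => h.exists⟩
  surjective A r hr := by
    obtain ⟨y, hy, h⟩ := G.exists_κJacobi_eq hw hI r hr
    exact ⟨⟨y, (RepFam.isJacobi_iff_relations _ _).2 hy⟩, h⟩

/-- The quotient map of the action on framed representations of the Jacobi algebra. -/
def πJacobi {A : CommAlgCat.{0} ℂ} (x : (framedJacobiAction d j W).X A) :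
    specAlg A ⟶ I.subscheme := G.κJacobi hw hI (stdFramed x.1) x.2

theorem πJacobi_ι {A : CommAlgCat.{0} ℂ} (x : (framedJacobiAction d j W).X A) :
    G.πJacobi hw hI x ≫ I.subschemeι = G.κ (stdFramed x.1) := G.κJacobi_ι hw hI _ _

theorem isFreeQuotient_jacobi : IsFreeQuotient (framedJacobiAction d j W) (I.subschemeι ≫ G.s)
    (fun _ x => G.πJacobi hw hI x) where
  over_base _ x := G.κJacobi_over_base hw hI _ _
  natural {A B} f x := by
    rw [← cancel_mono I.subschemeι, Category.assoc, πJacobi_ι, πJacobi_ι]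
    exact G.isFreeQuotient.natural f x.1
  eq_iff {A} x y := by
    rw [← cancel_mono I.subschemeι, πJacobi_ι, πJacobi_ι]
    exact (G.isFreeQuotient.eq_iff x.1 y.1).trans
      (existsUnique_congr fun g => ⟨fun h => Subtype.ext h, fun h => congrArg Subtype.val h⟩)
  locally_surjective A r hr := by
    obtain ⟨y, hy, rfl⟩ := G.exists_κJacobi_eq hw hI r hr
    refine EtaleCovers.of_away fun p => ?_
    obtain ⟨f, hf, x, hx, h⟩ := exists_framedOf_away y p
    refine ⟨f, hf, ⟨⟨x, hx⟩, h.relations hy⟩, ?_⟩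
    exact (G.κJacobi_eq_iff hw hI hy _).2 h

end SliceData.Gluing

end QuiverCrit
end
theorem proposition3p4 (Q : QuiverCrit.FinQuiver) (W : Q.Potential) (d : Q.V → ℕ) :
    -- the stack of families of representations is the quotient stack `[N_d / G_d]`, and is smooth
    (QuiverCrit.IsQuotientStack (QuiverCrit.Rep.proj Q d) (QuiverCrit.repAction Q d)
        (QuiverCrit.stdFunctor Q d) ∧
      QuiverCrit.IsSmoothAlgebraicStack (QuiverCrit.Rep.proj Q d) ∧
      -- it carries the regular function `Tr W`
      ∃ f : QuiverCrit.RegularFunction (QuiverCrit.Rep.proj Q d),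
        (∀ x : QuiverCrit.Rep Q d, (∀ i, Module.Free x.A (x.fam.U i)) →
          f.val x = x.fam.traceW W) ∧
        -- the critical locus of `Tr W` is the stack of families of `J(Q, W)`-representations
        (∀ x : QuiverCrit.Rep Q d, QuiverCrit.InCriticalLocus f x ↔ x.fam.IsJacobi W) ∧
        -- and it is the substack `[M_d / G_d]` of `[N_d / G_d]`
        (∃ F : (QuiverCrit.jacobiAction d W).Prestack ⥤
            ObjectProperty.FullSubcategory
              (fun x : QuiverCrit.Rep Q d => QuiverCrit.InCriticalLocus f x),
          F ⋙ ObjectProperty.ι _ =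
            (QuiverCrit.repAction Q d).prestackIncl (QuiverCrit.InM W)
              (QuiverCrit.inM_stable W) ⋙ QuiverCrit.stdFunctor Q d ∧
          QuiverCrit.IsQuotientStack (ObjectProperty.ι _ ⋙ QuiverCrit.Rep.proj Q d)
            (QuiverCrit.jacobiAction d W) F)) ∧
    -- framed representations
    ∀ j : Q.V, ∃ (R : Scheme.{0}) (s : R ⟶ QuiverCrit.SpecC)
      (π : ∀ A : CommAlgCat.{0} ℂ,
        (QuiverCrit.framedAction d j).X A → (QuiverCrit.specAlg A ⟶ R))
      (κ : ∀ A : CommAlgCat.{0} ℂ,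
        {_x : QuiverCrit.FramedRep Q d j A // True} → (QuiverCrit.specAlg A ⟶ R)),
      -- `R` is the quotient `N_d^j / G_d`, and a fine moduli space of framed representations
      QuiverCrit.IsFreeQuotient (QuiverCrit.framedAction d j) s π ∧
      QuiverCrit.IsFineModuli (fun _ _ => True) s κ ∧
      (∀ (A : CommAlgCat.{0} ℂ) (x : (QuiverCrit.framedAction d j).X A),
        κ A ⟨QuiverCrit.stdFramed x, trivial⟩ = π A x) ∧
      -- it is a smooth quasiprojective variety
      AlgebraicGeometry.Smooth s ∧ QuiverCrit.IsQuasiprojective s ∧ (IsEmpty R ∨ IsIntegral R) ∧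
      -- it carries the regular function `Tr W`
      ∃ w : Γ(R, ⊤),
        (∀ (A : CommAlgCat.{0} ℂ) (x : (QuiverCrit.framedAction d j).X A),
          QuiverCrit.evalAt w (π A x) = (QuiverCrit.stdFramed x).fam.traceW W) ∧
        -- the critical locus of `Tr W` is the subscheme `M_d^j / G_d`, which is the fine moduli
        -- space of framed `J(Q, W)`-representations
        ∃ I : R.IdealSheafData, QuiverCrit.IsCriticalLocus s w I ∧
          (∃ π' : ∀ A : CommAlgCat.{0} ℂ, (QuiverCrit.framedJacobiAction d j W).X A →
              (QuiverCrit.specAlg A ⟶ I.subscheme),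
            QuiverCrit.IsFreeQuotient (QuiverCrit.framedJacobiAction d j W)
              (I.subschemeι ≫ s) π' ∧
            ∀ (A : CommAlgCat.{0} ℂ) (x : (QuiverCrit.framedJacobiAction d j W).X A),
              π' A x ≫ I.subschemeι = π A x.1) ∧
          (∃ κ' : ∀ A : CommAlgCat.{0} ℂ,
              {x : QuiverCrit.FramedRep Q d j A // x.fam.IsJacobi W} →
                (QuiverCrit.specAlg A ⟶ I.subscheme),
            QuiverCrit.IsFineModuli (fun _ x => x.fam.IsJacobi W) (I.subschemeι ≫ s) κ' ∧
            ∀ (A : CommAlgCat.{0} ℂ)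
              (x : {x : QuiverCrit.FramedRep Q d j A // x.fam.IsJacobi W}),
              κ' A x ≫ I.subschemeι = κ A ⟨x.1, trivial⟩) := by
  refine ⟨QuiverCrit.Rep.stack_part d W, fun j => ?_⟩
  obtain ⟨D⟩ := QuiverCrit.nonempty_sliceData (Q := Q) (d := d) (j := j)
  obtain ⟨G⟩ := D.nonempty_gluing
  obtain ⟨w, hw⟩ := G.exists_trace W
  have hs := G.smooth
  obtain ⟨I, hI⟩ := QuiverCrit.exists_criticalLocus G.s w
  refine ⟨G.R, G.s, fun _ x => G.κ (QuiverCrit.stdFramed x), fun _ y => G.κ y.1, G.isFreeQuotient,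
    G.isFineModuli, fun _ _ => rfl, hs, G.isQuasiprojective, G.isEmpty_or_isIntegral, w,
    fun A x => ?_, I, hI, ⟨fun _ x => G.πJacobi hw hI x, G.isFreeQuotient_jacobi hw hI,
      fun _ x => G.πJacobi_ι hw hI x⟩,
    ⟨fun _ y => G.κJacobi hw hI y.1 ((QuiverCrit.RepFam.isJacobi_iff_relations _ _).1 y.2),
      G.isFineModuli_jacobi hw hI, fun _ y => G.κJacobi_ι hw hI y.1 _⟩⟩
  rw [hw]
  have : ∀ i, Module.Free A ((QuiverCrit.stdFramed x).fam.U i) := fun i =>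
    inferInstanceAs (Module.Free A (Fin (d i) → A))
  exact (QuiverCrit.stdFramed x).fam.trW_eq_traceW W
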